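/- Conventions. Let $R$ be a commutative ring, $\otimes=\otimes_R$, $(-)^*=\operatorname{Hom}_R(-,R)$. Let $A=\bigoplus_{n\ge 0}A_n$ be a quadratic $R$-algebra, $A=T(A_1)/(Q_2)$ with $Q_2=\ker(A_1\otimes A_1\to A_2)$, such that every $A_n$ is $R$-flat. $A$ is *Koszul* if $\operatorname{Tor}^A_i(R,R)_j=0$ for all $j\neq i$. Let $M=\bigoplus_{j\in\mathbb Z}M_j$ denote a graded left or right $A$-module, $R$-flat in each degree, with $M_j=0$ for $j<t$ ($t$ is the initial degree). A left module $M$ is *Koszul* if $\operatorname{Tor}^A_i(R,M)_j=0$ for all $j\ne t+i$, a right module if $\operatorname{Tor}^A_i(M,R)_j=0$ for all $j\ne t+i$. A *composition* is a nonempty tuple $\alpha=(\alpha_1,\dots,\alpha_k)$ of positive integers; $\alpha\cdot\beta$ is concatenation, and $\alpha\odot\beta=(\alpha_1,\dots,\alpha_{k-1},\alpha_k+\beta_1,\beta_2,\dots)$ is near-concatenation. The ribbon of $\alpha$ has row lengths $\alpha_1,\dots,\alpha_k$ from bottom to top, consecutive rows overlapping in one box; $\alpha^t$ is the composition of the transposed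 ribbon, so that $(\alpha\cdot\beta)^t=\beta^t\odot\alpha^t$, $(\alpha\odot\beta)^t=\beta^t\cdot\alpha^t$. The empty tuple $()$ is its own transpose. Put $A_\alpha=A_{\alpha_1}\otimes\cdots\otimes A_{\alpha_k}$. The *ribbon Schur module* $\mathbb S^\alpha_A$ is the kernel of the map from $A_\alpha$ to the direct sum of the modules obtained by multiplying two adjacent tensor factors. For a left (resp. right) module $M$, a possibly empty tuple $\alpha$ of positive integers and $d\ge t$, $\mathbb S^\alpha_{A,M_{\ge d}}\subseteq A_\alpha\otimes M_d$ (resp. $\mathbb S^\alpha_{M_{\ge d},A}\subseteq M_d\otimes A_\alpha$) is the kernel of the map to the direct sum of the modules obtained by multiplying two adjacent factors (including the action on $M_d$); $\mathbb S^\alpha_{A,M}$ and $\mathbb S^\alpha_{M,A}$ are the case $d=t$. The *quadratic dual* is $A^!=T(A_1^*)/(Q_2^\perp)$, with $Q_2^\perp\subseteq A_1^*\otimes A_1^*$ the annihilator of $Q_2$ under $\langle f\otimes g,a\otimes b\rangle=f(b)g(a)$. For a left module $M$, $M^!$ is the right $A^!$-module $(M_t^*\otimes A^!)/(Q^\perp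 A^!)$, where $Q=\ker(A_1\otimes M_t\to M_{t+1})$ and $Q^\perp\subseteq M_t^*\otimes A_1^*$ is its annihilator under $\langle g\otimes f,a\otimes m\rangle=f(a)g(m)$; for a right module, $M^!$ is the left $A^!$-module defined symmetrically. $M^!$ is graded with $M_t^*$ in degree $t$. Theorem, algebra case. 1. If $A$ is Koszul, then $\mathbb S^\alpha_A$ is $R$-flat for every composition $\alpha$, and $R$-projective if every $A_n$ is $R$-projective. 2. $A$ is Koszul if and only if for all compositions $\alpha,\beta$ the canonical sequence $$0\to\mathbb S^{\alpha\cdot\beta}_A\to\mathbb S^\alpha_A\otimes\mathbb S^\beta_A\to\mathbb S^{\alpha\odot\beta}_A\to0$$ is exact. (The left map is the one compatible with the inclusion $\mathbb S^{\alpha\cdot\beta}_A\subseteq A_\alpha\otimes A_\beta$ and the canonical map $\mathbb S^\alpha_A\otimes\mathbb S^\beta_A\to A_\alpha\otimes A_\beta$, its existence being part of exactness; the right map multiplies the last factor of $A_\alpha$ with the first factor of $A_\beta$.) 3. If $A$ is Koszul, every $A_n$ is $R$-projective and $A_1$ is finitely generated, then for every composition $\alpha$ there is a canonical isomorphism $(\mathbb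 S^\alpha_A)^*\cong\mathbb S^{\alpha^t}_{A^!}$, namely the one induced by the pairing $\langle f_1\otimes\cdots\otimes f_n,a_1\otimes\cdots\otimes a_n\rangle=f_1(a_n)\cdots f_n(a_1)$ between $(A_1^*)^{\otimes n}$ and $A_1^{\otimes n}$, $n=|\alpha|$. Theorem, module case. Let $A$ be Koszul and $M$ a left module as above. 1. If $M$ is Koszul, then $\mathbb S^\alpha_{A,M}$ is $R$-flat for every possibly empty tuple $\alpha$ of positive integers, and $R$-projective if all $A_n$ and $M_j$ are. 2. $M$ is Koszul if and only if for every composition $\alpha$ and every $\beta$ that is a composition or empty the canonical sequence $$0\to\mathbb S^{\alpha\cdot\beta}_{A,M}\to\mathbb S^\alpha_A\otimes\mathbb S^\beta_{A,M}\to\mathbb S^{\alpha\odot\beta}_{A,M}\to0$$ is exact, where for $\beta=()$ and $\alpha=\alpha'\cdot(a)$ the right-hand term means $\mathbb S^{\alpha'}_{A,M_{\ge t+a}}$. If $M$ is generated by $M_t$, then $M$ is Koszul already if these sequences are exact for all (nonempty) compositions $\alpha,\beta$. 3. Suppose that $M$ is Koszul, all $A_n$ and $M_j$ are $R$-projective,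 and $A_1$ and $M_t$ are finitely generated. Then there are canonical isomorphisms, induced by the analogous pairing, $$(\mathbb S^{\alpha}_{A,M})^*\cong\mathbb S^{\gamma}_{(M^!)_{\ge t+c},A^!}\ \text{ if }\alpha^t=(c)\cdot\gamma,\qquad(\mathbb S^{\alpha'}_{A,M_{\ge t+a}})^*\cong\mathbb S^{\alpha^t}_{M^!,A^!}\ \text{ if }\alpha=\alpha'\cdot(a),$$ for every composition $\alpha$; and $(\mathbb S^{()}_{A,M})^*=M_t^*=\mathbb S^{()}_{M^!,A^!}$. The mirror-image statements hold for a right module $M$: the same flatness and projectivity for $\mathbb S^\alpha_{M,A}$; $M$ is Koszul if and only if $0\to\mathbb S^{\alpha\cdot\beta}_{M,A}\to\mathbb S^\alpha_{M,A}\otimes\mathbb S^\beta_A\to\mathbb S^{\alpha\odot\beta}_{M,A}\to0$ is exact for all compositions $\beta$ and all $\alpha$ that are compositions or empty (for $\alpha=()$ and $\beta=(b)\cdot\beta'$ the right-hand term means $\mathbb S^{\beta'}_{M_{\ge t+b},A}$), and nonempty $\alpha$ suffice if $M$ is generated by $M_t$; and, under the hypotheses of 3, $(\mathbb S^\alpha_{M,A})^*\cong\mathbb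 S^{\gamma}_{A^!,(M^!)_{\ge t+c}}$ if $\alpha^t=\gamma\cdot(c)$, $(\mathbb S^{\alpha'}_{M_{\ge t+a},A})^*\cong\mathbb S^{\alpha^t}_{A^!,M^!}$ if $\alpha=(a)\cdot\alpha'$, and $(\mathbb S^{()}_{M,A})^*=\mathbb S^{()}_{A^!,M^!}$. -/

import Mathlib

open scoped TensorProduct DirectSum

noncomputable section

namespace RibbonSchur

/-! ## Compositions and ribbons

A composition is a nonempty list of positive integers.  The row lengths of its ribbon diagram,
read from bottom to top, are the entries of the list; consecutive rows overlap in one box. -/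

/-- `α` is a composition: a nonempty tuple of positive integers. -/
def IsComp (α : List ℕ) : Prop := α ≠ [] ∧ ∀ a ∈ α, 0 < a

/-- The near-concatenation `(α₁, …, αₖ + β₁, …, βⱼ)` of two nonempty tuples. -/
def nearConcat (α β : List ℕ) : List ℕ :=
  α.dropLast ++ (α.getLastD 0 + β.headD 0) :: β.tail

/-- The column lengths, from left to right, of the ribbon whose rows, from bottom to top, have
the given lengths.  The last box of each row lies below the first box of the next row. -/
def columns : List ℕ → List ℕ
  | [] => []
  | [a] => List.replicate a 1
  | a :: b :: l => List.replicate (a - 1) 1 ++ (columns (b :: l)).modifyHead (· + 1)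

/-- The transpose of a composition.  The rows of the transposed ribbon, from bottom to top, are
the columns of the original one, from right to left. -/
def transpose (α : List ℕ) : List ℕ := (columns α).reverse

/-! ## Words

Let `E` be an `R`-module with a bilinear product.  The tensor algebra `T(E)` contains the tensor
powers of `E`; `glue mul p` multiplies the letters number `p` and `p + 1` (counted from `0`). -/

section Words

universe u v w
variable {R : Type u} [CommRing R] {E : Type v} [AddCommGroup E] [Module R E]

/-- Changing one letter of a word changes one letter of the contracted word, linearly. -/
theorem contractNth_update (mul : E →ₗ[R] E →ₗ[R] E) {n : ℕ} (j : Fin n) (v : Fin (n + 1) → E)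
    (i : Fin (n + 1)) :
    ∃ (k : Fin n) (h : E →ₗ[R] E), ∀ x : E,
      Fin.contractNth j.castSucc (fun a b => mul a b) (Function.update v i x) =
        Function.update (Fin.contractNth j.castSucc (fun a b => mul a b) v) k (h x) := by
  rcases lt_trichotomy (i : ℕ) j with hij | hij | hij
  · refine ⟨⟨i, by omega⟩, LinearMap.id, fun x => ?_⟩
    ext k
    simp only [Fin.contractNth, Function.update_apply, Fin.ext_iff, Fin.val_castSucc, Fin.val_succ,
      LinearMap.id_apply]
    split_ifs <;> first | rfl | omega
  · refine ⟨j, mul.flip (v j.succ), fun x => ?_⟩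
    ext k
    simp only [Fin.contractNth, Function.update_apply, Fin.ext_iff, Fin.val_castSucc, Fin.val_succ,
      LinearMap.flip_apply]
    split_ifs with h1 h2 h3 h4 h5 h6 <;> first | rfl | omega | skip
    have : k = j := Fin.ext (by omega)
    subst this; rfl
  · by_cases hij' : (i : ℕ) = j + 1
    · refine ⟨j, mul (v j.castSucc), fun x => ?_⟩
      ext k
      simp only [Fin.contractNth, Function.update_apply, Fin.ext_iff, Fin.val_castSucc,
        Fin.val_succ]
      split_ifs with h1 h2 h3 h4 h5 h6 <;> first | rfl | omega | skip
      have : k = j := Fin.ext (by omega)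
      subst this; rfl
    · refine ⟨⟨i - 1, by omega⟩, LinearMap.id, fun x => ?_⟩
      ext k
      simp only [Fin.contractNth, Function.update_apply, Fin.ext_iff, Fin.val_castSucc,
        Fin.val_succ, LinearMap.id_apply]
      split_ifs <;> first | rfl | omega

/-- The linear map `E^{⊗ (n+1)} → E^{⊗ n}` multiplying the tensor factors `j` and `j + 1`. -/
def contract (mul : E →ₗ[R] E →ₗ[R] E) {n : ℕ} (j : Fin n) : ⨂[R]^(n + 1) E →ₗ[R] ⨂[R]^n E :=
  PiTensorProduct.lift
    { toFun := fun v =>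
        PiTensorProduct.tprod R (Fin.contractNth j.castSucc (fun a b => mul a b) v)
      map_update_add' := by
        intro inst v i x y
        rw [Subsingleton.elim inst (instDecidableEqFin _)]
        obtain ⟨k, h, hk⟩ := contractNth_update mul j v i
        simp only [hk, map_add, MultilinearMap.map_update_add]
      map_update_smul' := by
        intro inst v i c x
        rw [Subsingleton.elim inst (instDecidableEqFin _)]
        obtain ⟨k, h, hk⟩ := contractNth_update mul j v i
        simp only [hk, map_smul, MultilinearMap.map_update_smul] }

/-- The endomorphism of `T(E)` multiplying the letters number `p` and `p + 1` of every word (and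
sending words with fewer than `p + 2` letters to `0`). -/
def glue (mul : E →ₗ[R] E →ₗ[R] E) (p : ℕ) : Module.End R (TensorAlgebra R E) :=
  (DirectSum.toModule R ℕ (TensorAlgebra R E) fun n =>
      match n with
      | 0 => 0
      | n + 1 => if h : p < n then TensorPower.toTensorAlgebra ∘ₗ contract mul ⟨p, h⟩ else 0) ∘ₗ
    (TensorAlgebra.equivDirectSum (R := R) (M := E)).toLinearMap

theorem glue_tprod (mul : E →ₗ[R] E →ₗ[R] E) {p n : ℕ} (h : p < n) (v : Fin (n + 1) → E) :
    glue mul p (TensorAlgebra.tprod R E (n + 1) v) =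
      TensorAlgebra.tprod R E n
        (Fin.contractNth (Fin.castSucc ⟨p, h⟩) (fun a b => mul a b) v) := by
  have h1 : (TensorAlgebra.equivDirectSum (R := R) (M := E)).toLinearMap
      (TensorAlgebra.tprod R E (n + 1) v) =
      DirectSum.of (fun n => ⨂[R]^n E) (n + 1) (PiTensorProduct.tprod R v) :=
    TensorAlgebra.toDirectSum_tensorPower_tprod v
  rw [glue, LinearMap.comp_apply, h1]
  erw [DirectSum.toModule_lof]
  simp only [h, dif_pos, LinearMap.comp_apply, contract, PiTensorProduct.lift.tprod]
  erw [TensorPower.toTensorAlgebra_tprod]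

/-- The submodule of `T(E)` spanned by the words `w₁ ⊗ ⋯ ⊗ wₖ` with `wᵢ ∈ Wᵢ`.  When the `Wᵢ` are
direct summands of `E`, it is the tensor product `W₁ ⊗ ⋯ ⊗ Wₖ`. -/
def words (W : List (Submodule R E)) : Submodule R (TensorAlgebra R E) :=
  (W.map (Submodule.map (TensorAlgebra.ι R))).prod

/-- The kernel of the map from `W₁ ⊗ ⋯ ⊗ Wₖ` to the direct sum of the modules obtained by
multiplying two adjacent factors. -/
def ribbon (mul : E →ₗ[R] E →ₗ[R] E) (W : List (Submodule R E)) :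
    Submodule R (TensorAlgebra R E) :=
  words W ⊓ ⨅ (p : ℕ) (_ : p + 1 < W.length), LinearMap.ker (glue mul p)

/-- The bar differential `∑ₚ (-1)ᵖ (… ⊗ wₚ wₚ₊₁ ⊗ …)` on words with `k` letters. -/
def barDiff (mul : E →ₗ[R] E →ₗ[R] E) (k : ℕ) : Module.End R (TensorAlgebra R E) :=
  ∑ p ∈ Finset.range (k - 1), (-1 : R) ^ p • glue mul p

/-- The algebra homomorphism `T(E) → T(E')` induced by a linear map `E → E'`. -/
def wordMap {E' : Type w} [AddCommGroup E'] [Module R E'] (f : E →ₗ[R] E') :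
    TensorAlgebra R E →ₐ[R] TensorAlgebra R E' :=
  TensorAlgebra.lift R (TensorAlgebra.ι R ∘ₗ f)

/-- The canonical map `X ⊗ Y → T(E)` juxtaposing words, for submodules `X ⊆ T(E₁)`, `Y ⊆ T(E₂)`
and linear maps `E₁ → E`, `E₂ → E`. -/
def juxtapose {E₁ E₂ : Type*} [AddCommGroup E₁] [Module R E₁] [AddCommGroup E₂] [Module R E₂]
    (f : E₁ →ₗ[R] E) (g : E₂ →ₗ[R] E)
    (X : Submodule R (TensorAlgebra R E₁)) (Y : Submodule R (TensorAlgebra R E₂)) :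
    X ⊗[R] Y →ₗ[R] TensorAlgebra R E :=
  LinearMap.mul' R (TensorAlgebra R E) ∘ₗ
    TensorProduct.map ((wordMap f).toLinearMap ∘ₗ X.subtype) ((wordMap g).toLinearMap ∘ₗ Y.subtype)

/-- Exactness of the canonical sequence `0 → C → X ⊗ Y → N → 0` for `C, N ⊆ T(E)`: the left map
is the inclusion of `C`, i.e. it is compatible with the juxtaposition `X ⊗ Y → T(E)`; the right
map is induced by multiplying the letters number `p` and `p + 1`. -/
def ConcatExact (mul : E →ₗ[R] E →ₗ[R] E)
    {E₁ E₂ : Type*} [AddCommGroup E₁] [Module R E₁] [AddCommGroup E₂] [Module R E₂]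
    (f : E₁ →ₗ[R] E) (g : E₂ →ₗ[R] E)
    (X : Submodule R (TensorAlgebra R E₁)) (Y : Submodule R (TensorAlgebra R E₂))
    (p : ℕ) (C N : Submodule R (TensorAlgebra R E)) : Prop :=
  ∃ (i : C →ₗ[R] X ⊗[R] Y) (q : X ⊗[R] Y →ₗ[R] N),
    (∀ c : C, juxtapose f g X Y (i c) = c) ∧
    (∀ z : X ⊗[R] Y, (q z : TensorAlgebra R E) = glue mul p (juxtapose f g X Y z)) ∧
    Function.Injective i ∧ Function.Exact i q ∧ Function.Surjective q

/-- For `s = (s₁, …, sₖ)`, the map multiplying, from the letter number `p` on, the first `s₁`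
letters together, the next `s₂` letters together, and so on. -/
def blockMul (mul : E →ₗ[R] E →ₗ[R] E) : ℕ → List ℕ → Module.End R (TensorAlgebra R E)
  | _, [] => 1
  | p, a :: s => blockMul mul (p + 1) s * glue mul p ^ (a - 1)

/-- `p` and `p + 1` are the last and the first letter of consecutive blocks of sizes `s`. -/
def IsBoundary (s : List ℕ) (p : ℕ) : Prop :=
  ∃ i, 0 < i ∧ i < s.length ∧ p + 1 = (s.take i).sum

/-- The word in `T(E)` spelled by an element of a tensor power of `V`, for a map `V → E`. -/
def spell {V : Type w} [AddCommGroup V] [Module R V] (e : V →ₗ[R] E) {n : ℕ} :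
    ⨂[R]^n V →ₗ[R] TensorAlgebra R E :=
  (wordMap e).toLinearMap ∘ₗ TensorPower.toTensorAlgebra

end Words

/-- The pairing `⟨f₁ ⊗ ⋯ ⊗ fₙ, v₁ ⊗ ⋯ ⊗ vₙ⟩ = f₁(vₙ) f₂(vₙ₋₁) ⋯ fₙ(v₁)`. -/
def revPairing {R V V' : Type*} [CommRing R] [AddCommGroup V] [Module R V]
    [AddCommGroup V'] [Module R V'] (ev : V' →ₗ[R] Module.Dual R V) (n : ℕ) :
    ⨂[R]^n V' →ₗ[R] Module.Dual R (⨂[R]^n V) :=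
  PiTensorProduct.dualDistrib ∘ₗ
    (PiTensorProduct.map fun _ => ev) ∘ₗ
      (PiTensorProduct.reindex R (fun _ : Fin n => V') Fin.revPerm).toLinearMap

/-- The isomorphism `Φ : S^* ≅ S'` is the canonical one.  Here `S ⊆ T(E)` and `S' ⊆ T(E')` are
ribbon modules, whose elements are obtained from words with `n` letters of degree one (in the
submodules listed in `U` and `U'`) by multiplying blocks of sizes `s` and `s'`.  If `x` and `f` are
such words that are killed by every multiplication across two blocks, `⟨f, x⟩` is the value of the
functional `Φ⁻¹ [f]` on `[x]`. -/
def IsCanonicalDual {R V V' E E' : Type*} [CommRing R] [AddCommGroup V] [Module R V]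
    [AddCommGroup V'] [Module R V'] [AddCommGroup E] [Module R E] [AddCommGroup E'] [Module R E']
    (mul : E →ₗ[R] E →ₗ[R] E) (mul' : E' →ₗ[R] E' →ₗ[R] E')
    (e : V →ₗ[R] E) (e' : V' →ₗ[R] E') (ev : V' →ₗ[R] Module.Dual R V)
    (n : ℕ) (U : List (Submodule R E)) (U' : List (Submodule R E')) (s s' : List ℕ)
    {S : Submodule R (TensorAlgebra R E)} {S' : Submodule R (TensorAlgebra R E')}
    (Φ : Module.Dual R S ≃ₗ[R] S') : Prop :=
  ∀ (x : ⨂[R]^n V) (f : ⨂[R]^n V'), spell e x ∈ words U → spell e' f ∈ words U' →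
    (∀ p, IsBoundary s p → glue mul p (spell e x) = 0) →
    (∀ p, IsBoundary s' p → glue mul' p (spell e' f) = 0) →
    ∀ (y : S) (φ : Module.Dual R S),
      (y : TensorAlgebra R E) = blockMul mul 0 s (spell e x) →
      (Φ φ : TensorAlgebra R E') = blockMul mul' 0 s' (spell e' f) →
      φ y = revPairing ev n f x

/-! ## Algebras

`A` is a graded `R`-algebra with graded pieces `𝒜 n`. -/

section Algebras

universe u v
variable {R : Type u} [CommRing R] {A : Type v} [Ring A] [Algebra R A]

/-- The canonical algebra homomorphism `T(A₁) → A`. -/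
def fromTensor (𝒜 : ℕ → Submodule R A) : TensorAlgebra R (𝒜 1) →ₐ[R] A :=
  TensorAlgebra.lift R (𝒜 1).subtype

/-- `A` is quadratic: `A = T(A₁) / (Q₂)`, where `Q₂` is the kernel of `A₁ ⊗ A₁ → A`. -/
def IsQuadratic (𝒜 : ℕ → Submodule R A) : Prop :=
  Function.Surjective (fromTensor 𝒜) ∧
    ∀ x, fromTensor 𝒜 x = 0 ↔
      x ∈ TwoSidedIdeal.span {y | ∃ q : ⨂[R]^2 (𝒜 1),
        y = TensorPower.toTensorAlgebra q ∧ fromTensor 𝒜 y = 0}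

/-- The part of internal degree `n` of `(A₊)^{⊗ i}`: the sum of the `A_α` over all tuples `α` of
`i` positive integers with sum `n`. -/
def barPiece (𝒜 : ℕ → Submodule R A) (i n : ℕ) : Submodule R (TensorAlgebra R A) :=
  ⨆ (α : List ℕ) (_ : α.length = i ∧ α.sum = n ∧ ∀ a ∈ α, 0 < a), words (α.map 𝒜)

/-- The quadratic algebra `A` is Koszul: `Tor_i^A(R, R)_n = 0` for `n ≠ i`.  Here `Tor^A(R, R)` is
the homology of the bar complex `R ⊗_A Bar^A(R)`, which is a complex of Tor groups because `A` is
flat over `R` in each degree. -/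
def IsKoszul (𝒜 : ℕ → Submodule R A) : Prop :=
  IsQuadratic 𝒜 ∧
    ∀ i n : ℕ, n ≠ i → ∀ x ∈ barPiece 𝒜 i n, barDiff (LinearMap.mul R A) i x = 0 →
      ∃ y ∈ barPiece 𝒜 (i + 1) n, barDiff (LinearMap.mul R A) (i + 1) y = x

/-- The ribbon Schur module `S^α_A`. -/
def schur (𝒜 : ℕ → Submodule R A) (α : List ℕ) : Submodule R (TensorAlgebra R A) :=
  ribbon (LinearMap.mul R A) (α.map 𝒜)

/-- The canonical sequence `0 → S^{α·β}_A → S^α_A ⊗ S^β_A → S^{α⊙β}_A → 0` is exact. -/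
def SchurExact (𝒜 : ℕ → Submodule R A) (α β : List ℕ) : Prop :=
  ConcatExact (LinearMap.mul R A) LinearMap.id LinearMap.id (schur 𝒜 α) (schur 𝒜 β)
    (α.length - 1) (schur 𝒜 (α ++ β)) (schur 𝒜 (nearConcat α β))

/-- The relations of the quadratic dual: the elements of `A₁^* ⊗ A₁^*` that vanish on the kernel
`Q₂` of `A₁ ⊗ A₁ → A₂`, for the pairing `⟨f ⊗ g, a ⊗ b⟩ = f(b) g(a)`. -/
def dualRel (𝒜 : ℕ → Submodule R A) :
    TensorAlgebra R (Module.Dual R (𝒜 1)) → TensorAlgebra R (Module.Dual R (𝒜 1)) → Prop :=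
  fun y z => z = 0 ∧ ∃ f : ⨂[R]^2 (Module.Dual R (𝒜 1)), y = TensorPower.toTensorAlgebra f ∧
    ∀ q : ⨂[R]^2 (𝒜 1), fromTensor 𝒜 (TensorPower.toTensorAlgebra q) = 0 →
      revPairing LinearMap.id 2 f q = 0

/-- The quadratic dual algebra `A^! = T(A₁^*) / (Q₂^⊥)`. -/
def QuadDual (𝒜 : ℕ → Submodule R A) : Type _ := RingQuot (dualRel 𝒜)

instance (𝒜 : ℕ → Submodule R A) : Ring (QuadDual 𝒜) :=
  inferInstanceAs (Ring (RingQuot (dualRel 𝒜)))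

instance (𝒜 : ℕ → Submodule R A) : Algebra R (QuadDual 𝒜) :=
  inferInstanceAs (Algebra R (RingQuot (dualRel 𝒜)))

/-- The canonical map `T(A₁^*) → A^!`. -/
def QuadDual.mk (𝒜 : ℕ → Submodule R A) :
    TensorAlgebra R (Module.Dual R (𝒜 1)) →ₐ[R] QuadDual 𝒜 :=
  RingQuot.mkAlgHom R (dualRel 𝒜)

/-- The canonical map `A₁^* → A^!`. -/
def QuadDual.ι (𝒜 : ℕ → Submodule R A) : Module.Dual R (𝒜 1) →ₗ[R] QuadDual 𝒜 :=
  (QuadDual.mk 𝒜).toLinearMap ∘ₗ TensorAlgebra.ι R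

/-- The graded pieces `A^!_n` of the quadratic dual. -/
def QuadDual.piece (𝒜 : ℕ → Submodule R A) (n : ℕ) : Submodule R (QuadDual 𝒜) :=
  LinearMap.range (QuadDual.ι 𝒜) ^ n

/-- There is a canonical isomorphism `(S^α_A)^* ≅ S^{α^t}_{A^!}`. -/
def SchurDual (𝒜 : ℕ → Submodule R A) (α : List ℕ) : Prop :=
  ∃ Φ : Module.Dual R (schur 𝒜 α) ≃ₗ[R] schur (QuadDual.piece 𝒜) (transpose α),
    IsCanonicalDual (LinearMap.mul R A) (LinearMap.mul R (QuadDual 𝒜))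
      (𝒜 1).subtype (QuadDual.ι 𝒜) LinearMap.id α.sum
      (List.replicate α.sum (𝒜 1)) (List.replicate α.sum (QuadDual.piece 𝒜 1))
      α (transpose α) Φ

end Algebras

/-! ## Modules

The module structure of a left or right `A`-module `M` enters through the bilinear map
`act : A → M → M`, which is `act a m = a m` for left and `act a m = m a` for right modules.  Words
ending (for left modules) or beginning (for right modules) with a letter of `M` live in the tensor
algebra of `A × M`. -/

section Modules

universe u v w
variable {R : Type u} [CommRing R] {A : Type v} [Ring A] [Algebra R A]
  {M : Type w} [AddCommGroup M] [Module R M]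

/-- The action `(a, m) ↦ a m` on a left module. -/
def leftAct (R : Type u) [CommRing R] (A : Type v) [Ring A] [Algebra R A]
    (M : Type w) [AddCommGroup M] [Module R M] [Module A M] [IsScalarTower R A M] :
    A →ₗ[R] M →ₗ[R] M :=
  (Algebra.lsmul R R M).toLinearMap

/-- The action `(a, m) ↦ m a` on a right module. -/
def rightAct (R : Type u) [CommRing R] (A : Type v) [Ring A] [Algebra R A]
    (M : Type w) [AddCommGroup M] [Module R M] [Module Aᵐᵒᵖ M] [IsScalarTower R Aᵐᵒᵖ M] :
    A →ₗ[R] M →ₗ[R] M :=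
  (Algebra.lsmul R R M).toLinearMap ∘ₗ (MulOpposite.opLinearEquiv R (M := A)).toLinearMap

/-- `M = ⨁ M_j` is a graded module, flat over `R` in each degree, with `M_j = 0` for `j < t`. -/
structure IsGradedFlat (𝒜 : ℕ → Submodule R A) (act : A →ₗ[R] M →ₗ[R] M)
    (ℳ : ℤ → Submodule R M) (t : ℤ) : Prop where
  isInternal : DirectSum.IsInternal ℳ
  act_mem : ∀ (i : ℕ) (j : ℤ), ∀ a ∈ 𝒜 i, ∀ m ∈ ℳ j, act a m ∈ ℳ (i + j)
  eq_bot : ∀ j < t, ℳ j = ⊥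
  flat : ∀ j, Module.Flat R (ℳ j)

/-- The product `(a, m) (a', m') = (a a', a m')` on `A × M`, for a left module `M`. -/
def mulL (act : A →ₗ[R] M →ₗ[R] M) : (A × M) →ₗ[R] (A × M) →ₗ[R] (A × M) :=
  LinearMap.mk₂ R (fun x y => (x.1 * y.1, act x.1 y.2))
    (by intros; simp [add_mul]) (by intros; simp)
    (by intros; simp [mul_add]) (by intros; simp)

/-- The product `(a, m) (a', m') = (a a', m a')` on `A × M`, for a right module `M`. -/
def mulR (act : A →ₗ[R] M →ₗ[R] M) : (A × M) →ₗ[R] (A × M) →ₗ[R] (A × M) :=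
  LinearMap.mk₂ R (fun x y => (x.1 * y.1, act y.1 x.2))
    (by intros; simp [add_mul]) (by intros; simp)
    (by intros; simp [mul_add]) (by intros; simp)

/-- The letters `A_{α₁}, …, A_{αₖ}` as submodules of `A × M`. -/
def letters (M : Type w) [AddCommGroup M] [Module R M] (𝒜 : ℕ → Submodule R A) (α : List ℕ) :
    List (Submodule R (A × M)) :=
  α.map fun a => (𝒜 a).map (LinearMap.inl R A M)

/-- A submodule `X` of `M` as a submodule of `A × M`. -/
def letter (A : Type v) [Ring A] [Algebra R A] (X : Submodule R M) : Submodule R (A × M) :=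
  X.map (LinearMap.inr R A M)

/-- The part of internal degree `n` of `(A₊)^{⊗ i} ⊗ M`, for a left module `M`. -/
def barPieceL (𝒜 : ℕ → Submodule R A) (ℳ : ℤ → Submodule R M) (i : ℕ) (n : ℤ) :
    Submodule R (TensorAlgebra R (A × M)) :=
  ⨆ (α : List ℕ) (j : ℤ) (_ : α.length = i ∧ (α.sum : ℤ) + j = n ∧ ∀ a ∈ α, 0 < a),
    words (letters M 𝒜 α ++ [letter A (ℳ j)])

/-- The part of internal degree `n` of `M ⊗ (A₊)^{⊗ i}`, for a right module `M`. -/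
def barPieceR (𝒜 : ℕ → Submodule R A) (ℳ : ℤ → Submodule R M) (i : ℕ) (n : ℤ) :
    Submodule R (TensorAlgebra R (A × M)) :=
  ⨆ (α : List ℕ) (j : ℤ) (_ : α.length = i ∧ (α.sum : ℤ) + j = n ∧ ∀ a ∈ α, 0 < a),
    words (letter A (ℳ j) :: letters M 𝒜 α)

/-- The left module `M` with initial degree `t` is Koszul: `Tor_i^A(R, M)_n = 0` for `n ≠ t + i`.
Here `Tor^A(R, M)` is the homology of the bar complex `R ⊗_A Bar^A(M)`. -/
def IsKoszulL (𝒜 : ℕ → Submodule R A) (act : A →ₗ[R] M →ₗ[R] M) (ℳ : ℤ → Submodule R M)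
    (t : ℤ) : Prop :=
  ∀ (i : ℕ) (n : ℤ), n ≠ t + i → ∀ x ∈ barPieceL 𝒜 ℳ i n, barDiff (mulL act) (i + 1) x = 0 →
    ∃ y ∈ barPieceL 𝒜 ℳ (i + 1) n, barDiff (mulL act) (i + 2) y = x

/-- The right module `M` with initial degree `t` is Koszul: `Tor_i^A(M, R)_n = 0` for
`n ≠ t + i`. -/
def IsKoszulR (𝒜 : ℕ → Submodule R A) (act : A →ₗ[R] M →ₗ[R] M) (ℳ : ℤ → Submodule R M)
    (t : ℤ) : Prop :=
  ∀ (i : ℕ) (n : ℤ), n ≠ t + i → ∀ x ∈ barPieceR 𝒜 ℳ i n, barDiff (mulR act) (i + 1) x = 0 →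
    ∃ y ∈ barPieceR 𝒜 ℳ (i + 1) n, barDiff (mulR act) (i + 2) y = x

/-- `M` is generated as an `A`-module by its submodule `X`. -/
def IsGeneratedBy (act : A →ₗ[R] M →ₗ[R] M) (X : Submodule R M) : Prop :=
  Submodule.span R {z : M | ∃ a : A, ∃ m ∈ X, z = act a m} = ⊤

/-- The kernel of `A_α ⊗ X → ⨁ …` for a graded piece `X` of a left module `M`.  For `X = M_t` it is
`S^α_{A,M}` if `t` is the initial degree of `M`, and `S^α_{A,M_{≥t}}` in general. -/
def schurL (𝒜 : ℕ → Submodule R A) (act : A →ₗ[R] M →ₗ[R] M) (α : List ℕ) (X : Submodule R M) :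
    Submodule R (TensorAlgebra R (A × M)) :=
  ribbon (mulL act) (letters M 𝒜 α ++ [letter A X])

/-- The kernel of `X ⊗ A_α → ⨁ …` for a graded piece `X` of a right module `M`.  For `X = M_t` it is
`S^α_{M,A}` if `t` is the initial degree of `M`, and `S^α_{M_{≥t},A}` in general. -/
def schurR (𝒜 : ℕ → Submodule R A) (act : A →ₗ[R] M →ₗ[R] M) (α : List ℕ) (X : Submodule R M) :
    Submodule R (TensorAlgebra R (A × M)) :=
  ribbon (mulR act) (letter A X :: letters M 𝒜 α)

/-- The canonical sequence `0 → S^{α·β}_{A,M} → S^α_A ⊗ S^β_{A,M} → S^{α⊙β}_{A,M} → 0` is exact.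
If `β` is empty and `α = α'·(a)`, the term on the right is `S^{α'}_{A,M_{≥t+a}}`. -/
def SchurExactL (𝒜 : ℕ → Submodule R A) (act : A →ₗ[R] M →ₗ[R] M) (ℳ : ℤ → Submodule R M)
    (t : ℤ) (α β : List ℕ) : Prop :=
  ConcatExact (mulL act) (LinearMap.inl R A M) LinearMap.id
    (schur 𝒜 α) (schurL 𝒜 act β (ℳ t)) (α.length - 1) (schurL 𝒜 act (α ++ β) (ℳ t))
    (match β with
      | [] => schurL 𝒜 act α.dropLast (ℳ (t + α.getLastD 0))
      | b :: l => schurL 𝒜 act (nearConcat α (b :: l)) (ℳ t))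

/-- The canonical sequence `0 → S^{α·β}_{M,A} → S^α_{M,A} ⊗ S^β_A → S^{α⊙β}_{M,A} → 0` is exact.
If `α` is empty and `β = (b)·β'`, the term on the right is `S^{β'}_{M_{≥t+b},A}`. -/
def SchurExactR (𝒜 : ℕ → Submodule R A) (act : A →ₗ[R] M →ₗ[R] M) (ℳ : ℤ → Submodule R M)
    (t : ℤ) (α β : List ℕ) : Prop :=
  ConcatExact (mulR act) LinearMap.id (LinearMap.inl R A M)
    (schurR 𝒜 act α (ℳ t)) (schur 𝒜 β) α.length (schurR 𝒜 act (α ++ β) (ℳ t))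
    (match α with
      | [] => schurR 𝒜 act β.tail (ℳ (t + β.headD 0))
      | a :: l => schurR 𝒜 act (nearConcat (a :: l) β) (ℳ t))

/-! ### Quadratic duals of modules

Let `X` be the component `M_t` of initial degree, `Q = ker(A₁ ⊗ M_t → M_{t+1})` and `B` the algebra
`A^!` if `M` is a right module and `(A^!)ᵐᵒᵖ` if `M` is a left module.  The quadratic dual `M^!` is
the left `B`-module `B ⊗ M_t^* / (Q^⊥)`. -/

/-- The multiplication map `A₁ ⊗ M_t → M`. -/
def actMap (𝒜 : ℕ → Submodule R A) (act : A →ₗ[R] M →ₗ[R] M) (X : Submodule R M) :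
    (𝒜 1) ⊗[R] X →ₗ[R] M :=
  TensorProduct.lift (act.compl₁₂ (𝒜 1).subtype X.subtype)

/-- The relations of `M^!`: the elements of `A₁^* ⊗ M_t^*` that vanish on `Q`. -/
def modRel (𝒜 : ℕ → Submodule R A) (act : A →ₗ[R] M →ₗ[R] M) (X : Submodule R M)
    {B : Type*} [Ring B] [Algebra R B] (ι : Module.Dual R (𝒜 1) →ₗ[R] B) :
    Set (B ⊗[R] Module.Dual R X) :=
  {z | ∃ f : Module.Dual R (𝒜 1) ⊗[R] Module.Dual R X,
    z = TensorProduct.map ι LinearMap.id f ∧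
    ∀ q : (𝒜 1) ⊗[R] X, actMap 𝒜 act X q = 0 → TensorProduct.dualDistrib R (𝒜 1) X f q = 0}

/-- The quadratic dual `M^!`, a left module over `B`. -/
abbrev ModDual (𝒜 : ℕ → Submodule R A) (act : A →ₗ[R] M →ₗ[R] M) (X : Submodule R M)
    {B : Type*} [Ring B] [Algebra R B] (ι : Module.Dual R (𝒜 1) →ₗ[R] B) : Type _ :=
  (B ⊗[R] Module.Dual R X) ⧸ Submodule.span B (modRel 𝒜 act X ι)

/-- The class of `b ⊗ g` in `M^!`, for a fixed `b`, as a linear function of `g ∈ M_t^*`. -/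
def ModDual.mk (𝒜 : ℕ → Submodule R A) (act : A →ₗ[R] M →ₗ[R] M) (X : Submodule R M)
    {B : Type*} [Ring B] [Algebra R B] (ι : Module.Dual R (𝒜 1) →ₗ[R] B) (b : B) :
    Module.Dual R X →ₗ[R] ModDual 𝒜 act X ι :=
  ((Submodule.mkQ (Submodule.span B (modRel 𝒜 act X ι))).restrictScalars R) ∘ₗ
    TensorProduct.mk R B (Module.Dual R X) b

/-- The graded piece of `M^!` spanned by the classes of `b ⊗ g` with `b ∈ D`; for `D = A^!_d` it is
the piece of degree `t + d`. -/
def ModDual.piece (𝒜 : ℕ → Submodule R A) (act : A →ₗ[R] M →ₗ[R] M) (X : Submodule R M)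
    {B : Type*} [Ring B] [Algebra R B] (ι : Module.Dual R (𝒜 1) →ₗ[R] B) (D : Submodule R B) :
    Submodule R (ModDual 𝒜 act X ι) :=
  ⨆ b ∈ D, LinearMap.range (ModDual.mk 𝒜 act X ι b)

/-- The canonical map `A₁^* → (A^!)ᵐᵒᵖ`. -/
def QuadDual.ιop (𝒜 : ℕ → Submodule R A) : Module.Dual R (𝒜 1) →ₗ[R] (QuadDual 𝒜)ᵐᵒᵖ :=
  (MulOpposite.opLinearEquiv R (M := QuadDual 𝒜)).toLinearMap ∘ₗ QuadDual.ι 𝒜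

/-- The quadratic dual `M^!` of a left module with initial component `X = M_t`: a right
`A^!`-module. -/
abbrev DualL (𝒜 : ℕ → Submodule R A) (act : A →ₗ[R] M →ₗ[R] M) (X : Submodule R M) : Type _ :=
  ModDual 𝒜 act X (QuadDual.ιop 𝒜)

/-- The piece of degree `t + d` of the quadratic dual of a left module. -/
def DualL.piece (𝒜 : ℕ → Submodule R A) (act : A →ₗ[R] M →ₗ[R] M) (X : Submodule R M) (d : ℕ) :
    Submodule R (DualL 𝒜 act X) :=
  ModDual.piece 𝒜 act X (QuadDual.ιop 𝒜)
    ((QuadDual.piece 𝒜 d).map (MulOpposite.opLinearEquiv R (M := QuadDual 𝒜)).toLinearMap)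

/-- The quadratic dual `M^!` of a right module with initial component `X = M_t`: a left
`A^!`-module. -/
abbrev DualR (𝒜 : ℕ → Submodule R A) (act : A →ₗ[R] M →ₗ[R] M) (X : Submodule R M) : Type _ :=
  ModDual 𝒜 act X (QuadDual.ι 𝒜)

/-- The piece of degree `t + d` of the quadratic dual of a right module. -/
def DualR.piece (𝒜 : ℕ → Submodule R A) (act : A →ₗ[R] M →ₗ[R] M) (X : Submodule R M) (d : ℕ) :
    Submodule R (DualR 𝒜 act X) :=
  ModDual.piece 𝒜 act X (QuadDual.ι 𝒜) (QuadDual.piece 𝒜 d)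

/-- The map `A₁ × M_t → A × M`. -/
def degOne (𝒜 : ℕ → Submodule R A) (X : Submodule R M) : ((𝒜 1) × X) →ₗ[R] (A × M) :=
  LinearMap.prodMap (𝒜 1).subtype X.subtype

/-- The map `A₁^* × M_t^* → A^! × M^!`. -/
def degOneDual (𝒜 : ℕ → Submodule R A) (act : A →ₗ[R] M →ₗ[R] M) (X : Submodule R M)
    {B : Type*} [Ring B] [Algebra R B] (ι : Module.Dual R (𝒜 1) →ₗ[R] B) :
    (Module.Dual R (𝒜 1) × Module.Dual R X) →ₗ[R] (QuadDual 𝒜 × ModDual 𝒜 act X ι) :=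
  LinearMap.prodMap (QuadDual.ι 𝒜) (ModDual.mk 𝒜 act X ι 1)

/-- The canonical map `A₁^* × M_t^* → (A₁ × M_t)^*`. -/
def prodEval (𝒜 : ℕ → Submodule R A) (X : Submodule R M) :
    (Module.Dual R (𝒜 1) × Module.Dual R X) →ₗ[R] Module.Dual R ((𝒜 1) × X) :=
  (LinearMap.coprodEquiv R (M₃ := R) (M := 𝒜 1) (M₂ := X)).toLinearMap

/-- Let `M` be a left module with initial degree `t`.  There is a canonical isomorphism
`(S^α_{A,M_{≥t+a}})^* ≅ S^γ_{(M^!)_{≥t+c},A^!}`. -/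
def SchurDualL (𝒜 : ℕ → Submodule R A) (act : A →ₗ[R] M →ₗ[R] M) (ℳ : ℤ → Submodule R M)
    (t : ℤ) (α : List ℕ) (a : ℕ) (c : ℕ) (γ : List ℕ) : Prop :=
  ∃ Φ : Module.Dual R (schurL 𝒜 act α (ℳ (t + a))) ≃ₗ[R]
      schurR (QuadDual.piece 𝒜) (rightAct R (QuadDual 𝒜) (DualL 𝒜 act (ℳ t))) γ
        (DualL.piece 𝒜 act (ℳ t) c),
    IsCanonicalDual (mulL act) (mulR (rightAct R (QuadDual 𝒜) (DualL 𝒜 act (ℳ t))))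
      (degOne 𝒜 (ℳ t)) (degOneDual 𝒜 act (ℳ t) (QuadDual.ιop 𝒜)) (prodEval 𝒜 (ℳ t))
      (α.sum + a + 1)
      (letters M 𝒜 (List.replicate (α.sum + a) 1) ++ [letter A (ℳ t)])
      (letter (QuadDual 𝒜) (DualL.piece 𝒜 act (ℳ t) 0) ::
        letters (DualL 𝒜 act (ℳ t)) (QuadDual.piece 𝒜) (List.replicate (α.sum + a) 1))
      (α ++ [a + 1]) ((c + 1) :: γ) Φ

/-- Let `M` be a right module with initial degree `t`.  There is a canonical isomorphism
`(S^α_{M_{≥t+a},A})^* ≅ S^γ_{A^!,(M^!)_{≥t+c}}`. -/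
def SchurDualR (𝒜 : ℕ → Submodule R A) (act : A →ₗ[R] M →ₗ[R] M) (ℳ : ℤ → Submodule R M)
    (t : ℤ) (a : ℕ) (α : List ℕ) (γ : List ℕ) (c : ℕ) : Prop :=
  ∃ Φ : Module.Dual R (schurR 𝒜 act α (ℳ (t + a))) ≃ₗ[R]
      schurL (QuadDual.piece 𝒜) (leftAct R (QuadDual 𝒜) (DualR 𝒜 act (ℳ t))) γ
        (DualR.piece 𝒜 act (ℳ t) c),
    IsCanonicalDual (mulR act) (mulL (leftAct R (QuadDual 𝒜) (DualR 𝒜 act (ℳ t))))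
      (degOne 𝒜 (ℳ t)) (degOneDual 𝒜 act (ℳ t) (QuadDual.ι 𝒜)) (prodEval 𝒜 (ℳ t))
      (α.sum + a + 1)
      (letter A (ℳ t) :: letters M 𝒜 (List.replicate (α.sum + a) 1))
      (letters (DualR 𝒜 act (ℳ t)) (QuadDual.piece 𝒜) (List.replicate (α.sum + a) 1) ++
        [letter (QuadDual 𝒜) (DualR.piece 𝒜 act (ℳ t) 0)])
      ((a + 1) :: α) (γ ++ [c + 1]) Φ

end Modules

end RibbonSchur

end

open RibbonSchur

universe u v w

/-!
All statements concern submodules of a tensor algebra `T(E)`.  An algebra and a graded module over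
it are put into one module `E = A × M` with a product; this is a `RightSystem`.  Left modules are
right modules over the opposite algebra, with all words reversed.  Flatness is what makes
computations inside `T(E)` legitimate: for a flat space `X` of tensors of fixed degree, `X ⊗ Y` is
the product `X * Y` of submodules, and kernels and exact sequences may be multiplied by `X`
(`mulMap_injective_of_flat_left`, `mem_mul_inf_ker`, `mem_inf_ker_mul`).

*The Koszul property.*  Filtering the bar complex by the degree of the first letter, one sees that
homology (over a Koszul algebra) vanishes off the diagonal if and only if the multiplications
`Mo_a ⊗ S^{(1, …, 1)} → S^{(a + 1, 1, …, 1)}` are surjective for all `a > 0` (`MergesOnes`;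
`RightSystem.koszul_alg_iff`, `RightSystem.koszul_iff`).  This is a very special case of the
exactness of the canonical sequences.

*Exactness and flatness.*  By definition the ribbon module of a concatenation is the kernel of the
multiplication at the junction (`RightSystem.rib_append`), so only the surjectivity of
`S^{σ·b} ⊗ S^{c·τ} → S^{σ·(b+c)·τ}` has to be shown.  It follows from `MergesOnes` by adding rows in
front (`Merges.syzygy`), adding rows at the end (`Merges.cons`) and lengthening the row at the
junction (`Merges.trans`).  At the same time each ribbon module becomes the kernel of a surjection
between flat, respectively projective, modules (`MergesOnes.merges`, `MergesOnes.flat_rib`,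
`MergesOnes.projective_rib`).

*Duality.*  Let `c` be the list of columns of the ribbon `ρ`.  Multiplying the rows maps the product
of the ribbon modules of the columns onto `S^ρ`, and the kernel is the sum of the products with two
adjacent columns merged (`map_blockMul_cols`, `cols_inf_ker_le`).  Hence the dual of `S^ρ` consists
of the functionals on the product of the columns that vanish on all products with two columns
merged.  The product of the columns is a direct summand of the space of words of letters of degree
one, which is finitely generated projective, so that these functionals are given by words in the
dual letters.  In the quadratic dual, a word of dual letters becomes zero after multiplication of
its blocks exactly if it annihilates the product of the columns of the same sizes
(`DualSystem.blockMul_eq_zero`, `DualSystem.wordPairing_eq_zero`).  Therefore the functionals in question correspond to the products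
of blocks that are killed by all further multiplications, that is, to the ribbon module of the dual
whose rows are the columns of `ρ` (`DualSystem.exists_dual`).  That the quadratic duals of algebras
and modules have the required properties is shown in `exists_dualSystem_alg` and
`exists_dualSystem_mod`.
-/

noncomputable section

namespace RibbonSchur

/-! ### Words in the tensor algebra -/

section TensorAlgebraBasics

variable {R : Type*} [CommRing R] {E : Type*} [AddCommGroup E] [Module R E]

/-- The tensors of degree `k`. -/
abbrev degPart (R : Type*) [CommRing R] (E : Type*) [AddCommGroup E] [Module R E] (k : ℕ) :
    Submodule R (TensorAlgebra R E) := LinearMap.range (TensorAlgebra.ι R (M := E)) ^ k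

theorem ι_mem_degPart (e : E) : TensorAlgebra.ι R e ∈ degPart R E 1 := by
  rw [degPart, pow_one]; exact ⟨e, rfl⟩

theorem one_mem_degPart : (1 : TensorAlgebra R E) ∈ degPart R E 0 := by
  rw [degPart, pow_zero]; exact Submodule.one_le.mp le_rfl

theorem mul_mem_degPart {i j : ℕ} {x y : TensorAlgebra R E} (hx : x ∈ degPart R E i)
    (hy : y ∈ degPart R E j) : x * y ∈ degPart R E (i + j) := by
  rw [degPart, pow_add]; exact Submodule.mul_mem_mul hx hy

theorem ι_mul_mem_degPart {k : ℕ} (e : E) {x : TensorAlgebra R E} (hx : x ∈ degPart R E k) :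
    TensorAlgebra.ι R e * x ∈ degPart R E (k + 1) :=
  add_comm 1 k ▸ mul_mem_degPart (ι_mem_degPart e) hx

/-- A submodule containing `1` and closed under adding a letter in front is everything. -/
theorem eq_top_of_cons_mem (N : Submodule R (TensorAlgebra R E)) (h1 : 1 ∈ N)
    (hc : ∀ e, ∀ w ∈ N, TensorAlgebra.ι R e * w ∈ N) : N = ⊤ := by
  have key : ∀ u : TensorAlgebra R E, ∀ w ∈ N, u * w ∈ N := by
    intro u
    induction u using TensorAlgebra.induction with
    | algebraMap r => intro w hw; rw [← Algebra.smul_def]; exact N.smul_mem r hw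
    | ι e => exact hc e
    | mul a b ha hb => intro w hw; rw [mul_assoc]; exact ha _ (hb _ hw)
    | add a b ha hb => intro w hw; rw [add_mul]; exact N.add_mem (ha w hw) (hb w hw)
  exact eq_top_iff.mpr fun u _ => by simpa using key u 1 h1

/-- Induction on words, letter by letter. -/
theorem cons_induction {P : TensorAlgebra R E → Prop} (h0 : P 0)
    (hadd : ∀ x y, P x → P y → P (x + y)) (hsmul : ∀ (r : R) x, P x → P (r • x)) (h1 : P 1)
    (hc : ∀ e w, P w → P (TensorAlgebra.ι R e * w)) (w : TensorAlgebra R E) : P w := by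
  let N : Submodule R (TensorAlgebra R E) :=
    { carrier := {w | P w}, zero_mem' := h0, add_mem' := fun {a b} => hadd a b,
      smul_mem' := fun r {x} => hsmul r x }
  have : N = ⊤ := eq_top_of_cons_mem N h1 hc
  exact (this ▸ Submodule.mem_top : w ∈ N)

theorem degPart_induction {k : ℕ} {P : (x : TensorAlgebra R E) → x ∈ degPart R E (k + 1) → Prop}
    (hc : ∀ e w (hw : w ∈ degPart R E k), P (TensorAlgebra.ι R e * w) (ι_mul_mem_degPart e hw))
    (hadd : ∀ x y hx hy, P x hx → P y hy → P (x + y) (Submodule.add_mem _ hx hy))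
    {x : TensorAlgebra R E} (hx : x ∈ degPart R E (k + 1)) : P x hx := by
  have hx' : x ∈ LinearMap.range (TensorAlgebra.ι R (M := E)) * degPart R E k := by
    rwa [degPart, pow_succ'] at hx
  suffices h : ∃ h, P x h from h.2
  refine Submodule.mul_induction_on hx' ?_ ?_
  · rintro _ ⟨e, rfl⟩ w hw; exact ⟨_, hc e w hw⟩
  · rintro a b ⟨ha, pa⟩ ⟨hb, pb⟩; exact ⟨_, hadd a b ha hb pa pb⟩

/-- Adding a letter in front of a word. -/
def cons (R : Type*) [CommRing R] (E : Type*) [AddCommGroup E] [Module R E] :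
    E ⊗[R] TensorAlgebra R E →ₗ[R] TensorAlgebra R E :=
  LinearMap.mul' R _ ∘ₗ LinearMap.rTensor _ (TensorAlgebra.ι R)

@[simp] theorem cons_tmul (e : E) (w : TensorAlgebra R E) :
    cons R E (e ⊗ₜ w) = TensorAlgebra.ι R e * w := by simp [cons]

/-- The map `R × (E ⊗ T(E)) → T(E)`, which is an isomorphism. -/
def consUnit (R : Type*) [CommRing R] (E : Type*) [AddCommGroup E] [Module R E] :
    R × (E ⊗[R] TensorAlgebra R E) →ₗ[R] TensorAlgebra R E :=
  LinearMap.coprod (Algebra.linearMap R _) (cons R E)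

/-- Left multiplication by a letter, transported to `R × (E ⊗ T(E))`. -/
def consEnd (R : Type*) [CommRing R] (E : Type*) [AddCommGroup E] [Module R E] :
    E →ₗ[R] Module.End R (R × (E ⊗[R] TensorAlgebra R E)) where
  toFun e := LinearMap.inr R R _ ∘ₗ TensorProduct.mk R E _ e ∘ₗ consUnit R E
  map_add' e f := by ext <;> simp
  map_smul' r e := by ext <;> simp

theorem consUnit_lift (u : TensorAlgebra R E) (v : R × (E ⊗[R] TensorAlgebra R E)) :
    consUnit R E (TensorAlgebra.lift R (consEnd R E) u v) = u * consUnit R E v := by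
  induction u using TensorAlgebra.induction generalizing v with
  | algebraMap r => rw [AlgHom.commutes, Module.algebraMap_end_apply, map_smul, Algebra.smul_def]
  | ι e => simp [consEnd, consUnit]
  | mul a b ha hb => rw [map_mul, Module.End.mul_apply, ha, hb, mul_assoc]
  | add a b ha hb => rw [map_add, LinearMap.add_apply, map_add, ha, hb, add_mul]

/-- Splitting off the first letter; the inverse of `cons` on the augmentation ideal. -/
def uncons (R : Type*) [CommRing R] (E : Type*) [AddCommGroup E] [Module R E] :
    TensorAlgebra R E →ₗ[R] E ⊗[R] TensorAlgebra R E :=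
  LinearMap.snd R R _ ∘ₗ (LinearMap.applyₗ ((1, 0) : R × (E ⊗[R] TensorAlgebra R E))) ∘ₗ
    (TensorAlgebra.lift R (consEnd R E)).toLinearMap

@[simp] theorem uncons_one : uncons R E 1 = 0 := by simp [uncons]

@[simp] theorem uncons_cons (e : E) (w : TensorAlgebra R E) :
    uncons R E (TensorAlgebra.ι R e * w) = e ⊗ₜ w := by
  have h := consUnit_lift w (1, 0)
  have h1 : consUnit R E (1, 0) = 1 := by simp [consUnit]
  rw [h1, mul_one] at h
  have h2 : uncons R E (TensorAlgebra.ι R e * w) =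
      (consEnd R E e (TensorAlgebra.lift R (consEnd R E) w (1, 0))).2 := by
    simp [uncons]
  rw [h2]
  change e ⊗ₜ consUnit R E _ = _
  rw [h]

theorem cons_injective : Function.Injective (cons R E) := by
  apply Function.LeftInverse.injective (g := uncons R E)
  intro t
  induction t with
  | zero => simp
  | tmul e w => simp
  | add a b ha hb => rw [map_add, map_add, ha, hb]

/-! ### Multiplying adjacent letters -/

variable (mul : E →ₗ[R] E →ₗ[R] E)

theorem glue_tprod_of_le {p n : ℕ} (h : n ≤ p + 1) (v : Fin n → E) :
    glue mul p (TensorAlgebra.tprod R E n v) = 0 := by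
  have h1 : (TensorAlgebra.equivDirectSum (R := R) (M := E)).toLinearMap
      (TensorAlgebra.tprod R E n v) =
      DirectSum.of (fun n => ⨂[R]^n E) n (PiTensorProduct.tprod R v) :=
    TensorAlgebra.toDirectSum_tensorPower_tprod v
  rw [glue, LinearMap.comp_apply, h1]
  erw [DirectSum.toModule_lof]
  cases n with
  | zero => rfl
  | succ n =>
    have hn : ¬ p < n := by omega
    simp only [hn, dif_neg, not_false_eq_true, LinearMap.zero_apply]

theorem tprod_cons {n : ℕ} (e : E) (v : Fin n → E) :
    TensorAlgebra.tprod R E (n + 1) (Fin.cons e v) =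
      TensorAlgebra.ι R e * TensorAlgebra.tprod R E n v := by
  simp [TensorAlgebra.tprod_apply, List.ofFn_succ]

theorem tprod_induction {P : TensorAlgebra R E → Prop} (h0 : P 0)
    (hadd : ∀ x y, P x → P y → P (x + y)) (hsmul : ∀ (r : R) x, P x → P (r • x))
    (ht : ∀ n v, P (TensorAlgebra.tprod R E n v)) (w : TensorAlgebra R E) : P w := by
  have : Submodule.span R {x | ∃ n v, x = TensorAlgebra.tprod R E n v} = ⊤ := by
    refine eq_top_of_cons_mem _ (Submodule.subset_span ⟨0, Fin.elim0, ?_⟩) ?_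
    · simp [TensorAlgebra.tprod_apply]
    · intro e w hw
      induction hw using Submodule.span_induction with
      | mem x hx =>
        obtain ⟨n, v, rfl⟩ := hx
        exact Submodule.subset_span ⟨n + 1, Fin.cons e v, (tprod_cons e v).symm⟩
      | zero => simp
      | add x y _ _ hx hy => rw [mul_add]; exact Submodule.add_mem _ hx hy
      | smul r x _ hx => rw [mul_smul_comm]; exact Submodule.smul_mem _ r hx
  have hw : w ∈ Submodule.span R {x | ∃ n v, x = TensorAlgebra.tprod R E n v} := by
    rw [this]; exact Submodule.mem_top
  induction hw using Submodule.span_induction with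
  | mem x hx => obtain ⟨n, v, rfl⟩ := hx; exact ht n v
  | zero => exact h0
  | add x y _ _ hx hy => exact hadd x y hx hy
  | smul r x _ hx => exact hsmul r x hx

@[simp] theorem glue_one (p : ℕ) : glue mul p 1 = 0 := by
  have := glue_tprod_of_le mul (Nat.zero_le (p + 1)) (Fin.elim0 : Fin 0 → E)
  simpa [TensorAlgebra.tprod_apply] using this

@[simp] theorem glue_succ_cons (p : ℕ) (e : E) (w : TensorAlgebra R E) :
    glue mul (p + 1) (TensorAlgebra.ι R e * w) = TensorAlgebra.ι R e * glue mul p w := by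
  induction w using tprod_induction with
  | h0 => simp
  | hadd x y hx hy => rw [mul_add, map_add, map_add, mul_add, hx, hy]
  | hsmul r x hx => rw [mul_smul_comm, map_smul, map_smul, mul_smul_comm, hx]
  | ht n v =>
    rw [← tprod_cons]
    by_cases h : n ≤ p + 1
    · rw [glue_tprod_of_le mul (by omega), glue_tprod_of_le mul h, mul_zero]
    · obtain ⟨m, rfl⟩ : ∃ m, n = m + 1 := ⟨n - 1, by omega⟩
      rw [glue_tprod mul (by omega : p + 1 < m + 1), glue_tprod mul (by omega : p < m),
        ← tprod_cons]
      congr 1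
      ext k
      refine Fin.cases ?_ (fun k => ?_) k
      · rw [Fin.contractNth_apply_of_lt _ _ _ _ (by simp)]; rfl
      · simp only [Fin.contractNth, Fin.cons_succ, Fin.val_succ, Fin.val_castSucc]
        simp only [add_lt_add_iff_right, add_left_inj]
        rfl

@[simp] theorem glue_zero_cons (e f : E) (w : TensorAlgebra R E) :
    glue mul 0 (TensorAlgebra.ι R e * (TensorAlgebra.ι R f * w)) =
      TensorAlgebra.ι R (mul e f) * w := by
  induction w using tprod_induction with
  | h0 => simp
  | hadd x y hx hy => simp only [mul_add, map_add, hx, hy]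
  | hsmul r x hx => simp only [mul_smul_comm, map_smul, hx]
  | ht n v =>
    rw [← tprod_cons, ← tprod_cons, glue_tprod mul (by omega : 0 < n + 1), ← tprod_cons]
    congr 1
    ext k
    refine Fin.cases ?_ (fun k => ?_) k
    · rw [Fin.contractNth_apply_of_eq _ _ _ _ (by simp)]; rfl
    · rw [Fin.contractNth_apply_of_gt _ _ _ _ (by simp)]; rfl

@[simp] theorem glue_ι (p : ℕ) (e : E) : glue mul p (TensorAlgebra.ι R e) = 0 := by
  have := glue_tprod_of_le mul (show 1 ≤ p + 1 by omega) (fun _ : Fin 1 => e)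
  simpa [TensorAlgebra.tprod_apply] using this

theorem glue_zero_cons_two (e f : E) :
    glue mul 0 (TensorAlgebra.ι R e * TensorAlgebra.ι R f) = TensorAlgebra.ι R (mul e f) := by
  simpa using glue_zero_cons mul e f 1

/-- Gluing inside the right factor. -/
theorem glue_mul_of_mem {k : ℕ} {u : TensorAlgebra R E} (hu : u ∈ degPart R E k) (p : ℕ)
    (w : TensorAlgebra R E) : glue mul (k + p) (u * w) = u * glue mul p w := by
  induction k generalizing u with
  | zero =>
    rw [degPart, pow_zero] at hu
    obtain ⟨r, rfl⟩ := Submodule.mem_one.mp hu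
    rw [zero_add, ← Algebra.smul_def, ← Algebra.smul_def, map_smul]
  | succ k ih =>
    induction hu using degPart_induction with
    | hc e v hv =>
      rw [mul_assoc, show k + 1 + p = (k + p) + 1 by omega, glue_succ_cons, ih hv, mul_assoc]
    | hadd x y _ _ hx hy => rw [add_mul, map_add, hx, hy, add_mul]

theorem glue_eq_zero_of_mem {k p : ℕ} (h : k ≤ p + 1) {u : TensorAlgebra R E}
    (hu : u ∈ degPart R E k) : glue mul p u = 0 := by
  induction k generalizing u p with
  | zero =>
    have := glue_mul_of_mem mul hu p 1
    simpa using this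
  | succ k ih =>
    induction hu using degPart_induction with
    | hc e v hv =>
      cases p with
      | zero =>
        obtain rfl : k = 0 := by omega
        rw [degPart, pow_zero] at hv
        obtain ⟨r, rfl⟩ := Submodule.mem_one.mp hv
        rw [Algebra.algebraMap_eq_smul_one, mul_smul_comm, mul_one, map_smul, glue_ι, smul_zero]
      | succ p => rw [glue_succ_cons, ih (by omega) hv, mul_zero]
    | hadd x y _ _ hx hy => rw [map_add, hx, hy, add_zero]

/-- Gluing inside the left factor. -/
theorem glue_mul_left {k p : ℕ} (h : p + 2 ≤ k) {u : TensorAlgebra R E} (hu : u ∈ degPart R E k)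
    (w : TensorAlgebra R E) : glue mul p (u * w) = glue mul p u * w := by
  induction k generalizing u p with
  | zero => omega
  | succ k ih =>
    induction hu using degPart_induction with
    | hc e v hv =>
      cases p with
      | zero =>
        obtain ⟨j, rfl⟩ : ∃ j, k = j + 1 := ⟨k - 1, by omega⟩
        induction hv using degPart_induction with
        | hc f v' hv' => rw [glue_zero_cons, mul_assoc, mul_assoc, glue_zero_cons, mul_assoc]
        | hadd x y _ _ hx hy => rw [mul_add, add_mul, map_add, map_add, add_mul, hx, hy]
      | succ p => rw [mul_assoc, glue_succ_cons, glue_succ_cons, ih (by omega) hv, mul_assoc]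
    | hadd x y _ _ hx hy => rw [add_mul, map_add, map_add, hx, hy, add_mul]

theorem glue_mem_degPart {k : ℕ} {u : TensorAlgebra R E} (hu : u ∈ degPart R E (k + 1)) (p : ℕ) :
    glue mul p u ∈ degPart R E k := by
  induction k generalizing u p with
  | zero => rw [glue_eq_zero_of_mem mul (by omega) hu]; exact Submodule.zero_mem _
  | succ k ih =>
    induction hu using degPart_induction with
    | hc e v hv =>
      cases p with
      | zero =>
        induction hv using degPart_induction with
        | hc f v' hv' => rw [glue_zero_cons]; exact ι_mul_mem_degPart _ hv'
        | hadd x y _ _ hx hy => rw [mul_add, map_add]; exact Submodule.add_mem _ hx hy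
      | succ p => rw [glue_succ_cons]; exact ι_mul_mem_degPart _ (ih hv p)
    | hadd x y _ _ hx hy => rw [map_add]; exact Submodule.add_mem _ hx hy

/-- Gluing across a product, the left factor ending in a letter `e`. -/
theorem glue_across {k : ℕ} {u : TensorAlgebra R E} (hu : u ∈ degPart R E k) (e f : E)
    (w : TensorAlgebra R E) :
    glue mul k (u * TensorAlgebra.ι R e * (TensorAlgebra.ι R f * w)) =
      u * TensorAlgebra.ι R (mul e f) * w := by
  have := glue_mul_of_mem mul hu 0 (TensorAlgebra.ι R e * (TensorAlgebra.ι R f * w))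
  rw [add_zero, glue_zero_cons] at this
  rw [mul_assoc, this, mul_assoc]

/-- Associativity and locality: multiplications at different places commute. -/
theorem glue_glue (assoc : ∀ x y z, mul (mul x y) z = mul x (mul y z)) {p q : ℕ} (h : p ≤ q)
    (w : TensorAlgebra R E) : glue mul p (glue mul (q + 1) w) = glue mul q (glue mul p w) := by
  induction w using cons_induction generalizing p q with
  | h0 => simp
  | hadd x y hx hy => simp only [map_add, hx h, hy h]
  | hsmul r x hx => simp only [map_smul, hx h]
  | h1 => simp
  | hc e w ih =>
    cases p with
    | succ p =>
      obtain ⟨q, rfl⟩ : ∃ r, q = r + 1 := ⟨q - 1, by omega⟩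
      simp only [glue_succ_cons, ih (show p ≤ q by omega)]
    | zero =>
      clear ih
      induction w using cons_induction generalizing q e with
      | h0 => simp
      | hadd x y hx hy => simp only [mul_add, map_add, hx e h, hy e h]
      | hsmul r x hx => simp only [mul_smul_comm, map_smul, hx e h]
      | h1 => simp
      | hc f w ih =>
        cases q with
        | zero =>
          clear ih
          induction w using cons_induction with
          | h0 => simp
          | hadd x y hx hy => simp only [mul_add, map_add, hx, hy]
          | hsmul r x hx => simp only [mul_smul_comm, map_smul, hx]
          | h1 => simp [glue_zero_cons_two]
          | hc g w ih => simp [assoc]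
        | succ q => simp

/-! ### Spaces of words -/

@[simp] theorem words_nil : words ([] : List (Submodule R E)) = 1 := rfl

@[simp] theorem words_cons (W : Submodule R E) (Ws : List (Submodule R E)) :
    words (W :: Ws) = W.map (TensorAlgebra.ι R) * words Ws := by simp [words]

theorem words_append (Ws Vs : List (Submodule R E)) : words (Ws ++ Vs) = words Ws * words Vs := by
  simp [words]

theorem words_le_degPart (Ws : List (Submodule R E)) : words Ws ≤ degPart R E Ws.length := by
  induction Ws with
  | nil => rw [words_nil, degPart, List.length_nil, pow_zero]
  | cons W Ws ih =>
    rw [words_cons, degPart, List.length_cons, pow_succ']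
    exact mul_le_mul' LinearMap.map_le_range ih

end TensorAlgebraBasics

/-! ### Flatness and products of spaces of words -/

section FlatWords

variable {R : Type*} [CommRing R] {E : Type*} [AddCommGroup E] [Module R E]

/-- Juxtaposition `X ⊗ T(E) → T(E)`. -/
def mulT (X : Submodule R (TensorAlgebra R E)) :
    X ⊗[R] TensorAlgebra R E →ₗ[R] TensorAlgebra R E :=
  LinearMap.mul' R _ ∘ₗ LinearMap.rTensor _ X.subtype

@[simp] theorem mulT_tmul (X : Submodule R (TensorAlgebra R E)) (x : X) (w : TensorAlgebra R E) :
    mulT X (x ⊗ₜ w) = x * w := by simp [mulT]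

/-- `E ⊗ T_k(E) ≅ T_{k+1}(E)`, for flat `E`. -/
def consEquiv [Module.Flat R E] (k : ℕ) : E ⊗[R] degPart R E k ≃ₗ[R] degPart R E (k + 1) :=
  (LinearEquiv.ofInjective (cons R E ∘ₗ LinearMap.lTensor E (degPart R E k).subtype)
    (cons_injective.comp (Module.Flat.lTensor_preserves_injective_linearMap _
      (degPart R E k).injective_subtype))).trans
  (LinearEquiv.ofEq _ _ (by
    apply le_antisymm
    · rintro _ ⟨t, rfl⟩
      induction t with
      | zero => simp
      | tmul e w => simpa using ι_mul_mem_degPart e w.2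
      | add a b ha hb => rw [map_add]; exact Submodule.add_mem _ ha hb
    · intro x hx
      induction hx using degPart_induction with
      | hc e w hw => exact ⟨e ⊗ₜ ⟨w, hw⟩, by simp⟩
      | hadd x y _ _ hx hy => exact Submodule.add_mem _ hx hy))

@[simp] theorem consEquiv_tmul [Module.Flat R E] (k : ℕ) (e : E) (w : degPart R E k) :
    (consEquiv k (e ⊗ₜ w) : TensorAlgebra R E) = TensorAlgebra.ι R e * w := by
  change (cons R E ∘ₗ LinearMap.lTensor E (degPart R E k).subtype) (e ⊗ₜ w) = _
  simp

instance degPart_flat [Module.Flat R E] (k : ℕ) : Module.Flat R (degPart R E k) := by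
  induction k with
  | zero =>
    have : degPart R E 0 = LinearMap.range (Algebra.linearMap R (TensorAlgebra R E)) := by
      rw [degPart, pow_zero, Submodule.one_eq_range]
    rw [this]
    exact Module.Flat.of_linearEquiv (LinearEquiv.ofInjective
      (Algebra.linearMap R (TensorAlgebra R E))
      fun a b hab => (TensorAlgebra.algebraMap_inj E a b).mp hab).symm
  | succ k ih => exact Module.Flat.of_linearEquiv (consEquiv (R := R) (E := E) k).symm

instance tensorAlgebra_flat [Module.Flat R E] : Module.Flat R (TensorAlgebra R E) :=
  Module.Flat.of_linearEquiv (DirectSum.decomposeLinearEquiv (degPart R E))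

theorem mulT_degPart_injective [Module.Flat R E] (k : ℕ) :
    Function.Injective (mulT (degPart R E k)) := by
  induction k with
  | zero =>
    have hsurj : Function.Surjective fun w : TensorAlgebra R E =>
        ((⟨1, one_mem_degPart⟩ : degPart R E 0) ⊗ₜ[R] w) := by
      intro t
      induction t with
      | zero => exact ⟨0, by simp⟩
      | tmul x w =>
        have hx : (x : TensorAlgebra R E) ∈ (1 : Submodule R (TensorAlgebra R E)) := by
          simpa only [pow_zero] using x.2
        obtain ⟨r, hr⟩ := Submodule.mem_one.mp hx
        refine ⟨r • w, ?_⟩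
        simp only [TensorProduct.tmul_smul, TensorProduct.smul_tmul']
        congr 1
        ext
        simp [← hr, Algebra.algebraMap_eq_smul_one]
      | add a b ha hb =>
        obtain ⟨x, rfl⟩ := ha
        obtain ⟨y, rfl⟩ := hb
        exact ⟨x + y, by simp [TensorProduct.tmul_add]⟩
    intro a b hab
    obtain ⟨x, rfl⟩ := hsurj a
    obtain ⟨y, rfl⟩ := hsurj b
    have hab' : mulT (degPart R E 0) _ = mulT (degPart R E 0) _ := hab
    simp only [mulT_tmul, one_mul] at hab'
    rw [hab']
  | succ k ih =>
    have h : mulT (degPart R E (k + 1)) ∘ₗ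
        ((TensorProduct.congr (consEquiv k) (LinearEquiv.refl R (TensorAlgebra R E)))).toLinearMap =
        cons R E ∘ₗ LinearMap.lTensor E (mulT (degPart R E k)) ∘ₗ
          (TensorProduct.assoc R _ _ _).toLinearMap := by
      ext e x w
      simp [mul_assoc]
    have h2 : Function.Injective (cons R E ∘ₗ LinearMap.lTensor E (mulT (degPart R E k)) ∘ₗ
          (TensorProduct.assoc R _ _ _).toLinearMap) :=
      cons_injective.comp ((Module.Flat.lTensor_preserves_injective_linearMap _ ih).comp
        (LinearEquiv.injective _))
    rw [← h] at h2
    intro a b hab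
    obtain ⟨x, rfl⟩ := (TensorProduct.congr (consEquiv k)
      (LinearEquiv.refl R (TensorAlgebra R E))).surjective a
    obtain ⟨y, rfl⟩ := (TensorProduct.congr (consEquiv k)
      (LinearEquiv.refl R (TensorAlgebra R E))).surjective b
    rw [h2 hab]

variable [Module.Flat R E] {k : ℕ} {X Y : Submodule R (TensorAlgebra R E)}

theorem mulT_injective (hX : X ≤ degPart R E k) : Function.Injective (mulT X) := by
  have : mulT X = mulT (degPart R E k) ∘ₗ LinearMap.rTensor _ (Submodule.inclusion hX) := by
    ext; simp
  rw [this]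
  exact (mulT_degPart_injective k).comp (Module.Flat.rTensor_preserves_injective_linearMap _
    (Submodule.inclusion_injective hX))

/-- Words starting in a flat space `X` of tensors of fixed degree are honest tensors. -/
theorem mulMap_injective_of_flat_left (hX : X ≤ degPart R E k) [Module.Flat R X]
    (Y : Submodule R (TensorAlgebra R E)) : Function.Injective (Submodule.mulMap X Y) := by
  have : Submodule.mulMap X Y = mulT X ∘ₗ LinearMap.lTensor _ Y.subtype := by
    ext; simp
  rw [this]
  exact (mulT_injective hX).comp (Module.Flat.lTensor_preserves_injective_linearMap _
    Y.injective_subtype)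

/-- The isomorphism `X ⊗ Y ≅ X Y`. -/
def mulEquiv (h : Function.Injective (Submodule.mulMap X Y)) : X ⊗[R] Y ≃ₗ[R] ↥(X * Y) :=
  (LinearEquiv.ofInjective _ h).trans (LinearEquiv.ofEq _ _ (Submodule.mulMap_range X Y))

omit [Module.Flat R E] in
@[simp] theorem coe_mulEquiv (h : Function.Injective (Submodule.mulMap X Y)) (t : X ⊗[R] Y) :
    (mulEquiv h t : TensorAlgebra R E) = Submodule.mulMap X Y t := rfl

theorem flat_mul (hX : X ≤ degPart R E k) [Module.Flat R X] [Module.Flat R Y] :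
    Module.Flat R ↥(X * Y) :=
  Module.Flat.of_linearEquiv (mulEquiv (mulMap_injective_of_flat_left hX Y)).symm

theorem projective_mul (hX : X ≤ degPart R E k) [Module.Projective R X] [Module.Projective R Y] :
    Module.Projective R ↥(X * Y) :=
  Module.Projective.of_equiv (mulEquiv (mulMap_injective_of_flat_left hX Y))

/-- Tensoring a kernel with a flat module on the left. -/
theorem mem_mul_inf_ker (hX : X ≤ degPart R E k) [Module.Flat R X]
    {D D' : Module.End R (TensorAlgebra R E)} (h : ∀ u ∈ X, ∀ w ∈ Y, D' (u * w) = u * D w)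
    {z : TensorAlgebra R E} (hz : z ∈ X * Y) (h0 : D' z = 0) :
    z ∈ X * (Y ⊓ LinearMap.ker D) := by
  rw [← Submodule.mulMap_range] at hz ⊢
  obtain ⟨t, rfl⟩ := hz
  let f : ↥(Y ⊓ LinearMap.ker D) →ₗ[R] Y := Submodule.inclusion inf_le_left
  let g : Y →ₗ[R] TensorAlgebra R E := D ∘ₗ Y.subtype
  have hfg : Function.Exact f g := by
    intro y
    refine ⟨fun hy => ⟨⟨y, y.2, hy⟩, rfl⟩, ?_⟩
    rintro ⟨x, rfl⟩
    exact x.2.2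
  have h1 : mulT X ∘ₗ LinearMap.lTensor X g = D' ∘ₗ Submodule.mulMap X Y := by
    ext x y
    simp [h x x.2 y y.2, g]
  have h2 : LinearMap.lTensor X g t = 0 := by
    apply mulT_injective hX
    rw [map_zero, ← h0]
    exact congr($h1 t)
  obtain ⟨s, rfl⟩ := (Module.Flat.lTensor_exact X hfg t).mp h2
  refine ⟨s, ?_⟩
  have : Submodule.mulMap X Y ∘ₗ LinearMap.lTensor X f = Submodule.mulMap X _ := by ext; simp [f]
  exact congr($this.symm s)

/-- Tensoring a kernel with a flat module on the right. -/
theorem mem_inf_ker_mul {k' : ℕ} [Module.Flat R Y]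
    {D D' : Module.End R (TensorAlgebra R E)} (hD : ∀ x ∈ X, D x ∈ degPart R E k')
    (h : ∀ u ∈ X, ∀ w ∈ Y, D' (u * w) = D u * w)
    {z : TensorAlgebra R E} (hz : z ∈ X * Y) (h0 : D' z = 0) :
    z ∈ (X ⊓ LinearMap.ker D) * Y := by
  rw [← Submodule.mulMap_range] at hz ⊢
  obtain ⟨t, rfl⟩ := hz
  let f : ↥(X ⊓ LinearMap.ker D) →ₗ[R] X := Submodule.inclusion inf_le_left
  let g : X →ₗ[R] degPart R E k' := D.restrict hD
  have hfg : Function.Exact f g := by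
    intro y
    refine ⟨fun hy => ⟨⟨y, y.2, congrArg Subtype.val hy⟩, rfl⟩, ?_⟩
    rintro ⟨x, rfl⟩
    exact Subtype.ext x.2.2
  have h1 : Submodule.mulMap (degPart R E k') Y ∘ₗ LinearMap.rTensor Y g =
      D' ∘ₗ Submodule.mulMap X Y := by
    ext x y
    simp [h x x.2 y y.2, g]
  have h2 : LinearMap.rTensor Y g t = 0 := by
    apply mulMap_injective_of_flat_left le_rfl Y
    rw [map_zero, ← h0]
    exact congr($h1 t)
  obtain ⟨s, rfl⟩ := (Module.Flat.rTensor_exact Y hfg t).mp h2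
  refine ⟨s, ?_⟩
  have : Submodule.mulMap X Y ∘ₗ LinearMap.rTensor Y f = Submodule.mulMap _ Y := by ext; simp [f]
  exact congr($this.symm s)

/-- Tensoring an exact sequence with a flat module on the left. -/
theorem exists_of_mul_exact (hX : X ≤ degPart R E k) [Module.Flat R X]
    {Y' : Submodule R (TensorAlgebra R E)} {D D' D₂ D₂' : Module.End R (TensorAlgebra R E)}
    (h : ∀ u ∈ X, ∀ w ∈ Y, D' (u * w) = u * D w)
    (h₂ : ∀ u ∈ X, ∀ w ∈ Y', D₂' (u * w) = u * D₂ w)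
    (hex : ∀ y ∈ Y, D y = 0 → ∃ y' ∈ Y', D₂ y' = y)
    {z : TensorAlgebra R E} (hz : z ∈ X * Y) (h0 : D' z = 0) : ∃ y ∈ X * Y', D₂' y = z := by
  refine Submodule.mul_induction_on (mem_mul_inf_ker hX h hz h0) ?_ ?_
  · rintro u hu w ⟨hw, hw0⟩
    obtain ⟨y', hy', rfl⟩ := hex w hw hw0
    exact ⟨u * y', Submodule.mul_mem_mul hu hy', h₂ u hu y' hy'⟩
  · rintro a b ⟨x, hx, rfl⟩ ⟨y, hy, rfl⟩
    exact ⟨x + y, add_mem hx hy, map_add _ _ _⟩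

variable (mul : E →ₗ[R] E →ₗ[R] E)

theorem mem_mul_inf_ker_glue (hX : X ≤ degPart R E k) [Module.Flat R X]
    {z : TensorAlgebra R E} (hz : z ∈ X * Y) (N : ℕ) (h0 : ∀ p < N, glue mul (k + p) z = 0) :
    z ∈ X * (Y ⊓ ⨅ (p : ℕ) (_ : p < N), LinearMap.ker (glue mul p)) := by
  induction N with
  | zero => simpa using hz
  | succ N ih =>
    have := mem_mul_inf_ker hX (D := glue mul N) (D' := glue mul (k + N))
      (fun u hu w _ => glue_mul_of_mem mul (hX hu) N w) (ih fun p hp => h0 p (by omega))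
      (h0 N (by omega))
    refine (mul_le_mul' le_rfl ?_ : X * _ ≤ _) this
    intro x hx
    simp only [Submodule.mem_inf, Submodule.mem_iInf] at hx ⊢
    obtain ⟨⟨hx1, hx2⟩, hx3⟩ := hx
    refine ⟨hx1, ?_⟩
    intro p hp
    rcases Nat.lt_succ_iff_lt_or_eq.mp hp with h | rfl
    · exact hx2 p h
    · exact hx3

theorem mem_inf_ker_glue_mul (hX : X ≤ degPart R E k) [Module.Flat R Y]
    {z : TensorAlgebra R E} (hz : z ∈ X * Y) (N : ℕ) (hN : N < k ∨ N = 0)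
    (h0 : ∀ p < N, glue mul p z = 0) :
    z ∈ (X ⊓ ⨅ (p : ℕ) (_ : p < N), LinearMap.ker (glue mul p)) * Y := by
  induction N with
  | zero => simpa using hz
  | succ N ih =>
    obtain ⟨k, rfl⟩ : ∃ j, k = j + 1 := ⟨k - 1, by omega⟩
    have := mem_inf_ker_mul (k' := k) (D := glue mul N) (D' := glue mul N)
      (fun u hu => glue_mem_degPart mul (hX (Submodule.mem_inf.mp hu).1) N)
      (fun u hu w _ => glue_mul_left mul (by omega) (hX (Submodule.mem_inf.mp hu).1) w)
      (ih (by omega) fun p hp => h0 p (by omega)) (h0 N (by omega))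
    refine (mul_le_mul' ?_ le_rfl : _ * Y ≤ _) this
    intro x hx
    simp only [Submodule.mem_inf, Submodule.mem_iInf] at hx ⊢
    obtain ⟨⟨hx1, hx2⟩, hx3⟩ := hx
    refine ⟨hx1, ?_⟩
    intro p hp
    rcases Nat.lt_succ_iff_lt_or_eq.mp hp with h | rfl
    · exact hx2 p h
    · exact hx3

omit [Module.Flat R E] in
theorem mem_ribbon {W : List (Submodule R E)} {x : TensorAlgebra R E} :
    x ∈ ribbon mul W ↔ x ∈ words W ∧ ∀ p, glue mul p x = 0 := by
  simp only [ribbon, Submodule.mem_inf, Submodule.mem_iInf, LinearMap.mem_ker]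
  refine and_congr_right fun hx => ⟨fun h p => ?_, fun h p _ => h p⟩
  by_cases hp : p + 1 < W.length
  · exact h p hp
  · exact glue_eq_zero_of_mem mul (by omega) (words_le_degPart W hx)

omit [Module.Flat R E] in
theorem ribbon_le_words (W : List (Submodule R E)) : ribbon mul W ≤ words W := inf_le_left

omit [Module.Flat R E] in
theorem ribbon_le_degPart (W : List (Submodule R E)) : ribbon mul W ≤ degPart R E W.length :=
  inf_le_left.trans (words_le_degPart W)

omit [Module.Flat R E] in
theorem ribbon_eq (W : List (Submodule R E)) :
    ribbon mul W = words W ⊓ ⨅ (p : ℕ) (_ : p < W.length - 1), LinearMap.ker (glue mul p) := by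
  unfold ribbon
  simp only [Nat.lt_sub_iff_add_lt]

/-- Words killed by all multiplications inside each of two parts are products of ribbon
elements. -/
theorem mem_ribbon_mul_ribbon {W V : List (Submodule R E)} [Module.Flat R (ribbon mul W)]
    [Module.Flat R (words V)] {z : TensorAlgebra R E} (hz : z ∈ words (W ++ V))
    (h1 : ∀ p, p + 1 < W.length → glue mul p z = 0) (h2 : ∀ p, glue mul (W.length + p) z = 0) :
    z ∈ ribbon mul W * ribbon mul V := by
  rw [words_append] at hz
  have h3 := mem_inf_ker_glue_mul mul (words_le_degPart W) hz (W.length - 1) (by omega)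
    (fun p hp => h1 p (by omega))
  rw [← ribbon_eq] at h3
  have h4 := mem_mul_inf_ker_glue mul (ribbon_le_degPart mul W) h3 (V.length - 1)
    (fun p _ => h2 p)
  rwa [← ribbon_eq] at h4

omit [Module.Flat R E] in
theorem ribbon_mul_ribbon_le_words (W V : List (Submodule R E)) :
    ribbon mul W * ribbon mul V ≤ words (W ++ V) := by
  rw [words_append]
  exact mul_le_mul' (ribbon_le_words mul W) (ribbon_le_words mul V)

omit [Module.Flat R E] in
/-- Products of ribbon elements are killed by every multiplication inside the two parts. -/
theorem glue_ribbon_mul_ribbon {W V : List (Submodule R E)} {z : TensorAlgebra R E}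
    (hz : z ∈ ribbon mul W * ribbon mul V) {p : ℕ} (hp : p + 1 ≠ W.length) :
    glue mul p z = 0 := by
  refine Submodule.mul_induction_on hz (fun u hu v hv => ?_) fun x y hx hy => by
    rw [map_add, hx, hy, add_zero]
  rw [mem_ribbon] at hu hv
  have hd := words_le_degPart W hu.1
  by_cases h : p + 1 < W.length
  · rw [glue_mul_left mul (by omega) hd, hu.2, zero_mul]
  · obtain ⟨q, rfl⟩ : ∃ q, p = W.length + q := ⟨p - W.length, by omega⟩
    rw [glue_mul_of_mem mul hd, hv.2, mul_zero]

omit [Module.Flat R E] in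
theorem ribbon_mul_ribbon_inf_ker_le {W V : List (Submodule R E)} {p : ℕ}
    (hp : p + 1 = W.length) :
    ribbon mul W * ribbon mul V ⊓ LinearMap.ker (glue mul p) ≤ ribbon mul (W ++ V) := by
  rintro z ⟨hz, hz0⟩
  refine (mem_ribbon mul).mpr ⟨ribbon_mul_ribbon_le_words mul W V hz, fun q => ?_⟩
  by_cases h : q = p
  · rw [h]; exact hz0
  · exact glue_ribbon_mul_ribbon mul hz (by omega)

omit [Module.Flat R E] in
theorem flat_map_ι (W : Submodule R E) [Module.Flat R W] :
    Module.Flat R (W.map (TensorAlgebra.ι R)) :=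
  Module.Flat.of_linearEquiv (Submodule.equivMapOfInjective (TensorAlgebra.ι R)
    (TensorAlgebra.ι_leftInverse (R := R) (M := E)).injective W).symm

omit [Module.Flat R E] in
theorem projective_map_ι (W : Submodule R E) [Module.Projective R W] :
    Module.Projective R (W.map (TensorAlgebra.ι R)) :=
  Module.Projective.of_equiv (Submodule.equivMapOfInjective (TensorAlgebra.ι R)
    (TensorAlgebra.ι_leftInverse (R := R) (M := E)).injective W)

omit [Module.Flat R E] in
theorem map_ι_le_degPart (W : Submodule R E) : W.map (TensorAlgebra.ι R) ≤ degPart R E 1 := by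
  rw [degPart, pow_one]; exact LinearMap.map_le_range

omit [Module.Flat R E] in
instance flat_one : Module.Flat R (1 : Submodule R (TensorAlgebra R E)) := by
  rw [Submodule.one_eq_range]
  exact Module.Flat.of_linearEquiv (LinearEquiv.ofInjective
    (Algebra.linearMap R (TensorAlgebra R E))
      fun a b hab => (TensorAlgebra.algebraMap_inj E a b).mp hab).symm

theorem flat_words {W : List (Submodule R E)} (h : ∀ V ∈ W, Module.Flat R V) :
    Module.Flat R (words W) := by
  induction W with
  | nil => rw [words_nil]; infer_instance
  | cons V W ih =>
    have := h V (by simp)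
    have := flat_map_ι V
    have := ih fun V hV => h V (by simp [hV])
    rw [words_cons]
    exact flat_mul (map_ι_le_degPart V)

end FlatWords

/-! ### Right systems -/

section Kernels

variable {R : Type*} [CommRing R]

/-- The kernel of a surjection of flat modules is flat. -/
theorem flat_ker {N P : Type*} [AddCommGroup N] [Module R N] [AddCommGroup P] [Module R P]
    [Module.Flat R N] [Module.Flat R P] (f : N →ₗ[R] P) (hf : Function.Surjective f) :
    Module.Flat R (LinearMap.ker f) := by
  rw [Module.Flat.iff_rTensor_injective']
  intro I
  have h1 := LinearMap.lTensor_injective_of_exact_of_flat f hf (LinearMap.ker f).subtype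
    (LinearMap.ker f).injective_subtype (LinearMap.exact_subtype_ker_map f) I
  have h2 : Function.Injective (LinearMap.rTensor N I.subtype) :=
    Module.Flat.rTensor_preserves_injective_linearMap _ I.injective_subtype
  have h3 : LinearMap.lTensor R (LinearMap.ker f).subtype ∘ₗ
      LinearMap.rTensor (LinearMap.ker f) I.subtype =
      LinearMap.rTensor N I.subtype ∘ₗ LinearMap.lTensor I (LinearMap.ker f).subtype := by
    ext; simp
  have h4 : Function.Injective (LinearMap.lTensor R (LinearMap.ker f).subtype ∘ₗ
      LinearMap.rTensor (LinearMap.ker f) I.subtype) := by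
    rw [h3]; exact h2.comp h1
  exact Function.Injective.of_comp h4

theorem projective_ker {N P : Type*} [AddCommGroup N] [Module R N] [AddCommGroup P] [Module R P]
    [Module.Projective R N] [Module.Projective R P] (f : N →ₗ[R] P) (hf : Function.Surjective f) :
    Module.Projective R (LinearMap.ker f) := by
  obtain ⟨s, hs⟩ := f.exists_rightInverse_of_surjective (LinearMap.range_eq_top.mpr hf)
  have hs' : ∀ x, f (s x) = x := fun x => congr($hs x)
  refine Module.Projective.of_split (LinearMap.ker f).subtype
    ((LinearMap.id - s ∘ₗ f).codRestrict (LinearMap.ker f) fun x => by simp [hs']) ?_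
  ext x
  simp

variable {T : Type*} [AddCommGroup T] [Module R T] {X N : Submodule R T} {D : Module.End R T}

theorem exists_restrict_surjective (h : X.map D = N) :
    ∃ f : X →ₗ[R] N, Function.Surjective f ∧ (∀ x, (f x : T) = D x) ∧
      Nonempty (LinearMap.ker f ≃ₗ[R] ↥(X ⊓ LinearMap.ker D)) := by
  have hm : ∀ x ∈ X, D x ∈ N := fun x hx => h ▸ Submodule.mem_map_of_mem hx
  refine ⟨D.restrict hm, ?_, fun x => rfl, ⟨?_⟩⟩
  · rintro ⟨y, hy⟩
    rw [← h] at hy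
    obtain ⟨x, hx, rfl⟩ := hy
    exact ⟨⟨x, hx⟩, rfl⟩
  · refine LinearEquiv.ofBijective (LinearMap.codRestrict (X ⊓ LinearMap.ker D)
      (X.subtype ∘ₗ (LinearMap.ker (D.restrict hm)).subtype)
      fun x => ⟨x.1.2, congrArg Subtype.val x.2⟩) ⟨?_, ?_⟩
    · intro a b hab
      have := congrArg Subtype.val hab
      exact Subtype.ext (Subtype.ext this)
    · rintro ⟨x, hx, hx0⟩
      exact ⟨⟨⟨x, hx⟩, Subtype.ext hx0⟩, rfl⟩

theorem flat_inf_ker [Module.Flat R X] [Module.Flat R N] (h : X.map D = N) :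
    Module.Flat R ↥(X ⊓ LinearMap.ker D) := by
  obtain ⟨f, hf, -, ⟨e⟩⟩ := exists_restrict_surjective h
  have := flat_ker f hf
  exact Module.Flat.of_linearEquiv e.symm

theorem projective_inf_ker [Module.Projective R X] [Module.Projective R N] (h : X.map D = N) :
    Module.Projective R ↥(X ⊓ LinearMap.ker D) := by
  obtain ⟨f, hf, -, ⟨e⟩⟩ := exists_restrict_surjective h
  have := projective_ker f hf
  exact Module.Projective.of_equiv e

end Kernels

/-- A positively graded algebra without unit with pieces `L n`, acting from the right on a graded
module with pieces `Mo n`, all realised inside one module `E` with an associative product.  Both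
gradings start in degree one; the pieces with index `0` play no role. -/
structure RightSystem (R E : Type*) [CommRing R] [AddCommGroup E] [Module R E] where
  /-- the product -/
  mul : E →ₗ[R] E →ₗ[R] E
  /-- the pieces of the algebra -/
  L : ℕ → Submodule R E
  /-- the pieces of the module -/
  Mo : ℕ → Submodule R E
  assoc : ∀ x y z, mul (mul x y) z = mul x (mul y z)
  mul_mem : ∀ {i j x y}, 0 < i → 0 < j → x ∈ L i → y ∈ L j → mul x y ∈ L (i + j)
  act_mem : ∀ {i j x y}, 0 < i → 0 < j → x ∈ Mo i → y ∈ L j → mul x y ∈ Mo (i + j)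
  exists_proj_L : ∀ n, 0 < n →
    ∃ f : E →ₗ[R] E, (∀ x ∈ L n, f x = x) ∧ ∀ m, 0 < m → m ≠ n → ∀ x ∈ L m, f x = 0
  exists_proj_Mo : ∀ n, 0 < n →
    ∃ f : E →ₗ[R] E, (∀ x ∈ Mo n, f x = x) ∧ ∀ m, 0 < m → m ≠ n → ∀ x ∈ Mo m, f x = 0
  flat : Module.Flat R E
  flat_L : ∀ n, 0 < n → Module.Flat R (L n)
  flat_Mo : ∀ n, 0 < n → Module.Flat R (Mo n)

theorem mem_mul_of_le {R A : Type*} [CommRing R] [Ring A] [Algebra R A]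
    {X X' Y Y' : Submodule R A} (hX : X ≤ X') (hY : Y ≤ Y') {z : A} (hz : z ∈ X * Y) :
    z ∈ X' * Y' := (mul_le_mul' hX hY : X * Y ≤ X' * Y') hz

/-- All entries of a list are positive. -/
abbrev Pos (α : List ℕ) : Prop := ∀ a ∈ α, 0 < a

theorem pos_snoc {σ : List ℕ} {a : ℕ} (hσ : Pos σ) (ha : 0 < a) : Pos (σ ++ [a]) := by
  intro x hx
  rcases List.mem_append.mp hx with h | h
  · exact hσ x h
  · rwa [List.mem_singleton.mp h]

namespace RightSystem

variable {R : Type*} [CommRing R] {E : Type*} [AddCommGroup E] [Module R E]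
  (S : RightSystem R E)

/-- The algebra as a module over itself. -/
def alg : RightSystem R E :=
  { S with Mo := S.L, act_mem := S.mul_mem, exists_proj_Mo := S.exists_proj_L,
           flat_Mo := S.flat_L }

/-- The spaces of letters in `Mo_{ρ₁} ⊗ L_{ρ₂} ⊗ ⋯ ⊗ L_{ρₖ}`. -/
def lets : List ℕ → List (Submodule R E)
  | [] => []
  | a :: α => S.Mo a :: α.map S.L

/-- The ribbon module attached to `ρ`. -/
def rib (ρ : List ℕ) : Submodule R (TensorAlgebra R E) := ribbon S.mul (S.lets ρ)

@[simp] theorem alg_mul : S.alg.mul = S.mul := rfl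
@[simp] theorem alg_L : S.alg.L = S.L := rfl
@[simp] theorem alg_Mo : S.alg.Mo = S.L := rfl
@[simp] theorem alg_alg : S.alg.alg = S.alg := rfl

@[simp] theorem alg_lets (α : List ℕ) : S.alg.lets α = α.map S.L := by cases α <;> rfl

@[simp] theorem length_lets (ρ : List ℕ) : (S.lets ρ).length = ρ.length := by
  cases ρ <;> simp [lets]

theorem lets_append {ρ : List ℕ} (h : ρ ≠ []) (β : List ℕ) :
    S.lets (ρ ++ β) = S.lets ρ ++ S.alg.lets β := by
  cases ρ with
  | nil => exact absurd rfl h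
  | cons a α => rw [alg_lets]; simp [lets]

theorem flat_words_lets {ρ : List ℕ} (h : Pos ρ) : Module.Flat R (words (S.lets ρ)) := by
  have := S.flat
  apply flat_words
  cases ρ with
  | nil => simp [lets]
  | cons a α =>
    intro V hV
    rcases List.mem_cons.mp hV with rfl | hV
    · exact S.flat_Mo a (h a (by simp))
    · obtain ⟨b, hb, rfl⟩ := List.mem_map.mp hV
      exact S.flat_L b (h b (by simp [hb]))

theorem rib_le_degPart (ρ : List ℕ) : S.rib ρ ≤ degPart R E ρ.length := by
  have := ribbon_le_degPart S.mul (S.lets ρ)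
  rwa [length_lets] at this

theorem words_le_degPart (ρ : List ℕ) : words (S.lets ρ) ≤ degPart R E ρ.length := by
  have := RibbonSchur.words_le_degPart (S.lets ρ)
  rwa [length_lets] at this

theorem mem_rib {ρ : List ℕ} {x : TensorAlgebra R E} :
    x ∈ S.rib ρ ↔ x ∈ words (S.lets ρ) ∧ ∀ p, glue S.mul p x = 0 := mem_ribbon S.mul

theorem rib_singleton (a : ℕ) : S.rib [a] = (S.Mo a).map (TensorAlgebra.ι R) := by
  ext x
  rw [mem_rib]
  simp only [lets, List.map_nil, words_cons, words_nil, mul_one]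
  refine and_iff_left_of_imp fun hx p => ?_
  obtain ⟨e, -, rfl⟩ := hx
  exact glue_ι _ _ _

theorem flat_rib_singleton {a : ℕ} (h : 0 < a) : Module.Flat R (S.rib [a]) := by
  have := S.flat_Mo a h
  rw [rib_singleton]
  exact flat_map_ι _

theorem words_lets_append {ρ : List ℕ} (h : ρ ≠ []) (β : List ℕ) :
    words (S.lets (ρ ++ β)) = words (S.lets ρ) * words (S.alg.lets β) := by
  rw [lets_append S h, words_append]

theorem mem_rib_mul_rib {ρ β : List ℕ} (hρ : ρ ≠ []) (hβ : Pos β) [Module.Flat R (S.rib ρ)]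
    {z : TensorAlgebra R E} (hz : z ∈ words (S.lets (ρ ++ β)))
    (h1 : ∀ p, p + 1 ≠ ρ.length → glue S.mul p z = 0) :
    z ∈ S.rib ρ * S.alg.rib β := by
  have := S.flat
  have := S.alg.flat_words_lets hβ
  rw [lets_append S hρ] at hz
  have : Module.Flat R (ribbon S.mul (S.lets ρ)) := ‹Module.Flat R (S.rib ρ)›
  refine mem_ribbon_mul_ribbon S.mul hz (fun p hp => h1 p ?_) (fun p => h1 _ ?_)
  · rw [length_lets] at hp; omega
  · rw [length_lets]; omega

theorem rib_append_le {ρ β : List ℕ} (hρ : ρ ≠ []) (hβ : Pos β) [Module.Flat R (S.rib ρ)] :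
    S.rib (ρ ++ β) ≤ S.rib ρ * S.alg.rib β := fun _ hz =>
  S.mem_rib_mul_rib hρ hβ (S.mem_rib.mp hz).1 fun p _ => (S.mem_rib.mp hz).2 p

theorem rib_mul_rib_le_words {ρ : List ℕ} (hρ : ρ ≠ []) (β : List ℕ) :
    S.rib ρ * S.alg.rib β ≤ words (S.lets (ρ ++ β)) := by
  rw [lets_append S hρ]
  exact ribbon_mul_ribbon_le_words S.mul _ _

theorem glue_rib_mul_rib {ρ β : List ℕ} {z : TensorAlgebra R E}
    (hz : z ∈ S.rib ρ * S.alg.rib β) {p : ℕ} (hp : p + 1 ≠ ρ.length) : glue S.mul p z = 0 :=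
  glue_ribbon_mul_ribbon S.mul hz (by rwa [length_lets])

theorem rib_mul_rib_inf_ker_le {ρ β : List ℕ} (hρ : ρ ≠ []) {p : ℕ} (hp : p + 1 = ρ.length) :
    S.rib ρ * S.alg.rib β ⊓ LinearMap.ker (glue S.mul p) ≤ S.rib (ρ ++ β) := by
  have := ribbon_mul_ribbon_inf_ker_le S.mul (W := S.lets ρ) (V := S.alg.lets β) (p := p)
    (by rwa [length_lets])
  rwa [← lets_append S hρ] at this

/-- The ribbon module of a concatenation is the kernel of the multiplication at the junction. -/
theorem rib_append {ρ β : List ℕ} (hρ : ρ ≠ []) (hβ : Pos β) [Module.Flat R (S.rib ρ)] {p : ℕ}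
    (hp : p + 1 = ρ.length) :
    S.rib (ρ ++ β) = S.rib ρ * S.alg.rib β ⊓ LinearMap.ker (glue S.mul p) :=
  le_antisymm (le_inf (S.rib_append_le hρ hβ) fun _ hz => (S.mem_rib.mp hz).2 p)
    (S.rib_mul_rib_inf_ker_le hρ hp)

/-- Multiplication at a junction maps words to words. -/
theorem glue_words {σ : List ℕ} {b c : ℕ} {τ : List ℕ} (hσ : Pos σ) (hb : 0 < b) (hc : 0 < c)
    {z : TensorAlgebra R E} (hz : z ∈ words (S.lets (σ ++ [b]) ) * words (S.alg.lets (c :: τ))) :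
    glue S.mul σ.length z ∈ words (S.lets (σ ++ (b + c) :: τ)) := by
  have key : ∀ (V : Submodule R (TensorAlgebra R E)) (N N' : Submodule R E) (k : ℕ),
      V ≤ degPart R E k → (∀ x ∈ N, ∀ y ∈ S.L c, S.mul x y ∈ N') →
      z ∈ (V * N.map (TensorAlgebra.ι R)) * words (S.alg.lets (c :: τ)) →
      glue S.mul k z ∈ V * (N'.map (TensorAlgebra.ι R) * words (τ.map S.L)) := by
    intro V N N' k hV hN hz
    refine Submodule.mul_induction_on hz ?_ fun x y hx hy => by
      rw [map_add]; exact add_mem hx hy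
    intro m hm n hn
    simp only [alg_lets, List.map_cons, words_cons] at hn
    refine Submodule.mul_induction_on hm ?_ fun x y hx hy => by
      rw [add_mul, map_add]; exact add_mem hx hy
    rintro v hv _ ⟨x, hx, rfl⟩
    refine Submodule.mul_induction_on hn ?_ fun x y hx hy => by
      rw [mul_add, map_add]; exact add_mem hx hy
    rintro _ ⟨y, hy, rfl⟩ w hw
    rw [glue_across S.mul (hV hv), mul_assoc]
    exact Submodule.mul_mem_mul hv (Submodule.mul_mem_mul ⟨_, hN x hx y hy, rfl⟩ hw)
  cases σ with
  | nil =>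
    have := key 1 (S.Mo b) (S.Mo (b + c)) 0 (by rw [degPart, pow_zero])
      (fun x hx y hy => S.act_mem hb hc hx hy) (by simpa [lets] using hz)
    simpa [lets] using this
  | cons a σ =>
    have hw : words (S.lets (a :: σ ++ [b])) =
        words (S.lets (a :: σ)) * (S.L b).map (TensorAlgebra.ι R) := by
      rw [words_lets_append S (by simp)]; simp
    rw [hw] at hz
    have := key _ (S.L b) (S.L (b + c)) _ (S.words_le_degPart (a :: σ))
      (fun x hx y hy => S.mul_mem hb hc hx hy) hz
    rw [words_lets_append S (by simp)]
    simpa using this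

/-- Multiplication at a junction maps products of ribbon elements to ribbon elements. -/
theorem glue_rib {σ : List ℕ} {b c : ℕ} {τ : List ℕ} (hσ : Pos σ) (hb : 0 < b) (hc : 0 < c)
    {z : TensorAlgebra R E} (hz : z ∈ S.rib (σ ++ [b]) * S.alg.rib (c :: τ)) :
    glue S.mul σ.length z ∈ S.rib (σ ++ (b + c) :: τ) := by
  refine S.mem_rib.mpr ⟨S.glue_words hσ hb hc
    (mem_mul_of_le (ribbon_le_words _ _) (ribbon_le_words _ _) hz), fun p => ?_⟩
  · rcases lt_or_ge p σ.length with h | h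
    · obtain ⟨q, hq⟩ : ∃ q, σ.length = q + 1 := ⟨σ.length - 1, by omega⟩
      rw [hq, glue_glue S.mul S.assoc (by omega), S.glue_rib_mul_rib hz (by simp; omega), map_zero]
    · rw [← glue_glue S.mul S.assoc h, S.glue_rib_mul_rib hz (by simp; omega), map_zero]

theorem mul_map_glue_le {X Y : Submodule R (TensorAlgebra R E)} {k : ℕ} (hX : X ≤ degPart R E k)
    (p : ℕ) : X * Y.map (glue S.mul p) ≤ (X * Y).map (glue S.mul (k + p)) := by
  refine Submodule.mul_le.mpr ?_
  rintro u hu _ ⟨w, hw, rfl⟩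
  exact ⟨u * w, Submodule.mul_mem_mul hu hw, glue_mul_of_mem _ (hX hu) p w⟩

theorem map_glue_mul_le {X Y : Submodule R (TensorAlgebra R E)} {k p : ℕ} (hp : p + 2 ≤ k)
    (hX : X ≤ degPart R E k) :
    X.map (glue S.mul p) * Y ≤ (X * Y).map (glue S.mul p) := by
  refine Submodule.mul_le.mpr ?_
  rintro _ ⟨u, hu, rfl⟩ w hw
  exact ⟨u * w, Submodule.mul_mem_mul hu hw, glue_mul_left _ hp (hX hu) w⟩

theorem rib_mul_rib_le_degPart (ρ β : List ℕ) :
    S.rib ρ * S.alg.rib β ≤ degPart R E (ρ.length + β.length) := by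
  rw [degPart, pow_add]
  exact mul_le_mul' (S.rib_le_degPart ρ) (S.alg.rib_le_degPart β)

/-- The map `S^{σ·b} ⊗ S^{c·τ} → S^{σ·(b+c)·τ}` multiplying at the junction is surjective. -/
def Merges (σ : List ℕ) (b c : ℕ) (τ : List ℕ) : Prop :=
  S.rib (σ ++ (b + c) :: τ) ≤ (S.rib (σ ++ [b]) * S.alg.rib (c :: τ)).map (glue S.mul σ.length)

theorem glue_triple {ρ β γ : List ℕ} {z : TensorAlgebra R E}
    (hz : z ∈ S.rib ρ * S.alg.rib β * S.alg.rib γ) {p : ℕ} (h1 : p + 1 ≠ ρ.length)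
    (h2 : p + 1 ≠ ρ.length + β.length) : glue S.mul p z = 0 := by
  refine Submodule.mul_induction_on hz ?_ fun x y hx hy => by
    rw [map_add, hx, hy, add_zero]
  intro u hu v hv
  have hd := S.rib_mul_rib_le_degPart _ _ hu
  by_cases h : p + 2 ≤ ρ.length + β.length
  · rw [glue_mul_left S.mul h hd, S.glue_rib_mul_rib hu h1, zero_mul]
  · obtain ⟨q, rfl⟩ : ∃ q, p = ρ.length + β.length + q :=
      ⟨p - (ρ.length + β.length), by omega⟩
    rw [glue_mul_of_mem S.mul hd, ← alg_mul, (S.alg.mem_rib.mp hv).2, mul_zero]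

variable {S} {σ τ : List ℕ} {a b c : ℕ}

/-- Surjectivity is inherited by ribbons with a further row in front.  A preimage `w` under the
multiplication at the last junction is corrected by an element `z` that has the same product at the
junction before it, so that `w - z` is a ribbon element there. -/
theorem Merges.syzygy (h1 : S.alg.Merges [] b c τ) (h2 : S.Merges σ a b (c :: τ))
    (hσ : Pos σ) (ha : 0 < a) (hb : 0 < b) (hc : 0 < c) (hτ : Pos τ)
    (f1 : Module.Flat R (S.rib (σ ++ [a]))) (f2 : Module.Flat R (S.rib (σ ++ [a] ++ [b]))) :
    S.Merges (σ ++ [a]) b c τ := by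
  have hcτ : Pos (c :: τ) := by simpa [Pos, hc] using hτ
  have hbcτ : Pos (b :: c :: τ) := by simpa [Pos, hb] using hcτ
  have hk : (σ ++ [a]).length = σ.length + 1 := by simp
  intro y hy
  have hy1 := S.rib_append_le (by simp) (by simpa [Pos, hb] using hτ) hy
  have hy2 := S.mul_map_glue_le (S.rib_le_degPart (σ ++ [a])) 0
    (mem_mul_of_le le_rfl h1 hy1)
  obtain ⟨w, hw, rfl⟩ := hy2
  rw [hk, add_zero] at hy ⊢
  have hw' : w ∈ (S.rib (σ ++ [a]) * S.alg.rib [b]) * S.alg.rib (c :: τ) := by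
    rw [mul_assoc]; exact hw
  -- The product at the other junction lies in the ribbon module of a concatenation.
  have hz1 : glue S.mul σ.length w ∈ S.rib (σ ++ [a + b]) * S.alg.rib (c :: τ) := by
    refine Submodule.mul_induction_on hw' ?_ fun x y hx hy => by
      rw [map_add]; exact add_mem hx hy
    intro u hu v hv
    rw [glue_mul_left S.mul (by simp) (S.rib_mul_rib_le_degPart _ _ hu)]
    exact Submodule.mul_mem_mul (S.glue_rib hσ ha hb hu) hv
  have hz2 : glue S.mul σ.length w ∈ S.rib (σ ++ [a + b] ++ c :: τ) := by
    refine S.rib_mul_rib_inf_ker_le (by simp) (p := σ.length) (by simp) ⟨hz1, ?_⟩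
    refine LinearMap.mem_ker.mpr ?_
    rw [← glue_glue S.mul S.assoc le_rfl, (S.mem_rib.mp hy).2]
  rw [List.append_assoc, List.singleton_append] at hz2
  -- A second preimage of that product: it is killed at the last junction.
  obtain ⟨z, hz, hzw⟩ := h2 hz2
  have hzw' : z ∈ words (S.lets (σ ++ [a] ++ [b] ++ c :: τ)) := by
    have := S.rib_mul_rib_le_words (by simp) _ hz
    simpa using this
  have hww : w ∈ words (S.lets (σ ++ [a] ++ [b] ++ c :: τ)) := by
    rw [S.words_lets_append (by simp), S.words_lets_append (by simp)]
    exact mem_mul_of_le (mul_le_mul' (ribbon_le_words _ _) (ribbon_le_words _ _))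
      (ribbon_le_words _ _) hw'
  refine ⟨w - z, S.mem_rib_mul_rib (by simp) hcτ (sub_mem hww hzw') fun p hp => ?_, ?_⟩
  · rw [map_sub]
    rcases eq_or_ne p σ.length with rfl | hp'
    · rw [hzw, sub_self]
    · rw [S.glue_triple hw' (by simpa using hp') (by simpa using hp),
        S.glue_rib_mul_rib hz (by simpa using hp'), sub_zero]
  · rw [map_sub, S.glue_rib_mul_rib hz (by simp), sub_zero]

/-- Surjectivity at a junction with several letters on the right follows, one letter at a time,
from surjectivity for a single letter. -/
theorem Merges.cons {d : ℕ} (h1 : S.Merges σ a b []) (h2 : S.Merges (σ ++ [a]) b d τ)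
    (hσ : Pos σ) (ha : 0 < a) (hb : 0 < b) (hd : 0 < d) (hτ : Pos τ)
    (f1 : Module.Flat R (S.rib (σ ++ [a]))) (f2 : Module.Flat R (S.rib (σ ++ [a + b]))) :
    S.Merges σ a b (d :: τ) := by
  have hdτ : Pos (d :: τ) := by simpa [Pos, hd] using hτ
  have hbdτ : Pos (b :: d :: τ) := by simpa [Pos, hb] using hdτ
  have hσa : Pos (σ ++ [a]) := pos_snoc ‹Pos σ› (by omega)
  have hk : (σ ++ [a]).length = σ.length + 1 := by simp
  intro y hy
  have hy' : y ∈ S.rib (σ ++ [a + b] ++ d :: τ) := by simpa using hy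
  have hy1 := S.rib_append_le (by simp) hdτ hy'
  have hy2 := S.map_glue_mul_le (by simp : σ.length + 2 ≤ (σ ++ [a]).length + [b].length)
    (S.rib_mul_rib_le_degPart _ _)
    (mem_mul_of_le h1 le_rfl hy1)
  obtain ⟨w, hw, rfl⟩ := hy2
  have hw : w ∈ S.rib (σ ++ [a]) * S.alg.rib [b] * S.alg.rib (d :: τ) := hw
  -- The defect of `w` is its product at the second junction; `z` has the same defect and is killed
  -- at the first junction.
  have hu1 : glue S.mul (σ.length + 1) w ∈ S.rib (σ ++ [a]) * S.alg.rib ((b + d) :: τ) := by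
    rw [mul_assoc] at hw
    refine Submodule.mul_induction_on hw ?_ fun x y hx hy => by
      rw [map_add]; exact add_mem hx hy
    intro u hu v hv
    have := glue_mul_of_mem S.mul (S.rib_le_degPart _ hu) 0 v
    rw [hk, add_zero] at this
    rw [this]
    exact Submodule.mul_mem_mul hu (S.alg.glue_rib (σ := []) (List.forall_mem_nil _) hb hd hv)
  have hu2 : glue S.mul (σ.length + 1) w ∈ S.rib (σ ++ [a] ++ (b + d) :: τ) := by
    refine S.rib_mul_rib_inf_ker_le (by simp) (p := σ.length) (by simp) ⟨hu1, ?_⟩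
    refine LinearMap.mem_ker.mpr ?_
    rw [glue_glue S.mul S.assoc le_rfl, (S.mem_rib.mp hy).2]
  obtain ⟨z, hz, hzw⟩ := h2 hu2
  rw [hk] at hzw
  have hzw' : z ∈ words (S.lets (σ ++ [a] ++ b :: d :: τ)) := by
    have := S.rib_mul_rib_le_words (by simp) _ hz
    simpa using this
  have hww : w ∈ words (S.lets (σ ++ [a] ++ b :: d :: τ)) := by
    rw [show σ ++ [a] ++ b :: d :: τ = (σ ++ [a] ++ [b]) ++ d :: τ by simp,
      S.words_lets_append (by simp), S.words_lets_append (by simp)]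
    exact mem_mul_of_le (mul_le_mul' (ribbon_le_words _ _) (ribbon_le_words _ _))
      (ribbon_le_words _ _) hw
  refine ⟨w - z, S.mem_rib_mul_rib (by simp) hbdτ (sub_mem hww hzw') fun p hp => ?_, ?_⟩
  · rw [map_sub]
    rcases eq_or_ne p (σ.length + 1) with rfl | hp'
    · rw [hzw, sub_self]
    · rw [S.glue_triple hw (by simpa using hp) (by simpa using hp'),
        S.glue_rib_mul_rib hz (by simpa using hp'), sub_zero]
  · rw [map_sub, S.glue_rib_mul_rib hz (by simp), sub_zero]

/-- Surjectivity for a long first letter on the right. -/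
theorem Merges.trans {d : ℕ} (h1 : S.Merges σ a b []) (h2 : S.Merges σ (a + b) d τ)
    (hb : 0 < b) (hd : 0 < d) : S.Merges σ a (b + d) τ := by
  intro y hy
  rw [← add_assoc] at hy
  have hy1 := h2 hy
  obtain ⟨v, hv, rfl⟩ := hy1
  obtain ⟨w, hw, rfl⟩ := S.map_glue_mul_le (by simp : σ.length + 2 ≤ (σ ++ [a]).length + [b].length)
    (S.rib_mul_rib_le_degPart _ _)
    (mem_mul_of_le h1 le_rfl hv)
  refine ⟨glue S.mul (σ.length + 1) w, ?_, glue_glue S.mul S.assoc le_rfl w⟩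
  change w ∈ S.rib (σ ++ [a]) * S.alg.rib [b] * S.alg.rib (d :: τ) at hw
  rw [mul_assoc] at hw
  refine Submodule.mul_induction_on hw ?_ fun x y hx hy => by
    rw [map_add]; exact add_mem hx hy
  intro u hu v hv
  have := glue_mul_of_mem S.mul (S.rib_le_degPart _ hu) 0 v
  rw [List.length_append, List.length_singleton, add_zero] at this
  rw [this]
  exact Submodule.mul_mem_mul hu (S.alg.glue_rib (σ := []) (List.forall_mem_nil _) hb hd hv)

/-- Surjectivity for a long last letter on the left. -/
theorem Merges.shift (h1 : S.Merges σ a (b + c) τ) (h2 : S.alg.Merges [] b c τ) (hσ : Pos σ)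
    (ha : 0 < a) (hb : 0 < b) : S.Merges σ (a + b) c τ := by
  intro y hy
  rw [add_assoc] at hy
  obtain ⟨v, hv, rfl⟩ := h1 hy
  obtain ⟨w, hw, rfl⟩ := S.mul_map_glue_le (S.rib_le_degPart _) 0 (mem_mul_of_le le_rfl h2 hv)
  rw [List.length_append, List.length_singleton, add_zero]
  refine ⟨glue S.mul σ.length w, ?_, (glue_glue S.mul S.assoc le_rfl w).symm⟩
  have hw : w ∈ S.rib (σ ++ [a]) * (S.alg.rib [b] * S.alg.rib (c :: τ)) := hw
  rw [← mul_assoc] at hw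
  refine Submodule.mul_induction_on hw ?_ fun x y hx hy => by
    rw [map_add]; exact add_mem hx hy
  intro u hu v hv
  rw [glue_mul_left S.mul (by simp) (S.rib_mul_rib_le_degPart _ _ hu)]
  exact Submodule.mul_mem_mul (S.glue_rib hσ ha hb hu) hv

theorem Merges.map_eq (h : S.Merges σ a b τ) (hσ : Pos σ) (ha : 0 < a) (hb : 0 < b) :
    (S.rib (σ ++ [a]) * S.alg.rib (b :: τ)).map (glue S.mul σ.length) =
      S.rib (σ ++ (a + b) :: τ) := by
  refine le_antisymm ?_ h
  rintro _ ⟨z, hz, rfl⟩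
  exact S.glue_rib hσ ha hb hz

/-- A ribbon module with one more row is the kernel of a surjection of flat modules. -/
theorem Merges.flat (h : S.Merges σ a b []) (hσ : Pos σ) (ha : 0 < a) (hb : 0 < b)
    (f1 : Module.Flat R (S.rib (σ ++ [a]))) (f2 : Module.Flat R (S.rib (σ ++ [a + b]))) :
    Module.Flat R (S.rib (σ ++ [a] ++ [b])) := by
  have := S.flat
  have := S.alg.flat_rib_singleton hb
  have := flat_mul (S.rib_le_degPart (σ ++ [a])) (Y := S.alg.rib [b])
  rw [S.rib_append (by simp) (by simpa [Pos] using hb) (p := σ.length) (by simp)]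
  exact flat_inf_ker (h.map_eq hσ ha hb)

variable (S)

/-- The multiplications `Mo_a ⊗ S^{(1, …, 1)} → S^{(a + 1, 1, …, 1)}` are surjective; this turns
out to be equivalent to the Koszul property. -/
def MergesOnes : Prop := ∀ a n, 0 < a → S.Merges [] a 1 (List.replicate n 1)

theorem pos_replicate (n : ℕ) : Pos (List.replicate n 1) := by
  intro a ha; rw [List.eq_of_mem_replicate ha]; exact one_pos

/-- A long first letter on the right is split off one box at a time. -/
theorem Merges.of_ones (h : ∀ a n, 0 < a → S.Merges σ a 1 (List.replicate n 1)) :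
    ∀ a c n, 0 < a → 0 < c → S.Merges σ a c (List.replicate n 1) := by
  have h0 : ∀ a c, 0 < a → S.Merges σ a (c + 1) [] := by
    intro a c ha
    induction c with
    | zero => exact h a 0 ha
    | succ c ih => exact Merges.trans ih (h _ 0 (by omega)) (by omega) one_pos
  intro a c n ha hc
  obtain ⟨c, rfl⟩ : ∃ j, c = j + 1 := ⟨c - 1, by omega⟩
  cases c with
  | zero => exact h a n ha
  | succ c => exact Merges.trans (h0 a c ha) (h _ n (by omega)) (by omega) one_pos

/-- For a Koszul module all ribbon modules are flat and all multiplications at a junction are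
surjective, at least for a junction followed by ones. -/
theorem MergesOnes.aux (hS : S.MergesOnes) (hA : S.alg.MergesOnes) (hσ : Pos σ) :
    (∀ a, 0 < a → Module.Flat R (S.rib (σ ++ [a]))) ∧
      ∀ a n, 0 < a → S.Merges σ a 1 (List.replicate n 1) := by
  induction σ using List.reverseRecOn with
  | nil => exact ⟨fun a ha => S.flat_rib_singleton ha, hS⟩
  | append_singleton σ a ih =>
    have hσ' : Pos σ := fun x hx => hσ x (by simp [hx])
    have ha : 0 < a := hσ a (by simp)
    obtain ⟨ih1, ih2⟩ := ih hσ'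
    have ih3 := Merges.of_ones S ih2
    have hfl : ∀ b, 0 < b → Module.Flat R (S.rib (σ ++ [a] ++ [b])) := fun b hb =>
      (ih3 a b 0 ha hb).flat hσ' ha hb (ih1 a ha) (ih1 _ (by omega))
    refine ⟨hfl, fun b n hb => ?_⟩
    exact (hA b n hb).syzygy (ih3 a b (n + 1) ha hb) hσ' ha hb one_pos (pos_replicate n)
      (ih1 a ha) (hfl b hb)

/-- The ribbon modules of a Koszul module over a Koszul algebra are flat. -/
theorem MergesOnes.flat_rib (hS : S.MergesOnes) (hA : S.alg.MergesOnes) {ρ : List ℕ}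
    (hρ : Pos ρ) : Module.Flat R (S.rib ρ) := by
  cases ρ using List.reverseRecOn with
  | nil =>
    have : S.rib [] = 1 := by
      ext x
      rw [mem_rib]
      simp only [lets, words_nil, and_iff_left_iff_imp]
      intro hx p
      obtain ⟨r, rfl⟩ := Submodule.mem_one.mp hx
      rw [Algebra.algebraMap_eq_smul_one, map_smul, glue_one, smul_zero]
    rw [this]; infer_instance
  | append_singleton σ a =>
    exact (hS.aux S hA fun x hx => hρ x (by simp [hx])).1 a (hρ a (by simp))

/-- For a Koszul module over a Koszul algebra all multiplications at a junction are surjective. -/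
theorem MergesOnes.merges (hS : S.MergesOnes) (hA : S.alg.MergesOnes) (hσ : Pos σ) (ha : 0 < a)
    (hb : 0 < b) (hτ : Pos τ) : S.Merges σ a b τ := by
  induction τ generalizing σ a b with
  | nil => exact Merges.of_ones S (hS.aux S hA hσ).2 a b 0 ha hb
  | cons c τ ih =>
    have hσa : Pos (σ ++ [a]) := pos_snoc ‹Pos σ› (by omega)
    have hσb : Pos (σ ++ [a + b]) := pos_snoc ‹Pos σ› (by omega)
    have hc : 0 < c := hτ c (by simp)
    have hτ' : Pos τ := fun x hx => hτ x (by simp [hx])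
    exact (Merges.of_ones S (hS.aux S hA hσ).2 a b 0 ha hb).cons (ih hσa hb hc hτ') hσ ha hb hc
      hτ' (hS.flat_rib S hA hσa) (hS.flat_rib S hA hσb)

/-- The ribbon modules are built from projective modules by kernels of surjections. -/
theorem MergesOnes.projective_rib (hS : S.MergesOnes) (hA : S.alg.MergesOnes)
    (pL : ∀ n, 0 < n → Module.Projective R (S.L n)) (pM : ∀ n, 0 < n → Module.Projective R (S.Mo n))
    (hσ : Pos σ) : ∀ a, 0 < a → Module.Projective R (S.rib (σ ++ [a])) := by
  induction σ using List.reverseRecOn with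
  | nil =>
    intro a ha
    have := pM a ha
    rw [List.nil_append, rib_singleton]
    exact projective_map_ι _
  | append_singleton σ a ih =>
    intro b hb
    have hσ' : Pos σ := fun x hx => hσ x (by simp [hx])
    have ha : 0 < a := hσ a (by simp)
    have := S.flat
    have := ih hσ' a ha
    have := ih hσ' (a + b) (by omega)
    have : Module.Projective R (S.alg.rib [b]) := by
      have : Module.Projective R (S.alg.Mo b) := pL b hb
      rw [rib_singleton]
      exact projective_map_ι _
    have := projective_mul (S.rib_le_degPart (σ ++ [a])) (Y := S.alg.rib [b])
    rw [S.rib_append (by simp) (by simpa [Pos] using hb) (p := σ.length) (by simp)]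
    exact projective_inf_ker
      ((hS.merges S hA hσ' ha hb (List.forall_mem_nil _) : S.Merges σ a b []).map_eq hσ' ha hb)

end RightSystem

/-! ### The bar complex -/

section FirstLetter

variable {R : Type*} [CommRing R] {E : Type*} [AddCommGroup E] [Module R E]

/-- An endomorphism of `T(E)` acting on everything after the first letter. -/
def shiftEnd (D : Module.End R (TensorAlgebra R E)) : Module.End R (TensorAlgebra R E) :=
  cons R E ∘ₗ LinearMap.lTensor E D ∘ₗ uncons R E

@[simp] theorem shiftEnd_cons (D : Module.End R (TensorAlgebra R E)) (e : E)
    (w : TensorAlgebra R E) :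
    shiftEnd D (TensorAlgebra.ι R e * w) = TensorAlgebra.ι R e * D w := by simp [shiftEnd]

@[simp] theorem shiftEnd_one (D : Module.End R (TensorAlgebra R E)) : shiftEnd D 1 = 0 := by
  simp [shiftEnd]

/-- A linear map applied to the first letter. -/
def firstMap (f : E →ₗ[R] E) : Module.End R (TensorAlgebra R E) :=
  cons R E ∘ₗ LinearMap.rTensor _ f ∘ₗ uncons R E

@[simp] theorem firstMap_cons (f : E →ₗ[R] E) (e : E) (w : TensorAlgebra R E) :
    firstMap f (TensorAlgebra.ι R e * w) = TensorAlgebra.ι R (f e) * w := by simp [firstMap]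

variable (mul : E →ₗ[R] E →ₗ[R] E)

@[simp] theorem barDiff_zero : barDiff mul 0 = 0 := by simp [barDiff]

@[simp] theorem barDiff_one : barDiff mul 1 = 0 := by simp [barDiff]

theorem shiftEnd_glue (p : ℕ) : shiftEnd (glue mul p) = glue mul (p + 1) := by
  ext w
  induction w using cons_induction with
  | h0 => simp
  | hadd x y hx hy => rw [map_add, map_add, hx, hy]
  | hsmul r x hx => rw [map_smul, map_smul, hx]
  | h1 => simp
  | hc e w _ => simp

theorem shiftEnd_sum {ι : Type*} (s : Finset ι) (D : ι → Module.End R (TensorAlgebra R E)) :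
    shiftEnd (∑ i ∈ s, D i) = ∑ i ∈ s, shiftEnd (D i) := by
  ext w
  induction w using cons_induction with
  | h0 => simp
  | hadd x y hx hy => rw [map_add, map_add, hx, hy]
  | hsmul r x hx => rw [map_smul, map_smul, hx]
  | h1 => simp
  | hc e w _ => simp [Finset.mul_sum]

theorem shiftEnd_smul (r : R) (D : Module.End R (TensorAlgebra R E)) :
    shiftEnd (r • D) = r • shiftEnd D := by
  ext w
  simp [shiftEnd, LinearMap.lTensor_smul]

/-- The bar differential, split according to whether the first letter is involved. -/
theorem barDiff_succ (k : ℕ) :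
    barDiff mul (k + 2) = glue mul 0 - shiftEnd (barDiff mul (k + 1)) := by
  simp only [barDiff, shiftEnd_sum, shiftEnd_smul, shiftEnd_glue]
  rw [show k + 2 - 1 = k + 1 by omega, show k + 1 - 1 = k by omega, Finset.sum_range_succ']
  rw [pow_zero, one_smul, add_comm, sub_eq_add_neg, ← Finset.sum_neg_distrib]
  congr 1
  refine Finset.sum_congr rfl fun p _ => ?_
  rw [pow_succ, mul_neg, mul_one]
  ext w
  simp

theorem barDiff_barDiff (assoc : ∀ x y z, mul (mul x y) z = mul x (mul y z)) (k : ℕ)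
    (w : TensorAlgebra R E) : barDiff mul (k + 1) (barDiff mul (k + 2) w) = 0 := by
  induction k generalizing w with
  | zero => simp
  | succ k ih =>
    have h1 : ∀ w, glue mul 0 (shiftEnd (barDiff mul (k + 1 + 1)) w) =
        glue mul 0 (glue mul 0 w) - shiftEnd (barDiff mul (k + 1)) (glue mul 0 w) := by
      intro w
      rw [barDiff_succ mul k]
      induction w using cons_induction with
      | h0 => simp
      | hadd x y hx hy => simp only [map_add, hx, hy]; abel
      | hsmul r x hx => simp only [map_smul, hx, smul_sub]
      | h1 => simp
      | hc e w _ =>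
        rw [shiftEnd_cons, LinearMap.sub_apply, mul_sub, map_sub]
        congr 1
        · rw [← glue_succ_cons, glue_glue mul assoc le_rfl]
        · rename_i hw
          clear hw
          induction w using cons_induction with
          | h0 => simp
          | hadd x y hx hy => simp only [map_add, mul_add, hx, hy]
          | hsmul r x hx => simp only [map_smul, mul_smul_comm, hx]
          | h1 => simp
          | hc f w _ => simp
    have h2 : ∀ w, shiftEnd (barDiff mul (k + 1)) (shiftEnd (barDiff mul (k + 1 + 1)) w) = 0 := by
      intro w
      induction w using cons_induction with
      | h0 => simp
      | hadd x y hx hy => simp only [map_add, hx, hy, add_zero]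
      | hsmul r x hx => simp only [map_smul, hx, smul_zero]
      | h1 => simp
      | hc e w _ => rw [shiftEnd_cons, shiftEnd_cons, ih, mul_zero]
    have h3 : barDiff mul (k + 1 + 1) (glue mul 0 w) =
        glue mul 0 (glue mul 0 w) - shiftEnd (barDiff mul (k + 1)) (glue mul 0 w) := by
      rw [barDiff_succ mul k]; rfl
    have h4 : barDiff mul (k + 1 + 1) (shiftEnd (barDiff mul (k + 1 + 1)) w) =
        glue mul 0 (shiftEnd (barDiff mul (k + 1 + 1)) w) - 0 := by
      rw [← h2 w]; nth_rewrite 1 [barDiff_succ mul k]; rfl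
    rw [barDiff_succ mul (k + 1), LinearMap.sub_apply, map_sub, h3, h4, h1]
    abel

end FirstLetter

namespace RightSystem

variable {R : Type*} [CommRing R] {E : Type*} [AddCommGroup E] [Module R E]
  (S : RightSystem R E)

/-- The part of total degree `N` of `Mo_{≥ a₀} ⊗ L^{⊗ i}`. -/
def bar (a₀ i N : ℕ) : Submodule R (TensorAlgebra R E) :=
  ⨆ (a : ℕ) (β : List ℕ) (_ : a₀ ≤ a ∧ β.length = i ∧ a + β.sum = N ∧ Pos β),
    words (S.lets (a :: β))

/-- The part of total degree `n` of `L^{⊗ i}`. -/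
def barAlg (i n : ℕ) : Submodule R (TensorAlgebra R E) :=
  ⨆ (β : List ℕ) (_ : β.length = i ∧ β.sum = n ∧ Pos β), words (S.alg.lets β)

/-- In total degree `N`, the bar complex of `Mo_{≥ a₀}` has homology only on the diagonal. -/
def KoszulAt (a₀ N : ℕ) : Prop :=
  ∀ i, a₀ + i < N → ∀ x ∈ S.bar a₀ i N, barDiff S.mul (i + 1) x = 0 →
    ∃ y ∈ S.bar a₀ (i + 1) N, barDiff S.mul (i + 2) y = x

/-- In total degree `n`, the bar complex of the algebra has homology only on the diagonal. -/
def ExactAlg (n : ℕ) : Prop :=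
  ∀ i < n, ∀ x ∈ S.barAlg i n, barDiff S.mul i x = 0 →
    ∃ y ∈ S.barAlg (i + 1) n, barDiff S.mul (i + 1) y = x

variable {S} {a₀ i N n : ℕ} {x y : TensorAlgebra R E}

theorem words_le_bar {a : ℕ} {β : List ℕ} (h0 : a₀ ≤ a) (hi : β.length = i)
    (hN : a + β.sum = N) (hβ : Pos β) : words (S.lets (a :: β)) ≤ S.bar a₀ i N :=
  le_iSup_of_le a (le_iSup_of_le β (le_iSup_of_le ⟨h0, hi, hN, hβ⟩ le_rfl))

theorem words_le_barAlg {β : List ℕ} (hi : β.length = i)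
    (hN : β.sum = n) (hβ : Pos β) : words (S.alg.lets β) ≤ S.barAlg i n :=
  le_iSup_of_le β (le_iSup_of_le ⟨hi, hN, hβ⟩ le_rfl)

theorem bar_le {K : Submodule R (TensorAlgebra R E)}
    (h : ∀ a β, a₀ ≤ a → β.length = i → a + β.sum = N → Pos β → words (S.lets (a :: β)) ≤ K) :
    S.bar a₀ i N ≤ K :=
  iSup_le fun a => iSup_le fun β => iSup_le fun hh => h a β hh.1 hh.2.1 hh.2.2.1 hh.2.2.2

theorem barAlg_le {K : Submodule R (TensorAlgebra R E)}
    (h : ∀ β, β.length = i → β.sum = n → Pos β → words (S.alg.lets β) ≤ K) :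
    S.barAlg i n ≤ K :=
  iSup_le fun β => iSup_le fun hh => h β hh.1 hh.2.1 hh.2.2

theorem barAlg_succ : S.barAlg (i + 1) n = S.alg.bar 1 i n := by
  apply le_antisymm
  · refine barAlg_le fun β hi hn hβ => ?_
    obtain ⟨a, β, rfl⟩ : ∃ a β', β = a :: β' := List.exists_cons_of_length_eq_add_one hi
    exact words_le_bar (hβ a (by simp)) (by simpa using hi) (by simpa using hn)
      fun x hx => hβ x (by simp [hx])
  · refine bar_le fun a β ha hi hn hβ => ?_
    exact words_le_barAlg (S := S) (β := a :: β) (by simp [hi]) (by simp [hn])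
      (by simp only [Pos, List.mem_cons, forall_eq_or_imp]; exact ⟨ha, hβ⟩)

theorem barAlg_zero (hn : 0 < n) : S.barAlg 0 n = ⊥ := by
  refine le_bot_iff.mp (barAlg_le fun β hi hn' _ => ?_)
  obtain rfl := List.length_eq_zero_iff.mp hi
  simp at hn'
  omega

theorem words_lets_cons (a : ℕ) (β : List ℕ) :
    words (S.lets (a :: β)) = S.rib [a] * words (S.alg.lets β) := by
  rw [rib_singleton, alg_lets]; simp [lets]

theorem bar_mono : S.bar (a₀ + 1) i N ≤ S.bar a₀ i N :=
  bar_le fun _ _ h0 hi hN hβ => words_le_bar (by omega) hi hN hβ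

theorem rib_mul_barAlg_le : S.rib [a₀] * S.barAlg i n ≤ S.bar a₀ i (a₀ + n) := by
  rw [barAlg]
  simp only [Submodule.mul_iSup]
  refine iSup_le fun β => iSup_le fun h => ?_
  rw [← words_lets_cons]
  exact words_le_bar le_rfl h.1 (by omega) h.2.2

/-- Splitting an element of the bar complex according to the degree of the first letter. -/
theorem exists_add_of_mem_bar (hx : x ∈ S.bar a₀ i N) :
    ∃ y ∈ S.rib [a₀] * S.barAlg i (N - a₀), ∃ z ∈ S.bar (a₀ + 1) i N, x = y + z := by
  suffices h : S.bar a₀ i N ≤ S.rib [a₀] * S.barAlg i (N - a₀) ⊔ S.bar (a₀ + 1) i N by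
    obtain ⟨y, hy, z, hz, rfl⟩ := Submodule.mem_sup.mp (h hx)
    exact ⟨y, hy, z, hz, rfl⟩
  refine bar_le fun a β h0 hi hN hβ => ?_
  rcases Nat.eq_or_lt_of_le h0 with rfl | h
  · refine le_trans ?_ le_sup_left
    rw [words_lets_cons]
    exact mul_le_mul' le_rfl (words_le_barAlg hi (by omega) hβ)
  · exact le_trans (words_le_bar h hi hN hβ) le_sup_right

theorem glue_mem_bar (h0 : 0 < a₀) {p : ℕ} (hp : p ≤ i) (hx : x ∈ S.bar a₀ (i + 1) N) :
    glue S.mul p x ∈ S.bar a₀ i N := by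
  suffices h : S.bar a₀ (i + 1) N ≤ (S.bar a₀ i N).comap (glue S.mul p) from h hx
  refine bar_le fun a β ha hi hN hβ x hx => ?_
  cases p with
  | zero =>
    obtain ⟨c, τ, rfl⟩ : ∃ a β', β = a :: β' := List.exists_cons_of_length_eq_add_one hi
    have hc : 0 < c := hβ c (by simp)
    have := S.glue_words (σ := []) (List.forall_mem_nil _) (lt_of_lt_of_le h0 ha) hc (τ := τ)
      (z := x) (by simpa [lets] using hx)
    exact words_le_bar (by omega) (by simpa using hi) (by simp at hN; omega)
      (fun x hx => hβ x (by simp [hx])) this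
  | succ p =>
    obtain ⟨σ, b, c, τ, rfl, hσ⟩ : ∃ σ b c τ, β = σ ++ b :: c :: τ ∧ σ.length = p := by
      refine ⟨β.take p, β[p], β[p + 1], β.drop (p + 2), ?_, by simp; omega⟩
      rw [List.cons_getElem_drop_succ, List.cons_getElem_drop_succ, List.take_append_drop]
    have hb : 0 < b := hβ b (by simp)
    have hc : 0 < c := hβ c (by simp)
    have hσ' : Pos σ := fun x hx => hβ x (by simp [hx])
    have hτ : Pos τ := fun x hx => hβ x (by simp [hx])
    have := S.glue_words (σ := a :: σ) (z := x) (τ := τ) ?_ hb hc ?_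
    · rw [List.length_cons, hσ] at this
      refine words_le_bar (β := σ ++ (b + c) :: τ) ha ?_ ?_ ?_ this
      · rw [List.length_append, List.length_cons, List.length_cons] at hi
        rw [List.length_append, List.length_cons]; omega
      · rw [List.sum_append, List.sum_cons, List.sum_cons] at hN
        rw [List.sum_append, List.sum_cons]; omega
      · intro x hx
        simp only [List.mem_append, List.mem_cons] at hx
        rcases hx with h | h | h
        · exact hσ' x h
        · omega
        · exact hτ x h
    · intro x hx
      rcases List.mem_cons.mp hx with h | h
      · omega
      · exact hσ' x h
    · rw [← S.words_lets_append (by simp)]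
      simpa using hx

theorem barDiff_mem_bar (h0 : 0 < a₀) (hx : x ∈ S.bar a₀ (i + 1) N) :
    barDiff S.mul (i + 2) x ∈ S.bar a₀ i N := by
  rw [barDiff, LinearMap.sum_apply]
  refine sum_mem fun p hp => ?_
  rw [LinearMap.smul_apply]
  exact Submodule.smul_mem _ _ (glue_mem_bar h0 (by simp at hp; omega) hx)

theorem barDiff_mem_barAlg (hx : x ∈ S.barAlg (i + 1) n) :
    barDiff S.mul (i + 1) x ∈ S.barAlg i n := by
  cases i with
  | zero => simp
  | succ i =>
    rw [barAlg_succ] at hx ⊢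
    exact barDiff_mem_bar (S := S.alg) one_pos hx

theorem shiftEnd_mem {D : Module.End R (TensorAlgebra R E)}
    {Y Y' : Submodule R (TensorAlgebra R E)} (hD : ∀ y ∈ Y, D y ∈ Y') {a : ℕ}
    (hx : x ∈ S.rib [a] * Y) : shiftEnd D x ∈ S.rib [a] * Y' := by
  rw [rib_singleton] at hx ⊢
  refine Submodule.mul_induction_on hx ?_ fun x y hx hy => by rw [map_add]; exact add_mem hx hy
  rintro _ ⟨e, he, rfl⟩ w hw
  rw [shiftEnd_cons]
  exact Submodule.mul_mem_mul ⟨e, he, rfl⟩ (hD w hw)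

theorem glue_zero_mem_bar (h0 : 0 < a₀) (hx : x ∈ S.rib [a₀] * S.barAlg (i + 1) n) :
    glue S.mul 0 x ∈ S.bar (a₀ + 1) i (a₀ + n) := by
  suffices h : S.rib [a₀] * S.barAlg (i + 1) n ≤
      (S.bar (a₀ + 1) i (a₀ + n)).comap (glue S.mul 0) from h hx
  rw [barAlg]
  simp only [Submodule.mul_iSup]
  refine iSup_le fun β => iSup_le fun ⟨hi, hn, hβ⟩ x hx => ?_
  obtain ⟨c, τ, rfl⟩ : ∃ a β', β = a :: β' := List.exists_cons_of_length_eq_add_one hi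
  have hc : 0 < c := hβ c (by simp)
  have := S.glue_words (σ := []) (List.forall_mem_nil _) h0 hc (τ := τ)
    (z := x) (by rw [← words_lets_cons] at hx; simpa [lets] using hx)
  exact words_le_bar (by omega) (by simpa using hi) (by simp at hn; omega)
    (fun x hx => hβ x (by simp [hx])) this

/-- The parts of the bar complex with first letter of degree `a₀`, resp. of larger degree, are
independent. -/
theorem eq_zero_of_add_eq_zero (h0 : 0 < a₀) {Y : Submodule R (TensorAlgebra R E)}
    (hx : x ∈ S.rib [a₀] * Y) (hy : y ∈ S.bar (a₀ + 1) i N) (h : x + y = 0) : x = 0 := by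
  obtain ⟨f, hf1, hf2⟩ := S.exists_proj_Mo a₀ h0
  have h1 : firstMap f x = x := by
    rw [rib_singleton] at hx
    refine Submodule.mul_induction_on hx ?_ fun x y hx hy => by rw [map_add, hx, hy]
    rintro _ ⟨e, he, rfl⟩ w hw
    rw [firstMap_cons, hf1 e he]
  have h2 : firstMap f y = 0 := by
    suffices h : S.bar (a₀ + 1) i N ≤ LinearMap.ker (firstMap f) from h hy
    refine bar_le fun a β ha _ _ _ => ?_
    rw [words_lets_cons, rib_singleton]
    refine Submodule.mul_le.mpr ?_
    rintro _ ⟨e, he, rfl⟩ w hw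
    rw [LinearMap.mem_ker, firstMap_cons, hf2 a (by omega) (by omega) e he, map_zero, zero_mul]
  have h3 := congrArg (firstMap f) h
  rwa [map_add, h1, h2, map_zero, add_zero] at h3

/-- On the diagonal, the cycles of the bar complex are the ribbon elements. -/
theorem mem_rib_of_barDiff_eq_zero (h0 : 0 < a₀) (m : ℕ)
    (hx : x ∈ words (S.lets (a₀ :: List.replicate m 1)))
    (hd : barDiff S.mul (m + 1) x = 0) : x ∈ S.rib (a₀ :: List.replicate m 1) := by
  induction m generalizing S a₀ x with
  | zero => simpa [rib_singleton, lets] using hx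
  | succ m ih =>
    have := S.flat
    have := S.flat_rib_singleton h0
    rw [words_lets_cons] at hx
    rw [barDiff_succ] at hd
    have hb : words (S.alg.lets (List.replicate (m + 1) 1)) ≤ S.barAlg (m + 1) (m + 1) :=
      words_le_barAlg (by simp) (by simp) (pos_replicate _)
    have hx' := mem_mul_of_le le_rfl hb hx
    have h1 := shiftEnd_mem (fun y hy => barDiff_mem_barAlg hy) hx'
    have h2 := glue_zero_mem_bar h0 hx'
    have h3 : shiftEnd (barDiff S.mul (m + 1)) x = 0 := by
      refine eq_zero_of_add_eq_zero h0 h1 (neg_mem h2) ?_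
      rw [LinearMap.sub_apply] at hd
      rw [← sub_eq_add_neg, ← neg_sub, hd, neg_zero]
    have h4 : glue S.mul 0 x = 0 := by
      rw [LinearMap.sub_apply, h3, sub_zero] at hd; exact hd
    have h5 := mem_mul_inf_ker (k := 1) (S.rib_le_degPart [a₀]) (D := barDiff S.mul (m + 1))
      (D' := shiftEnd (barDiff S.mul (m + 1))) ?_ hx h3
    · refine S.rib_mul_rib_inf_ker_le (ρ := [a₀]) (by simp) (p := 0) (by simp) ⟨?_, h4⟩
      refine mem_mul_of_le le_rfl ?_ h5
      rintro y ⟨hy, hy0⟩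
      exact ih (S := S.alg) one_pos hy hy0
    · intro u hu w _
      rw [rib_singleton] at hu
      obtain ⟨e, -, rfl⟩ := hu
      rw [shiftEnd_cons]

theorem shiftEnd_rib {D : Module.End R (TensorAlgebra R E)} {a : ℕ} {u : TensorAlgebra R E}
    (hu : u ∈ S.rib [a]) (w : TensorAlgebra R E) : shiftEnd D (u * w) = u * D w := by
  rw [rib_singleton] at hu
  obtain ⟨e, -, rfl⟩ := hu
  rw [shiftEnd_cons]

theorem length_le_sum {β : List ℕ} (hβ : Pos β) : β.length ≤ β.sum := by
  induction β with
  | nil => simp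
  | cons b β ih =>
    have := hβ b (by simp)
    have := ih fun x hx => hβ x (by simp [hx])
    simp; omega

theorem bar_diag (m : ℕ) : S.bar a₀ m (a₀ + m) ≤ words (S.lets (a₀ :: List.replicate m 1)) := by
  refine bar_le fun a β ha hi hN hβ => ?_
  have h1 := length_le_sum hβ
  obtain rfl : a = a₀ := by omega
  have h2 : β = List.replicate m 1 := by
    have h3 : β.sum = m := by omega
    clear hN ha h1
    induction β generalizing m with
    | nil => simp at hi; simp [← hi]
    | cons b β ih =>
      have hb := hβ b (by simp)
      have hβ' : Pos β := fun x hx => hβ x (by simp [hx])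
      have h1 := length_le_sum hβ'
      simp at hi h3
      obtain ⟨m, rfl⟩ : ∃ j, m = j + 1 := ⟨m - 1, by omega⟩
      obtain rfl : b = 1 := by omega
      rw [List.replicate_succ, ← ih m (by omega) hβ' (by omega)]
  rw [h2]

theorem bar_eq_bot (h : N < a₀ + i) : S.bar a₀ i N = ⊥ := by
  refine le_bot_iff.mp (bar_le fun a β ha hi hN hβ => ?_)
  have h1 := length_le_sum hβ
  omega

/-- The Koszul property passes to the truncation `Mo_{> a₀}`. -/
theorem KoszulAt.truncate (h0 : 0 < a₀) (h : S.KoszulAt a₀ N) (hA : S.ExactAlg (N - a₀)) :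
    S.KoszulAt (a₀ + 1) N := by
  intro i hi x hx hdx
  have := S.flat
  have := S.flat_rib_singleton h0
  obtain ⟨y, hy, rfl⟩ := h i (by omega) x (bar_mono hx) hdx
  obtain ⟨y0, hy0, y1, hy1, rfl⟩ := exists_add_of_mem_bar hy
  have hN : a₀ + (N - a₀) = N := by omega
  have h1 := glue_zero_mem_bar h0 hy0
  rw [hN] at h1
  have h2 := barDiff_mem_bar (by omega) hy1
  have h3 : shiftEnd (barDiff S.mul (i + 1)) y0 = 0 := by
    refine eq_zero_of_add_eq_zero h0 (shiftEnd_mem (fun y hy => barDiff_mem_barAlg hy) hy0)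
      (sub_mem (sub_mem hx h1) h2) ?_
    rw [map_add, barDiff_succ, LinearMap.sub_apply]
    abel
  obtain ⟨z, hz, rfl⟩ := exists_of_mul_exact (k := 1) (S.rib_le_degPart [a₀])
    (D' := shiftEnd (barDiff S.mul (i + 1))) (D₂ := barDiff S.mul (i + 2))
    (D₂' := shiftEnd (barDiff S.mul (i + 2))) (fun u hu w _ => shiftEnd_rib hu w)
    (fun u hu w _ => shiftEnd_rib hu w) (hA (i + 1) (by omega)) hy0 h3
  have h4 := glue_zero_mem_bar h0 hz
  rw [hN] at h4
  refine ⟨y1 + glue S.mul 0 z, add_mem hy1 h4, ?_⟩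
  have h5 := barDiff_barDiff S.mul S.assoc (i + 1) z
  rw [barDiff_succ S.mul (i + 1), LinearMap.sub_apply, map_sub, sub_eq_zero] at h5
  rw [map_add, map_add, h5, add_comm]

/-- An element of `S^{(a₀ + 1, 1, …, 1)}` is a cycle one step below the diagonal; the part with
first letter of degree `a₀` of a chain that it bounds is a preimage under the multiplication. -/
theorem KoszulAt.merges (h0 : 0 < a₀) {m : ℕ} (h : S.KoszulAt a₀ (a₀ + m + 1)) :
    S.Merges [] a₀ 1 (List.replicate m 1) := by
  intro x hx
  have := S.flat
  have := S.flat_rib_singleton h0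
  have hx' : x ∈ S.bar (a₀ + 1) m (a₀ + m + 1) :=
    words_le_bar le_rfl (by simp) (by simp; omega) (pos_replicate m) (S.mem_rib.mp hx).1
  have hd : barDiff S.mul (m + 1) x = 0 := by
    rw [barDiff, LinearMap.sum_apply]
    exact Finset.sum_eq_zero fun p _ => by
      rw [LinearMap.smul_apply, (S.mem_rib.mp hx).2, smul_zero]
  obtain ⟨y, hy, rfl⟩ := h m (by omega) x (bar_mono hx') hd
  have hy1 : y ∈ words (S.lets (a₀ :: List.replicate (m + 1) 1)) :=
    bar_diag (m + 1) hy
  rw [words_lets_cons] at hy1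
  have hy2 := mem_mul_of_le le_rfl (words_le_barAlg (S := S) (i := m + 1) (n := m + 1) (by simp)
    (by simp) (pos_replicate _)) hy1
  have h1 := glue_zero_mem_bar h0 hy2
  have h3 : shiftEnd (barDiff S.mul (m + 1)) y = 0 := by
    refine eq_zero_of_add_eq_zero h0 (shiftEnd_mem (fun y hy => barDiff_mem_barAlg hy) hy2)
      (sub_mem hx' h1) ?_
    rw [barDiff_succ, LinearMap.sub_apply]
    abel
  refine ⟨y, ?_, ?_⟩
  · refine mem_mul_of_le le_rfl ?_ (mem_mul_inf_ker (k := 1) (S.rib_le_degPart [a₀])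
      (fun u hu w _ => shiftEnd_rib hu w) hy1 h3)
    rintro z ⟨hz, hz0⟩
    exact mem_rib_of_barDiff_eq_zero (S := S.alg) one_pos m hz hz0
  · rw [barDiff_succ, LinearMap.sub_apply, h3, sub_zero]; rfl

/-- Descent on the truncation: a cycle of `Mo_{≥ a₀}` is moved into `Mo_{> a₀}` by the exactness
for the algebra, and is a boundary there, except one step below the diagonal, where the
surjectivity of the multiplication is needed. -/
theorem KoszulAt.of_merges (h0 : 0 < a₀) (h : S.KoszulAt (a₀ + 1) N) (hA : S.ExactAlg (N - a₀))
    (hm : ∀ m, N = a₀ + m + 1 → S.Merges [] a₀ 1 (List.replicate m 1)) : S.KoszulAt a₀ N := by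
  intro i hi x hx hdx
  have := S.flat
  have := S.flat_rib_singleton h0
  have hN : a₀ + (N - a₀) = N := by omega
  obtain ⟨x0, hx0, x1, hx1, rfl⟩ := exists_add_of_mem_bar hx
  have h3 : shiftEnd (barDiff S.mul i) x0 = 0 := by
    cases i with
    | zero => simp [shiftEnd]
    | succ i =>
      have h1 := glue_zero_mem_bar h0 hx0
      rw [hN] at h1
      have h2 := barDiff_mem_bar (by omega) hx1
      refine eq_zero_of_add_eq_zero h0 (shiftEnd_mem (fun y hy => barDiff_mem_barAlg hy) hx0)
        (neg_mem (add_mem h1 h2)) ?_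
      rw [map_add, barDiff_succ, LinearMap.sub_apply] at hdx
      rw [← neg_eq_zero, ← hdx, ← barDiff_succ]
      abel
  obtain ⟨y0, hy0, rfl⟩ := exists_of_mul_exact (k := 1) (S.rib_le_degPart [a₀])
    (D' := shiftEnd (barDiff S.mul i)) (D₂ := barDiff S.mul (i + 1))
    (D₂' := shiftEnd (barDiff S.mul (i + 1))) (fun u hu w _ => shiftEnd_rib hu w)
    (fun u hu w _ => shiftEnd_rib hu w) (hA i (by omega)) hx0 h3
  have hy0' : y0 ∈ S.bar a₀ (i + 1) N := hN ▸ rib_mul_barAlg_le hy0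
  have h4 := glue_zero_mem_bar h0 hy0
  rw [hN] at h4
  have h5 : shiftEnd (barDiff S.mul (i + 1)) y0 + x1 + barDiff S.mul (i + 2) y0 =
      x1 + glue S.mul 0 y0 := by
    rw [barDiff_succ S.mul i, LinearMap.sub_apply]; abel
  have h6 : barDiff S.mul (i + 1) (x1 + glue S.mul 0 y0) = 0 := by
    rw [← h5, map_add, hdx, zero_add, barDiff_barDiff S.mul S.assoc]
  have h7 := add_mem hx1 h4
  -- Subtracting the boundary of `y0` leaves a cycle of the truncated module.
  suffices hs : ∃ y ∈ S.bar a₀ (i + 1) N, barDiff S.mul (i + 2) y = x1 + glue S.mul 0 y0 by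
    obtain ⟨y, hy, hy'⟩ := hs
    refine ⟨y - y0, sub_mem hy hy0', ?_⟩
    rw [map_sub, hy', ← h5, add_sub_cancel_right]
  by_cases hi' : a₀ + 1 + i < N
  · obtain ⟨y, hy, hy'⟩ := h i hi' _ h7 h6
    exact ⟨y, bar_mono hy, hy'⟩
  · obtain rfl : N = a₀ + i + 1 := by omega
    have h8 : x1 + glue S.mul 0 y0 ∈ S.rib ((a₀ + 1) :: List.replicate i 1) := by
      refine mem_rib_of_barDiff_eq_zero (by omega) i (bar_diag i ?_) h6
      rwa [show a₀ + 1 + i = a₀ + i + 1 by omega]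
    obtain ⟨z, hz, hz'⟩ := hm i rfl h8
    have hz : z ∈ S.rib [a₀] * S.alg.rib (List.replicate (i + 1) 1) := hz
    refine ⟨z, ?_, ?_⟩
    · refine rib_mul_barAlg_le (n := i + 1) (mem_mul_of_le le_rfl ?_ hz)
      exact (ribbon_le_words _ _).trans (words_le_barAlg (by simp) (by simp) (pos_replicate _))
    · rw [barDiff_succ, LinearMap.sub_apply]
      have : shiftEnd (barDiff S.mul (i + 1)) z = 0 := by
        refine Submodule.mul_induction_on hz ?_ fun x y hx hy => by
          rw [map_add, hx, hy, add_zero]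
        intro u hu w hw
        rw [shiftEnd_rib hu, barDiff, LinearMap.sum_apply, Finset.sum_eq_zero, mul_zero]
        intro p _
        rw [LinearMap.smul_apply, ← alg_mul, (S.alg.mem_rib.mp hw).2, smul_zero]
      rw [this, sub_zero]
      exact hz'

/-- The bar complex of the algebra is the one of its augmentation ideal as a module over itself,
shifted by one. -/
theorem ExactAlg.of_koszulAt (h : S.alg.KoszulAt 1 n) : S.ExactAlg n := by
  intro i hi x hx hd
  cases i with
  | zero =>
    rw [barAlg_zero hi, Submodule.mem_bot] at hx
    exact ⟨0, zero_mem _, by rw [hx, map_zero]⟩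
  | succ i =>
    rw [barAlg_succ] at hx ⊢
    exact h i (by omega) x hx hd

/-- The bar complex has homology only on the diagonal. -/
def Koszul (S : RightSystem R E) : Prop := ∀ N, S.KoszulAt 1 N

/-- Truncating the module one degree at a time, the vanishing of homology just below the diagonal
gives the surjectivity of `Mo_a ⊗ S^{(1, …, 1)} → S^{(a + 1, 1, …, 1)}` for every `a`. -/
theorem Koszul.mergesOnes (h : S.Koszul) (hA : S.alg.Koszul) : S.MergesOnes := by
  have key : ∀ a N, S.KoszulAt (a + 1) N := by
    intro a
    induction a with
    | zero => exact h
    | succ a ih => exact fun N => (ih N).truncate (by omega) (.of_koszulAt (hA _))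
  intro a n ha
  obtain ⟨a, rfl⟩ : ∃ j, a = j + 1 := ⟨a - 1, by omega⟩
  exact (key a _).merges ha

theorem MergesOnes.koszul_of_exactAlg (h : S.MergesOnes) (hA : ∀ n, S.ExactAlg n) :
    S.Koszul := by
  have key : ∀ d a, 0 < a → S.KoszulAt a (a + d) := by
    intro d
    induction d with
    | zero => intro a _ i hi; omega
    | succ d ih =>
      intro a ha
      refine KoszulAt.of_merges ha ?_ (hA _) fun m _ => h a m ha
      rw [show a + (d + 1) = a + 1 + d by omega]
      exact ih (a + 1) (by omega)
  intro N
  rcases Nat.eq_zero_or_pos N with rfl | hN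
  · intro i hi; omega
  · obtain ⟨d, rfl⟩ : ∃ d, N = 1 + d := ⟨N - 1, by omega⟩
    exact key d 1 one_pos

theorem MergesOnes.koszul_alg (h : S.alg.MergesOnes) : S.alg.Koszul := by
  have key : ∀ d a, 0 < a → S.alg.KoszulAt a (a + d) := by
    intro d
    induction d with
    | zero => intro a _ i hi; omega
    | succ d ih =>
      intro a ha
      refine KoszulAt.of_merges ha ?_ (.of_koszulAt ?_) fun m _ => h a m ha
      · rw [show a + (d + 1) = a + 1 + d by omega]
        exact ih (a + 1) (by omega)
      · rw [show a + (d + 1) - a = 1 + d by omega]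
        exact ih 1 one_pos
  intro N
  rcases Nat.eq_zero_or_pos N with rfl | hN
  · intro i hi; omega
  · obtain ⟨d, rfl⟩ : ∃ d, N = 1 + d := ⟨N - 1, by omega⟩
    exact key d 1 one_pos

theorem koszul_alg_iff : S.alg.Koszul ↔ S.alg.MergesOnes :=
  ⟨fun h => h.mergesOnes h, fun h => MergesOnes.koszul_alg h⟩

theorem koszul_iff (hA : S.alg.MergesOnes) : S.Koszul ↔ S.MergesOnes :=
  ⟨fun h => h.mergesOnes (MergesOnes.koszul_alg hA), fun h =>
    h.koszul_of_exactAlg fun n => .of_koszulAt (MergesOnes.koszul_alg hA n)⟩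

end RightSystem

/-! ### Reversal of words -/

section Reversal

variable {R : Type*} [CommRing R] {E : Type*} [AddCommGroup E] [Module R E]

/-- The anti-automorphism of `T(E)` reversing all words. -/
def rev (R : Type*) [CommRing R] (E : Type*) [AddCommGroup E] [Module R E] :
    TensorAlgebra R E →ₗ[R] TensorAlgebra R E :=
  (MulOpposite.opLinearEquiv R).symm.toLinearMap ∘ₗ
    (TensorAlgebra.lift R ((MulOpposite.opLinearEquiv R).toLinearMap ∘ₗ
      TensorAlgebra.ι R (M := E))).toLinearMap

@[simp] theorem rev_one : rev R E 1 = 1 := by simp [rev]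

@[simp] theorem rev_ι (e : E) : rev R E (TensorAlgebra.ι R e) = TensorAlgebra.ι R e := by
  simp [rev]

@[simp] theorem rev_mul (x y : TensorAlgebra R E) : rev R E (x * y) = rev R E y * rev R E x := by
  simp [rev]

@[simp] theorem rev_rev (x : TensorAlgebra R E) : rev R E (rev R E x) = x := by
  induction x using TensorAlgebra.induction with
  | algebraMap r => simp [Algebra.algebraMap_eq_smul_one]
  | ι e => simp
  | mul a b ha hb => simp [ha, hb]
  | add a b ha hb => simp [ha, hb]

theorem rev_injective : Function.Injective (rev R E) :=
  Function.LeftInverse.injective (g := rev R E) rev_rev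

theorem map_rev_map_rev (X : Submodule R (TensorAlgebra R E)) :
    (X.map (rev R E)).map (rev R E) = X := by
  rw [← Submodule.map_comp]
  convert Submodule.map_id X
  ext x
  simp

theorem map_rev_eq_of_le {X Y : Submodule R (TensorAlgebra R E)} (h1 : X.map (rev R E) ≤ Y)
    (h2 : Y.map (rev R E) ≤ X) : X.map (rev R E) = Y :=
  le_antisymm h1 (by rw [← map_rev_map_rev Y]; exact Submodule.map_mono h2)

theorem mem_map_rev {X : Submodule R (TensorAlgebra R E)} {x : TensorAlgebra R E} :
    x ∈ X.map (rev R E) ↔ rev R E x ∈ X :=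
  ⟨by rintro ⟨y, hy, rfl⟩; rwa [rev_rev], fun h => ⟨_, h, rev_rev x⟩⟩

theorem map_rev_mul (X Y : Submodule R (TensorAlgebra R E)) :
    (X * Y).map (rev R E) = Y.map (rev R E) * X.map (rev R E) := by
  refine map_rev_eq_of_le ?_ ?_
  · rw [Submodule.map_le_iff_le_comap]
    refine Submodule.mul_le.mpr fun x hx y hy => ?_
    rw [Submodule.mem_comap, rev_mul]
    exact Submodule.mul_mem_mul ⟨y, hy, rfl⟩ ⟨x, hx, rfl⟩
  · rw [Submodule.map_le_iff_le_comap]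
    refine Submodule.mul_le.mpr ?_
    rintro _ ⟨y, hy, rfl⟩ _ ⟨x, hx, rfl⟩
    rw [Submodule.mem_comap, rev_mul, rev_rev, rev_rev]
    exact Submodule.mul_mem_mul hx hy

theorem map_rev_map_ι (W : Submodule R E) :
    (W.map (TensorAlgebra.ι R)).map (rev R E) = W.map (TensorAlgebra.ι R) := by
  rw [← Submodule.map_comp]
  congr 1
  ext e
  simp

theorem map_rev_one : (1 : Submodule R (TensorAlgebra R E)).map (rev R E) = 1 := by
  have h : (1 : Submodule R (TensorAlgebra R E)).map (rev R E) ≤ 1 := by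
    rintro _ ⟨x, hx, rfl⟩
    obtain ⟨r, rfl⟩ := Submodule.mem_one.mp hx
    rw [Algebra.algebraMap_eq_smul_one, map_smul, rev_one]
    exact Submodule.smul_mem _ _ (Submodule.one_le.mp le_rfl)
  exact map_rev_eq_of_le h h

theorem map_rev_words (W : List (Submodule R E)) :
    (words W).map (rev R E) = words W.reverse := by
  induction W with
  | nil => simpa using map_rev_one
  | cons V W ih =>
    rw [words_cons, map_rev_mul, map_rev_map_ι, ih, List.reverse_cons, words_append, words_cons,
      words_nil, mul_one]

theorem rev_mem_degPart {k : ℕ} {x : TensorAlgebra R E} (hx : x ∈ degPart R E k) :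
    rev R E x ∈ degPart R E k := by
  induction k generalizing x with
  | zero =>
    rw [degPart, pow_zero] at hx ⊢
    exact map_rev_one.le ⟨x, hx, rfl⟩
  | succ k ih =>
    induction hx using degPart_induction with
    | hc e w hw => rw [rev_mul, rev_ι]; exact mul_mem_degPart (ih hw) (ι_mem_degPart e)
    | hadd x y _ _ hx hy => rw [map_add]; exact add_mem hx hy

variable (mul : E →ₗ[R] E →ₗ[R] E)

theorem glue_rev {k p q : ℕ} (h : p + q + 2 = k) {x : TensorAlgebra R E}
    (hx : x ∈ degPart R E k) :
    glue mul p (rev R E x) = rev R E (glue mul.flip q x) := by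
  have hx' : x ∈ degPart R E q * degPart R E (p + 2) := by
    rw [← pow_add]; rwa [← h, show p + q + 2 = q + (p + 2) by omega] at hx
  refine Submodule.mul_induction_on hx' ?_ fun x y hx hy => by simp only [map_add, hx, hy]
  intro u hu w hw
  induction hw using degPart_induction with
  | hadd x y _ _ hx hy => simp only [map_add, mul_add, hx, hy]
  | hc e w hw =>
    induction hw using degPart_induction with
    | hadd x y _ _ hx hy => simp only [map_add, mul_add, hx, hy]
    | hc f v hv =>
      have h1 := glue_mul_of_mem mul.flip hu 0 (TensorAlgebra.ι R e * (TensorAlgebra.ι R f * v))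
      rw [add_zero, glue_zero_cons] at h1
      rw [h1]
      simp only [rev_mul, rev_ι]
      have h2 := glue_across mul (rev_mem_degPart hv) f e (rev R E u)
      rw [← mul_assoc] at h2
      rw [h2]
      simp

theorem rev_mem_ribbon {W : List (Submodule R E)} {x : TensorAlgebra R E}
    (hx : x ∈ ribbon mul.flip W) : rev R E x ∈ ribbon mul W.reverse := by
  rw [mem_ribbon] at hx ⊢
  refine ⟨map_rev_words W ▸ ⟨x, hx.1, rfl⟩, fun p => ?_⟩
  by_cases h : p + 2 ≤ W.length
  · rw [glue_rev mul (q := W.length - (p + 2)) (by omega) (words_le_degPart W hx.1), hx.2,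
      map_zero]
  · exact glue_eq_zero_of_mem mul (by omega) (rev_mem_degPart (words_le_degPart W hx.1))

theorem map_rev_ribbon (W : List (Submodule R E)) :
    (ribbon mul.flip W).map (rev R E) = ribbon mul W.reverse := by
  refine map_rev_eq_of_le ?_ ?_
  · rintro _ ⟨x, hx, rfl⟩; exact rev_mem_ribbon mul hx
  · rintro _ ⟨x, hx, rfl⟩
    have := rev_mem_ribbon mul.flip (W := W.reverse) (x := x) (by simpa using hx)
    simpa using this

theorem barDiff_rev {k : ℕ} {x : TensorAlgebra R E} (hx : x ∈ degPart R E k) :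
    barDiff mul k (rev R E x) = (-1 : R) ^ k • rev R E (barDiff mul.flip k x) := by
  simp only [barDiff, LinearMap.sum_apply, LinearMap.smul_apply, map_sum, map_smul,
    Finset.smul_sum]
  rw [← Finset.sum_range_reflect]
  refine Finset.sum_congr rfl fun p hp => ?_
  rw [Finset.mem_range] at hp
  rw [glue_rev mul (q := p) (by omega) hx, smul_smul, ← pow_add]
  congr 1
  rw [neg_one_pow_eq_pow_mod_two, neg_one_pow_eq_pow_mod_two (n := k + p)]
  congr 1
  omega

end Reversal

/-! ### Functoriality of words -/

section WordMap

variable {R : Type*} [CommRing R] {E E' : Type*} [AddCommGroup E] [Module R E]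
  [AddCommGroup E'] [Module R E']

@[simp] theorem wordMap_ι (f : E →ₗ[R] E') (e : E) :
    wordMap f (TensorAlgebra.ι R e) = TensorAlgebra.ι R (f e) := by simp [wordMap]

theorem wordMap_id : (wordMap (LinearMap.id : E →ₗ[R] E)) = AlgHom.id R _ := by
  ext; simp

theorem wordMap_injective {f : E →ₗ[R] E'} (g : E' →ₗ[R] E) (h : ∀ x, g (f x) = x) :
    Function.Injective (wordMap f) := by
  have : (wordMap g).comp (wordMap f) = AlgHom.id R _ := by ext; simp [h]
  exact Function.LeftInverse.injective (g := wordMap g) fun x => congr($this x)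

theorem wordMap_glue {mul : E →ₗ[R] E →ₗ[R] E} {mul' : E' →ₗ[R] E' →ₗ[R] E'} {f : E →ₗ[R] E'}
    (h : ∀ x y, f (mul x y) = mul' (f x) (f y)) (p : ℕ) (w : TensorAlgebra R E) :
    wordMap f (glue mul p w) = glue mul' p (wordMap f w) := by
  induction w using cons_induction generalizing p with
  | h0 => simp
  | hadd x y hx hy => simp only [map_add, hx, hy]
  | hsmul r x hx => simp only [map_smul, hx]
  | h1 => simp
  | hc e w ih =>
    cases p with
    | succ p => simp [ih]
    | zero =>
      clear ih
      induction w using cons_induction with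
      | h0 => simp
      | hadd x y hx hy => simp only [mul_add, map_add, hx, hy]
      | hsmul r x hx => simp only [mul_smul_comm, map_smul, hx]
      | h1 => simp
      | hc g w _ => simp [h]

theorem map_wordMap_words (f : E →ₗ[R] E') (W : List (Submodule R E)) :
    (words W).map (wordMap f).toLinearMap = words (W.map (Submodule.map f)) := by
  induction W with
  | nil => simp [Submodule.map_one]
  | cons V W ih =>
    rw [words_cons, Submodule.map_mul, ih, List.map_cons, words_cons]
    congr 1
    rw [← Submodule.map_comp, ← Submodule.map_comp]
    congr 1
    ext e
    simp

theorem map_wordMap_ribbon {mul : E →ₗ[R] E →ₗ[R] E} {mul' : E' →ₗ[R] E' →ₗ[R] E'}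
    {f : E →ₗ[R] E'} (h : ∀ x y, f (mul x y) = mul' (f x) (f y))
    (hf : Function.Injective (wordMap f)) (W : List (Submodule R E)) :
    (ribbon mul W).map (wordMap f).toLinearMap = ribbon mul' (W.map (Submodule.map f)) := by
  ext x
  rw [mem_ribbon, ← map_wordMap_words]
  constructor
  · rintro ⟨y, hy, rfl⟩
    have hy' := (mem_ribbon mul).mp hy
    refine ⟨⟨y, hy'.1, rfl⟩, fun p => ?_⟩
    change glue mul' p (wordMap f y) = 0
    rw [← wordMap_glue h, hy'.2, map_zero]
  · rintro ⟨⟨y, hy, rfl⟩, h2⟩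
    refine ⟨y, (mem_ribbon mul).mpr ⟨hy, fun p => hf ?_⟩, rfl⟩
    rw [wordMap_glue h, map_zero]
    exact h2 p

end WordMap

/-! ### The canonical sequences as identities between spaces of words -/

section ConcatExact

variable {R : Type*} [CommRing R] {E E₁ E₂ : Type*} [AddCommGroup E] [Module R E]
  [AddCommGroup E₁] [Module R E₁] [AddCommGroup E₂] [Module R E₂]
  {mul : E →ₗ[R] E →ₗ[R] E} {f : E₁ →ₗ[R] E} {g : E₂ →ₗ[R] E}
  {X : Submodule R (TensorAlgebra R E₁)} {Y : Submodule R (TensorAlgebra R E₂)}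
  {p : ℕ} {C N : Submodule R (TensorAlgebra R E)}

theorem range_juxtapose : LinearMap.range (juxtapose f g X Y) =
    X.map (wordMap f).toLinearMap * Y.map (wordMap g).toLinearMap := by
  apply le_antisymm
  · rintro _ ⟨z, rfl⟩
    induction z with
    | zero => simp
    | tmul x y =>
      simp only [juxtapose, LinearMap.comp_apply, TensorProduct.map_tmul, LinearMap.mul'_apply]
      exact Submodule.mul_mem_mul ⟨x, x.2, rfl⟩ ⟨y, y.2, rfl⟩
    | add a b ha hb => rw [map_add]; exact add_mem ha hb
  · refine Submodule.mul_le.mpr ?_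
    rintro _ ⟨x, hx, rfl⟩ _ ⟨y, hy, rfl⟩
    exact ⟨⟨x, hx⟩ ⊗ₜ ⟨y, hy⟩, by simp [juxtapose]⟩

theorem juxtapose_injective (hf : Function.Injective (wordMap f))
    (hg : Function.Injective (wordMap g))
    (h : Function.Injective (Submodule.mulMap (X.map (wordMap f).toLinearMap)
      (Y.map (wordMap g).toLinearMap))) :
    Function.Injective (juxtapose f g X Y) := by
  have : juxtapose f g X Y = Submodule.mulMap (X.map (wordMap f).toLinearMap)
      (Y.map (wordMap g).toLinearMap) ∘ₗ (TensorProduct.congr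
        (Submodule.equivMapOfInjective (wordMap f).toLinearMap hf X)
        (Submodule.equivMapOfInjective (wordMap g).toLinearMap hg Y)).toLinearMap := by
    ext x y
    rfl
  rw [this]
  exact h.comp (LinearEquiv.injective _)

theorem ConcatExact.le (h : ConcatExact mul f g X Y p C N) :
    N ≤ (X.map (wordMap f).toLinearMap * Y.map (wordMap g).toLinearMap).map (glue mul p) := by
  obtain ⟨i, q, -, hq, -, -, hs⟩ := h
  intro y hy
  obtain ⟨z, hz⟩ := hs ⟨y, hy⟩
  rw [← range_juxtapose]
  exact ⟨_, ⟨z, rfl⟩, by rw [← hq, hz]⟩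

theorem ConcatExact.of_eq (hJ : Function.Injective (juxtapose f g X Y))
    (hC : C = X.map (wordMap f).toLinearMap * Y.map (wordMap g).toLinearMap ⊓
      LinearMap.ker (glue mul p))
    (hN : (X.map (wordMap f).toLinearMap * Y.map (wordMap g).toLinearMap).map (glue mul p) = N) :
    ConcatExact mul f g X Y p C N := by
  rw [← range_juxtapose] at hC hN
  let e := LinearEquiv.ofInjective (juxtapose f g X Y) hJ
  have he : ∀ z, juxtapose f g X Y (e.symm z) = z := fun z =>
    congrArg Subtype.val (e.apply_symm_apply z)
  have hC' : C ≤ LinearMap.range (juxtapose f g X Y) := by rw [hC]; exact inf_le_left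
  let i : C →ₗ[R] X ⊗[R] Y := e.symm.toLinearMap ∘ₗ Submodule.inclusion hC'
  have hi : ∀ c : C, juxtapose f g X Y (i c) = c := fun c => he _
  let q : X ⊗[R] Y →ₗ[R] N := (glue mul p ∘ₗ juxtapose f g X Y).codRestrict N
    fun z => hN ▸ ⟨_, ⟨z, rfl⟩, rfl⟩
  refine ⟨i, q, hi, fun z => rfl, ?_, ?_, ?_⟩
  · intro a b hab
    exact Subtype.ext (by rw [← hi, hab, hi])
  · intro z
    constructor
    · intro hz
      have hz' : glue mul p (juxtapose f g X Y z) = 0 := congrArg Subtype.val hz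
      refine ⟨⟨juxtapose f g X Y z, hC ▸ ⟨⟨z, rfl⟩, hz'⟩⟩, hJ ?_⟩
      rw [hi]
    · rintro ⟨c, rfl⟩
      refine Subtype.ext ?_
      change glue mul p (juxtapose f g X Y (i c)) = 0
      rw [hi]
      exact (hC.le c.2).2
  · rintro ⟨y, hy⟩
    rw [← hN] at hy
    obtain ⟨_, ⟨z, rfl⟩, rfl⟩ := hy
    exact ⟨z, rfl⟩

end ConcatExact

/-! ### Systems attached to graded algebras and modules -/

namespace RightSystem

variable {R : Type*} [CommRing R] {E : Type*} [AddCommGroup E] [Module R E]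
  {S : RightSystem R E}

/-- Surjectivity for the first letter `1` suffices. -/
theorem MergesOnes.of_initial (hA : S.alg.MergesOnes)
    (h : ∀ c n, 0 < c → S.Merges [] 1 c (List.replicate n 1)) : S.MergesOnes := by
  intro a n ha
  obtain ⟨a, rfl⟩ : ∃ j, a = j + 1 := ⟨a - 1, by omega⟩
  cases a with
  | zero => exact h 1 n one_pos
  | succ a =>
    rw [add_comm (a + 1) 1]
    exact (h (a + 1 + 1) n (by omega)).shift (hA (a + 1) n (by omega)) (List.forall_mem_nil _)
      one_pos (by omega)

/-- For a module generated in the lowest degree, surjectivity after a first letter `1` suffices. -/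
theorem MergesOnes.of_generated (hA : S.alg.MergesOnes) (h0 : ∀ c, 0 < c → S.Merges [] 1 c [])
    (h : ∀ b c τ, 0 < b → 0 < c → Pos τ → S.Merges [1] b c τ) : S.MergesOnes := by
  refine .of_initial hA fun c n hc => ?_
  cases n with
  | zero => exact h0 c hc
  | succ n =>
    exact (h0 c hc).cons (h c 1 _ hc one_pos (pos_replicate n)) (List.forall_mem_nil _) one_pos hc
      one_pos (pos_replicate n) (S.flat_rib_singleton one_pos)
      (S.flat_rib_singleton (by omega))

end RightSystem

section Internal

variable {R : Type*} [CommRing R] {M : Type*} [AddCommGroup M] [Module R M]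
  {ι : Type*} [DecidableEq ι] {ℳ : ι → Submodule R M}

theorem exists_proj_of_isInternal (h : DirectSum.IsInternal ℳ) (i : ι) :
    ∃ f : M →ₗ[R] M, (∀ x ∈ ℳ i, f x = x) ∧ (∀ j ≠ i, ∀ x ∈ ℳ j, f x = 0) ∧ ∀ x, f x ∈ ℳ i := by
  let _ := h.chooseDecomposition
  refine ⟨(ℳ i).subtype ∘ₗ DirectSum.component R ι _ i ∘ₗ
    (DirectSum.decomposeLinearEquiv ℳ).toLinearMap, ?_, ?_, fun x => Subtype.property _⟩
  · intro x hx
    exact DirectSum.decompose_of_mem_same ℳ hx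
  · intro j hj x hx
    exact DirectSum.decompose_of_mem_ne ℳ hx hj

theorem flat_of_isInternal (h : DirectSum.IsInternal ℳ) (hf : ∀ i, Module.Flat R (ℳ i)) :
    Module.Flat R M :=
  Module.Flat.of_linearEquiv (LinearEquiv.ofBijective (DirectSum.coeLinearMap ℳ) h).symm

theorem flat_prod {N : Type*} [AddCommGroup N] [Module R N] [Module.Flat R M] [Module.Flat R N] :
    Module.Flat R (M × N) := by
  rw [Module.Flat.iff_rTensor_injective']
  intro I
  rw [injective_iff_map_eq_zero]
  intro z hz
  have h1 : LinearMap.lTensor I (LinearMap.fst R M N) z = 0 := by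
    apply Module.Flat.rTensor_preserves_injective_linearMap (M := M) _ I.injective_subtype
    rw [← LinearMap.comp_apply, LinearMap.rTensor_comp_lTensor, ← LinearMap.lTensor_comp_rTensor,
      LinearMap.comp_apply, hz, map_zero, map_zero]
  have h2 : LinearMap.lTensor I (LinearMap.snd R M N) z = 0 := by
    apply Module.Flat.rTensor_preserves_injective_linearMap (M := N) _ I.injective_subtype
    rw [← LinearMap.comp_apply, LinearMap.rTensor_comp_lTensor, ← LinearMap.lTensor_comp_rTensor,
      LinearMap.comp_apply, hz, map_zero, map_zero]
  have h3 : LinearMap.inl R M N ∘ₗ LinearMap.fst R M N + LinearMap.inr R M N ∘ₗ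
      LinearMap.snd R M N = LinearMap.id := by ext <;> simp
  have h4 := LinearMap.lTensor_id_apply (R := R) (M := I) (N := M × N) (x := z)
  rw [← h3, LinearMap.lTensor_add, LinearMap.add_apply, LinearMap.lTensor_comp,
    LinearMap.lTensor_comp, LinearMap.comp_apply, LinearMap.comp_apply, h1, h2] at h4
  rw [← h4, map_zero, map_zero, add_zero]

end Internal

section Systems

variable {R : Type*} [CommRing R] {A : Type*} [Ring A] [Algebra R A]
  {M : Type*} [AddCommGroup M] [Module R M]

/-- `mulA` is an associative graded product on `A = ⨁ 𝒜 n`, with flat pieces.  The two cases of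
interest are the product of `A` and the opposite product. -/
structure IsGradedMul (𝒜 : ℕ → Submodule R A) (mulA : A →ₗ[R] A →ₗ[R] A) : Prop where
  isInternal : DirectSum.IsInternal 𝒜
  assoc : ∀ x y z, mulA (mulA x y) z = mulA x (mulA y z)
  mul_mem : ∀ {i j x y}, x ∈ 𝒜 i → y ∈ 𝒜 j → mulA x y ∈ 𝒜 (i + j)
  flat : ∀ n, Module.Flat R (𝒜 n)

variable {𝒜 : ℕ → Submodule R A} {mulA : A →ₗ[R] A →ₗ[R] A}

theorem IsGradedMul.flip (h : IsGradedMul 𝒜 mulA) : IsGradedMul 𝒜 mulA.flip where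
  isInternal := h.isInternal
  assoc x y z := (h.assoc z y x).symm
  mul_mem {i j x y} hx hy := by rw [add_comm]; exact h.mul_mem hy hx
  flat := h.flat

theorem isGradedMul_mul (𝒜 : ℕ → Submodule R A) [GradedAlgebra 𝒜]
    (hflat : ∀ n, Module.Flat R (𝒜 n)) : IsGradedMul 𝒜 (LinearMap.mul R A) where
  isInternal := DirectSum.Decomposition.isInternal 𝒜
  assoc x y z := by simp [mul_assoc]
  mul_mem hx hy := SetLike.mul_mem_graded hx hy
  flat := hflat

/-- The system given by an algebra, acting on itself. -/
def algSystem (h : IsGradedMul 𝒜 mulA) : RightSystem R A where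
  mul := mulA
  L := 𝒜
  Mo := 𝒜
  assoc := h.assoc
  mul_mem _ _ hx hy := h.mul_mem hx hy
  act_mem _ _ hx hy := h.mul_mem hx hy
  exists_proj_L n _ := by
    obtain ⟨f, h1, h2, -⟩ := exists_proj_of_isInternal h.isInternal n
    exact ⟨f, h1, fun m _ => h2 m⟩
  exists_proj_Mo n _ := by
    obtain ⟨f, h1, h2, -⟩ := exists_proj_of_isInternal h.isInternal n
    exact ⟨f, h1, fun m _ => h2 m⟩
  flat := flat_of_isInternal h.isInternal h.flat
  flat_L n _ := h.flat n
  flat_Mo n _ := h.flat n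

variable {act : A →ₗ[R] M →ₗ[R] M} {ℳ : ℤ → Submodule R M} {t : ℤ}
  {m : (A × M) →ₗ[R] (A × M) →ₗ[R] (A × M)}

/-- A graded module on which `A` with the product `mulA` acts from the right by `act`.  The product
on `A × M` is called `m`. -/
structure IsGradedAct (𝒜 : ℕ → Submodule R A) (mulA : A →ₗ[R] A →ₗ[R] A)
    (act : A →ₗ[R] M →ₗ[R] M) (ℳ : ℤ → Submodule R M) (t : ℤ)
    (m : (A × M) →ₗ[R] (A × M) →ₗ[R] (A × M)) : Prop where
  gradedMul : IsGradedMul 𝒜 mulA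
  gradedFlat : IsGradedFlat 𝒜 act ℳ t
  act_act : ∀ x y z, act y (act x z) = act (mulA x y) z
  m_apply : ∀ x y, m x y = (mulA x.1 y.1, act y.1 x.2)

theorem flat_map_of_injective {N P : Type*} [AddCommGroup N] [Module R N] [AddCommGroup P]
    [Module R P] {f : N →ₗ[R] P} (hf : Function.Injective f) (X : Submodule R N)
    [Module.Flat R X] : Module.Flat R (X.map f) :=
  Module.Flat.of_linearEquiv (Submodule.equivMapOfInjective f hf X).symm

theorem projective_map_of_injective {N P : Type*} [AddCommGroup N] [Module R N] [AddCommGroup P]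
    [Module R P] {f : N →ₗ[R] P} (hf : Function.Injective f) (X : Submodule R N)
    [Module.Projective R X] : Module.Projective R (X.map f) :=
  Module.Projective.of_equiv (Submodule.equivMapOfInjective f hf X)

/-- The system given by a graded module.  Its piece of index `n` is the piece of `M` of degree
`t + n - 1`. -/
def modSystem (h : IsGradedAct 𝒜 mulA act ℳ t m) : RightSystem R (A × M) where
  mul := m
  L n := (𝒜 n).map (LinearMap.inl R A M)
  Mo n := letter A (ℳ (t + ((n : ℤ) - 1)))
  assoc x y z := by simp [h.m_apply, h.gradedMul.assoc, h.act_act]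
  mul_mem := by
    rintro i j _ _ _ _ ⟨x, hx, rfl⟩ ⟨y, hy, rfl⟩
    exact ⟨_, h.gradedMul.mul_mem hx hy, by simp [h.m_apply]⟩
  act_mem := by
    rintro i j _ _ _ _ ⟨x, hx, rfl⟩ ⟨y, hy, rfl⟩
    refine ⟨act y x, ?_, by simp [h.m_apply]⟩
    have := h.gradedFlat.act_mem _ _ _ hy _ hx
    rwa [show (j : ℤ) + (t + ((i : ℤ) - 1)) = t + (((i + j : ℕ) : ℤ) - 1) by push_cast; ring]
      at this
  exists_proj_L n _ := by
    obtain ⟨f, h1, h2, -⟩ := exists_proj_of_isInternal h.gradedMul.isInternal n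
    refine ⟨LinearMap.inl R A M ∘ₗ f ∘ₗ LinearMap.fst R A M, ?_, ?_⟩
    · rintro _ ⟨x, hx, rfl⟩; simp [h1 x hx]
    · rintro k _ hk _ ⟨x, hx, rfl⟩; simp [h2 k hk x hx]
  exists_proj_Mo n _ := by
    obtain ⟨f, h1, h2, -⟩ := exists_proj_of_isInternal h.gradedFlat.isInternal (t + ((n : ℤ) - 1))
    refine ⟨LinearMap.inr R A M ∘ₗ f ∘ₗ LinearMap.snd R A M, ?_, ?_⟩
    · rintro _ ⟨x, hx, rfl⟩; simp [h1 x hx]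
    · rintro k _ hk _ ⟨x, hx, rfl⟩; simp [h2 _ (by omega) x hx]
  flat := by
    have := flat_of_isInternal h.gradedMul.isInternal h.gradedMul.flat
    have := flat_of_isInternal h.gradedFlat.isInternal h.gradedFlat.flat
    exact flat_prod
  flat_L n _ := by
    have := h.gradedMul.flat n
    exact flat_map_of_injective LinearMap.inl_injective _
  flat_Mo n _ := by
    have := h.gradedFlat.flat (t + ((n : ℤ) - 1))
    exact flat_map_of_injective LinearMap.inr_injective _

section Algebra

variable (h : IsGradedMul 𝒜 mulA)

theorem algSystem_lets (α : List ℕ) : (algSystem h).lets α = α.map 𝒜 :=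
  (algSystem h).alg_lets α

theorem algSystem_alg : (algSystem h).alg = algSystem h := rfl

theorem algSystem_rib_reverse (h' : IsGradedMul 𝒜 mulA.flip) (α : List ℕ) :
    ((algSystem h').rib α).map (rev R A) = (algSystem h).rib α.reverse := by
  unfold RightSystem.rib
  rw [algSystem_lets, algSystem_lets, List.map_reverse]
  exact map_rev_ribbon mulA _

theorem rev_map_glue {E : Type*} [AddCommGroup E] [Module R E] (mul : E →ₗ[R] E →ₗ[R] E)
    {k p q : ℕ} (hk : p + q + 2 = k) {X : Submodule R (TensorAlgebra R E)}
    (hX : X ≤ degPart R E k) :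
    (X.map (glue mul.flip q)).map (rev R E) = (X.map (rev R E)).map (glue mul p) := by
  ext x
  constructor
  · rintro ⟨_, ⟨y, hy, rfl⟩, rfl⟩
    exact ⟨_, ⟨y, hy, rfl⟩, glue_rev mul hk (hX hy)⟩
  · rintro ⟨_, ⟨y, hy, rfl⟩, rfl⟩
    exact ⟨_, ⟨y, hy, rfl⟩, (glue_rev mul hk (hX hy)).symm⟩

/-- The opposite of a Koszul algebra is Koszul. -/
theorem mergesOnes_flip (h' : IsGradedMul 𝒜 mulA.flip) (hA : (algSystem h).MergesOnes) :
    (algSystem h').MergesOnes := by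
  intro a n ha
  have key := hA.merges (algSystem h) hA (σ := List.replicate n 1) (τ := [])
    (RightSystem.pos_replicate n) one_pos ha (List.forall_mem_nil _)
  unfold RightSystem.Merges at key ⊢
  rw [← Submodule.map_le_map_iff_of_injective (f := rev R A) rev_injective]
  have hd := (algSystem h').rib_mul_rib_le_degPart [a] (1 :: List.replicate n 1)
  have e1 := rev_map_glue mulA (p := n) (q := 0) (by simp; omega) hd
  change _ ≤ Submodule.map (rev R A) (Submodule.map (glue mulA.flip 0) _)
  change _ ≤ Submodule.map (glue mulA (List.replicate n 1).length) _ at key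
  simp only [List.nil_append]
  rw [e1, map_rev_mul, algSystem_rib_reverse h]
  change _ ≤ Submodule.map _ (Submodule.map _ ((algSystem h').rib _) * _)
  rw [algSystem_rib_reverse h, algSystem_rib_reverse h]
  simpa [add_comm, algSystem_alg] using key

end Algebra

section Module

variable (h : IsGradedAct 𝒜 mulA act ℳ t m)

theorem wordMap_inl_injective :
    Function.Injective (wordMap (LinearMap.inl R A M)) :=
  wordMap_injective (LinearMap.fst R A M) fun _ => rfl

theorem map_algSystem_rib (α : List ℕ) :
    ((algSystem h.gradedMul).rib α).map (wordMap (LinearMap.inl R A M)).toLinearMap =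
      (modSystem h).alg.rib α := by
  unfold RightSystem.rib
  rw [algSystem_lets, RightSystem.alg_lets]
  refine (map_wordMap_ribbon (mul' := m) (fun x y => ?_) wordMap_inl_injective _).trans ?_
  · simp [h.m_apply, algSystem]
  · rw [List.map_map]; rfl

theorem modSystem_alg_mergesOnes (hA : (algSystem h.gradedMul).MergesOnes) :
    (modSystem h).alg.MergesOnes := by
  intro a n ha
  have key := Submodule.map_mono (f := (wordMap (LinearMap.inl R A M)).toLinearMap) (hA a n ha)
  unfold RightSystem.Merges
  rw [List.nil_append] at key
  rw [map_algSystem_rib h] at key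
  refine key.trans ?_
  change _ ≤ Submodule.map _ ((modSystem h).alg.rib _ * (modSystem h).alg.rib _)
  rw [← map_algSystem_rib h, ← map_algSystem_rib h, ← Submodule.map_mul]
  rintro _ ⟨_, ⟨y, hy, rfl⟩, rfl⟩
  refine ⟨_, ⟨y, hy, rfl⟩, ?_⟩
  exact (wordMap_glue (mul := mulA) (mul' := m) (fun x y => by simp [h.m_apply]) _ _).symm

/-- A module generated by its component of initial degree. -/
theorem merges_of_isGeneratedBy (hgen : IsGeneratedBy act (ℳ t)) {c : ℕ} (hc : 0 < c) :
    (modSystem h).Merges [] 1 c [] := by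
  obtain ⟨P, hP1, hP2, -⟩ := exists_proj_of_isInternal h.gradedFlat.isInternal (t + c)
  have key : ∀ z, P z ∈ Submodule.map₂ act (𝒜 c) (ℳ t) := by
    intro z
    have hz : z ∈ Submodule.span R {z : M | ∃ a : A, ∃ m ∈ ℳ t, z = act a m} := by
      rw [show Submodule.span R _ = ⊤ from hgen]; trivial
    induction hz using Submodule.span_induction with
    | zero => simp
    | add x y _ _ hx hy => rw [map_add]; exact add_mem hx hy
    | smul r x _ hx => rw [map_smul]; exact Submodule.smul_mem _ _ hx
    | mem z hz =>
      obtain ⟨a, x, hx, rfl⟩ := hz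
      have ha : a ∈ ⨆ n, 𝒜 n := by
        rw [h.gradedMul.isInternal.submodule_iSup_eq_top]; trivial
      induction ha using Submodule.iSup_induction' with
      | zero => simp
      | add a b _ _ ha hb => rw [map_add, LinearMap.add_apply, map_add]; exact add_mem ha hb
      | mem n a ha =>
        have hm := h.gradedFlat.act_mem _ _ _ ha _ hx
        by_cases hn : n = c
        · subst hn
          rw [hP1 _ (by rwa [add_comm])]
          exact Submodule.apply_mem_map₂ _ ha hx
        · rw [hP2 _ (by omega) _ hm]; exact zero_mem _
  have key2 : ∀ z ∈ Submodule.map₂ act (𝒜 c) (ℳ t), TensorAlgebra.ι R ((0, z) : A × M) ∈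
      ((modSystem h).rib [1] * (modSystem h).alg.rib [c]).map (glue m 0) := by
    intro z hz
    have : Submodule.map₂ act (𝒜 c) (ℳ t) ≤ (((modSystem h).rib [1] *
        (modSystem h).alg.rib [c]).map (glue m 0)).comap
          (TensorAlgebra.ι R ∘ₗ LinearMap.inr R A M) := by
      refine Submodule.map₂_le.mpr fun a ha x hx => ?_
      refine ⟨TensorAlgebra.ι R ((0, x) : A × M) * TensorAlgebra.ι R ((a, 0) : A × M),
        Submodule.mul_mem_mul ?_ ?_, ?_⟩
      · rw [RightSystem.rib_singleton]
        exact ⟨_, ⟨x, by simpa using hx, rfl⟩, rfl⟩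
      · rw [RightSystem.rib_singleton]
        exact ⟨_, ⟨a, ha, rfl⟩, rfl⟩
      · have := glue_zero_cons m ((0, x) : A × M) ((a, 0) : A × M) 1
        rw [mul_one] at this
        rw [this]
        simp [h.m_apply]
    exact this hz
  unfold RightSystem.Merges
  simp only [List.nil_append]
  rw [RightSystem.rib_singleton]
  rintro _ ⟨_, ⟨x, hx, rfl⟩, rfl⟩
  have hx' : x ∈ ℳ (t + c) := by
    have hx : x ∈ ℳ (t + (((1 + c : ℕ) : ℤ) - 1)) := hx
    rwa [show t + (((1 + c : ℕ) : ℤ) - 1) = t + c by push_cast; ring] at hx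
  exact key2 x (hP1 x hx' ▸ key x)

end Module

end Systems

/-! ### The canonical sequences and the Koszul property -/

theorem nearConcat_snoc_cons (σ τ : List ℕ) (a b : ℕ) :
    nearConcat (σ ++ [a]) (b :: τ) = σ ++ (a + b) :: τ := by
  simp [nearConcat]

namespace RightSystem

variable {R : Type*} [CommRing R] {E : Type*} [AddCommGroup E] [Module R E]
  {S : RightSystem R E} {E₁ E₂ : Type*} [AddCommGroup E₁] [Module R E₁]
  [AddCommGroup E₂] [Module R E₂] {f : E₁ →ₗ[R] E} {g : E₂ →ₗ[R] E}
  {X : Submodule R (TensorAlgebra R E₁)} {Y : Submodule R (TensorAlgebra R E₂)}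
  {σ τ : List ℕ} {b c : ℕ}

/-- The canonical sequence, read inside the tensor algebra: exactness in the middle is the
description of the ribbon module of a concatenation as a kernel. -/
theorem MergesOnes.concatExact (hS : S.MergesOnes) (hA : S.alg.MergesOnes)
    (hf : Function.Injective (wordMap f)) (hg : Function.Injective (wordMap g))
    (hX : X.map (wordMap f).toLinearMap = S.rib (σ ++ [b]))
    (hY : Y.map (wordMap g).toLinearMap = S.alg.rib (c :: τ))
    (hσ : Pos σ) (hb : 0 < b) (hc : 0 < c) (hτ : Pos τ) :
    ConcatExact S.mul f g X Y σ.length (S.rib (σ ++ [b] ++ c :: τ))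
      (S.rib (σ ++ (b + c) :: τ)) := by
  have := S.flat
  have hp := pos_snoc hσ hb
  have hq : Pos (c :: τ) := by simpa [Pos] using ⟨hc, hτ⟩
  have := hS.flat_rib S hA hp
  refine ConcatExact.of_eq (juxtapose_injective hf hg ?_) ?_ ?_
  · rw [hX, hY]; exact mulMap_injective_of_flat_left (S.rib_le_degPart _) _
  · rw [hX, hY]; exact S.rib_append (by simp) hq (by simp)
  · rw [hX, hY]; exact (hS.merges S hA hσ hb hc hτ).map_eq hσ hb hc

/-- The canonical sequence for words read from right to left. -/
theorem MergesOnes.concatExact_rev {mul : E →ₗ[R] E →ₗ[R] E} (hm : S.mul = mul.flip)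
    (hS : S.MergesOnes) (hA : S.alg.MergesOnes)
    (hf : Function.Injective (wordMap f)) (hg : Function.Injective (wordMap g))
    (hX : X.map (wordMap f).toLinearMap = (S.alg.rib (c :: τ)).map (rev R E))
    (hY : Y.map (wordMap g).toLinearMap = (S.rib (σ ++ [b])).map (rev R E))
    (hσ : Pos σ) (hb : 0 < b) (hc : 0 < c) (hτ : Pos τ) :
    ConcatExact mul f g X Y τ.length ((S.rib (σ ++ [b] ++ c :: τ)).map (rev R E))
      ((S.rib (σ ++ (b + c) :: τ)).map (rev R E)) := by
  have := S.flat
  have hp := pos_snoc hσ hb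
  have hq : Pos (c :: τ) := by simpa [Pos] using ⟨hc, hτ⟩
  have := hS.flat_rib S hA hp
  have := hA.flat_rib S.alg hA hq
  have hd := S.rib_mul_rib_le_degPart (σ ++ [b]) (c :: τ)
  have hk : τ.length + σ.length + 2 = (σ ++ [b]).length + (c :: τ).length := by simp; omega
  refine ConcatExact.of_eq (juxtapose_injective hf hg ?_) ?_ ?_
  · rw [hX, hY]
    have := flat_map_of_injective (f := rev R E) rev_injective (S.alg.rib (c :: τ))
    refine mulMap_injective_of_flat_left (k := (c :: τ).length) ?_ _
    rintro _ ⟨x, hx, rfl⟩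
    exact rev_mem_degPart (S.alg.rib_le_degPart _ hx)
  · rw [hX, hY, ← map_rev_mul, S.rib_append (by simp) hq (p := σ.length) (by simp)]
    ext x
    rw [Submodule.mem_inf, mem_map_rev, mem_map_rev, Submodule.mem_inf]
    refine and_congr_right fun hx => ?_
    rw [LinearMap.mem_ker, LinearMap.mem_ker, ← rev_rev x, glue_rev mul hk (hd hx), rev_rev, hm,
      map_eq_zero_iff _ rev_injective]
  · rw [hX, hY, ← map_rev_mul, ← rev_map_glue mul hk hd, ← hm,
      (hS.merges S hA hσ hb hc hτ).map_eq hσ hb hc]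

theorem merges_of_concatExact_rev {mul : E →ₗ[R] E →ₗ[R] E} (hm : S.mul = mul.flip)
    (hX : X.map (wordMap f).toLinearMap = (S.alg.rib (c :: τ)).map (rev R E))
    (hY : Y.map (wordMap g).toLinearMap = (S.rib (σ ++ [b])).map (rev R E))
    {C : Submodule R (TensorAlgebra R E)}
    (h : ConcatExact mul f g X Y τ.length C ((S.rib (σ ++ (b + c) :: τ)).map (rev R E))) :
    S.Merges σ b c τ := by
  have hd := S.rib_mul_rib_le_degPart (σ ++ [b]) (c :: τ)
  have hk : τ.length + σ.length + 2 = (σ ++ [b]).length + (c :: τ).length := by simp; omega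
  have := h.le
  rw [hX, hY, ← map_rev_mul, ← rev_map_glue mul hk hd, ← hm] at this
  exact (Submodule.map_le_map_iff_of_injective rev_injective _ _).mp this

end RightSystem

section Algebra

variable {R : Type*} [CommRing R] {A : Type*} [Ring A] [Algebra R A] {𝒜 : ℕ → Submodule R A}
  (h : IsGradedMul 𝒜 (LinearMap.mul R A))

theorem schur_eq (α : List ℕ) : schur 𝒜 α = (algSystem h).rib α := by
  unfold schur RightSystem.rib
  rw [algSystem_lets]
  rfl

theorem barPiece_succ (i n : ℕ) : barPiece 𝒜 (i + 1) n = (algSystem h).bar 1 i n := by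
  rw [← algSystem_alg h, ← RightSystem.barAlg_succ]
  unfold barPiece RightSystem.barAlg
  simp only [algSystem_alg, algSystem_lets]

/-- The bar complex vanishes on one side of the diagonal, so that the Koszul property only concerns
the other side. -/
theorem isKoszul_iff (hquad : IsQuadratic 𝒜) : IsKoszul 𝒜 ↔ (algSystem h).MergesOnes := by
  have key := RightSystem.koszul_alg_iff (S := algSystem h)
  rw [algSystem_alg] at key
  rw [← key]
  constructor
  · intro hK N i hi x hx hx0
    rw [← barPiece_succ] at hx
    obtain ⟨y, hy, hyx⟩ := hK.2 (i + 1) N (by omega) x hx hx0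
    exact ⟨y, by rwa [← barPiece_succ], hyx⟩
  · intro hK
    refine ⟨hquad, fun i n hn x hx hx0 => ?_⟩
    have hz : x = 0 → ∃ y ∈ barPiece 𝒜 (i + 1) n, barDiff (LinearMap.mul R A) (i + 1) y = x :=
      fun h0 => ⟨0, zero_mem _, by rw [map_zero, h0]⟩
    cases i with
    | zero =>
      refine hz ?_
      rw [← Submodule.mem_bot R]
      refine (iSup_le fun α => iSup_le fun hα => ?_ : barPiece 𝒜 0 n ≤ ⊥) hx
      obtain rfl := List.length_eq_zero_iff.mp hα.1
      exact absurd hα.2.1.symm hn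
    | succ i =>
      rw [barPiece_succ h] at hx
      rcases lt_or_ge n (1 + i) with hlt | hge
      · exact hz (by rwa [RightSystem.bar_eq_bot hlt, Submodule.mem_bot] at hx)
      · rw [barPiece_succ h]
        exact hK n i (by omega) x hx hx0

theorem map_wordMap_id {E : Type*} [AddCommGroup E] [Module R E]
    (X : Submodule R (TensorAlgebra R E)) :
    X.map (wordMap (LinearMap.id : E →ₗ[R] E)).toLinearMap = X := by
  rw [wordMap_id]; exact Submodule.map_id X

theorem wordMap_id_injective {E : Type*} [AddCommGroup E] [Module R E] :
    Function.Injective (wordMap (LinearMap.id : E →ₗ[R] E)) :=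
  wordMap_injective LinearMap.id fun _ => rfl

theorem IsComp.exists_snoc {α : List ℕ} (hα : IsComp α) :
    ∃ σ a, α = σ ++ [a] ∧ Pos σ ∧ 0 < a := by
  obtain ⟨σ, a, rfl⟩ : ∃ σ a, α = σ ++ [a] := ⟨_, _, (List.dropLast_append_getLast hα.1).symm⟩
  exact ⟨σ, a, rfl, fun x hx => hα.2 x (by simp [hx]), hα.2 a (by simp)⟩

theorem IsComp.exists_cons {α : List ℕ} (hα : IsComp α) :
    ∃ a σ, α = a :: σ ∧ 0 < a ∧ Pos σ := by
  obtain ⟨a, σ, rfl⟩ := List.exists_cons_of_ne_nil hα.1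
  exact ⟨a, σ, rfl, hα.2 a (by simp), fun x hx => hα.2 x (by simp [hx])⟩

theorem isComp_cons {a : ℕ} {τ : List ℕ} (ha : 0 < a) (hτ : Pos τ) : IsComp (a :: τ) :=
  ⟨by simp, by simpa using ⟨ha, hτ⟩⟩

theorem isComp_snoc {a : ℕ} {σ : List ℕ} (ha : 0 < a) (hσ : Pos σ) : IsComp (σ ++ [a]) :=
  ⟨by simp, pos_snoc hσ ha⟩

theorem mergesOnes_iff_schurExact : (algSystem h).MergesOnes ↔
    ∀ α β, IsComp α → IsComp β → SchurExact 𝒜 α β := by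
  constructor
  · intro hA α β hα hβ
    obtain ⟨σ, a, rfl, hσ, ha⟩ := hα.exists_snoc
    obtain ⟨b, τ, rfl, hb, hτ⟩ := hβ.exists_cons
    have := hA.concatExact (f := LinearMap.id) (g := LinearMap.id) (X := schur 𝒜 (σ ++ [a]))
      (Y := schur 𝒜 (b :: τ)) hA wordMap_id_injective wordMap_id_injective
      (by rw [map_wordMap_id, schur_eq h]) (by rw [map_wordMap_id, schur_eq h]; rfl) hσ ha hb hτ
    rw [← schur_eq, ← schur_eq] at this
    unfold SchurExact
    rw [nearConcat_snoc_cons, List.length_append, List.length_singleton, Nat.add_sub_cancel]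
    exact this
  · intro hE a n ha
    have := (hE [a] (1 :: List.replicate n 1) (isComp_cons ha (by simp [Pos]))
      (isComp_cons one_pos (RightSystem.pos_replicate n))).le
    rw [map_wordMap_id, map_wordMap_id, schur_eq h, schur_eq h, schur_eq h] at this
    exact this

end Algebra

section Module

variable {R : Type*} [CommRing R] {A : Type*} [Ring A] [Algebra R A] {𝒜 : ℕ → Submodule R A}
  {M : Type*} [AddCommGroup M] [Module R M]
  {mulA : A →ₗ[R] A →ₗ[R] A} {act : A →ₗ[R] M →ₗ[R] M} {ℳ : ℤ → Submodule R M} {t : ℤ}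
  {m : (A × M) →ₗ[R] (A × M) →ₗ[R] (A × M)}

theorem modSystem_lets (h : IsGradedAct 𝒜 mulA act ℳ t m) (a : ℕ) (α : List ℕ) :
    (modSystem h).lets ((a + 1) :: α) = letter A (ℳ (t + a)) :: letters M 𝒜 α := by
  simp [RightSystem.lets, modSystem, letters]

theorem letters_reverse (α : List ℕ) : letters M 𝒜 α.reverse = (letters M 𝒜 α).reverse := by
  simp [letters]

theorem exists_add_of_le {t j : ℤ} (h : t ≤ j) : ∃ a : ℕ, j = t + a :=
  ⟨(j - t).toNat, by omega⟩

theorem words_cons_bot {E : Type*} [AddCommGroup E] [Module R E] (W : List (Submodule R E)) :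
    words ((⊥ : Submodule R E) :: W) = ⊥ := by
  rw [words_cons, Submodule.map_bot, Submodule.bot_mul]

/-- The bar complex of a module, with degrees counted from the initial one. -/
theorem barPieceR_eq (h : IsGradedAct 𝒜 mulA act ℳ t m) (i N : ℕ) :
    barPieceR 𝒜 ℳ i (t + N) = (modSystem h).bar 1 i (N + 1) := by
  apply le_antisymm
  · refine iSup_le fun α => iSup_le fun j => iSup_le fun hα => ?_
    rcases lt_or_ge j t with hj | hj
    · rw [h.gradedFlat.eq_bot j hj, letter, Submodule.map_bot, words_cons_bot]
      exact bot_le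
    · obtain ⟨a, rfl⟩ := exists_add_of_le hj
      rw [← modSystem_lets h]
      exact RightSystem.words_le_bar (by omega) hα.1 (by omega) hα.2.2
  · refine RightSystem.bar_le fun a β ha hi hn hβ => ?_
    obtain ⟨a, rfl⟩ : ∃ j, a = j + 1 := ⟨a - 1, by omega⟩
    rw [modSystem_lets]
    exact le_iSup_of_le β (le_iSup_of_le (t + (a : ℤ)) (le_iSup_of_le ⟨hi, by omega, hβ⟩ le_rfl))

theorem barPieceR_eq_bot (h : IsGradedAct 𝒜 mulA act ℳ t m) {i : ℕ} {n : ℤ} (hn : n < t) :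
    barPieceR 𝒜 ℳ i n = ⊥ := by
  refine le_bot_iff.mp (iSup_le fun α => iSup_le fun j => iSup_le fun hα => ?_)
  rw [h.gradedFlat.eq_bot j (by omega), letter, Submodule.map_bot, words_cons_bot]

/-- The bar complex of a left module is the reversed bar complex of the same module over the
opposite algebra. -/
theorem barPieceL_eq (i : ℕ) (n : ℤ) :
    barPieceL 𝒜 ℳ i n = (barPieceR 𝒜 ℳ i n).map (rev R (A × M)) := by
  unfold barPieceL barPieceR
  simp only [Submodule.map_iSup, map_rev_words]
  apply le_antisymm
  · refine iSup_le fun α => iSup_le fun j => iSup_le fun hα => ?_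
    refine le_iSup_of_le α.reverse (le_iSup_of_le j (le_iSup_of_le ?_ ?_))
    · simpa using hα
    · simp [letters_reverse]
  · refine iSup_le fun α => iSup_le fun j => iSup_le fun hα => ?_
    refine le_iSup_of_le α.reverse (le_iSup_of_le j (le_iSup_of_le ?_ ?_))
    · simpa using hα
    · simp [letters_reverse]

theorem barPieceR_le_degPart (i : ℕ) (n : ℤ) :
    barPieceR 𝒜 ℳ i n ≤ degPart R (A × M) (i + 1) := by
  refine iSup_le fun α => iSup_le fun j => iSup_le fun hα => ?_
  convert words_le_degPart _ using 2
  simp [letters, hα.1]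

theorem koszul_iff_barPieceR (h : IsGradedAct 𝒜 mulA act ℳ t m) :
    (modSystem h).Koszul ↔ ∀ (i : ℕ) (n : ℤ), n ≠ t + i → ∀ x ∈ barPieceR 𝒜 ℳ i n,
      barDiff m (i + 1) x = 0 → ∃ y ∈ barPieceR 𝒜 ℳ (i + 1) n, barDiff m (i + 2) y = x := by
  constructor
  · intro hK i n hn x hx hx0
    have hz : x = 0 → ∃ y ∈ barPieceR 𝒜 ℳ (i + 1) n, barDiff m (i + 2) y = x :=
      fun h0 => ⟨0, zero_mem _, by rw [map_zero, h0]⟩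
    rcases lt_or_ge n t with hlt | hge
    · exact hz (by rwa [barPieceR_eq_bot h hlt, Submodule.mem_bot] at hx)
    obtain ⟨N, rfl⟩ := exists_add_of_le hge
    rw [barPieceR_eq h] at hx
    rcases lt_or_ge N i with hlt | hge
    · exact hz (by rwa [RightSystem.bar_eq_bot (by omega), Submodule.mem_bot] at hx)
    · rw [barPieceR_eq h]
      exact hK (N + 1) i (by omega) x hx hx0
  · intro hK N i hi x hx hx0
    obtain ⟨N, rfl⟩ : ∃ j, N = j + 1 := ⟨N - 1, by omega⟩
    rw [← barPieceR_eq h] at hx ⊢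
    exact hK i (t + N) (by omega) x hx hx0

end Module

section Projective

variable {R : Type*} [CommRing R] {A : Type*} [Ring A] [Algebra R A] {𝒜 : ℕ → Submodule R A}
  {M : Type*} [AddCommGroup M] [Module R M]
  {mulA : A →ₗ[R] A →ₗ[R] A} {act : A →ₗ[R] M →ₗ[R] M} {ℳ : ℤ → Submodule R M} {t : ℤ}
  {m : (A × M) →ₗ[R] (A × M) →ₗ[R] (A × M)}

theorem modSystem_projective_L (h : IsGradedAct 𝒜 mulA act ℳ t m)
    (hP : ∀ n, Module.Projective R (𝒜 n)) (n : ℕ) (_ : 0 < n) :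
    Module.Projective R ((modSystem h).L n) := by
  have := hP n
  exact projective_map_of_injective LinearMap.inl_injective _

theorem modSystem_projective_Mo (h : IsGradedAct 𝒜 mulA act ℳ t m)
    (hP : ∀ j, Module.Projective R (ℳ j)) (n : ℕ) (_ : 0 < n) :
    Module.Projective R ((modSystem h).Mo n) := by
  have := hP (t + ((n : ℤ) - 1))
  exact projective_map_of_injective LinearMap.inr_injective _

theorem RightSystem.MergesOnes.projective_rib_of_pos {E : Type*} [AddCommGroup E] [Module R E]
    {S : RightSystem R E} (hS : S.MergesOnes) (hA : S.alg.MergesOnes)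
    (pL : ∀ n, 0 < n → Module.Projective R (S.L n)) (pM : ∀ n, 0 < n → Module.Projective R (S.Mo n))
    {ρ : List ℕ} (h0 : ρ ≠ []) (hρ : Pos ρ) : Module.Projective R (S.rib ρ) := by
  obtain ⟨σ, a, rfl, hσ, ha⟩ := IsComp.exists_snoc ⟨h0, hρ⟩
  exact hS.projective_rib S hA pL pM hσ a ha

end Projective

section RightModule

variable {R : Type*} [CommRing R] {A : Type*} [Ring A] [Algebra R A] {𝒜 : ℕ → Submodule R A}
  {M : Type*} [AddCommGroup M] [Module R M]
  {act : A →ₗ[R] M →ₗ[R] M} {ℳ : ℤ → Submodule R M} {t : ℤ}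
  (h : IsGradedAct 𝒜 (LinearMap.mul R A) act ℳ t (mulR act))

theorem schurR_eq (α : List ℕ) (a : ℕ) :
    schurR 𝒜 act α (ℳ (t + a)) = (modSystem h).rib ((a + 1) :: α) := by
  unfold schurR RightSystem.rib
  rw [modSystem_lets]
  rfl

theorem schurR_eq_zero (α : List ℕ) : schurR 𝒜 act α (ℳ t) = (modSystem h).rib (1 :: α) := by
  rw [← schurR_eq]; simp

theorem isKoszulR_iff (hA : (algSystem h.gradedMul).MergesOnes) :
    IsKoszulR 𝒜 act ℳ t ↔ (modSystem h).MergesOnes := by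
  rw [← RightSystem.koszul_iff (modSystem_alg_mergesOnes h hA), koszul_iff_barPieceR]
  rfl

theorem map_inl_schur (α : List ℕ) :
    (schur 𝒜 α).map (wordMap (LinearMap.inl R A M)).toLinearMap = (modSystem h).alg.rib α := by
  rw [schur_eq h.gradedMul, map_algSystem_rib]

/-- The sequences with `α` empty account for the surjectivity of the multiplications at the letter of
initial degree. -/
theorem mergesOnes_iff_schurExactR (hA : (algSystem h.gradedMul).MergesOnes) :
    (modSystem h).MergesOnes ↔
      ∀ α β : List ℕ, Pos α → IsComp β → SchurExactR 𝒜 act ℳ t α β := by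
  have hA' := modSystem_alg_mergesOnes h hA
  constructor
  · intro hS α β hα hβ
    obtain ⟨c, τ, rfl, hc, hτ⟩ := hβ.exists_cons
    have key := fun σ b (hb : 0 < b) (hσ : Pos σ) => hS.concatExact (f := LinearMap.id)
      (g := LinearMap.inl R A M) (X := (modSystem h).rib (σ ++ [b])) (Y := schur 𝒜 (c :: τ)) hA'
      wordMap_id_injective wordMap_inl_injective (map_wordMap_id _) (map_inl_schur h _) hσ hb hc hτ
    cases α using List.reverseRecOn with
    | nil =>
      have := key [] 1 one_pos (List.forall_mem_nil _)
      simp only [List.nil_append, List.cons_append, add_comm 1 c] at this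
      rw [← schurR_eq_zero, ← schurR_eq_zero, ← schurR_eq] at this
      exact this
    | append_singleton σ b =>
      have := key (1 :: σ) b (hα b (by simp))
        (by simpa [Pos] using fun x hx => hα x (by simp [hx]))
      simp only [List.cons_append] at this
      rw [← schurR_eq_zero, ← schurR_eq_zero, ← schurR_eq_zero, ← nearConcat_snoc_cons] at this
      unfold SchurExactR
      rw [List.length_append]
      cases σ <;> exact this
  · intro hE
    refine .of_initial hA' fun c n hc => ?_
    have := (hE [] (c :: List.replicate n 1) (List.forall_mem_nil _)
      (isComp_cons hc (RightSystem.pos_replicate n))).le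
    simp only [List.headD_cons, List.tail_cons] at this
    rw [map_wordMap_id, map_inl_schur h, schurR_eq h, schurR_eq_zero h] at this
    unfold RightSystem.Merges
    rw [List.nil_append, add_comm]
    exact this

/-- For a module generated in its initial degree the sequences with `α` empty are not needed. -/
theorem mergesOnes_of_schurExactR (hA : (algSystem h.gradedMul).MergesOnes)
    (hgen : IsGeneratedBy act (ℳ t))
    (hE : ∀ α β : List ℕ, IsComp α → IsComp β → SchurExactR 𝒜 act ℳ t α β) :
    (modSystem h).MergesOnes := by
  refine .of_generated (modSystem_alg_mergesOnes h hA)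
    (fun c hc => merges_of_isGeneratedBy h hgen hc) fun b c τ hb hc hτ => ?_
  have := (hE [b] (c :: τ) (isComp_cons hb (List.forall_mem_nil _)) (isComp_cons hc hτ)).le
  have e : nearConcat [b] (c :: τ) = (b + c) :: τ := nearConcat_snoc_cons [] τ b c
  dsimp only at this
  rw [e, map_wordMap_id, map_inl_schur h, schurR_eq_zero h, schurR_eq_zero h] at this
  exact this

end RightModule

section LeftModule

variable {R : Type*} [CommRing R] {A : Type*} [Ring A] [Algebra R A] {𝒜 : ℕ → Submodule R A}
  {M : Type*} [AddCommGroup M] [Module R M]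
  {act : A →ₗ[R] M →ₗ[R] M} {ℳ : ℤ → Submodule R M} {t : ℤ}
  (h : IsGradedAct 𝒜 (LinearMap.mul R A).flip act ℳ t (mulL act).flip)

theorem schurL_eq (α : List ℕ) (a : ℕ) : schurL 𝒜 act α (ℳ (t + a)) =
    ((modSystem h).rib ((a + 1) :: α.reverse)).map (rev R (A × M)) := by
  unfold schurL RightSystem.rib
  rw [modSystem_lets, letters_reverse]
  refine Eq.trans ?_ (map_rev_ribbon (mulL act) _).symm
  simp

theorem schurL_eq_zero (α : List ℕ) : schurL 𝒜 act α (ℳ t) =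
    ((modSystem h).rib (1 :: α.reverse)).map (rev R (A × M)) := by
  rw [← schurL_eq]; simp

theorem isKoszulL_iff (hA : (algSystem h.gradedMul).MergesOnes) :
    IsKoszulL 𝒜 act ℳ t ↔ (modSystem h).MergesOnes := by
  rw [← RightSystem.koszul_iff (modSystem_alg_mergesOnes h hA), koszul_iff_barPieceR]
  have hs : ∀ k (x y : TensorAlgebra R (A × M)), (-1 : R) ^ k • x = y ↔ x = (-1 : R) ^ k • y := by
    intro k x y
    constructor <;> rintro rfl <;>
      rw [smul_smul, ← pow_add, Even.neg_one_pow ⟨k, rfl⟩, one_smul]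
  refine forall_congr' fun i => forall_congr' fun n => forall_congr' fun _ => ?_
  rw [barPieceL_eq, barPieceL_eq]
  constructor
  · intro H x hx hx0
    obtain ⟨_, ⟨y, hy, rfl⟩, hyx⟩ := H _ ⟨x, hx, rfl⟩ (by
      rw [barDiff_rev _ (barPieceR_le_degPart _ _ hx), hx0, map_zero, smul_zero])
    rw [barDiff_rev _ (barPieceR_le_degPart _ _ hy), hs, ← map_smul] at hyx
    refine ⟨(-1 : R) ^ (i + 2) • y, Submodule.smul_mem _ _ hy, ?_⟩
    rw [map_smul, hs]
    exact rev_injective hyx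
  · rintro H _ ⟨x, hx, rfl⟩ hx0
    rw [barDiff_rev _ (barPieceR_le_degPart _ _ hx), hs, smul_zero,
      map_eq_zero_iff _ rev_injective] at hx0
    obtain ⟨y, hy, hyx⟩ := H x hx hx0
    refine ⟨rev R _ ((-1 : R) ^ (i + 2) • y), ⟨_, Submodule.smul_mem _ _ hy, rfl⟩, ?_⟩
    rw [barDiff_rev _ (barPieceR_le_degPart _ _ (Submodule.smul_mem _ _ hy)), hs, map_smul, hyx,
      map_smul]

theorem map_inl_schur_rev (h' : IsGradedMul 𝒜 (LinearMap.mul R A)) (α : List ℕ) :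
    (schur 𝒜 α).map (wordMap (LinearMap.inl R A M)).toLinearMap =
      ((modSystem h).alg.rib α.reverse).map (rev R (A × M)) := by
  have h1 : (schur 𝒜 α.reverse.reverse).map (rev R A) = (algSystem h.gradedMul).rib α.reverse := by
    rw [schur_eq h', ← algSystem_rib_reverse h' h.gradedMul, map_rev_map_rev]
  rw [List.reverse_reverse] at h1
  rw [← map_algSystem_rib h, ← h1, ← Submodule.map_comp, ← Submodule.map_comp]
  congr 1
  ext x
  simp only [LinearMap.comp_apply, AlgHom.toLinearMap_apply]
  induction x using cons_induction with
  | h0 => simp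
  | hadd x y hx hy => rw [map_add, map_add, hx, hy]; simp
  | hsmul r x hx => rw [map_smul, hx]; simp
  | h1 => simp
  | hc e w ih => rw [map_mul, ih]; simp [wordMap_ι]

theorem mergesOnes_iff_schurExactL (h' : IsGradedMul 𝒜 (LinearMap.mul R A))
    (hA : (algSystem h.gradedMul).MergesOnes) : (modSystem h).MergesOnes ↔
      ∀ α β : List ℕ, IsComp α → Pos β → SchurExactL 𝒜 act ℳ t α β := by
  have hA' := modSystem_alg_mergesOnes h hA
  constructor
  · intro hS α β hα hβ
    obtain ⟨τ, c, rfl, hτ, hc⟩ := hα.exists_snoc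
    have key := fun σ b (hb : 0 < b) (hσ : Pos σ) => hS.concatExact_rev (mul := mulL act) rfl
      (τ := τ.reverse) (c := c)
      (f := LinearMap.inl R A M) (g := LinearMap.id) (X := schur 𝒜 (τ ++ [c]))
      (Y := ((modSystem h).rib (σ ++ [b])).map (rev R (A × M))) hA'
      wordMap_inl_injective wordMap_id_injective
      (by rw [map_inl_schur_rev h h']; simp) (map_wordMap_id _) hσ hb hc
      (fun x hx => hτ x (by simpa using hx))
    cases β with
    | nil =>
      have := key [] 1 one_pos (List.forall_mem_nil _)
      simp only [List.nil_append, List.cons_append, add_comm 1 c, List.length_reverse] at this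
      unfold SchurExactL
      rw [schurL_eq_zero h, schurL_eq_zero h]
      simpa [schurL_eq h] using this
    | cons b σ =>
      have := key (1 :: σ.reverse) b (hβ b (by simp))
        (by simpa [Pos] using fun x hx => hβ x (by simp [hx]))
      unfold SchurExactL
      simp only [nearConcat_snoc_cons]
      rw [schurL_eq_zero h, schurL_eq_zero h, schurL_eq_zero h]
      simpa [add_comm] using this
  · intro hE
    refine .of_initial hA' fun c n hc => ?_
    have := hE (List.replicate n 1 ++ [c]) [] (isComp_snoc hc (RightSystem.pos_replicate n))
      (List.forall_mem_nil _)
    unfold SchurExactL at this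
    simp only at this
    rw [schurL_eq h] at this
    refine RightSystem.merges_of_concatExact_rev (mul := mulL act) rfl (f := LinearMap.inl R A M)
      (g := LinearMap.id) (X := schur 𝒜 (List.replicate n 1 ++ [c])) (Y := schurL 𝒜 act [] (ℳ t))
      ?_ ?_ (C := schurL 𝒜 act (List.replicate n 1 ++ [c] ++ []) (ℳ t)) ?_
    · rw [map_inl_schur_rev h h']; simp
    · rw [map_wordMap_id, schurL_eq_zero h]; simp
    · simpa [add_comm] using this

theorem mergesOnes_of_schurExactL (h' : IsGradedMul 𝒜 (LinearMap.mul R A))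
    (hA : (algSystem h.gradedMul).MergesOnes) (hgen : IsGeneratedBy act (ℳ t))
    (hE : ∀ α β : List ℕ, IsComp α → IsComp β → SchurExactL 𝒜 act ℳ t α β) :
    (modSystem h).MergesOnes := by
  refine .of_generated (modSystem_alg_mergesOnes h hA)
    (fun c hc => merges_of_isGeneratedBy h hgen hc) fun b c τ hb hc hτ => ?_
  have := hE (τ.reverse ++ [c]) [b] (isComp_snoc hc fun x hx => hτ x (by simpa using hx))
    (isComp_cons hb (List.forall_mem_nil _))
  unfold SchurExactL at this
  change ConcatExact _ _ _ _ _ _ _ (schurL 𝒜 act (nearConcat (τ.reverse ++ [c]) (b :: [])) (ℳ t))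
    at this
  rw [nearConcat_snoc_cons, schurL_eq_zero h (τ.reverse ++ _)] at this
  refine RightSystem.merges_of_concatExact_rev (mul := mulL act) rfl (f := LinearMap.inl R A M)
    (g := LinearMap.id) (X := schur 𝒜 (τ.reverse ++ [c])) (Y := schurL 𝒜 act [b] (ℳ t))
    ?_ ?_ (C := schurL 𝒜 act (τ.reverse ++ [c] ++ [b]) (ℳ t)) ?_
  · rw [map_inl_schur_rev h h']; simp
  · rw [map_wordMap_id, schurL_eq_zero h]; simp
  · simpa [add_comm] using this

end LeftModule

/-! ### Multiplication of blocks -/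

section BlockMul

variable {R : Type*} [CommRing R] {E : Type*} [AddCommGroup E] [Module R E]
  {mul : E →ₗ[R] E →ₗ[R] E}

theorem blockMul_append (p : ℕ) (s t : List ℕ) :
    blockMul mul p (s ++ t) = blockMul mul (p + s.length) t * blockMul mul p s := by
  induction s generalizing p with
  | nil => simp [blockMul]
  | cons a s ih =>
    rw [List.cons_append, blockMul, ih, blockMul, mul_assoc, List.length_cons,
      show p + 1 + s.length = p + (s.length + 1) by omega]

theorem blockMul_singleton (p a : ℕ) : blockMul mul p [a] = glue mul p ^ (a - 1) := by
  simp [blockMul]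

theorem blockMul_ones (p k : ℕ) : blockMul mul p (List.replicate k 1) = 1 := by
  induction k generalizing p with
  | zero => rfl
  | succ k ih => rw [List.replicate_succ, blockMul, ih]; simp

/-- Attaching a column to a ribbon whose last row has length `b`. -/
theorem blockMul_snoc_succ (σ : List ℕ) {b : ℕ} (hb : 0 < b) (k : ℕ) :
    blockMul mul 0 (σ ++ (b + 1) :: List.replicate k 1) =
      glue mul σ.length * blockMul mul 0 (σ ++ [b]) := by
  obtain ⟨b, rfl⟩ : ∃ j, b = j + 1 := ⟨b - 1, by omega⟩
  rw [blockMul_append, blockMul_append, blockMul_singleton, blockMul, blockMul_ones, one_mul,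
    Nat.add_sub_cancel, Nat.add_sub_cancel, zero_add, pow_succ', mul_assoc]

theorem blockMul_succ_cons (p : ℕ) (s : List ℕ) (e : E) (w : TensorAlgebra R E) :
    blockMul mul (p + 1) s (TensorAlgebra.ι R e * w) =
      TensorAlgebra.ι R e * blockMul mul p s w := by
  induction s generalizing p w with
  | nil => rfl
  | cons a s ih =>
    have : ∀ k w, (glue mul (p + 1) ^ k) (TensorAlgebra.ι R e * w) =
        TensorAlgebra.ι R e * (glue mul p ^ k) w := by
      intro k
      induction k with
      | zero => intro w; rfl
      | succ k ih =>
        intro w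
        rw [pow_succ, pow_succ, Module.End.mul_apply, Module.End.mul_apply, glue_succ_cons, ih]
    rw [blockMul, blockMul, Module.End.mul_apply, Module.End.mul_apply, this, ih]

/-- Multiplying the letters of a first block. -/
theorem exists_blockMul_cons {d : ℕ} (hd : 0 < d) {u : TensorAlgebra R E}
    (hu : u ∈ degPart R E d) : ∃ e, blockMul mul 0 [d] u = TensorAlgebra.ι R e ∧
      ∀ q w, blockMul mul 0 (d :: q) (u * w) = TensorAlgebra.ι R e * blockMul mul 0 q w := by
  obtain ⟨d, rfl⟩ : ∃ j, d = j + 1 := ⟨d - 1, by omega⟩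
  have key : ∃ e, ∀ w, (glue mul 0 ^ d) (u * w) = TensorAlgebra.ι R e * w := by
    clear hd
    induction d generalizing u with
    | zero =>
      rw [zero_add, degPart, pow_one] at hu
      obtain ⟨e, rfl⟩ := hu
      exact ⟨e, fun w => rfl⟩
    | succ d ih =>
      obtain ⟨e, he⟩ := ih (glue_mem_degPart mul hu 0)
      refine ⟨e, fun w => ?_⟩
      rw [pow_succ, Module.End.mul_apply, glue_mul_left mul (by omega) hu, he]
  obtain ⟨e, he⟩ := key
  refine ⟨e, ?_, fun q w => ?_⟩
  · have := he 1
    rwa [mul_one, mul_one] at this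
  · rw [blockMul, Module.End.mul_apply, Nat.add_sub_cancel, he, blockMul_succ_cons]

theorem blockMul_mul_left {s : List ℕ} (hs : Pos s) {u : TensorAlgebra R E}
    (hu : u ∈ degPart R E s.sum) (w : TensorAlgebra R E) :
    blockMul mul 0 s (u * w) = blockMul mul 0 s u * w := by
  induction s generalizing u with
  | nil => rfl
  | cons a s ih =>
    have hu' : u ∈ degPart R E a * degPart R E s.sum := by
      rw [← pow_add]; rwa [List.sum_cons] at hu
    refine Submodule.mul_induction_on hu' (fun x hx y hy => ?_) fun x y hx hy => by
      rw [add_mul, map_add, map_add, add_mul, hx, hy]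
    obtain ⟨e, -, he⟩ := exists_blockMul_cons (mul := mul) (hs a (by simp)) hx
    rw [mul_assoc, he, he, ih (fun x hx => hs x (by simp [hx])) hy, mul_assoc]

theorem blockMul_snoc_succ_succ (s : List ℕ) (d : ℕ) :
    blockMul mul 0 (s ++ [d + 2]) = glue mul s.length * blockMul mul 0 (s ++ [d + 1]) := by
  simpa using blockMul_snoc_succ s (Nat.succ_pos d) 0

section Assoc

variable (assoc : ∀ x y z, mul (mul x y) z = mul x (mul y z))
include assoc

theorem glue_mul_glue {p q : ℕ} (h : p ≤ q) :
    glue mul p * glue mul (q + 1) = glue mul q * glue mul p :=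
  LinearMap.ext fun w => glue_glue mul assoc h w

theorem glue_mul_glue_pow {p q : ℕ} (h : p ≤ q) (k : ℕ) :
    glue mul p * glue mul (q + 1) ^ k = glue mul q ^ k * glue mul p := by
  induction k with
  | zero => simp
  | succ k ih => rw [pow_succ, pow_succ, ← mul_assoc, ih, mul_assoc,
      glue_mul_glue assoc h, mul_assoc]

theorem glue_mul_blockMul {p q : ℕ} (h : p ≤ q) (s : List ℕ) :
    glue mul p * blockMul mul (q + 1) s = blockMul mul q s * glue mul p := by
  induction s generalizing q with
  | nil => simp [blockMul]
  | cons a s ih =>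
    rw [blockMul, blockMul, ← mul_assoc, ih (by omega), mul_assoc, glue_mul_glue_pow assoc h,
      mul_assoc]

/-- Multiplying across the boundary of two blocks merges them. -/
theorem glue_mul_blockMul_merge (p q : List ℕ) {x y : ℕ} (hx : 0 < x) (hy : 0 < y) :
    glue mul p.length * blockMul mul 0 (p ++ x :: y :: q) =
      blockMul mul 0 (p ++ (x + y) :: q) := by
  obtain ⟨x, rfl⟩ : ∃ j, x = j + 1 := ⟨x - 1, by omega⟩
  obtain ⟨y, rfl⟩ : ∃ j, y = j + 1 := ⟨y - 1, by omega⟩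
  rw [blockMul_append, blockMul_append, zero_add, ← mul_assoc]
  congr 1
  rw [blockMul, blockMul, blockMul, ← mul_assoc, ← mul_assoc,
    glue_mul_blockMul assoc (by omega), mul_assoc (blockMul _ _ _), Nat.add_sub_cancel,
    glue_mul_glue_pow assoc le_rfl, Nat.add_sub_cancel, mul_assoc, mul_assoc, ← pow_succ',
    ← pow_add]
  congr 2
  omega

theorem glue_pow_mul_glue (p j k : ℕ) :
    glue mul p ^ k * glue mul (p + k + j) = glue mul (p + j) * glue mul p ^ k := by
  induction k generalizing j with
  | zero => simp
  | succ k ih =>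
    rw [pow_succ', mul_assoc, show p + (k + 1) + j = p + k + (j + 1) by omega, ih, ← mul_assoc,
      ← add_assoc, glue_mul_glue assoc (by omega), mul_assoc]

theorem blockMul_mul_glue {s : List ℕ} (hs : Pos s) (p k : ℕ) :
    blockMul mul p s * glue mul (p + s.sum + k) =
      glue mul (p + s.length + k) * blockMul mul p s := by
  induction s generalizing p k with
  | nil => simp [blockMul]
  | cons a s ih =>
    obtain ⟨a, rfl⟩ : ∃ j, a = j + 1 := ⟨a - 1, by have := hs a (by simp); omega⟩
    rw [blockMul, Nat.add_sub_cancel, mul_assoc, List.sum_cons, List.length_cons,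
      show p + (a + 1 + s.sum) + k = p + a + (1 + s.sum + k) by omega, glue_pow_mul_glue assoc,
      ← mul_assoc, show p + (1 + s.sum + k) = p + 1 + s.sum + k by omega,
      ih (fun x hx => hs x (by simp [hx])), mul_assoc,
      show p + 1 + s.length + k = p + (s.length + 1) + k by omega]

/-- A block may be multiplied starting with its last two letters. -/
theorem blockMul_snoc_mul_glue {s : List ℕ} (hs : Pos s) (d : ℕ) :
    blockMul mul 0 (s ++ [d + 2]) = blockMul mul 0 (s ++ [d + 1]) * glue mul (s.sum + d) := by
  have h1 := glue_pow_mul_glue assoc s.length 0 d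
  have h2 := blockMul_mul_glue assoc hs 0 d
  simp only [zero_add, add_zero] at h1 h2
  rw [blockMul_append, blockMul_append, blockMul_singleton, blockMul_singleton, mul_assoc, zero_add,
    h2, ← mul_assoc]
  simp only [Nat.add_sub_cancel, show d + 2 - 1 = d + 1 by omega]
  rw [h1, ← pow_succ']

end Assoc

end BlockMul

/-! ### Ribbons as quotients of products of columns -/

/-- `c` lists the columns, from left to right, of the ribbon with rows `ρ`.  The ribbons are built
by attaching columns: the first box of the new column extends the last row. -/
inductive IsConjugate : List ℕ → List ℕ → Prop
  | column (d : ℕ) : IsConjugate (List.replicate (d + 1) 1) [d + 1]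
  | snoc {σ c : List ℕ} {b : ℕ} (d : ℕ) (h : IsConjugate (σ ++ [b]) c) :
    IsConjugate (σ ++ (b + 1) :: List.replicate d 1) (c ++ [d + 1])

namespace IsConjugate

variable {ρ c : List ℕ}

theorem pos_left (h : IsConjugate ρ c) : Pos ρ := by
  induction h with
  | column d => exact RightSystem.pos_replicate _
  | snoc d h ih =>
    intro x hx
    simp only [List.mem_append, List.mem_cons, List.mem_replicate] at hx
    rcases hx with hx | hx | hx
    · exact ih x (by simp [hx])
    · omega
    · omega

theorem pos_right (h : IsConjugate ρ c) : Pos c := by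
  induction h with
  | column d => simp [Pos]
  | snoc d h ih => exact pos_snoc ih (by omega)

theorem ne_nil_left (h : IsConjugate ρ c) : ρ ≠ [] := by cases h <;> simp

theorem ne_nil_right (h : IsConjugate ρ c) : c ≠ [] := by cases h <;> simp

theorem sum_eq (h : IsConjugate ρ c) : ρ.sum = c.sum := by
  induction h with
  | column d => simp
  | snoc d h ih =>
    simp only [List.sum_append, List.sum_cons, List.sum_nil, List.sum_replicate] at ih ⊢
    simp
    omega

/-- Making the last column longer. -/
theorem extend (h : IsConjugate ρ c) : ∀ {p : List ℕ} {e : ℕ}, c = p ++ [e] → ∀ k,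
    IsConjugate (ρ ++ List.replicate k 1) (p ++ [e + k]) := by
  cases h with
  | column d =>
    intro p e hc k
    obtain ⟨rfl, h⟩ := List.append_inj' (t₁ := [d + 1]) (s₁ := []) hc rfl
    obtain rfl : d + 1 = e := by simpa using h
    rw [← List.replicate_add, show d + 1 + k = d + k + 1 by omega]
    exact .column _
  | snoc d h =>
    intro p e hc k
    obtain ⟨rfl, h'⟩ := List.append_inj' hc rfl
    obtain rfl : d + 1 = e := by simpa using h'
    rw [List.append_assoc, List.cons_append, ← List.replicate_add,
      show d + 1 + k = d + k + 1 by omega]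
    exact .snoc _ h

end IsConjugate

theorem map_mul_eq_map_mul {R A : Type*} [CommRing R] [Ring A] [Algebra R A]
    {X Y : Submodule R A} {D : Module.End R A} (h : ∀ u ∈ X, ∀ w ∈ Y, D (u * w) = D u * w) :
    (X * Y).map D = X.map D * Y := by
  apply le_antisymm
  · rw [Submodule.map_le_iff_le_comap]
    refine Submodule.mul_le.mpr fun u hu w hw => ?_
    rw [Submodule.mem_comap, h u hu w hw]
    exact Submodule.mul_mem_mul ⟨u, hu, rfl⟩ hw
  · refine Submodule.mul_le.mpr ?_
    rintro _ ⟨u, hu, rfl⟩ w hw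
    exact ⟨u * w, Submodule.mul_mem_mul hu hw, h u hu w hw⟩

namespace RightSystem

variable {R : Type*} [CommRing R] {E : Type*} [AddCommGroup E] [Module R E]
  (S : RightSystem R E)

/-- The ribbon module of a column of `d` boxes. -/
abbrev col (d : ℕ) : Submodule R (TensorAlgebra R E) := S.rib (List.replicate d 1)

/-- The product of the ribbon modules of the columns listed in `c`. -/
def cols : List ℕ → Submodule R (TensorAlgebra R E)
  | [] => 1
  | d :: c => S.col d * (c.map S.alg.col).prod

theorem alg_cols (c : List ℕ) : S.alg.cols c = (c.map S.alg.col).prod := by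
  cases c <;> simp [cols]

theorem cols_append {c : List ℕ} (h : c ≠ []) (q : List ℕ) :
    S.cols (c ++ q) = S.cols c * S.alg.cols q := by
  cases c with
  | nil => exact absurd rfl h
  | cons d c => rw [alg_cols, List.cons_append, cols, cols, List.map_append,
      List.prod_append, mul_assoc]

@[simp] theorem cols_singleton (d : ℕ) : S.cols [d] = S.col d := by simp [cols]

theorem cols_snoc {c : List ℕ} (h : c ≠ []) (d : ℕ) :
    S.cols (c ++ [d]) = S.cols c * S.alg.col d := by
  rw [cols_append S h, cols_singleton]

theorem cols_cons (d : ℕ) (c : List ℕ) : S.cols (d :: c) = S.col d * S.alg.cols c := by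
  rw [alg_cols]; rfl

theorem words_ones_append {k : ℕ} (hk : 0 < k) (l : ℕ) :
    words (S.lets (List.replicate (k + l) 1)) =
      words (S.lets (List.replicate k 1)) * words (S.alg.lets (List.replicate l 1)) := by
  rw [List.replicate_add, words_lets_append]
  simpa using hk.ne'

theorem cols_le_words {c : List ℕ} (hc : Pos c) :
    S.cols c ≤ words (S.lets (List.replicate c.sum 1)) := by
  induction c using List.reverseRecOn with
  | nil => simp [cols, lets]
  | append_singleton c d ih =>
    by_cases h : c = []
    · subst h
      rw [List.nil_append, cols_singleton, List.sum_singleton]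
      exact ribbon_le_words _ _
    · have hc' : Pos c := fun x hx => hc x (by simp [hx])
      rw [cols_snoc S h, List.sum_append, List.sum_singleton, words_ones_append]
      · exact mul_le_mul' (ih hc') (ribbon_le_words _ _)
      · exact List.sum_pos _ hc' h

theorem cols_le_degPart {c : List ℕ} (hc : Pos c) : S.cols c ≤ degPart R E c.sum := by
  have := S.words_le_degPart (List.replicate c.sum 1)
  rw [List.length_replicate] at this
  exact (S.cols_le_words hc).trans this

/-- The sum of the modules `S.cols c'` over all `c'` obtained from `c` by merging two adjacent
columns. -/
def merged (c : List ℕ) : Submodule R (TensorAlgebra R E) :=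
  ⨆ (p : List ℕ) (x : ℕ) (y : ℕ) (q : List ℕ) (_ : c = p ++ x :: y :: q),
    S.cols (p ++ (x + y) :: q)

theorem cols_le_merged (p q : List ℕ) (x y : ℕ) :
    S.cols (p ++ (x + y) :: q) ≤ S.merged (p ++ x :: y :: q) :=
  le_iSup_of_le p (le_iSup_of_le x (le_iSup_of_le y (le_iSup_of_le q (le_iSup_of_le rfl le_rfl))))

theorem merged_le {c : List ℕ} {K : Submodule R (TensorAlgebra R E)}
    (h : ∀ p x y q, c = p ++ x :: y :: q → S.cols (p ++ (x + y) :: q) ≤ K) : S.merged c ≤ K :=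
  iSup_le fun p => iSup_le fun x => iSup_le fun y => iSup_le fun q => iSup_le fun hc =>
    h p x y q hc

variable {S} {ρ c : List ℕ} (hS : S.MergesOnes) (hA : S.alg.MergesOnes)
include hA

theorem flat_cols_alg : Module.Flat R (S.alg.cols c) := by
  have := S.flat
  rw [alg_cols]
  induction c with
  | nil => exact flat_one
  | cons d c ih =>
    have := hA.flat_rib S.alg hA (pos_replicate d)
    rw [List.map_cons, List.prod_cons]
    exact flat_mul (S.alg.rib_le_degPart _)

include hS

theorem flat_cols : Module.Flat R (S.cols c) := by
  have := S.flat
  cases c with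
  | nil => exact flat_one
  | cons d c =>
    have := hS.flat_rib S hA (pos_replicate d)
    have := flat_cols_alg (c := c) hA
    rw [cols_cons]
    exact flat_mul (S.rib_le_degPart _)

theorem col_add_le {d e : ℕ} (hd : 0 < d) : S.col (d + e) ≤ S.col d * S.alg.col e := by
  have := hS.flat_rib S hA (pos_replicate d)
  have h := S.rib_append_le (ρ := List.replicate d 1) (β := List.replicate e 1)
    (by simpa using hd.ne') (pos_replicate e)
  rwa [← List.replicate_add] at h

theorem cols_merge_le {p q : List ℕ} {x y : ℕ} (hx : 0 < x) :
    S.cols (p ++ (x + y) :: q) ≤ S.cols (p ++ x :: y :: q) := by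
  by_cases h : p = []
  · subst h
    simp only [List.nil_append]
    rw [cols_cons, cols_cons, cols_cons, ← mul_assoc]
    exact mul_le_mul' (col_add_le hS hA hx) le_rfl
  · rw [cols_append S h, cols_append S h, cols_cons, cols_cons, cols_cons,
      ← mul_assoc (S.alg.col x)]
    exact mul_le_mul' le_rfl (mul_le_mul' (col_add_le (S := S.alg) hA hA hx) le_rfl)

/-- Multiplying the rows maps the product of the columns onto the ribbon module. -/
theorem map_blockMul_cols (h : IsConjugate ρ c) :
    (S.cols c).map (blockMul S.mul 0 ρ) = S.rib ρ := by
  induction h with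
  | column d => rw [blockMul_ones, cols_singleton]; exact Submodule.map_id _
  | @snoc σ c b d h ih =>
    have hσ : Pos σ := fun x hx => h.pos_left x (by simp [hx])
    have hb : 0 < b := h.pos_left b (by simp)
    rw [blockMul_snoc_succ σ hb, cols_snoc S h.ne_nil_right, Module.End.mul_eq_comp,
      Submodule.map_comp, map_mul_eq_map_mul, ih]
    · exact (hS.merges S hA hσ hb one_pos (pos_replicate d)).map_eq hσ hb one_pos
    · intro u hu w _
      refine blockMul_mul_left h.pos_left ?_ w
      rw [h.sum_eq]
      exact S.cols_le_degPart h.pos_right hu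

/-- Products with two columns merged are killed by the multiplication of rows: if the last two
columns are merged, multiplying the rows before the last column yields an element of a ribbon
module, and this is killed by the multiplication that remains. -/
theorem merged_le_ker (h : IsConjugate ρ c) :
    S.merged c ≤ LinearMap.ker (blockMul S.mul 0 ρ) := by
  induction h with
  | column d =>
    refine S.merged_le fun p x y q hc => ?_
    have := congrArg List.length hc
    simp at this
    omega
  | @snoc σ c b d h ih =>
    have hb : 0 < b := h.pos_left b (by simp)
    refine S.merged_le fun p x y q hc w hw => ?_
    rw [LinearMap.mem_ker, blockMul_snoc_succ σ hb, Module.End.mul_apply]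
    induction q using List.reverseRecOn with
    | nil =>
      have hc' : c ++ [d + 1] = (p ++ [x]) ++ [y] := by rw [hc, List.append_assoc]; rfl
      obtain ⟨rfl, hy⟩ := List.append_inj' hc' rfl
      obtain rfl : d + 1 = y := by simpa using hy
      have h2 := h.extend rfl (d + 1)
      have h3 : blockMul S.mul 0 (σ ++ [b] ++ List.replicate (d + 1) 1) w ∈
          S.rib (σ ++ [b] ++ List.replicate (d + 1) 1) := by
        rw [← map_blockMul_cols hS hA h2]; exact ⟨w, hw, rfl⟩
      rw [blockMul_append, blockMul_ones, one_mul] at h3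
      exact (S.mem_rib.mp h3).2 _
    | append_singleton q z _ =>
      have hc' : c ++ [d + 1] = (p ++ x :: y :: q) ++ [z] := by rw [hc]; simp
      obtain ⟨rfl, -⟩ := List.append_inj' hc' rfl
      rw [← List.cons_append, ← List.append_assoc, cols_snoc S (by simp)] at hw
      have h2 : blockMul S.mul 0 (σ ++ [b]) w = 0 := by
        refine Submodule.mul_induction_on hw (fun u hu v _ => ?_) fun x y hx hy => by
          rw [map_add, hx, hy, add_zero]
        have hu' := S.cols_le_merged p q x y hu
        rw [blockMul_mul_left h.pos_left, LinearMap.mem_ker.mp (ih hu'), zero_mul]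
        rw [h.sum_eq]
        have hp := h.pos_right
        exact S.cols_le_degPart hp (cols_merge_le hS hA (hp x (by simp)) hu)
      rw [h2, map_zero]

/-- The kernel of the multiplication of rows is generated by the products with two columns
merged. -/
theorem cols_inf_ker_le (h : IsConjugate ρ c) :
    S.cols c ⊓ LinearMap.ker (blockMul S.mul 0 ρ) ≤ S.merged c := by
  have := S.flat
  induction h with
  | column d =>
    rintro w ⟨-, hw⟩
    rw [SetLike.mem_coe, LinearMap.mem_ker, blockMul_ones] at hw
    obtain rfl : w = 0 := hw
    exact zero_mem _
  | @snoc σ c b d h ih =>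
    have hσ : Pos σ := fun x hx => h.pos_left x (by simp [hx])
    have hb : 0 < b := h.pos_left b (by simp)
    have hd : ∀ u ∈ S.cols c, ∀ w : TensorAlgebra R E, blockMul S.mul 0 (σ ++ [b]) (u * w) =
        blockMul S.mul 0 (σ ++ [b]) u * w := fun u hu w =>
      blockMul_mul_left h.pos_left (by rw [h.sum_eq]; exact S.cols_le_degPart h.pos_right hu) w
    obtain ⟨p, e, rfl, -, he⟩ := IsComp.exists_snoc ⟨h.ne_nil_right, h.pos_right⟩
    have h2 := h.extend rfl (d + 1)
    have hfl := hA.flat_rib S.alg hA (pos_replicate (d + 1))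
    have hfr := hS.flat_rib S hA h.pos_left
    rintro z ⟨hz, hz0⟩
    rw [SetLike.mem_coe, cols_snoc S h.ne_nil_right] at hz
    rw [SetLike.mem_coe, LinearMap.mem_ker, blockMul_snoc_succ σ hb, Module.End.mul_apply] at hz0
    have hz1 : blockMul S.mul 0 (σ ++ [b]) z ∈ S.rib (σ ++ [b]) * S.alg.col (d + 1) := by
      rw [← map_blockMul_cols hS hA h, ← map_mul_eq_map_mul fun u hu w _ => hd u hu w]
      exact ⟨z, hz, rfl⟩
    have hz2 : blockMul S.mul 0 (σ ++ [b]) z ∈ S.rib (σ ++ [b] ++ List.replicate (d + 1) 1) := by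
      rw [S.rib_append (by simp) (pos_replicate _) (p := σ.length) (by simp)]
      exact ⟨hz1, hz0⟩
    rw [← map_blockMul_cols hS hA h2, blockMul_append, blockMul_ones, one_mul] at hz2
    -- `w` lies in the product with the last two columns merged and agrees with `z` on the rows
    -- before the last column.
    obtain ⟨w, hw, hwz⟩ := hz2
    have hw' : w ∈ S.cols (p ++ [e]) * S.alg.col (d + 1) := by
      rw [← cols_snoc S (by simp), List.append_assoc]
      exact cols_merge_le hS hA he hw
    have h3 : z - w ∈ (S.cols (p ++ [e]) ⊓ LinearMap.ker (blockMul S.mul 0 (σ ++ [b]))) *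
        S.alg.col (d + 1) := by
      refine mem_inf_ker_mul (k' := (σ ++ [b]).length) ?_ (fun u hu w _ => hd u hu w)
        (sub_mem hz hw') (by rw [map_sub, hwz, sub_self])
      intro x hx
      refine S.rib_le_degPart (σ ++ [b]) ?_
      rw [← map_blockMul_cols hS hA h]; exact ⟨x, hx, rfl⟩
    have h4 : z - w ∈ S.merged (p ++ [e] ++ [d + 1]) := by
      have h5 := mem_mul_of_le ih le_rfl h3
      refine Submodule.mul_induction_on h5 (fun u hu v hv => ?_) fun x y hx hy => add_mem hx hy
      have : S.merged (p ++ [e]) ≤ (S.merged (p ++ [e] ++ [d + 1])).comap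
          (LinearMap.mulRight R v) := by
        refine S.merged_le fun p' x y q hc u hu => ?_
        rw [hc]
        have := S.cols_le_merged p' (q ++ [d + 1]) x y
        simp only [← List.cons_append, ← List.append_assoc] at this
        refine this ?_
        rw [cols_snoc S (by simp)]
        exact Submodule.mul_mem_mul hu hv
      exact this hu
    have h5 : w ∈ S.merged (p ++ [e] ++ [d + 1]) := by
      rw [List.append_assoc]
      exact S.cols_le_merged p [] e (d + 1) hw
    have := add_mem h4 h5
    rwa [sub_add_cancel] at this

end RightSystem

theorem isBoundary_ones {d p : ℕ} (hp : p < d) : IsBoundary (List.replicate (d + 1) 1) p :=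
  ⟨p + 1, by omega, by simp; omega, by simp [List.take_replicate]; omega⟩

theorem IsBoundary.snoc {σ : List ℕ} {b p : ℕ} (h : IsBoundary (σ ++ [b]) p) (τ : List ℕ) :
    IsBoundary (σ ++ (b + 1) :: τ) p := by
  obtain ⟨i, h0, hi, hp⟩ := h
  simp only [List.length_append, List.length_singleton] at hi
  refine ⟨i, h0, by simp; omega, ?_⟩
  rw [hp, List.take_append_of_le_length (by omega), List.take_append_of_le_length (by omega)]

theorem isBoundary_snoc_add (σ : List ℕ) (b : ℕ) {j d : ℕ} (hj : j < d) :
    IsBoundary (σ ++ (b + 1) :: List.replicate d 1) ((σ ++ [b]).sum + j) := by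
  refine ⟨σ.length + (j + 1), by omega, by simp; omega, ?_⟩
  rw [List.take_length_add_append, List.take_succ_cons, List.take_replicate]
  simp
  omega

namespace RightSystem

variable {R : Type*} [CommRing R] {E : Type*} [AddCommGroup E] [Module R E]
  {S : RightSystem R E} {ρ c : List ℕ}

/-- The version of `mem_cols_of_boundary` with a flat factor on the right, as required by the
induction on the number of columns. -/
theorem mem_cols_mul_of_boundary (hA : S.alg.MergesOnes) (h : IsConjugate ρ c)
    {Y : Submodule R (TensorAlgebra R E)} [Module.Flat R Y] {x : TensorAlgebra R E}
    (hx : x ∈ words (S.lets (List.replicate c.sum 1)) * Y)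
    (h0 : ∀ p, IsBoundary ρ p → glue S.mul p x = 0) : x ∈ S.cols c * Y := by
  have := S.flat
  induction h generalizing Y x with
  | column d =>
    rw [List.sum_singleton] at hx
    have h1 := mem_inf_ker_glue_mul S.mul (S.words_le_degPart _) hx d (by simp)
      fun p hp => h0 p (isBoundary_ones hp)
    rw [cols_singleton]
    refine mem_mul_of_le (le_of_eq ?_) le_rfl h1
    unfold col rib
    rw [ribbon_eq]
    simp
  | @snoc σ c b d h ih =>
    have hfl := hA.flat_rib S.alg hA (pos_replicate (d + 1))
    have : Module.Flat R ↥(S.alg.col (d + 1) * Y) := flat_mul (S.alg.rib_le_degPart _)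
    have : Module.Flat R ↥(words (S.lets (List.replicate c.sum 1))) :=
      S.flat_words_lets (pos_replicate _)
    rw [cols_snoc S h.ne_nil_right, mul_assoc]
    refine ih ?_ fun p hp => h0 p (hp.snoc _)
    rw [List.sum_append, List.sum_singleton, words_ones_append S (List.sum_pos _ h.pos_right
      h.ne_nil_right), mul_assoc] at hx
    have h1 := mem_mul_inf_ker_glue S.mul (S.words_le_degPart _) hx d fun p hp => by
      rw [List.length_replicate, ← h.sum_eq]
      exact h0 _ (isBoundary_snoc_add σ b hp)
    refine mem_mul_of_le le_rfl ?_ h1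
    rintro y ⟨hy, hy0⟩
    rw [SetLike.mem_coe] at hy hy0
    simp only [Submodule.mem_iInf, LinearMap.mem_ker] at hy0
    have h2 := mem_inf_ker_glue_mul S.mul (S.alg.words_le_degPart _) hy d (by simp) hy0
    refine mem_mul_of_le (le_of_eq ?_) le_rfl h2
    unfold col rib
    rw [ribbon_eq]
    simp

/-- Words of letters of degree one that are killed by all multiplications across two rows lie in
the product of the columns. -/
theorem mem_cols_of_boundary (hA : S.alg.MergesOnes) (h : IsConjugate ρ c)
    {x : TensorAlgebra R E} (hx : x ∈ words (S.lets (List.replicate c.sum 1)))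
    (h0 : ∀ p, IsBoundary ρ p → glue S.mul p x = 0) : x ∈ S.cols c := by
  have := mem_cols_mul_of_boundary hA h (Y := 1) (x := x) (by rwa [mul_one]) h0
  rwa [mul_one] at this

end RightSystem

/-! ### The pairing of words -/

section Pairing

variable {R : Type*} [CommRing R] {E E' : Type*} [AddCommGroup E] [Module R E]
  [AddCommGroup E'] [Module R E']

/-- The functional on `T(E)` applying `η` to the first letter and `Ψ` to the rest of a word. -/
def consFun (η : Module.Dual R E) (Ψ : Module.Dual R (TensorAlgebra R E)) :
    Module.Dual R (TensorAlgebra R E) :=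
  LinearMap.mul' R R ∘ₗ TensorProduct.map η Ψ ∘ₗ uncons R E

@[simp] theorem consFun_one (η : Module.Dual R E) (Ψ : Module.Dual R (TensorAlgebra R E)) :
    consFun η Ψ 1 = 0 := by simp [consFun]

@[simp] theorem consFun_cons (η : Module.Dual R E) (Ψ : Module.Dual R (TensorAlgebra R E)) (e : E)
    (w : TensorAlgebra R E) : consFun η Ψ (TensorAlgebra.ι R e * w) = η e * Ψ w := by
  simp [consFun]

/-- `consFun` as a family of endomorphisms of the dual of `T(E)`. -/
def consFunEnd (b : E' →ₗ[R] Module.Dual R E) :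
    E' →ₗ[R] Module.End R (Module.Dual R (TensorAlgebra R E)) :=
  LinearMap.mk₂ R (fun e' Ψ => consFun (b e') Ψ)
    (fun x y Ψ => by simp [consFun, TensorProduct.map_add_left, LinearMap.add_comp,
      LinearMap.comp_add])
    (fun r x Ψ => by simp [consFun, TensorProduct.map_smul_left, LinearMap.smul_comp,
      LinearMap.comp_smul])
    (fun x Ψ Φ => by simp [consFun, TensorProduct.map_add_right, LinearMap.add_comp,
      LinearMap.comp_add])
    (fun r x Ψ => by simp [consFun, TensorProduct.map_smul_right, LinearMap.smul_comp,
      LinearMap.comp_smul])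

/-- The pairing `⟨f₁ ⋯ fₙ, e₁ ⋯ eₙ⟩ = b(f₁, e₁) ⋯ b(fₙ, eₙ)` of words. -/
def wordPairing (b : E' →ₗ[R] Module.Dual R E) :
    TensorAlgebra R E' →ₗ[R] Module.Dual R (TensorAlgebra R E) :=
  LinearMap.applyₗ (TensorAlgebra.algebraMapInv (R := R) (M := E)).toLinearMap ∘ₗ
    (TensorAlgebra.lift R (consFunEnd b)).toLinearMap

variable {b : E' →ₗ[R] Module.Dual R E}

@[simp] theorem wordPairing_one_one : wordPairing b 1 1 = 1 := by simp [wordPairing]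

theorem wordPairing_cons (e' : E') (f : TensorAlgebra R E') :
    wordPairing b (TensorAlgebra.ι R e' * f) = consFun (b e') (wordPairing b f) := by
  simp only [wordPairing, LinearMap.comp_apply, AlgHom.toLinearMap_apply, map_mul,
    TensorAlgebra.lift_ι_apply]
  rfl

@[simp] theorem wordPairing_cons_cons (e' : E') (f : TensorAlgebra R E') (e : E)
    (w : TensorAlgebra R E) :
    wordPairing b (TensorAlgebra.ι R e' * f) (TensorAlgebra.ι R e * w) =
      b e' e * wordPairing b f w := by
  rw [wordPairing_cons, consFun_cons]

@[simp] theorem wordPairing_ι_ι (e' : E') (e : E) :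
    wordPairing b (TensorAlgebra.ι R e') (TensorAlgebra.ι R e) = b e' e := by
  have := wordPairing_cons_cons (b := b) e' 1 e 1
  simpa using this

theorem wordPairing_mul_mul {k : ℕ} {f : TensorAlgebra R E'} (hf : f ∈ degPart R E' k)
    {u : TensorAlgebra R E} (hu : u ∈ degPart R E k) (g : TensorAlgebra R E')
    (w : TensorAlgebra R E) :
    wordPairing b (f * g) (u * w) = wordPairing b f u * wordPairing b g w := by
  induction k generalizing f u with
  | zero =>
    rw [degPart, pow_zero] at hf hu
    obtain ⟨r, rfl⟩ := Submodule.mem_one.mp hf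
    obtain ⟨s, rfl⟩ := Submodule.mem_one.mp hu
    simp only [Algebra.algebraMap_eq_smul_one, smul_mul_assoc, one_mul, map_smul,
      LinearMap.smul_apply, wordPairing_one_one, smul_eq_mul, mul_one]
    ring
  | succ k ih =>
    induction hf using degPart_induction with
    | hadd x y _ _ hx hy =>
      rw [add_mul, map_add, LinearMap.add_apply, hx, hy, map_add, LinearMap.add_apply, add_mul]
    | hc e' f hf =>
      induction hu using degPart_induction with
      | hadd x y _ _ hx hy => rw [add_mul, map_add, hx, hy, map_add, add_mul]
      | hc e u hu =>
        rw [mul_assoc, mul_assoc, wordPairing_cons_cons, wordPairing_cons_cons, ih hf hu, mul_assoc]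

end Pairing

/-! ### Finite dual bases -/

section DualPair

variable {R : Type*} [CommRing R] {N N' : Type*} [AddCommGroup N] [Module R N]
  [AddCommGroup N'] [Module R N']

/-- The submodules `V'` and `V` have finite dual bases with respect to the pairing `P`.  Thus `V`
is finitely generated projective, and `P` identifies `V'` with its dual. -/
def IsDualPair (P : N' →ₗ[R] Module.Dual R N) (V' : Submodule R N') (V : Submodule R N) : Prop :=
  ∃ (n : ℕ) (u' : Fin n → N') (u : Fin n → N), (∀ j, u' j ∈ V') ∧ (∀ j, u j ∈ V) ∧
    (∀ x ∈ V, x = ∑ j, P (u' j) x • u j) ∧ ∀ f ∈ V', f = ∑ j, P f (u j) • u' j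

variable {P : N' →ₗ[R] Module.Dual R N} {V' : Submodule R N'} {V : Submodule R N}

theorem IsDualPair.eq_zero (h : IsDualPair P V' V) {f : N'} (hf : f ∈ V')
    (h0 : ∀ x ∈ V, P f x = 0) : f = 0 := by
  obtain ⟨n, u', u, -, hu, -, hf'⟩ := h
  rw [hf' f hf]
  exact Finset.sum_eq_zero fun j _ => by rw [h0 _ (hu j), zero_smul]

theorem IsDualPair.exists_eq (h : IsDualPair P V' V) (ψ : Module.Dual R V) :
    ∃ f ∈ V', ∀ x : V, P f x = ψ x := by
  obtain ⟨n, u', u, hu', hu, hx, -⟩ := h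
  refine ⟨∑ j, ψ ⟨u j, hu j⟩ • u' j, sum_mem fun j _ => Submodule.smul_mem _ _ (hu' j),
    fun x => ?_⟩
  have h1 : x = ∑ j, P (u' j) x • (⟨u j, hu j⟩ : V) :=
    Subtype.ext ((hx x x.2).trans (by simp))
  conv_rhs => rw [h1]
  simp only [map_sum, LinearMap.sum_apply, map_smul, LinearMap.smul_apply, smul_eq_mul, mul_comm]

end DualPair

section DualPairWords

variable {R : Type*} [CommRing R] {E E' : Type*} [AddCommGroup E] [Module R E]
  [AddCommGroup E'] [Module R E'] {b : E' →ₗ[R] Module.Dual R E}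
  {V' V₂' : Submodule R (TensorAlgebra R E')} {V V₂ X : Submodule R (TensorAlgebra R E)} {k : ℕ}

theorem IsDualPair.map_ι {W' : Submodule R E'} {W : Submodule R E} (h : IsDualPair b W' W) :
    IsDualPair (wordPairing b) (W'.map (TensorAlgebra.ι R)) (W.map (TensorAlgebra.ι R)) := by
  obtain ⟨n, u', u, hu', hu, hx, hf⟩ := h
  refine ⟨n, fun j => TensorAlgebra.ι R (u' j), fun j => TensorAlgebra.ι R (u j),
    fun j => ⟨_, hu' j, rfl⟩, fun j => ⟨_, hu j, rfl⟩, ?_, ?_⟩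
  · rintro _ ⟨x, hx', rfl⟩
    conv_lhs => rw [hx x hx']
    simp
  · rintro _ ⟨f, hf', rfl⟩
    conv_lhs => rw [hf f hf']
    simp

variable (hk' : V' ≤ degPart R E' k) (hk : V ≤ degPart R E k)
include hk' hk

theorem IsDualPair.mul (h : IsDualPair (wordPairing b) V' V)
    (h₂ : IsDualPair (wordPairing b) V₂' V₂) :
    IsDualPair (wordPairing b) (V' * V₂') (V * V₂) := by
  obtain ⟨n, u', u, hu', hu, hx, hf⟩ := h
  obtain ⟨m, v', v, hv', hv, hy, hg⟩ := h₂
  refine ⟨n * m, fun j => u' (finProdFinEquiv.symm j).1 * v' (finProdFinEquiv.symm j).2,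
    fun j => u (finProdFinEquiv.symm j).1 * v (finProdFinEquiv.symm j).2,
    fun j => Submodule.mul_mem_mul (hu' _) (hv' _), fun j => Submodule.mul_mem_mul (hu _) (hv _),
    fun z hz => ?_, fun z hz => ?_⟩
  · refine Submodule.mul_induction_on hz (fun x hx1 y hy1 => ?_) fun x y h1 h2 => by
      conv_lhs => rw [h1, h2]
      simp only [map_add, add_smul, Finset.sum_add_distrib]
    rw [← finProdFinEquiv.sum_comp]
    simp only [Equiv.symm_apply_apply, Fintype.sum_prod_type]
    conv_lhs => rw [hx x hx1, hy y hy1, Finset.sum_mul_sum]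
    refine Finset.sum_congr rfl fun i _ => Finset.sum_congr rfl fun j _ => ?_
    rw [wordPairing_mul_mul (hk' (hu' i)) (hk hx1), smul_mul_smul_comm]
  · refine Submodule.mul_induction_on hz (fun x hx1 y hy1 => ?_) fun x y h1 h2 => by
      conv_lhs => rw [h1, h2]
      simp only [map_add, LinearMap.add_apply, add_smul, Finset.sum_add_distrib]
    rw [← finProdFinEquiv.sum_comp]
    simp only [Equiv.symm_apply_apply, Fintype.sum_prod_type]
    conv_lhs => rw [hf x hx1, hg y hy1, Finset.sum_mul_sum]
    refine Finset.sum_congr rfl fun i _ => Finset.sum_congr rfl fun j _ => ?_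
    rw [wordPairing_mul_mul (hk' hx1) (hk (hu i)), smul_mul_smul_comm]

/-- A word vanishing on `V * X` is a combination of words whose second part vanishes on `X`. -/
theorem IsDualPair.mem_mul_perp (h : IsDualPair (wordPairing b) V' V)
    (h₂ : IsDualPair (wordPairing b) V₂' V₂) (hX : X ≤ V₂) {f : TensorAlgebra R E'}
    (hf : f ∈ V' * V₂') (h0 : ∀ v ∈ V, ∀ x ∈ X, wordPairing b f (v * x) = 0) :
    ∃ (n : ℕ) (g g₂ : Fin n → TensorAlgebra R E'), (∀ j, g j ∈ V') ∧ (∀ j, g₂ j ∈ V₂') ∧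
      (∀ j, ∀ x ∈ X, wordPairing b (g₂ j) x = 0) ∧ f = ∑ j, g j * g₂ j := by
  obtain ⟨n, u', u, hu', hu, hx, hu2⟩ := h
  obtain ⟨m, v', v, hv', hv, hy, hv2⟩ := h₂
  refine ⟨n, u', fun i => ∑ j, wordPairing b f (u i * v j) • v' j, hu',
    fun i => sum_mem fun j _ => Submodule.smul_mem _ _ (hv' j), fun i x hx1 => ?_, ?_⟩
  · rw [← h0 _ (hu i) x hx1]
    conv_rhs => rw [hy x (hX hx1)]
    simp [Finset.mul_sum, mul_comm]
  · refine Submodule.mul_induction_on hf (fun x hx1 y hy1 => ?_) fun x y h1 h2 => by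
      conv_lhs => rw [h1, h2]
      simp only [map_add, LinearMap.add_apply, add_smul, Finset.sum_add_distrib, mul_add]
    conv_lhs => rw [hu2 x hx1, hv2 y hy1, Finset.sum_mul_sum]
    refine Finset.sum_congr rfl fun i _ => ?_
    rw [Finset.mul_sum]
    refine Finset.sum_congr rfl fun j _ => ?_
    rw [wordPairing_mul_mul (hk' hx1) (hk (hu i)), smul_mul_smul_comm, mul_smul_comm]

/-- A word vanishing on `X * V₂` is a combination of words whose first part vanishes on `X`. -/
theorem IsDualPair.mem_perp_mul (h : IsDualPair (wordPairing b) V' V)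
    (h₂ : IsDualPair (wordPairing b) V₂' V₂) (hX : X ≤ V) {f : TensorAlgebra R E'}
    (hf : f ∈ V' * V₂') (h0 : ∀ x ∈ X, ∀ v ∈ V₂, wordPairing b f (x * v) = 0) :
    ∃ (n : ℕ) (g g₂ : Fin n → TensorAlgebra R E'), (∀ j, g j ∈ V') ∧ (∀ j, g₂ j ∈ V₂') ∧
      (∀ j, ∀ x ∈ X, wordPairing b (g j) x = 0) ∧ f = ∑ j, g j * g₂ j := by
  obtain ⟨n, u', u, hu', hu, hx, hu2⟩ := h
  obtain ⟨m, v', v, hv', hv, hy, hv2⟩ := h₂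
  refine ⟨m, fun j => ∑ i, wordPairing b f (u i * v j) • u' i, v',
    fun j => sum_mem fun i _ => Submodule.smul_mem _ _ (hu' i), hv', fun j x hx1 => ?_, ?_⟩
  · rw [← h0 x hx1 _ (hv j)]
    conv_rhs => rw [hx x (hX hx1)]
    simp [Finset.sum_mul, mul_comm]
  · refine Submodule.mul_induction_on hf (fun x hx1 y hy1 => ?_) fun x y h1 h2 => by
      conv_lhs => rw [h1, h2]
      simp only [map_add, LinearMap.add_apply, add_smul, Finset.sum_add_distrib, add_mul]
    conv_lhs => rw [hu2 x hx1, hv2 y hy1, Finset.sum_mul_sum, Finset.sum_comm]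
    refine Finset.sum_congr rfl fun j _ => ?_
    rw [Finset.sum_mul]
    refine Finset.sum_congr rfl fun i _ => ?_
    rw [wordPairing_mul_mul (hk' hx1) (hk (hu i)), smul_mul_smul_comm, smul_mul_assoc]

end DualPairWords

/-! ### Direct summands -/

section Summands

variable {R : Type*} [CommRing R] {N : Type*} [AddCommGroup N] [Module R N]

/-- `X` is a direct summand of `W`. -/
def IsSummand (X W : Submodule R N) : Prop :=
  X ≤ W ∧ ∃ e : W →ₗ[R] N, (∀ w, e w ∈ X) ∧ ∀ w : W, (w : N) ∈ X → e w = w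

theorem IsSummand.refl (X : Submodule R N) : IsSummand X X :=
  ⟨le_rfl, X.subtype, fun w => w.2, fun _ _ => rfl⟩

theorem IsSummand.trans {X Y Z : Submodule R N} (h : IsSummand X Y) (h' : IsSummand Y Z) :
    IsSummand X Z := by
  obtain ⟨h1, e, he, he'⟩ := h
  obtain ⟨h2, f, hf, hf'⟩ := h'
  refine ⟨h1.trans h2, e ∘ₗ f.codRestrict Y hf, fun w => he _, fun w hw => ?_⟩
  have : f.codRestrict Y hf w = ⟨w, h1 hw⟩ := Subtype.ext (hf' w (h1 hw))
  rw [LinearMap.comp_apply, this]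
  exact he' _ hw

theorem IsSummand.exists_extend {X W : Submodule R N} (h : IsSummand X W) (φ : Module.Dual R X) :
    ∃ ψ : Module.Dual R W, ∀ (x : N) (hx : x ∈ X) (hw : x ∈ W), ψ ⟨x, hw⟩ = φ ⟨x, hx⟩ := by
  obtain ⟨-, e, he, he'⟩ := h
  exact ⟨φ ∘ₗ e.codRestrict X he, fun x hx hw => congrArg φ (Subtype.ext (he' ⟨x, hw⟩ hx))⟩

theorem isSummand_inf_ker {X Y : Submodule R N} {D : Module.End R N} [Module.Projective R Y]
    (h : X.map D = Y) : IsSummand (X ⊓ LinearMap.ker D) X := by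
  obtain ⟨f, hf, hfD, -⟩ := exists_restrict_surjective h
  obtain ⟨s, hs⟩ := f.exists_rightInverse_of_surjective (LinearMap.range_eq_top.mpr hf)
  have hs' : ∀ y, f (s y) = y := fun y => congr($hs y)
  refine ⟨inf_le_left, X.subtype ∘ₗ (LinearMap.id - s ∘ₗ f), fun w => ⟨Subtype.property _, ?_⟩,
    fun w hw => ?_⟩
  · change D ((w - s (f w) : X) : N) = 0
    rw [← hfD, map_sub, hs', sub_self, Submodule.coe_zero]
  · have : f w = 0 := Subtype.ext ((hfD w).trans hw.2)
    simp [this]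

theorem IsSummand.mul {E : Type*} [AddCommGroup E] [Module R E] [Module.Flat R E]
    {X W X₂ W₂ : Submodule R (TensorAlgebra R E)} {k : ℕ} (hk : W ≤ degPart R E k)
    [Module.Flat R W] (h : IsSummand X W) (h₂ : IsSummand X₂ W₂) :
    IsSummand (X * X₂) (W * W₂) := by
  obtain ⟨h1, e, he, he'⟩ := h
  obtain ⟨h2, f, hf, hf'⟩ := h₂
  let m := mulEquiv (mulMap_injective_of_flat_left hk W₂)
  refine ⟨mul_le_mul' h1 h2, LinearMap.mul' R _ ∘ₗ TensorProduct.map e f ∘ₗ m.symm.toLinearMap,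
    fun w => ?_, fun w hw => ?_⟩
  · obtain ⟨t, rfl⟩ := m.surjective w
    simp only [LinearMap.comp_apply, LinearEquiv.coe_coe, LinearEquiv.symm_apply_apply]
    induction t with
    | zero => simp
    | tmul x y => simpa using Submodule.mul_mem_mul (he x) (hf y)
    | add a b ha hb => rw [map_add, map_add]; exact add_mem ha hb
  · obtain ⟨w, hw'⟩ := w
    change w ∈ X * X₂ at hw
    have key : X * X₂ ≤ (LinearMap.eqLocus (LinearMap.mul' R _ ∘ₗ TensorProduct.map e f ∘ₗ
        m.symm.toLinearMap) (W * W₂).subtype).map (W * W₂).subtype := by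
      refine Submodule.mul_le.mpr fun x hx y hy => ?_
      refine ⟨⟨x * y, Submodule.mul_mem_mul (h1 hx) (h2 hy)⟩, ?_, rfl⟩
      have : (⟨x * y, Submodule.mul_mem_mul (h1 hx) (h2 hy)⟩ : ↥(W * W₂)) =
          m (⟨x, h1 hx⟩ ⊗ₜ ⟨y, h2 hy⟩) := Subtype.ext (by simp [m])
      rw [SetLike.mem_coe, LinearMap.mem_eqLocus, this]
      simp only [LinearMap.comp_apply, LinearEquiv.coe_coe, LinearEquiv.symm_apply_apply,
        TensorProduct.map_tmul, LinearMap.mul'_apply]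
      rw [he' _ hx, hf' _ hy]
      simp [m]
    obtain ⟨v, hv, rfl⟩ := key hw
    exact hv

end Summands

/-! ### Dual systems -/

section Letters

variable {R : Type*} [CommRing R] {E : Type*} [AddCommGroup E] [Module R E]

/-- The spaces of letters in `Mo_{ρ₁} ⊗ L_{ρ₂} ⊗ ⋯ ⊗ L_{ρₖ}`. -/
def lettersOf (Mo L : ℕ → Submodule R E) : List ℕ → List (Submodule R E)
  | [] => []
  | a :: α => Mo a :: α.map L

@[simp] theorem lettersOf_self (L : ℕ → Submodule R E) (α : List ℕ) :
    lettersOf L L α = α.map L := by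
  cases α <;> rfl

@[simp] theorem length_lettersOf (Mo L : ℕ → Submodule R E) (α : List ℕ) :
    (lettersOf Mo L α).length = α.length := by
  cases α <;> simp [lettersOf]

theorem words_lettersOf_append (Mo L : ℕ → Submodule R E) {α : List ℕ} (h : α ≠ []) (β : List ℕ) :
    words (lettersOf Mo L (α ++ β)) = words (lettersOf Mo L α) * words (lettersOf L L β) := by
  cases α with
  | nil => exact absurd rfl h
  | cons a α => rw [lettersOf_self]; simp [lettersOf, words_append, mul_assoc]

/-- Words with `k` letters of degree one. -/
abbrev ones (Mo L : ℕ → Submodule R E) (k : ℕ) : Submodule R (TensorAlgebra R E) :=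
  words (lettersOf Mo L (List.replicate k 1))

theorem ones_add (Mo L : ℕ → Submodule R E) {k : ℕ} (hk : 0 < k) (l : ℕ) :
    ones Mo L (k + l) = ones Mo L k * ones L L l := by
  rw [ones, List.replicate_add, words_lettersOf_append]
  simpa using hk.ne'

theorem ones_le_degPart (Mo L : ℕ → Submodule R E) (k : ℕ) : ones Mo L k ≤ degPart R E k := by
  have := words_le_degPart (lettersOf Mo L (List.replicate k 1))
  rwa [length_lettersOf, List.length_replicate] at this

theorem RightSystem.lets_eq (S : RightSystem R E) (α : List ℕ) :
    S.lets α = lettersOf S.Mo S.L α := by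
  cases α <;> rfl

end Letters

/-- The quadratic dual of a system, together with the properties on which the duality of ribbon
modules rests: the pieces of degree one are dual to each other, the dual is generated in degree
one, its relations are the annihilators of the relations of `S`, and each element of
`Mo₁ ⊗ L₁ ⊗ ⋯ ⊗ L₁` annihilated by all multiplications defines a functional on the dual. -/
structure DualSystem {R E : Type*} [CommRing R] [AddCommGroup E] [Module R E]
    (S : RightSystem R E) (E' : Type*) [AddCommGroup E'] [Module R E'] where
  /-- the product -/
  mul : E' →ₗ[R] E' →ₗ[R] E'
  /-- the pieces of the dual algebra -/
  L : ℕ → Submodule R E'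
  /-- the pieces of the dual module -/
  Mo : ℕ → Submodule R E'
  /-- the pairing -/
  b : E' →ₗ[R] Module.Dual R E
  assoc : ∀ x y z, mul (mul x y) z = mul x (mul y z)
  pair_L : IsDualPair b (L 1) (S.L 1)
  pair_Mo : IsDualPair b (Mo 1) (S.Mo 1)
  rel_L : ∀ f ∈ ones L L 2, (∀ x ∈ ones S.L S.L 2, glue S.mul 0 x = 0 → wordPairing b f x = 0) →
    glue mul 0 f = 0
  rel_Mo : ∀ f ∈ ones Mo L 2, (∀ x ∈ ones S.Mo S.L 2, glue S.mul 0 x = 0 → wordPairing b f x = 0) →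
    glue mul 0 f = 0
  gen_L : ∀ d, 0 < d → (ones L L d).map (blockMul mul 0 [d]) = (L d).map (TensorAlgebra.ι R)
  gen_Mo : ∀ d, 0 < d → (ones Mo L d).map (blockMul mul 0 [d]) = (Mo d).map (TensorAlgebra.ι R)
  eval_L : ∀ d, 0 < d → ∀ ξ ∈ S.alg.col d, ∃ η : Module.Dual R E', ∀ f ∈ ones L L d, ∀ e,
    blockMul mul 0 [d] f = TensorAlgebra.ι R e → wordPairing b f ξ = η e
  eval_Mo : ∀ d, 0 < d → ∀ ξ ∈ S.col d, ∃ η : Module.Dual R E', ∀ f ∈ ones Mo L d, ∀ e,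
    blockMul mul 0 [d] f = TensorAlgebra.ι R e → wordPairing b f ξ = η e

theorem map_mul_eq_map_mul_map {R A : Type*} [CommRing R] [Ring A] [Algebra R A]
    {X Y : Submodule R A} {D D₁ D₂ : Module.End R A}
    (h : ∀ u ∈ X, ∀ w ∈ Y, D (u * w) = D₁ u * D₂ w) : (X * Y).map D = X.map D₁ * Y.map D₂ := by
  apply le_antisymm
  · rw [Submodule.map_le_iff_le_comap]
    refine Submodule.mul_le.mpr fun u hu w hw => ?_
    rw [Submodule.mem_comap, h u hu w hw]
    exact Submodule.mul_mem_mul ⟨u, hu, rfl⟩ ⟨w, hw, rfl⟩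
  · refine Submodule.mul_le.mpr ?_
    rintro _ ⟨u, hu, rfl⟩ _ ⟨w, hw, rfl⟩
    exact ⟨u * w, Submodule.mul_mem_mul hu hw, h u hu w hw⟩

namespace DualSystem

variable {R : Type*} [CommRing R] {E E' : Type*} [AddCommGroup E] [Module R E]
  [AddCommGroup E'] [Module R E'] {S : RightSystem R E} (D : DualSystem S E')

theorem pair_ones_aux (Mo : ℕ → Submodule R E) (Mo' : ℕ → Submodule R E')
    (h : IsDualPair D.b (Mo' 1) (Mo 1)) (k : ℕ)
    (hk : IsDualPair (wordPairing D.b) (ones D.L D.L k) (ones S.L S.L k)) :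
    IsDualPair (wordPairing D.b) (ones Mo' D.L (k + 1)) (ones Mo S.L (k + 1)) := by
  rw [add_comm, ones_add _ _ one_pos, ones_add _ _ one_pos]
  refine IsDualPair.mul (ones_le_degPart _ _ 1) (ones_le_degPart _ _ 1) ?_ hk
  simpa [ones, lettersOf] using h.map_ι

theorem pair_ones_L (k : ℕ) :
    IsDualPair (wordPairing D.b) (ones D.L D.L k) (ones S.L S.L k) := by
  induction k with
  | zero =>
    refine ⟨1, fun _ => 1, fun _ => 1, fun _ => Submodule.one_le.mp le_rfl,
      fun _ => Submodule.one_le.mp le_rfl, fun x hx => ?_, fun x hx => ?_⟩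
    all_goals
      obtain ⟨r, rfl⟩ := Submodule.mem_one.mp hx
      simp [Algebra.algebraMap_eq_smul_one]
  | succ k ih => exact D.pair_ones_aux _ _ D.pair_L k ih

theorem pair_ones (k : ℕ) : IsDualPair (wordPairing D.b) (ones D.Mo D.L k) (ones S.Mo S.L k) := by
  cases k with
  | zero => exact D.pair_ones_L 0
  | succ k => exact D.pair_ones_aux _ _ D.pair_Mo k (D.pair_ones_L k)

theorem map_blockMul_aux (Mo' : ℕ → Submodule R E')
    (h : ∀ d, 0 < d → (ones Mo' D.L d).map (blockMul D.mul 0 [d]) =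
      (Mo' d).map (TensorAlgebra.ι R)) {d : ℕ} (hd : 0 < d) {q : List ℕ}
    (hq : (ones D.L D.L q.sum).map (blockMul D.mul 0 q) = words (lettersOf D.L D.L q)) :
    (ones Mo' D.L (d :: q).sum).map (blockMul D.mul 0 (d :: q)) =
      words (lettersOf Mo' D.L (d :: q)) := by
  rw [List.sum_cons, ones_add _ _ hd, map_mul_eq_map_mul_map (D₁ := blockMul D.mul 0 [d])
    (D₂ := blockMul D.mul 0 q), h d hd, hq, lettersOf_self]
  · simp [lettersOf]
  · intro u hu w _
    obtain ⟨e, he, he'⟩ := exists_blockMul_cons (mul := D.mul) hd (ones_le_degPart _ _ _ hu)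
    rw [he, he']

theorem map_blockMul_L {c : List ℕ} (hc : Pos c) :
    (ones D.L D.L c.sum).map (blockMul D.mul 0 c) = words (lettersOf D.L D.L c) := by
  induction c with
  | nil => exact Submodule.map_id _
  | cons d q ih =>
    exact D.map_blockMul_aux _ D.gen_L (hc d (by simp)) (ih fun x hx => hc x (by simp [hx]))

/-- The dual is generated in degree one. -/
theorem map_blockMul {c : List ℕ} (hc : Pos c) :
    (ones D.Mo D.L c.sum).map (blockMul D.mul 0 c) = words (lettersOf D.Mo D.L c) := by
  cases c with
  | nil => exact Submodule.map_id _
  | cons d q =>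
    exact D.map_blockMul_aux _ D.gen_Mo (hc d (by simp))
      (D.map_blockMul_L fun x hx => hc x (by simp [hx]))

theorem exists_eval_aux (Mo' : ℕ → Submodule R E') {d : ℕ} (hd : 0 < d) {q : List ℕ}
    {X Y : Submodule R (TensorAlgebra R E)} (hX : X ≤ degPart R E d)
    (hX' : ∀ ξ ∈ X, ∃ η : Module.Dual R E', ∀ f ∈ ones Mo' D.L d, ∀ e,
      blockMul D.mul 0 [d] f = TensorAlgebra.ι R e → wordPairing D.b f ξ = η e)
    (hY : ∀ y ∈ Y, ∃ Ψ : Module.Dual R (TensorAlgebra R E'), ∀ f ∈ ones D.L D.L q.sum,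
      wordPairing D.b f y = Ψ (blockMul D.mul 0 q f)) {x : TensorAlgebra R E} (hx : x ∈ X * Y) :
    ∃ Ψ : Module.Dual R (TensorAlgebra R E'), ∀ f ∈ ones Mo' D.L (d :: q).sum,
      wordPairing D.b f x = Ψ (blockMul D.mul 0 (d :: q) f) := by
  refine Submodule.mul_induction_on hx (fun ξ hξ y hy => ?_) ?_
  · obtain ⟨η, hη⟩ := hX' ξ hξ
    obtain ⟨Ψ, hΨ⟩ := hY y hy
    refine ⟨consFun η Ψ, fun f hf => ?_⟩
    rw [List.sum_cons, ones_add _ _ hd] at hf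
    refine Submodule.mul_induction_on hf (fun u hu w hw => ?_) fun a b ha hb => by
      rw [map_add, map_add, map_add, LinearMap.add_apply, ha, hb]
    obtain ⟨e, he, he'⟩ := exists_blockMul_cons (mul := D.mul) hd (ones_le_degPart _ _ _ hu)
    rw [he', consFun_cons, wordPairing_mul_mul (ones_le_degPart _ _ _ hu) (hX hξ), hη u hu e he,
      hΨ w hw]
  · rintro a b ⟨Ψ, hΨ⟩ ⟨Φ, hΦ⟩
    exact ⟨Ψ + Φ, fun f hf => by rw [map_add, hΨ f hf, hΦ f hf, LinearMap.add_apply]⟩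

theorem exists_eval_L {c : List ℕ} (hc : Pos c) : ∀ x ∈ S.alg.cols c,
    ∃ Ψ : Module.Dual R (TensorAlgebra R E'), ∀ f ∈ ones D.L D.L c.sum,
      wordPairing D.b f x = Ψ (blockMul D.mul 0 c f) := by
  induction c with
  | nil => exact fun x _ => ⟨(wordPairing D.b).flip x, fun f _ => rfl⟩
  | cons d q ih =>
    intro x hx
    rw [RightSystem.cols_cons] at hx
    refine D.exists_eval_aux _ (hc d (by simp)) ?_ (D.eval_L d (hc d (by simp)))
      (ih fun x hx => hc x (by simp [hx])) hx
    simpa using S.alg.rib_le_degPart (List.replicate d 1)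

theorem exists_eval {c : List ℕ} (hc : Pos c) : ∀ x ∈ S.cols c,
    ∃ Ψ : Module.Dual R (TensorAlgebra R E'), ∀ f ∈ ones D.Mo D.L c.sum,
      wordPairing D.b f x = Ψ (blockMul D.mul 0 c f) := by
  cases c with
  | nil => exact fun x _ => ⟨(wordPairing D.b).flip x, fun f _ => rfl⟩
  | cons d q =>
    intro x hx
    rw [RightSystem.cols_cons] at hx
    refine D.exists_eval_aux _ (hc d (by simp)) ?_ (D.eval_Mo d (hc d (by simp)))
      (D.exists_eval_L fun x hx => hc x (by simp [hx])) hx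
    simpa using S.rib_le_degPart (List.replicate d 1)

/-- The pairing with the columns of the ribbon factors through the multiplication of blocks. -/
theorem wordPairing_eq_zero {c : List ℕ} (hc : Pos c) {f : TensorAlgebra R E'}
    (hf : f ∈ ones D.Mo D.L c.sum) (h0 : blockMul D.mul 0 c f = 0) {x : TensorAlgebra R E}
    (hx : x ∈ S.cols c) : wordPairing D.b f x = 0 := by
  obtain ⟨Ψ, hΨ⟩ := D.exists_eval hc x hx
  rw [hΨ f hf, h0, map_zero]

end DualSystem

namespace RightSystem

variable {R : Type*} [CommRing R] {E : Type*} [AddCommGroup E] [Module R E]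
  {S : RightSystem R E}

/-- All pieces of positive degree of the algebra and of the module are projective. -/
structure IsProjective (S : RightSystem R E) : Prop where
  L : ∀ n, 0 < n → Module.Projective R (S.L n)
  Mo : ∀ n, 0 < n → Module.Projective R (S.Mo n)

theorem IsProjective.alg (h : S.IsProjective) : S.alg.IsProjective := ⟨h.L, h.L⟩

variable (hS : S.MergesOnes) (hA : S.alg.MergesOnes) (hP : S.IsProjective)
include hS hA hP

theorem projective_rib {ρ : List ℕ} (h0 : ρ ≠ []) (hρ : Pos ρ) : Module.Projective R (S.rib ρ) :=
  hS.projective_rib_of_pos hA hP.L hP.Mo h0 hρ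

theorem isSummand_rib {σ : List ℕ} (hσ : Pos σ) : ∀ a, 0 < a →
    IsSummand (S.rib (σ ++ [a])) (words (S.lets (σ ++ [a]))) := by
  have := S.flat
  induction σ using List.reverseRecOn with
  | nil =>
    intro a _
    have : S.rib [a] = words (S.lets [a]) := by rw [rib_singleton]; simp [lets]
    rw [List.nil_append, this]
    exact .refl _
  | append_singleton σ a ih =>
    intro b hb
    have hσ' : Pos σ := fun x hx => hσ x (by simp [hx])
    have ha : 0 < a := hσ a (by simp)
    have := hS.flat_rib S hA hσ
    have := S.flat_words_lets hσ
    have := projective_rib hS hA hP (ρ := σ ++ [a + b]) (by simp) (pos_snoc hσ' (by omega))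
    rw [S.rib_append (by simp) (by simpa [Pos] using hb) (p := σ.length) (by simp),
      words_lets_append S (by simp)]
    refine (isSummand_inf_ker ((hS.merges S hA hσ' ha hb (List.forall_mem_nil _)).map_eq
      hσ' ha hb)).trans ?_
    refine IsSummand.mul (S.words_le_degPart _) (ih hσ' a ha) ?_
    have : S.alg.rib [b] = words (S.alg.lets [b]) := by rw [rib_singleton]; simp [lets]
    rw [this]
    exact .refl _

theorem isSummand_col (d : ℕ) : IsSummand (S.col (d + 1)) (ones S.Mo S.L (d + 1)) := by
  rw [ones, ← lets_eq, col, List.replicate_succ']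
  exact isSummand_rib hS hA hP (pos_replicate d) 1 one_pos

theorem isSummand_cols {c : List ℕ} (hc : Pos c) :
    IsSummand (S.cols c) (ones S.Mo S.L c.sum) := by
  have := S.flat
  induction c using List.reverseRecOn with
  | nil => exact .refl _
  | append_singleton c d ih =>
    obtain ⟨d, rfl⟩ : ∃ j, d = j + 1 := ⟨d - 1, by have := hc d (by simp); omega⟩
    have hc' : Pos c := fun x hx => hc x (by simp [hx])
    by_cases h : c = []
    · subst h
      rw [List.nil_append, cols_singleton, List.sum_singleton]
      exact isSummand_col hS hA hP d
    · have : Module.Flat R (ones S.Mo S.L c.sum) := by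
        rw [ones, ← lets_eq]; exact S.flat_words_lets (pos_replicate _)
      rw [cols_snoc S h, List.sum_append, List.sum_singleton, ones_add _ _ (List.sum_pos _ hc' h)]
      exact (ih hc').mul (ones_le_degPart _ _ _) (isSummand_col (S := S.alg) hA hA hP.alg d)

theorem projective_cols {c : List ℕ} (hc : Pos c) : Module.Projective R (S.cols c) := by
  have := S.flat
  induction c using List.reverseRecOn with
  | nil =>
    change Module.Projective R (1 : Submodule R (TensorAlgebra R E))
    rw [Submodule.one_eq_range]
    exact Module.Projective.of_equiv (LinearEquiv.ofInjective
      (Algebra.linearMap R (TensorAlgebra R E))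
      fun a b hab => (TensorAlgebra.algebraMap_inj E a b).mp hab)
  | append_singleton c d ih =>
    have hd : 0 < d := hc d (by simp)
    have hc' : Pos c := fun x hx => hc x (by simp [hx])
    by_cases h : c = []
    · subst h
      rw [List.nil_append, cols_singleton]
      exact projective_rib hS hA hP (by simpa using hd.ne') (pos_replicate d)
    · have := ih hc'
      have := projective_rib (S := S.alg) hA hA hP.alg (ρ := List.replicate d 1)
        (by simpa using hd.ne') (pos_replicate d)
      rw [cols_snoc S h]
      exact projective_mul (S.cols_le_degPart hc')

/-- The cokernel of the inclusion of a longer last column: it is the module obtained by merging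
the last two boxes, which is a direct summand of the space of all words of this shape. -/
theorem cols_snoc_succ_succ {c : List ℕ} (hc : Pos c) (d : ℕ) :
    S.cols (c ++ [d + 1]) * S.alg.col 1 ⊓ LinearMap.ker (glue S.mul (c.sum + d)) ≤
      S.cols (c ++ [d + 2]) ∧
    ∃ N W : Submodule R (TensorAlgebra R E),
      (S.cols (c ++ [d + 1]) * S.alg.col 1).map (glue S.mul (c.sum + d)) = N ∧
      Module.Projective R N ∧ IsSummand N W ∧
      (ones S.Mo S.L (c.sum + d + 2)).map (glue S.mul (c.sum + d)) ≤ W := by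
  have := S.flat
  have key : ∀ {S : RightSystem R E}, S.MergesOnes → S.alg.MergesOnes → S.IsProjective →
      S.col (d + 1) * S.alg.col 1 ⊓ LinearMap.ker (glue S.mul d) ≤ S.col (d + 2) ∧
      (S.col (d + 1) * S.alg.col 1).map (glue S.mul d) = S.rib (List.replicate d 1 ++ [2]) ∧
      Module.Projective R (S.rib (List.replicate d 1 ++ [2])) ∧
      IsSummand (S.rib (List.replicate d 1 ++ [2])) (words (S.lets (List.replicate d 1 ++ [2]))) ∧
      (ones S.Mo S.L (d + 2)).map (glue S.mul d) ≤ words (S.lets (List.replicate d 1 ++ [2])) := by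
    intro S hS hA hP
    have h1 : List.replicate (d + 2) 1 = List.replicate (d + 1) 1 ++ [1] := List.replicate_succ'
    have h2 : List.replicate (d + 1) 1 = List.replicate d 1 ++ [1] := List.replicate_succ'
    refine ⟨?_, ?_, ?_, isSummand_rib hS hA hP (pos_replicate d) 2 two_pos, ?_⟩
    · unfold col
      rw [h1]
      exact S.rib_mul_rib_inf_ker_le (by simp) (by simp)
    · have := (hS.merges S hA (pos_replicate d) one_pos one_pos (List.forall_mem_nil _) :
        S.Merges _ 1 1 []).map_eq (pos_replicate d) one_pos one_pos
      rw [List.length_replicate, ← h2] at this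
      exact this
    · exact projective_rib hS hA hP (by simp) (pos_snoc (pos_replicate d) two_pos)
    · rintro _ ⟨z, hz, rfl⟩
      rw [ones, ← lets_eq] at hz
      have := S.glue_words (σ := List.replicate d 1) (b := 1) (c := 1) (τ := []) (z := z)
        (pos_replicate d) one_pos one_pos
      rw [List.length_replicate] at this
      refine this ?_
      rw [← words_lets_append S (by simp), ← h2, ← h1]
      exact hz
  by_cases h : c = []
  · subst h
    obtain ⟨h1, h2, h3, h4, h5⟩ := key hS hA hP
    simp only [List.nil_append, cols_singleton, List.sum_nil, zero_add]
    exact ⟨h1, _, _, h2, h3, h4, h5⟩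
  · obtain ⟨h1, h2, h3, h4, h5⟩ := key (S := S.alg) hA hA hP.alg
    have hd := S.cols_le_degPart hc
    have := flat_cols (c := c) hS hA
    have := projective_cols hS hA hP hc
    have hpos := List.sum_pos _ hc h
    have hfl : Module.Flat R (ones S.Mo S.L c.sum) := by
      rw [ones, ← lets_eq]; exact S.flat_words_lets (pos_replicate _)
    refine ⟨?_, _, ones S.Mo S.L c.sum * words (S.alg.lets (List.replicate d 1 ++ [2])), rfl, ?_,
      ?_, ?_⟩
    · rintro z ⟨hz, hz0⟩
      rw [SetLike.mem_coe, cols_snoc S h, mul_assoc] at hz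
      rw [cols_snoc S h]
      refine mem_mul_of_le le_rfl h1 (mem_mul_inf_ker hd (D := glue S.mul d) ?_ hz hz0)
      exact fun u hu w _ => glue_mul_of_mem S.mul (hd hu) d w
    all_goals
      have hN : (S.cols (c ++ [d + 1]) * S.alg.col 1).map (glue S.mul (c.sum + d)) =
          S.cols c * S.alg.rib (List.replicate d 1 ++ [2]) := by
        rw [cols_snoc S h, mul_assoc, ← h2]
        refine (map_mul_eq_map_mul_map (D := glue S.mul (c.sum + d)) (D₁ := LinearMap.id)
          (D₂ := glue S.mul d) fun u hu w _ => ?_).trans ?_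
        · exact glue_mul_of_mem S.mul (hd hu) d w
        · rw [Submodule.map_id]; rfl
    · rw [hN]
      exact projective_mul hd
    · rw [hN]
      exact (isSummand_cols hS hA hP hc).mul (ones_le_degPart _ _ _) h4
    · rw [add_assoc, ones_add _ _ hpos]
      refine (map_mul_eq_map_mul_map (D := glue S.mul (c.sum + d)) (D₁ := LinearMap.id)
        (D₂ := glue S.mul d) fun u hu w _ => ?_).trans_le ?_
      · exact glue_mul_of_mem S.mul (ones_le_degPart _ _ _ hu) d w
      · rw [Submodule.map_id]
        exact mul_le_mul' le_rfl h5

end RightSystem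

/-! ### The duality of ribbon modules and ribbon modules of columns -/

namespace DualSystem

variable {R : Type*} [CommRing R] {E E' : Type*} [AddCommGroup E] [Module R E]
  [AddCommGroup E'] [Module R E'] {S : RightSystem R E} (D : DualSystem S E')

/-- The relations between the last two letters. -/
theorem glue_eq_zero (m : ℕ) {f : TensorAlgebra R E'} (hf : f ∈ ones D.Mo D.L (m + 2))
    (h0 : ∀ x ∈ ones S.Mo S.L (m + 2), glue S.mul m x = 0 → wordPairing D.b f x = 0) :
    glue D.mul m f = 0 := by
  rcases Nat.eq_zero_or_pos m with rfl | hm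
  · exact D.rel_Mo f hf h0
  rw [ones_add _ _ hm] at hf
  obtain ⟨n, g, g₂, hg, hg₂, hz, rfl⟩ := IsDualPair.mem_mul_perp (b := D.b)
    (ones_le_degPart _ _ m) (ones_le_degPart _ _ m) (D.pair_ones m) (D.pair_ones_L 2)
    (X := ones S.L S.L 2 ⊓ LinearMap.ker (glue S.mul 0)) inf_le_left hf fun v hv x hx => by
      refine h0 _ ?_ ?_
      · rw [ones_add _ _ hm]; exact Submodule.mul_mem_mul hv hx.1
      · have := glue_mul_of_mem S.mul (ones_le_degPart _ _ _ hv) 0 x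
        rw [add_zero] at this
        rw [this, LinearMap.mem_ker.mp hx.2, mul_zero]
  rw [map_sum]
  refine Finset.sum_eq_zero fun j _ => ?_
  have := glue_mul_of_mem D.mul (ones_le_degPart _ _ _ (hg j)) 0 (g₂ j)
  rw [add_zero] at this
  rw [this, D.rel_L _ (hg₂ j) fun x hx hx0 => hz j x ⟨hx, hx0⟩, mul_zero]

/-- The case of a last column with a single box. -/
theorem blockMul_eq_zero_of_mul {c : List ℕ} (hc : Pos c) (h : c ≠ [])
    (ih : ∀ f ∈ ones D.Mo D.L c.sum, (∀ x ∈ S.cols c, wordPairing D.b f x = 0) →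
      blockMul D.mul 0 c f = 0) {f : TensorAlgebra R E'} (hf : f ∈ ones D.Mo D.L (c.sum + 1))
    (h0 : ∀ x ∈ S.cols c * S.alg.col 1, wordPairing D.b f x = 0) : blockMul D.mul 0 c f = 0 := by
  rw [ones_add _ _ (List.sum_pos _ hc h)] at hf
  have h1 : S.alg.col 1 = ones S.L S.L 1 := by
    unfold RightSystem.col
    rw [List.replicate_one, S.alg.rib_singleton]
    simp [ones, lettersOf, RightSystem.alg]
  obtain ⟨n, g, g₂, hg, -, hz, rfl⟩ := IsDualPair.mem_perp_mul (b := D.b)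
    (ones_le_degPart _ _ _) (ones_le_degPart _ _ _) (D.pair_ones c.sum) (D.pair_ones_L 1)
    (X := S.cols c) (by rw [ones, ← S.lets_eq]; exact S.cols_le_words hc) hf fun x hx v hv =>
      h0 _ (Submodule.mul_mem_mul hx (h1 ▸ hv))
  rw [map_sum]
  refine Finset.sum_eq_zero fun j _ => ?_
  rw [blockMul_mul_left hc (ones_le_degPart _ _ _ (hg j)), ih _ (hg j) (hz j), zero_mul]

variable (hS : S.MergesOnes) (hA : S.alg.MergesOnes) (hP : S.IsProjective)
include hS hA hP

/-- The annihilator of the product of the columns consists of relations of the dual.  For a column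
with at least two boxes, a word annihilating the column is the sum of a word annihilating the
shortened column times any letter, and of a word in the relations between the last two boxes. -/
theorem blockMul_eq_zero {c : List ℕ} (hc : Pos c) (h : c ≠ []) {f : TensorAlgebra R E'}
    (hf : f ∈ ones D.Mo D.L c.sum) (h0 : ∀ x ∈ S.cols c, wordPairing D.b f x = 0) :
    blockMul D.mul 0 c f = 0 := by
  have := S.flat
  obtain ⟨n, hn⟩ : ∃ n, c.sum = n := ⟨_, rfl⟩
  induction n generalizing c f with
  | zero => exact absurd hn (List.sum_pos _ hc h).ne'
  | succ n ih =>
    obtain ⟨p, d, rfl, hp, hd⟩ := IsComp.exists_snoc ⟨h, hc⟩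
    rw [List.sum_append, List.sum_singleton] at hf hn
    obtain rfl | ⟨d, rfl⟩ : d = 1 ∨ ∃ j, d = j + 2 := by
      obtain _ | _ | j := d
      exacts [absurd hd (lt_irrefl 0), .inl rfl, .inr ⟨j, rfl⟩]
    · rw [blockMul_append, blockMul_singleton, Nat.sub_self, pow_zero, one_mul]
      by_cases h' : p = []
      · subst h'
        refine (D.pair_ones 1).eq_zero hf fun x hx => h0 x ?_
        rw [List.nil_append, S.cols_singleton]
        unfold RightSystem.col
        rw [List.replicate_one, S.rib_singleton]
        simpa [ones, lettersOf] using hx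
      · exact D.blockMul_eq_zero_of_mul hp h' (fun f hf h0 => ih hp h' hf h0 (by omega)) hf
          fun x hx => h0 x (by rwa [S.cols_snoc h'])
    have hc1 : Pos (p ++ [d + 1]) := pos_snoc hp (by omega)
    have hsum : (p ++ [d + 1]).sum = p.sum + d + 1 := by simp [add_assoc]
    have ih1 := fun f hf h0 => ih (f := f) hc1 (by simp) hf h0 (by omega)
    obtain ⟨hker, N, W, hN, hNP, hNW, hW⟩ := S.cols_snoc_succ_succ hS hA hP hp d
    have hX : S.cols (p ++ [d + 1]) * S.alg.col 1 ≤ ones S.Mo S.L (p.sum + d + 2) := by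
      have := S.cols_le_words (c := p ++ [d + 1] ++ [1]) (pos_snoc hc1 one_pos)
      rwa [S.cols_snoc (by simp), S.lets_eq, List.sum_append, hsum] at this
    -- On `X`, the functional given by `f` vanishes on the kernel of the multiplication of the last
    -- two letters, so that it factors through the image `N` of `X`.  As `N` is a direct summand, the
    -- factor extends to all words; this gives a word `f1` in the relations between the last two
    -- letters, and `f - f1` vanishes on `X`.
    set X := S.cols (p ++ [d + 1]) * S.alg.col 1
    obtain ⟨r, hr, hrD, -⟩ := exists_restrict_surjective hN
    obtain ⟨s, hs⟩ := r.exists_rightInverse_of_surjective (LinearMap.range_eq_top.mpr hr)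
    have hs' : ∀ y, r (s y) = y := fun y => congr($hs y)
    obtain ⟨ψ, hψ⟩ := hNW.exists_extend (wordPairing D.b f ∘ₗ X.subtype ∘ₗ s)
    obtain ⟨f1, hf1, hf1'⟩ := (D.pair_ones (p.sum + d + 2)).exists_eq
      (ψ ∘ₗ (glue S.mul (p.sum + d)).restrict fun x hx => hW ⟨x, hx, rfl⟩)
    have hff : ∀ x ∈ X, wordPairing D.b (f - f1) x = 0 := by
      intro x hx
      have h1 : wordPairing D.b f (x - s (r ⟨x, hx⟩)) = 0 := by
        refine h0 _ (hker ⟨sub_mem hx (s _).2, ?_⟩)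
        rw [SetLike.mem_coe, LinearMap.mem_ker, map_sub, ← hrD, hs', hrD, sub_self]
      have h2 := hf1' ⟨x, hX hx⟩
      have h3 := hψ (glue S.mul (p.sum + d) x) (hrD ⟨x, hx⟩ ▸ (r _).2) (hW ⟨x, hX hx, rfl⟩)
      have h4 : (⟨glue S.mul (p.sum + d) x, hrD ⟨x, hx⟩ ▸ (r _).2⟩ : N) = r ⟨x, hx⟩ :=
        Subtype.ext (hrD ⟨x, hx⟩).symm
      rw [h4] at h3
      rw [map_sub, sub_eq_zero] at h1
      rw [map_sub, LinearMap.sub_apply, h1, sub_eq_zero]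
      exact (h2.trans h3).symm
    have hg1 : glue D.mul (p.sum + d) f1 = 0 := by
      refine D.glue_eq_zero _ hf1 fun x hx hx0 => ?_
      rw [hf1' ⟨x, hx⟩, LinearMap.comp_apply]
      convert map_zero ψ
      exact Subtype.ext hx0
    have h1 : blockMul D.mul 0 (p ++ [d + 2]) f1 = 0 := by
      rw [blockMul_snoc_mul_glue D.assoc hp, Module.End.mul_apply, hg1, map_zero]
    have h2 : blockMul D.mul 0 (p ++ [d + 1]) (f - f1) = 0 :=
      D.blockMul_eq_zero_of_mul hc1 (by simp) ih1 (by rw [hsum]; exact sub_mem hf hf1) hff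
    rw [← sub_add_cancel f f1, map_add, h1, add_zero, blockMul_snoc_succ_succ, Module.End.mul_apply,
      h2, map_zero]

/-- The ribbon module is dual to the ribbon module of the dual system with columns for rows.  Both
are quotients of modules of words of letters of degree one: the former of the product of the
columns, the latter of the words that annihilate all products with two columns merged. -/
theorem exists_dual {ρ c : List ℕ} (h : IsConjugate ρ c) :
    ∃ Φ : Module.Dual R (S.rib ρ) ≃ₗ[R] ribbon D.mul (lettersOf D.Mo D.L c),
      ∀ (φ : Module.Dual R (S.rib ρ)) (f : TensorAlgebra R E') (x : TensorAlgebra R E)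
        (y : S.rib ρ), f ∈ ones D.Mo D.L c.sum → (Φ φ : TensorAlgebra R E') = blockMul D.mul 0 c f →
        x ∈ S.cols c → (y : TensorAlgebra R E) = blockMul S.mul 0 ρ x →
        φ y = wordPairing D.b f x := by
  have := S.flat
  have hc := h.pos_right
  have hproj := S.projective_rib hS hA hP h.ne_nil_left h.pos_left
  have hmerge : S.merged c ≤ S.cols c := by
    refine S.merged_le fun p x y q hpq => ?_
    subst hpq
    exact S.cols_merge_le hS hA (hc x (by simp))
  have hglue : ∀ (p q : List ℕ) (x y : ℕ), c = p ++ x :: y :: q → ∀ f,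
      glue D.mul p.length (blockMul D.mul 0 c f) = blockMul D.mul 0 (p ++ (x + y) :: q) f ∧
        Pos (p ++ (x + y) :: q) ∧ (p ++ (x + y) :: q).sum = c.sum := by
    rintro p q x y rfl f
    have hx := hc x (by simp)
    refine ⟨?_, ?_, by simp [add_assoc]⟩
    · rw [← glue_mul_blockMul_merge D.assoc p q hx (hc y (by simp)), Module.End.mul_apply]
    · intro z hz
      simp only [List.mem_append, List.mem_cons] at hz
      rcases hz with hz | rfl | hz
      · exact hc z (by simp [hz])
      · omega
      · exact hc z (by simp [hz])
  -- The words in the dual letters that annihilate all products with two columns merged.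
  let K : Submodule R (TensorAlgebra R E') :=
    ones D.Mo D.L c.sum ⊓ (S.merged c).dualAnnihilator.comap (wordPairing D.b)
  have hK : ∀ f, f ∈ K ↔ f ∈ ones D.Mo D.L c.sum ∧ ∀ x ∈ S.merged c, wordPairing D.b f x = 0 :=
    fun f => by simp only [K, Submodule.mem_inf, Submodule.mem_comap, Submodule.mem_dualAnnihilator]
  have hβ : ∀ f ∈ K, blockMul D.mul 0 c f ∈ ribbon D.mul (lettersOf D.Mo D.L c) := by
    intro f hf
    obtain ⟨hf, hf0⟩ := (hK f).mp hf
    refine (mem_ribbon D.mul).mpr ⟨D.map_blockMul hc ▸ ⟨f, hf, rfl⟩, fun p => ?_⟩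
    have hw : blockMul D.mul 0 c f ∈ words (lettersOf D.Mo D.L c) :=
      D.map_blockMul hc ▸ ⟨f, hf, rfl⟩
    by_cases hp : c.length ≤ p + 1
    · exact glue_eq_zero_of_mem D.mul (k := c.length) hp (by simpa using words_le_degPart _ hw)
    obtain ⟨P, x, y, q, hsplit, rfl⟩ : ∃ P x y q, c = P ++ x :: y :: q ∧ P.length = p := by
      have h1 : (c.drop p).length = c.length - p := List.length_drop
      match hq : c.drop p with
      | [] | [_] => simp [hq] at h1; omega
      | x :: y :: q =>
        exact ⟨c.take p, x, y, q, by rw [← hq, List.take_append_drop], by simp; omega⟩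
    obtain ⟨h1, h2, h3⟩ := hglue _ _ _ _ hsplit f
    rw [h1]
    refine D.blockMul_eq_zero hS hA hP h2 (by simp) (by rwa [h3]) fun z hz => hf0 z ?_
    rw [hsplit]
    exact S.cols_le_merged P q x y hz
  obtain ⟨m, hm, hmD, -⟩ := exists_restrict_surjective (S.map_blockMul_cols hS hA h)
  -- Evaluation on the columns and multiplication of the blocks have the same kernel on `K`; their
  -- images are the two modules to be identified.
  let α : K →ₗ[R] Module.Dual R (S.cols c) :=
    (S.cols c).subtype.dualMap ∘ₗ wordPairing D.b ∘ₗ K.subtype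
  let β : K →ₗ[R] ribbon D.mul (lettersOf D.Mo D.L c) := (blockMul D.mul 0 c).restrict hβ
  have hβs : Function.Surjective β := by
    rintro ⟨y, hy⟩
    obtain ⟨hy1, hy2⟩ := (mem_ribbon D.mul).mp hy
    rw [← D.map_blockMul hc] at hy1
    obtain ⟨f, hf, rfl⟩ := hy1
    refine ⟨⟨f, (hK f).mpr ⟨hf, fun x hx => ?_⟩⟩, rfl⟩
    have : S.merged c ≤ LinearMap.ker (wordPairing D.b f) := by
      refine S.merged_le fun p a b q hpq x hx => ?_
      obtain ⟨h1, h2, h3⟩ := hglue _ _ _ _ hpq f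
      rw [hy2] at h1
      exact D.wordPairing_eq_zero h2 (by rwa [h3]) h1.symm hx
    exact this hx
  have hker : LinearMap.ker α = LinearMap.ker β := by
    ext ⟨f, hf⟩
    have hf' := ((hK f).mp hf).1
    rw [LinearMap.mem_ker, LinearMap.mem_ker]
    constructor
    · intro h1
      refine Subtype.ext (D.blockMul_eq_zero hS hA hP hc h.ne_nil_right hf' fun x hx => ?_)
      exact congr($h1 ⟨x, hx⟩)
    · intro h1
      refine LinearMap.ext fun x => ?_
      exact D.wordPairing_eq_zero hc hf' congr(($h1 : TensorAlgebra R E')) x.2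
  have hrange : LinearMap.range m.dualMap = LinearMap.range α := by
    apply le_antisymm
    · rintro _ ⟨φ, rfl⟩
      obtain ⟨ψ, hψ⟩ := (S.isSummand_cols hS hA hP hc).exists_extend (m.dualMap φ)
      obtain ⟨f, hf, hf'⟩ := (D.pair_ones c.sum).exists_eq ψ
      have hw := S.cols_le_words hc
      rw [S.lets_eq] at hw
      have h1 : ∀ x (hx : x ∈ S.cols c), wordPairing D.b f x = φ (m ⟨x, hx⟩) := fun x hx =>
        (hf' ⟨x, hw hx⟩).trans (hψ x hx (hw hx))
      refine ⟨⟨f, (hK f).mpr ⟨hf, fun x hx => ?_⟩⟩, LinearMap.ext fun x => h1 x x.2⟩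
      rw [h1 x (hmerge hx)]
      convert map_zero φ
      exact Subtype.ext ((hmD _).trans (S.merged_le_ker hS hA h hx))
    · rintro _ ⟨⟨f, hf⟩, rfl⟩
      obtain ⟨s, hs⟩ := m.exists_rightInverse_of_surjective (LinearMap.range_eq_top.mpr hm)
      have hs' : ∀ y, m (s y) = y := fun y => congr($hs y)
      refine ⟨wordPairing D.b f ∘ₗ (S.cols c).subtype ∘ₗ s, LinearMap.ext fun x => ?_⟩
      have h1 := ((hK f).mp hf).2 (s (m x) - x : S.cols c)
        (S.cols_inf_ker_le hS hA h ⟨Subtype.property _, ?_⟩)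
      · rw [Submodule.coe_sub, map_sub, sub_eq_zero] at h1
        exact h1
      · rw [SetLike.mem_coe, LinearMap.mem_ker, ← hmD, map_sub, hs', sub_self, Submodule.coe_zero]
  have hinj : Function.Injective m.dualMap := LinearMap.dualMap_injective_of_surjective hm
  let Φ := (LinearEquiv.ofInjective m.dualMap hinj).trans <| (LinearEquiv.ofEq _ _ hrange).trans <|
    α.quotKerEquivRange.symm.trans <| (Submodule.quotEquivOfEq _ _ hker).trans <|
    β.quotKerEquivOfSurjective hβs
  refine ⟨Φ, fun φ f x y hf hΦ hx hy => ?_⟩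
  obtain ⟨k, hk1, hk2⟩ : ∃ k, Φ φ = β k ∧ m.dualMap φ = α k := by
    obtain ⟨k, hk⟩ : m.dualMap φ ∈ LinearMap.range α := hrange ▸ ⟨φ, rfl⟩
    refine ⟨k, ?_, hk.symm⟩
    have : LinearEquiv.ofEq _ _ hrange (LinearEquiv.ofInjective m.dualMap hinj φ) =
        α.quotKerEquivRange (Submodule.Quotient.mk k) := Subtype.ext hk.symm
    simp only [Φ, LinearEquiv.trans_apply, this, LinearEquiv.symm_apply_apply]
    rfl
  have h1 : wordPairing D.b (f - k) x = 0 := by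
    refine D.wordPairing_eq_zero hc (sub_mem hf ((hK _).mp k.2).1) ?_ hx
    rw [map_sub, ← hΦ, hk1, sub_eq_zero]
    rfl
  rw [map_sub, LinearMap.sub_apply, sub_eq_zero] at h1
  have h2 : y = m ⟨x, hx⟩ := Subtype.ext (hy.trans (hmD ⟨x, hx⟩).symm)
  rw [h2, h1]
  exact congr($hk2 ⟨x, hx⟩)

end DualSystem

/-! ### Columns of ribbons -/

namespace IsConjugate

variable {ρ c : List ℕ}

/-- Making the first column longer by a new first row. -/
theorem one_cons (h : IsConjugate ρ c) : IsConjugate (1 :: ρ) (c.modifyHead (· + 1)) := by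
  induction h with
  | column d => exact .column (d + 1)
  | @snoc σ c b d h ih =>
    obtain ⟨e, c, rfl⟩ := List.exists_cons_of_ne_nil h.ne_nil_right
    exact .snoc (σ := 1 :: σ) d ih

/-- Making the first row longer by a new first column. -/
theorem succ_cons {b : ℕ} {τ : List ℕ} (h : IsConjugate (b :: τ) c) :
    IsConjugate ((b + 1) :: τ) (1 :: c) := by
  generalize hρ : b :: τ = ρ at h
  induction h generalizing b τ with
  | column d =>
    rw [List.replicate_succ] at hρ
    obtain ⟨rfl, rfl⟩ := List.cons.inj hρ
    exact .snoc (σ := []) d (.column 0)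
  | @snoc σ c b' d h ih =>
    cases σ with
    | nil =>
      obtain ⟨rfl, rfl⟩ := List.cons.inj hρ
      exact .snoc (σ := []) d (ih rfl)
    | cons s σ =>
      obtain ⟨rfl, rfl⟩ := List.cons.inj hρ
      exact .snoc (σ := (b + 1) :: σ) d (ih rfl)

theorem add_cons {b : ℕ} {τ : List ℕ} (h : IsConjugate (b :: τ) c) (k : ℕ) :
    IsConjugate ((b + k) :: τ) (List.replicate k 1 ++ c) := by
  induction k with
  | zero => exact h
  | succ k ih => exact ih.succ_cons

theorem snoc_add {σ : List ℕ} {b : ℕ} (h : IsConjugate (σ ++ [b]) c) (k : ℕ) :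
    IsConjugate (σ ++ [b + k]) (c ++ List.replicate k 1) := by
  induction k with
  | zero => simpa using h
  | succ k ih =>
    rw [List.replicate_succ', ← List.append_assoc]
    exact .snoc 0 ih

end IsConjugate

theorem isConjugate_columns {ρ : List ℕ} (h : ρ ≠ []) (hρ : Pos ρ) :
    IsConjugate ρ (columns ρ) := by
  induction ρ with
  | nil => exact absurd rfl h
  | cons a l ih =>
    obtain ⟨a, rfl⟩ : ∃ j, a = 1 + j := ⟨a - 1, by have := hρ a (by simp); omega⟩
    cases l with
    | nil =>
      have := (IsConjugate.column 0).add_cons (b := 1) (τ := []) a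
      rw [columns, add_comm, List.replicate_succ']
      rwa [add_comm] at this
    | cons b l =>
      rw [columns, Nat.add_sub_cancel_left]
      exact (ih (by simp) fun x hx => hρ x (by simp [hx])).one_cons.add_cons a

theorem isConjugate_columns_reverse {ρ : List ℕ} (h : ρ ≠ []) (hρ : Pos ρ) :
    IsConjugate ρ.reverse (transpose ρ) := by
  unfold transpose
  induction ρ with
  | nil => exact absurd rfl h
  | cons a l ih =>
    cases l with
    | nil =>
      have := isConjugate_columns (ρ := [a]) (by simp) hρ
      rw [columns] at this ⊢
      rwa [List.reverse_replicate, List.reverse_singleton]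
    | cons b l =>
      obtain ⟨a, rfl⟩ : ∃ j, a = 1 + j := ⟨a - 1, by have := hρ a (by simp); omega⟩
      have h1 := ih (by simp) fun x hx => hρ x (by simp [hx])
      obtain ⟨e, c, hc⟩ := List.exists_cons_of_ne_nil (List.reverse_ne_nil_iff.mp h1.ne_nil_right)
      rw [hc] at h1
      have h2 := (h1.extend List.reverse_cons 1).snoc_add a
      rw [columns, Nat.add_sub_cancel_left, hc, List.modifyHead_cons, List.reverse_append,
        List.reverse_replicate, List.reverse_cons (a := 1 + a), List.reverse_cons (a := e + 1)]
      exact h2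

/-! ### Reversed words of blocks -/

section Reversal

variable {R : Type*} [CommRing R] {E : Type*} [AddCommGroup E] [Module R E]
  {mul : E →ₗ[R] E →ₗ[R] E}

theorem blockMul_append_mul {s : List ℕ} (hs : Pos s) (t : List ℕ) {u : TensorAlgebra R E}
    (hu : u ∈ degPart R E s.sum) (w : TensorAlgebra R E) :
    blockMul mul 0 (s ++ t) (u * w) = blockMul mul 0 s u * blockMul mul 0 t w := by
  induction s generalizing u with
  | nil =>
    obtain ⟨r, rfl⟩ := Submodule.mem_one.mp (by simpa [degPart] using hu)
    simp [Algebra.algebraMap_eq_smul_one, blockMul]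
  | cons d s ih =>
    rw [List.sum_cons, degPart, pow_add] at hu
    refine Submodule.mul_induction_on hu (fun x hx y hy => ?_) fun x y hx hy => by
      rw [add_mul, map_add, map_add, hx, hy, add_mul]
    obtain ⟨e, -, he⟩ := exists_blockMul_cons (mul := mul) (hs d (by simp)) hx
    rw [List.cons_append, mul_assoc, he, he, ih (fun x hx => hs x (by simp [hx])) hy, mul_assoc]

variable (assoc : ∀ x y z, mul (mul x y) z = mul x (mul y z))
include assoc

theorem rev_blockMul_singleton {d : ℕ} {w : TensorAlgebra R E} (hw : w ∈ degPart R E (d + 1)) :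
    rev R E (blockMul mul 0 [d + 1] w) = blockMul mul.flip 0 [d + 1] (rev R E w) := by
  induction d generalizing w with
  | zero => simp [blockMul]
  | succ d ih =>
    have h1 := blockMul_snoc_mul_glue assoc (s := []) (List.forall_mem_nil _) d
    simp only [List.nil_append, List.sum_nil, zero_add] at h1
    have h2 : rev R E (glue mul d w) = glue mul.flip 0 (rev R E w) :=
      (glue_rev mul.flip (k := d + 2) (by omega) hw).symm
    rw [h1, Module.End.mul_apply, ih (glue_mem_degPart mul hw d), h2, blockMul_singleton,
      blockMul_singleton]
    simp only [Nat.add_sub_cancel]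
    rw [pow_succ, Module.End.mul_apply]

theorem rev_blockMul {s : List ℕ} (hs : Pos s) {w : TensorAlgebra R E}
    (hw : w ∈ degPart R E s.sum) :
    rev R E (blockMul mul 0 s.reverse w) = blockMul mul.flip 0 s (rev R E w) := by
  induction s generalizing w with
  | nil => rfl
  | cons d s ih =>
    have hs' : Pos s := fun x hx => hs x (by simp [hx])
    obtain ⟨d, rfl⟩ : ∃ j, d = j + 1 := ⟨d - 1, by have := hs d (by simp); omega⟩
    rw [List.sum_cons, add_comm, degPart, pow_add] at hw
    refine Submodule.mul_induction_on hw (fun x hx y hy => ?_) fun x y hx hy => by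
      simp only [map_add, hx, hy]
    rw [List.reverse_cons, blockMul_append_mul (fun x hx => hs' x (by simpa using hx)) _ (by
      rw [List.sum_reverse]; exact hx), rev_mul, rev_mul, ih hs' hx,
      rev_blockMul_singleton assoc hy]
    obtain ⟨e, he, he'⟩ := exists_blockMul_cons (mul := mul.flip) d.succ_pos (rev_mem_degPart hy)
    rw [he', he]

end Reversal

theorem IsBoundary.reverse {ρ : List ℕ} (hρ : Pos ρ) {p : ℕ} (h : IsBoundary ρ p) :
    ∃ q, IsBoundary ρ.reverse q ∧ p + q + 2 = ρ.sum := by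
  obtain ⟨i, hi, hi', hp⟩ := h
  have h1 : (ρ.take i).sum + (ρ.drop i).sum = ρ.sum := List.sum_take_add_sum_drop ρ i
  have h2 : 0 < (ρ.drop i).sum :=
    List.sum_pos _ (fun x hx => hρ x (List.mem_of_mem_drop hx)) (by simpa using hi')
  refine ⟨(ρ.drop i).sum - 1, ⟨ρ.length - i, by omega, by simp; omega, ?_⟩, by omega⟩
  rw [List.take_reverse, List.sum_reverse, Nat.sub_sub_self (by omega)]
  omega

section Spell

variable {R V V' E E' : Type*} [CommRing R] [AddCommGroup V] [Module R V] [AddCommGroup V']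
  [Module R V'] [AddCommGroup E] [Module R E] [AddCommGroup E'] [Module R E']

theorem spell_tprod (e : V →ₗ[R] E) {n : ℕ} (v : Fin n → V) :
    spell e (PiTensorProduct.tprod R v) =
      (List.ofFn fun i => TensorAlgebra.ι R (e (v i))).prod := by
  rw [spell, LinearMap.comp_apply, TensorPower.toTensorAlgebra_tprod, TensorAlgebra.tprod_apply]
  simp [map_list_prod, Function.comp_def, List.map_ofFn]

theorem rev_prod (l : List E) :
    rev R E (l.map (TensorAlgebra.ι R)).prod = (l.reverse.map (TensorAlgebra.ι R)).prod := by
  induction l with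
  | nil => simp
  | cons a l ih => simp [ih]

theorem wordPairing_prod (b : E' →ₗ[R] Module.Dual R E) {n : ℕ} (u : Fin n → E') (v : Fin n → E) :
    wordPairing b (List.ofFn fun i => TensorAlgebra.ι R (u i)).prod
      (List.ofFn fun i => TensorAlgebra.ι R (v i)).prod = ∏ i, b (u i) (v i) := by
  induction n with
  | zero => simp
  | succ n ih => simp [List.ofFn_succ, Fin.prod_univ_succ, ih]

theorem rev_prod_ofFn {n : ℕ} (v : Fin n → E) :
    rev R E (List.ofFn fun i => TensorAlgebra.ι R (v i)).prod =
      (List.ofFn fun i => TensorAlgebra.ι R (v (Fin.rev i))).prod := by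
  have h1 : (List.ofFn fun i => TensorAlgebra.ι R (v i)) =
      (List.ofFn v).map (TensorAlgebra.ι R) := by
    rw [List.map_ofFn]; rfl
  have h2 : (List.ofFn fun i => TensorAlgebra.ι R (v (Fin.rev i))) =
      (List.ofFn v).reverse.map (TensorAlgebra.ι R) := by
    refine List.ext_getElem (by simp) fun i h1 h2 => ?_
    simp only [List.getElem_ofFn, List.getElem_map, List.getElem_reverse, List.length_ofFn]
    congr 2
    exact Fin.ext (by simp [Fin.val_rev]; omega)
  rw [h1, h2, rev_prod]

theorem revPairing_tprod (ev : V' →ₗ[R] Module.Dual R V) {n : ℕ} (f : Fin n → V') (v : Fin n → V) :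
    revPairing ev n (PiTensorProduct.tprod R f) (PiTensorProduct.tprod R v) =
      ∏ i, ev (f (Fin.rev i)) (v i) := by
  simp [revPairing, PiTensorProduct.dualDistrib_apply]

variable {b : E' →ₗ[R] Module.Dual R E} {e : V →ₗ[R] E} {e' : V' →ₗ[R] E'}
  {ev : V' →ₗ[R] Module.Dual R V} (hb : ∀ v' v, b (e' v') (e v) = ev v' v) {n : ℕ}
include hb

theorem wordPairing_rev_spell (f : ⨂[R]^n V') (x : ⨂[R]^n V) :
    wordPairing b (rev R E' (spell e' f)) (spell e x) = revPairing ev n f x := by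
  have : (((wordPairing b ∘ₗ rev R E' ∘ₗ spell e' : ⨂[R]^n V' →ₗ[R] _)).compl₂
      (spell e : ⨂[R]^n V →ₗ[R] _)) = revPairing ev n := by
    refine PiTensorProduct.ext (MultilinearMap.ext fun f => ?_)
    refine PiTensorProduct.ext (MultilinearMap.ext fun v => ?_)
    simp only [LinearMap.compMultilinearMap_apply, LinearMap.compl₂_apply, LinearMap.comp_apply]
    rw [spell_tprod, spell_tprod, rev_prod_ofFn, wordPairing_prod, revPairing_tprod]
    exact Finset.prod_congr rfl fun i _ => hb _ _
  exact congr($this f x)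

theorem wordPairing_spell_rev (f : ⨂[R]^n V') (x : ⨂[R]^n V) :
    wordPairing b (spell e' f) (rev R E (spell e x)) = revPairing ev n f x := by
  have : (((wordPairing b ∘ₗ spell e' : ⨂[R]^n V' →ₗ[R] _)).compl₂
      (rev R E ∘ₗ spell e : ⨂[R]^n V →ₗ[R] _)) = revPairing ev n := by
    refine PiTensorProduct.ext (MultilinearMap.ext fun f => ?_)
    refine PiTensorProduct.ext (MultilinearMap.ext fun v => ?_)
    simp only [LinearMap.compMultilinearMap_apply, LinearMap.compl₂_apply, LinearMap.comp_apply]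
    rw [spell_tprod, spell_tprod, rev_prod_ofFn, wordPairing_prod, revPairing_tprod]
    rw [← Equiv.prod_comp Fin.revPerm]
    refine Finset.prod_congr rfl fun i _ => ?_
    rw [hb]
    simp
  exact congr($this f x)

end Spell

/-! ### Canonical isomorphisms -/

namespace DualSystem

variable {R E E' V V' : Type*} [CommRing R] [AddCommGroup E] [Module R E]
  [AddCommGroup E'] [Module R E'] [AddCommGroup V] [Module R V] [AddCommGroup V'] [Module R V']
  {S : RightSystem R E} (D : DualSystem S E') (hS : S.MergesOnes) (hA : S.alg.MergesOnes)
  (hP : S.IsProjective) {ρ c : List ℕ} (h : IsConjugate ρ c)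
  {mul : E →ₗ[R] E →ₗ[R] E} {mul' : E' →ₗ[R] E' →ₗ[R] E'}
  {e : V →ₗ[R] E} {e' : V' →ₗ[R] E'} {ev : V' →ₗ[R] Module.Dual R V}
  (hb : ∀ v' v, D.b (e' v') (e v) = ev v' v) {n : ℕ} {U : List (Submodule R E)}
  {U' : List (Submodule R E')} {s s' : List ℕ} {X : Submodule R (TensorAlgebra R E)}
  {Y : Submodule R (TensorAlgebra R E')}
include hS hA hP h hb

/-- The canonical isomorphism when the words of the dual system are read from right to left. -/
theorem exists_isCanonicalDual_of_rev (hm : mul = S.mul) (hm' : mul' = D.mul.flip) (hn : n = c.sum)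
    (hU : U = S.lets (List.replicate n 1))
    (hU' : U' = (lettersOf D.Mo D.L (List.replicate n 1)).reverse) (hs : s = ρ)
    (hs' : s' = c.reverse) (hX : X = S.rib ρ)
    (hY : Y = ribbon mul' (lettersOf D.Mo D.L c).reverse) :
    ∃ Φ : Module.Dual R X ≃ₗ[R] Y, IsCanonicalDual mul mul' e e' ev n U U' s s' Φ := by
  subst hm hm' hn hU hU' hs hs' hX hY
  obtain ⟨Φ, hΦ⟩ := D.exists_dual hS hA hP h
  refine ⟨Φ.trans <| (Submodule.equivMapOfInjective (rev R E') rev_injective _).trans <|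
    LinearEquiv.ofEq _ _ (map_rev_ribbon D.mul.flip _), fun x f hx hf hx0 _ y φ hy hφ => ?_⟩
  have hf' : rev R E' (spell e' f) ∈ ones D.Mo D.L c.sum := by
    rw [← mem_map_rev, map_rev_words]; exact hf
  rw [hΦ φ (rev R E' (spell e' f)) (spell e x) y hf' ?_ (S.mem_cols_of_boundary hA h hx hx0) hy,
    wordPairing_rev_spell hb]
  have h1 := rev_blockMul D.assoc (s := c.reverse) (w := rev R E' (spell e' f))
    (fun x hx => h.pos_right x (by simpa using hx))
    (by rw [List.sum_reverse]; exact ones_le_degPart _ _ _ hf')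
  rw [List.reverse_reverse, rev_rev, ← hφ] at h1
  exact (rev_injective h1).symm

/-- The canonical isomorphism when the words of the system are read from right to left. -/
theorem exists_isCanonicalDual_of_rev_left (hm : mul = S.mul.flip) (hm' : mul' = D.mul)
    (hn : n = c.sum) (hU : U = (S.lets (List.replicate n 1)).reverse)
    (hU' : U' = lettersOf D.Mo D.L (List.replicate n 1)) (hs : s = ρ.reverse) (hs' : s' = c)
    (hX : X = (S.rib ρ).map (rev R E)) (hY : Y = ribbon mul' (lettersOf D.Mo D.L c)) :
    ∃ Φ : Module.Dual R X ≃ₗ[R] Y, IsCanonicalDual mul mul' e e' ev n U U' s s' Φ := by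
  subst hm hm' hn hU hU' hs hs' hX hY
  obtain ⟨Φ, hΦ⟩ := D.exists_dual hS hA hP h
  let r := Submodule.equivMapOfInjective (rev R E) rev_injective (S.rib ρ)
  refine ⟨r.dualMap.trans Φ, fun x f hx hf hx0 _ y φ hy hφ => ?_⟩
  have hx' : rev R E (spell e x) ∈ words (S.lets (List.replicate s'.sum 1)) := by
    rw [← mem_map_rev, map_rev_words]; exact hx
  have hxd := S.words_le_degPart _ hx'
  rw [List.length_replicate] at hxd
  replace hxd := le_of_eq (congrArg (degPart R E) h.sum_eq.symm) hxd
  obtain ⟨y, rfl⟩ := r.surjective y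
  have h1 := rev_blockMul S.assoc (s := ρ.reverse)
    (fun x hx => h.pos_left x (by simpa using hx)) (by rwa [List.sum_reverse])
  rw [List.reverse_reverse, rev_rev, ← hy] at h1
  rw [← wordPairing_spell_rev hb]
  refine hΦ (r.dualMap φ) (spell e' f) _ y hf hφ (S.mem_cols_of_boundary hA h hx' fun p hp => ?_)
    (rev_injective h1).symm
  obtain ⟨q, hq, hpq⟩ := hp.reverse h.pos_left
  have := glue_rev S.mul hpq (x := spell e x) (by simpa using rev_mem_degPart hxd)
  rw [this, hx0 q hq, map_zero]

end DualSystem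

/-! ### Quadratic presentations -/

section RevLift

variable {R V' C E' : Type*} [CommRing R] [AddCommGroup V'] [Module R V'] [Ring C] [Algebra R C]
  [AddCommGroup E'] [Module R E']

/-- The anti-homomorphism `T(V') → C` extending a linear map `V' → C`. -/
def revLift (ι : V' →ₗ[R] C) : TensorAlgebra R V' →ₗ[R] C :=
  (TensorAlgebra.lift R ι).toLinearMap ∘ₗ rev R V'

variable (ι : V' →ₗ[R] C)

@[simp] theorem revLift_one : revLift ι 1 = 1 := by simp [revLift]

@[simp] theorem revLift_ι (f : V') : revLift ι (TensorAlgebra.ι R f) = ι f := by simp [revLift]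

@[simp] theorem revLift_mul (x y : TensorAlgebra R V') :
    revLift ι (x * y) = revLift ι y * revLift ι x := by simp [revLift]

/-- `C` is the quotient of `T(V')` by the relations `N`, with the order of the factors reversed. -/
structure IsPresentedBy (N : Set (TensorAlgebra R V')) : Prop where
  surjective : Function.Surjective (revLift ι)
  rel : ∀ F ∈ N, revLift ι F = 0
  eq_zero : ∀ Φ : Module.Dual R (TensorAlgebra R V'), (∀ u, ∀ F ∈ N, ∀ v, Φ (u * F * v) = 0) →
    ∀ F, revLift ι F = 0 → Φ F = 0

variable {ι}

theorem IsPresentedBy.exists_eq {N : Set (TensorAlgebra R V')} (h : IsPresentedBy ι N)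
    {P : Type*} [AddCommGroup P] [Module R P] (Φ : P →ₗ[R] Module.Dual R (TensorAlgebra R V'))
    (hΦ : ∀ p u, ∀ F ∈ N, ∀ v, Φ p (u * F * v) = 0) :
    ∃ η : C →ₗ[R] Module.Dual R P, ∀ F p, η (revLift ι F) p = Φ p F := by
  let q := (revLift ι).quotKerEquivOfSurjective h.surjective
  refine ⟨(LinearMap.ker (revLift ι)).liftQ Φ.flip (fun F hF => LinearMap.ext fun p =>
    h.eq_zero (Φ p) (hΦ p) F hF) ∘ₗ q.symm.toLinearMap, fun F p => ?_⟩
  have : q.symm (revLift ι F) = Submodule.Quotient.mk F := by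
    rw [LinearEquiv.symm_apply_eq]; rfl
  rw [LinearMap.comp_apply, LinearEquiv.coe_coe, this]
  rfl

/-- Multiplying a word of the algebra to a letter `k x`, where `k` is compatible with the action. -/
theorem glue_pow_wordMap {mul' : E' →ₗ[R] E' →ₗ[R] E'} {e' : V' →ₗ[R] E'} {k : C →ₗ[R] E'}
    (hk : ∀ x f, mul' (k x) (e' f) = k (ι f * x)) {d : ℕ} {F : TensorAlgebra R V'}
    (hF : F ∈ degPart R V' d) (x : C) :
    (glue mul' 0 ^ d) (TensorAlgebra.ι R (k x) * wordMap e' F) =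
      TensorAlgebra.ι R (k (revLift ι F * x)) := by
  induction d generalizing F x with
  | zero =>
    obtain ⟨r, rfl⟩ := Submodule.mem_one.mp (by simpa [degPart] using hF)
    simp [Algebra.algebraMap_eq_smul_one]
  | succ d ih =>
    induction hF using degPart_induction with
    | hadd x y _ _ hx hy => simp only [map_add, mul_add, add_mul, hx, hy]
    | hc f w hw =>
      rw [pow_succ, Module.End.mul_apply, map_mul (wordMap e'), wordMap_ι, glue_zero_cons, hk,
        ih hw, revLift_mul, revLift_ι, mul_assoc]

theorem blockMul_wordMap {mul' : E' →ₗ[R] E' →ₗ[R] E'} {j : C →ₗ[R] E'}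
    (hj : ∀ x f, mul' (j x) (j (ι f)) = j (ι f * x)) {d : ℕ} {F : TensorAlgebra R V'}
    (hF : F ∈ degPart R V' (d + 1)) :
    blockMul mul' 0 [d + 1] (wordMap (j ∘ₗ ι) F) = TensorAlgebra.ι R (j (revLift ι F)) := by
  rw [blockMul_singleton, Nat.add_sub_cancel]
  induction hF using degPart_induction with
  | hadd x y _ _ hx hy => simp only [map_add, hx, hy]
  | hc f w hw =>
    have := glue_pow_wordMap (e' := j ∘ₗ ι) hj hw (ι f)
    rw [map_mul, wordMap_ι, LinearMap.comp_apply, this, revLift_mul, revLift_ι]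

end RevLift

section PairingLemmas

variable {R V' E E' : Type*} [CommRing R] [AddCommGroup V'] [Module R V'] [AddCommGroup E]
  [Module R E] [AddCommGroup E'] [Module R E']

theorem wordPairing_wordMap (b : E' →ₗ[R] Module.Dual R E) (e' : V' →ₗ[R] E')
    (F : TensorAlgebra R V') : wordPairing b (wordMap e' F) = wordPairing (b ∘ₗ e') F := by
  induction F using cons_induction with
  | h0 => simp
  | h1 => simp [wordPairing]
  | hc f w hw => rw [map_mul, wordMap_ι, wordPairing_cons, wordPairing_cons, hw]; rfl
  | hadd x y hx hy => simp [hx, hy]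
  | hsmul r x hx => simp [hx]

theorem wordPairing_mul_eq_zero {b : E' →ₗ[R] Module.Dual R E} {k l : ℕ} (h : l < k)
    {f : TensorAlgebra R E'} (hf : f ∈ degPart R E' k) {x : TensorAlgebra R E}
    (hx : x ∈ degPart R E l) (g : TensorAlgebra R E') : wordPairing b (f * g) x = 0 := by
  induction k generalizing f x l with
  | zero => omega
  | succ k ih =>
    induction hf using degPart_induction with
    | hadd x y _ _ hx hy => rw [add_mul, map_add, LinearMap.add_apply, hx, hy, add_zero]
    | hc e' f hf =>
      rw [mul_assoc, wordPairing_cons]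
      cases l with
      | zero =>
        obtain ⟨r, rfl⟩ := Submodule.mem_one.mp (by simpa [degPart] using hx)
        simp [Algebra.algebraMap_eq_smul_one]
      | succ l =>
        induction hx using degPart_induction with
        | hadd x y _ _ hx hy => rw [map_add, hx, hy, add_zero]
        | hc e w hw => rw [consFun_cons, ih (by omega) hf hw, mul_zero]

/-- Words in the relations of the dual annihilate the columns. -/
theorem RightSystem.wordPairing_rel_mul {S : RightSystem R E} (hS : S.MergesOnes)
    (hA : S.alg.MergesOnes) {b : E' →ₗ[R] Module.Dual R E} {r : TensorAlgebra R E'}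
    (hr : r ∈ degPart R E' 2) (h0 : ∀ x ∈ S.col 2, wordPairing b r x = 0)
    (w : TensorAlgebra R E') {d : ℕ} {ξ : TensorAlgebra R E} (hξ : ξ ∈ S.col d) :
    wordPairing b (r * w) ξ = 0 := by
  have h2 : ∀ d, S.col d ≤ degPart R E d := fun d => by
    simpa using S.rib_le_degPart (List.replicate d 1)
  rcases lt_or_ge d 2 with hd | hd
  · exact wordPairing_mul_eq_zero hd hr (h2 d hξ) w
  · obtain ⟨d, rfl⟩ := Nat.exists_eq_add_of_le hd
    refine Submodule.mul_induction_on (S.col_add_le hS hA two_pos hξ) (fun u hu v _ => ?_)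
      fun x y hx hy => by rw [map_add, hx, hy, add_zero]
    rw [wordPairing_mul_mul hr (h2 2 hu), h0 u hu, zero_mul]

/-- The quadratic relations dual to those of the algebra of a system. -/
def RightSystem.dualRels (S : RightSystem R E) (β : V' →ₗ[R] Module.Dual R E) :
    Set (TensorAlgebra R V') :=
  {F | F ∈ degPart R V' 2 ∧ ∀ x ∈ S.alg.col 2, wordPairing β F x = 0}

theorem RightSystem.wordPairing_mul_rel_mul {S : RightSystem R E} (hA : S.alg.MergesOnes)
    {β : V' →ₗ[R] Module.Dual R E} (u : TensorAlgebra R V') {F : TensorAlgebra R V'}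
    (hF : F ∈ S.dualRels β) (v : TensorAlgebra R V') {d : ℕ} {ξ : TensorAlgebra R E}
    (hξ : ξ ∈ S.alg.col d) : wordPairing β (u * F * v) ξ = 0 := by
  induction u using cons_induction generalizing d ξ with
  | h0 => simp
  | h1 => rw [one_mul]; exact S.alg.wordPairing_rel_mul hA hA hF.1 hF.2 v hξ
  | hc f w hw =>
    rw [mul_assoc, mul_assoc, wordPairing_cons, ← mul_assoc]
    cases d with
    | zero =>
      have h1 := S.alg.rib_le_degPart _ hξ
      obtain ⟨r, rfl⟩ := Submodule.mem_one.mp (by simpa [degPart] using h1)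
      simp [Algebra.algebraMap_eq_smul_one]
    | succ d =>
      rw [add_comm] at hξ
      refine Submodule.mul_induction_on (S.alg.col_add_le hA hA one_pos hξ) (fun a ha y hy => ?_)
        fun x y hx hy => by rw [map_add, hx, hy, add_zero]
      unfold col at ha
      rw [List.replicate_one, rib_singleton] at ha
      obtain ⟨a, -, rfl⟩ := ha
      rw [consFun_cons, hw hy, mul_zero]
  | hadd x y hx hy => rw [add_mul, add_mul, map_add, LinearMap.add_apply, hx hξ, hy hξ, add_zero]
  | hsmul r x hx =>
    rw [smul_mul_assoc, smul_mul_assoc, map_smul, LinearMap.smul_apply, hx hξ, smul_zero]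

end PairingLemmas

/-! ### Dual systems from presentations -/

theorem words_replicate_top {R V : Type*} [CommRing R] [AddCommGroup V] [Module R V] (d : ℕ) :
    words (List.replicate d (⊤ : Submodule R V)) = degPart R V d := by
  rw [words, List.map_replicate, List.prod_replicate, Submodule.map_top]

/-- A finitely generated projective module and its dual have finite dual bases. -/
theorem isDualPair_range {R V E E' : Type*} [CommRing R] [AddCommGroup V] [Module R V]
    [AddCommGroup E] [Module R E] [AddCommGroup E'] [Module R E'] [Module.Finite R V]
    [Module.Projective R V] {b : E' →ₗ[R] Module.Dual R E} {e : V →ₗ[R] E}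
    {e' : Module.Dual R V →ₗ[R] E'} (hb : ∀ f v, b (e' f) (e v) = f v) :
    IsDualPair b (LinearMap.range e') (LinearMap.range e) := by
  obtain ⟨n, p, hp⟩ := Module.Finite.exists_fin' R V
  obtain ⟨s, hs⟩ := p.exists_rightInverse_of_surjective (LinearMap.range_eq_top.mpr hp)
  have hs' : ∀ v, v = ∑ i, s v i • p (Pi.single i 1) := fun v => by
    conv_lhs => rw [← LinearMap.id_apply (R := R) v, ← hs, LinearMap.comp_apply,
      pi_eq_sum_univ' (s v), map_sum]
    simp only [map_smul]
  refine ⟨n, fun i => e' (LinearMap.proj i ∘ₗ s), fun i => e (p (Pi.single i 1)),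
    fun i => ⟨_, rfl⟩, fun i => ⟨_, rfl⟩, ?_, ?_⟩
  · rintro _ ⟨v, rfl⟩
    simp only [hb, LinearMap.comp_apply, LinearMap.proj_apply]
    conv_lhs => rw [hs' v]
    simp
  · rintro _ ⟨f, rfl⟩
    have : f = ∑ i, f (p (Pi.single i 1)) • (LinearMap.proj i ∘ₗ s : Module.Dual R V) := by
      refine LinearMap.ext fun v => ?_
      conv_lhs => rw [hs' v]
      simp [mul_comm]
    simp only [hb]
    conv_lhs => rw [this]
    simp

section AlgebraPart

variable {R V' C E E' : Type*} [CommRing R] [AddCommGroup V'] [Module R V'] [Ring C] [Algebra R C]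
  [AddCommGroup E] [Module R E] [AddCommGroup E'] [Module R E'] {S : RightSystem R E}
  {b : E' →ₗ[R] Module.Dual R E} {ι : V' →ₗ[R] C} {j : C →ₗ[R] E'}
  {mul' : E' →ₗ[R] E' →ₗ[R] E'} (hj : ∀ x f, mul' (j x) (j (ι f)) = j (ι f * x))
  {L' : ℕ → Submodule R E'}
  (hL : ∀ d, 0 < d → L' d = ((degPart R V' d).map (revLift ι)).map j)

section
include hL

theorem dual_piece_one : L' 1 = LinearMap.range (j ∘ₗ ι) := by
  rw [hL 1 one_pos, degPart, pow_one, LinearMap.range_comp, ← LinearMap.range_comp]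
  congr 2
  exact LinearMap.ext fun f => revLift_ι ι f

theorem dual_ones (d : ℕ) :
    ones L' L' d = (degPart R V' d).map (wordMap (j ∘ₗ ι)).toLinearMap := by
  rw [← words_replicate_top, map_wordMap_words, ones, lettersOf_self, List.map_replicate,
    List.map_replicate, dual_piece_one hL, Submodule.map_top]

include hj

theorem dual_gen (d : ℕ) (hd : 0 < d) :
    (ones L' L' d).map (blockMul mul' 0 [d]) = (L' d).map (TensorAlgebra.ι R) := by
  obtain ⟨d, rfl⟩ : ∃ k, d = k + 1 := ⟨d - 1, by omega⟩
  rw [dual_ones hL, hL _ hd]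
  ext x
  constructor
  · rintro ⟨_, ⟨F, hF, rfl⟩, rfl⟩
    exact ⟨_, ⟨_, ⟨F, hF, rfl⟩, rfl⟩, (blockMul_wordMap hj hF).symm⟩
  · rintro ⟨_, ⟨_, ⟨F, hF, rfl⟩, rfl⟩, rfl⟩
    exact ⟨_, ⟨F, hF, rfl⟩, blockMul_wordMap hj hF⟩

end

variable (hC : IsPresentedBy ι (S.dualRels (b ∘ₗ j ∘ₗ ι)))

theorem col_two_eq : S.col 2 = ones S.Mo S.L 2 ⊓ LinearMap.ker (glue S.mul 0) := by
  have : S.col 2 = ribbon S.mul (S.lets [1, 1]) := rfl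
  rw [this, ribbon, ones, ← S.lets_eq]
  refine congrArg _ (le_antisymm (iInf₂_le_of_le 0 (by simp [RightSystem.lets]) le_rfl)
    (le_iInf₂ fun p hp => ?_))
  obtain rfl : p = 0 := by simp [RightSystem.lets] at hp; omega
  exact le_rfl

include hL hj hC

/-- The relations of the dual algebra are the annihilators of the relations of the algebra. -/
theorem dual_rel (f : TensorAlgebra R E') (hf : f ∈ ones L' L' 2)
    (h0 : ∀ x ∈ ones S.L S.L 2, glue S.mul 0 x = 0 → wordPairing b f x = 0) :
    glue mul' 0 f = 0 := by
  rw [dual_ones hL] at hf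
  obtain ⟨F, hF, rfl⟩ := hf
  have h1 := blockMul_wordMap hj hF
  rw [blockMul_singleton, Nat.add_sub_cancel, pow_one] at h1
  refine h1.trans ?_
  rw [hC.rel F ⟨hF, fun x hx => ?_⟩, map_zero, map_zero]
  rw [col_two_eq] at hx
  rw [← wordPairing_wordMap]
  exact h0 x hx.1 hx.2

/-- A column element annihilates all words in the dual relations, and so defines a functional on the
dual algebra. -/
theorem dual_eval (hA : S.alg.MergesOnes) {r : E' →ₗ[R] C} (hr : ∀ c, r (j c) = c) (d : ℕ)
    (hd : 0 < d) (ξ : TensorAlgebra R E) (hξ : ξ ∈ S.alg.col d) :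
    ∃ η : Module.Dual R E', ∀ f ∈ ones L' L' d, ∀ e,
      blockMul mul' 0 [d] f = TensorAlgebra.ι R e → wordPairing b f ξ = η e := by
  obtain ⟨d, rfl⟩ : ∃ k, d = k + 1 := ⟨d - 1, by omega⟩
  obtain ⟨η, hη⟩ := hC.exists_eq (LinearMap.toSpanSingleton R _
    ((wordPairing (b ∘ₗ j ∘ₗ ι)).flip ξ)) fun p u F hF v => by
      simp [S.wordPairing_mul_rel_mul hA u hF v hξ]
  refine ⟨LinearMap.applyₗ 1 ∘ₗ η ∘ₗ r, fun f hf e he => ?_⟩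
  rw [dual_ones hL] at hf
  obtain ⟨F, hF, rfl⟩ := hf
  obtain rfl := (TensorAlgebra.ι_inj R _ _).mp ((blockMul_wordMap hj hF).symm.trans he)
  simp [hr, hη, wordPairing_wordMap]

end AlgebraPart

section ModulePart

variable {R V' G C E E' : Type*} [CommRing R] [AddCommGroup V'] [Module R V'] [AddCommGroup G]
  [Module R G] [Ring C] [Algebra R C]
  [AddCommGroup E] [Module R E] [AddCommGroup E'] [Module R E'] {S : RightSystem R E}
  {b : E' →ₗ[R] Module.Dual R E} {ι : V' →ₗ[R] C} {j : C →ₗ[R] E'} {k : C →ₗ[R] G →ₗ[R] E'}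
  {mul' : E' →ₗ[R] E' →ₗ[R] E'} 

/-- The word of `T(E')` corresponding to an element of `V' ⊗ G`. -/
def relWord (j : C →ₗ[R] E') (k : C →ₗ[R] G →ₗ[R] E') (ι : V' →ₗ[R] C) :
    V' ⊗[R] G →ₗ[R] TensorAlgebra R E' :=
  TensorProduct.lift ((LinearMap.mul R (TensorAlgebra R E')).compl₁₂ (TensorAlgebra.ι R ∘ₗ k 1)
    (TensorAlgebra.ι R ∘ₗ j ∘ₗ ι)).flip

@[simp] theorem relWord_tmul (f : V') (g : G) : relWord j k ι (f ⊗ₜ g) =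
    TensorAlgebra.ι R (k 1 g) * TensorAlgebra.ι R (j (ι f)) := by simp [relWord]

/-- The quadratic relations dual to those of the module of a system. -/
def RightSystem.dualModRels (S : RightSystem R E) (b : E' →ₗ[R] Module.Dual R E) (j : C →ₗ[R] E')
    (k : C →ₗ[R] G →ₗ[R] E') (ι : V' →ₗ[R] C) : Set (V' ⊗[R] G) :=
  {t | ∀ x ∈ S.col 2, wordPairing b (relWord j k ι t) x = 0}

/-- The image of `k` is the quotient of `C ⊗ G` by the relations `N`. -/
structure IsModPresentedBy (ι : V' →ₗ[R] C) (k : C →ₗ[R] G →ₗ[R] E') (N : Set (V' ⊗[R] G)) :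
    Prop where
  rel : ∀ t ∈ N, TensorProduct.lift (k ∘ₗ ι) t = 0
  desc : ∀ η : C →ₗ[R] Module.Dual R G,
    (∀ t ∈ N, ∀ c, TensorProduct.lift (η ∘ₗ LinearMap.mulLeft R c ∘ₗ ι) t = 0) →
    ∃ Ψ : Module.Dual R E', ∀ c g, Ψ (k c g) = η c g

variable {L' Mo' : ℕ → Submodule R E'} (hk : ∀ x g f, mul' (k x g) (j (ι f)) = k (ι f * x) g)
  (hL : ∀ d, 0 < d → L' d = ((degPart R V' d).map (revLift ι)).map j)
  (hMo : ∀ d, Mo' (d + 1) = Submodule.map₂ k ((degPart R V' d).map (revLift ι)) ⊤)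

section
include hMo

theorem dual_mod_one : Mo' 1 = LinearMap.range (k 1) := by
  have h := hMo 0
  rw [zero_add] at h
  rw [h]
  apply le_antisymm
  · refine Submodule.map₂_le.mpr ?_
    rintro _ ⟨F, hF, rfl⟩ g -
    obtain ⟨r, rfl⟩ := Submodule.mem_one.mp (by simpa [degPart] using hF)
    exact ⟨r • g, by simp [Algebra.algebraMap_eq_smul_one]⟩
  · rintro _ ⟨g, rfl⟩
    exact Submodule.apply_mem_map₂ _ ⟨1, one_mem_degPart, revLift_one ι⟩ trivial

include hL

theorem dual_mod_ones (d : ℕ) : ones Mo' L' (d + 1) =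
    (LinearMap.range (k 1)).map (TensorAlgebra.ι R) *
      (degPart R V' d).map (wordMap (j ∘ₗ ι)).toLinearMap := by
  rw [add_comm, ones_add _ _ one_pos, dual_ones hL, ← dual_mod_one hMo]
  simp [ones, lettersOf]

end

section
include hk

theorem blockMul_mod {d : ℕ} {F : TensorAlgebra R V'} (hF : F ∈ degPart R V' d) (g : G) :
    blockMul mul' 0 [d + 1] (TensorAlgebra.ι R (k 1 g) * wordMap (j ∘ₗ ι) F) =
      TensorAlgebra.ι R (k (revLift ι F) g) := by
  rw [blockMul_singleton, Nat.add_sub_cancel]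
  have := glue_pow_wordMap (ι := ι) (mul' := mul') (e' := j ∘ₗ ι) (k := k.flip g)
    (fun x f => hk x g f) hF 1
  rwa [mul_one] at this

include hL hMo

theorem dual_mod_gen (d : ℕ) (hd : 0 < d) :
    (ones Mo' L' d).map (blockMul mul' 0 [d]) = (Mo' d).map (TensorAlgebra.ι R) := by
  obtain ⟨d, rfl⟩ : ∃ k, d = k + 1 := ⟨d - 1, by omega⟩
  rw [dual_mod_ones hL hMo, hMo]
  apply le_antisymm
  · rw [Submodule.map_le_iff_le_comap]
    refine Submodule.mul_le.mpr ?_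
    rintro _ ⟨_, ⟨g, rfl⟩, rfl⟩ _ ⟨F, hF, rfl⟩
    exact ⟨_, Submodule.apply_mem_map₂ _ ⟨F, hF, rfl⟩ trivial, (blockMul_mod hk hF g).symm⟩
  · rw [Submodule.map_le_iff_le_comap]
    refine Submodule.map₂_le.mpr ?_
    rintro _ ⟨F, hF, rfl⟩ g -
    exact ⟨_, Submodule.mul_mem_mul ⟨_, ⟨g, rfl⟩, rfl⟩ ⟨F, hF, rfl⟩, blockMul_mod hk hF g⟩

variable (hM : IsModPresentedBy ι k (S.dualModRels b j k ι))
include hM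

theorem dual_mod_rel (f : TensorAlgebra R E') (hf : f ∈ ones Mo' L' 2)
    (h0 : ∀ x ∈ ones S.Mo S.L 2, glue S.mul 0 x = 0 → wordPairing b f x = 0) :
    glue mul' 0 f = 0 := by
  obtain ⟨t, rfl⟩ : f ∈ LinearMap.range (relWord j k ι) := by
    rw [dual_mod_ones hL hMo] at hf
    refine (Submodule.mul_le (P := LinearMap.range (relWord j k ι))).mpr ?_ hf
    rintro _ ⟨_, ⟨g, rfl⟩, rfl⟩ _ ⟨F, hF, rfl⟩
    rw [SetLike.mem_coe, degPart, pow_one] at hF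
    obtain ⟨f, rfl⟩ := hF
    exact ⟨f ⊗ₜ g, by simp⟩
  have h1 : glue mul' 0 ∘ₗ relWord j k ι = TensorAlgebra.ι R ∘ₗ TensorProduct.lift (k ∘ₗ ι) := by
    refine TensorProduct.ext' fun f g => ?_
    simp [glue_zero_cons_two, hk]
  refine congr($h1 t).trans ?_
  rw [LinearMap.comp_apply, hM.rel t fun x hx => ?_, map_zero]
  rw [col_two_eq] at hx
  exact h0 x hx.1 hx.2

/-- A column element of the module defines a functional on the dual module. -/
theorem dual_mod_eval (hC : IsPresentedBy ι (S.dualRels (b ∘ₗ j ∘ₗ ι))) (hS : S.MergesOnes)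
    (hA : S.alg.MergesOnes) (d : ℕ)
    (hd : 0 < d) (ξ : TensorAlgebra R E) (hξ : ξ ∈ S.col d) :
    ∃ η : Module.Dual R E', ∀ f ∈ ones Mo' L' d, ∀ e,
      blockMul mul' 0 [d] f = TensorAlgebra.ι R e → wordPairing b f ξ = η e := by
  obtain ⟨d, rfl⟩ : ∃ k, d = k + 1 := ⟨d - 1, by omega⟩
  let Φ : G →ₗ[R] Module.Dual R (TensorAlgebra R V') :=
    ((LinearMap.mul R (TensorAlgebra R E')).compl₁₂ (TensorAlgebra.ι R ∘ₗ k 1)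
      (wordMap (j ∘ₗ ι)).toLinearMap).compr₂ ((wordPairing b).flip ξ)
  have hΦ : ∀ g F, Φ g F = wordPairing b (TensorAlgebra.ι R (k 1 g) * wordMap (j ∘ₗ ι) F) ξ :=
    fun g F => rfl
  obtain ⟨η, hη⟩ := hC.exists_eq Φ fun g u F hF v => by
    rw [hΦ, wordPairing_cons, wordPairing_wordMap]
    rw [add_comm] at hξ
    refine Submodule.mul_induction_on (S.col_add_le hS hA one_pos hξ) (fun a ha y hy => ?_)
        fun x y hx hy => by rw [map_add, hx, hy, add_zero]
    unfold RightSystem.col at ha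
    rw [List.replicate_one, S.rib_singleton] at ha
    obtain ⟨a, -, rfl⟩ := ha
    rw [consFun_cons, S.wordPairing_mul_rel_mul hA u hF v hy, mul_zero]
  obtain ⟨Ψ, hΨ⟩ := hM.desc η fun t ht c => by
    obtain ⟨F, rfl⟩ := hC.surjective c
    have h1 : TensorProduct.lift (η ∘ₗ LinearMap.mulLeft R (revLift ι F) ∘ₗ ι) =
        (wordPairing b).flip ξ ∘ₗ LinearMap.mulRight R (wordMap (j ∘ₗ ι) F) ∘ₗ relWord j k ι := by
      refine TensorProduct.ext' fun f g => ?_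
      have h2 := hη (TensorAlgebra.ι R f * F) g
      rw [revLift_mul, revLift_ι, hΦ, map_mul (wordMap (j ∘ₗ ι)), wordMap_ι, ← mul_assoc] at h2
      simpa using h2
    refine congr($h1 t).trans ?_
    refine S.wordPairing_rel_mul hS hA ?_ ht _ hξ
    have : LinearMap.range (relWord j k ι) ≤ degPart R E' 2 := by
      rintro _ ⟨t, rfl⟩
      induction t with
      | zero => simp
      | tmul f g =>
        rw [relWord_tmul]
        exact mul_mem_degPart (ι_mem_degPart _) (ι_mem_degPart _)
      | add x y hx hy => rw [map_add]; exact add_mem hx hy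
    exact this ⟨t, rfl⟩
  refine ⟨Ψ, fun f hf e he => ?_⟩
  rw [dual_mod_ones hL hMo] at hf
  obtain ⟨e', he1, he2⟩ : ∃ e', blockMul mul' 0 [d + 1] f = TensorAlgebra.ι R e' ∧
      wordPairing b f ξ = Ψ e' := by
    refine Submodule.mul_induction_on hf ?_ ?_
    · rintro _ ⟨_, ⟨g, rfl⟩, rfl⟩ _ ⟨F, hF, rfl⟩
      exact ⟨_, blockMul_mod hk hF g, by rw [hΨ, hη, hΦ]; rfl⟩
    · rintro x y ⟨a, ha, ha'⟩ ⟨c, hc, hc'⟩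
      exact ⟨a + c, by rw [map_add, ha, hc, map_add], by
        rw [map_add, LinearMap.add_apply, ha', hc', map_add]⟩
  rw [he2, (TensorAlgebra.ι_inj R _ _).mp (he1.symm.trans he)]

end

end ModulePart

/-! ### The quadratic dual algebra -/

section ToTensorAlgebra

variable {R V E : Type*} [CommRing R] [AddCommGroup V] [Module R V] [AddCommGroup E] [Module R E]

theorem range_toTensorAlgebra_two :
    LinearMap.range (TensorPower.toTensorAlgebra : ⨂[R]^2 V →ₗ[R] TensorAlgebra R V) =
      degPart R V 2 := by
  have h : ∀ v : Fin 2 → V, TensorPower.toTensorAlgebra (PiTensorProduct.tprod R v) =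
      TensorAlgebra.ι R (v 0) * TensorAlgebra.ι R (v 1) := fun v => by
    simp [TensorPower.toTensorAlgebra_tprod, TensorAlgebra.tprod_apply, List.ofFn_succ]
  apply le_antisymm
  · rintro _ ⟨q, rfl⟩
    induction q using PiTensorProduct.induction_on with
    | smul_tprod r v =>
      rw [map_smul, h]
      exact Submodule.smul_mem _ _ (mul_mem_degPart (ι_mem_degPart _) (ι_mem_degPart _))
    | add x y hx hy => rw [map_add]; exact add_mem hx hy
  · rw [degPart, pow_two]
    refine Submodule.mul_le.mpr ?_
    rintro _ ⟨a, rfl⟩ _ ⟨b, rfl⟩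
    exact ⟨PiTensorProduct.tprod R ![a, b], by simp [h]⟩

theorem toTensorAlgebra_mem_degPart (q : ⨂[R]^2 V) :
    TensorPower.toTensorAlgebra q ∈ degPart R V 2 :=
  range_toTensorAlgebra_two.le ⟨q, rfl⟩

theorem spell_eq (e : V →ₗ[R] E) {n : ℕ} (q : ⨂[R]^n V) :
    spell e q = wordMap e (TensorPower.toTensorAlgebra q) := rfl

theorem spell_id {n : ℕ} (q : ⨂[R]^n V) :
    spell (LinearMap.id : V →ₗ[R] V) q = TensorPower.toTensorAlgebra q := by
  rw [spell_eq, wordMap_id]; rfl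

end ToTensorAlgebra

namespace QuadDual

variable {R A : Type*} [CommRing R] [Ring A] [Algebra R A] {𝒜 : ℕ → Submodule R A}

theorem mk_surjective : Function.Surjective (mk 𝒜) := RingQuot.mkAlgHom_surjective R _

theorem mk_eq_zero {y : TensorAlgebra R (Module.Dual R (𝒜 1))} (h : dualRel 𝒜 y 0) :
    mk 𝒜 y = 0 := (RingQuot.mkAlgHom_rel R h).trans (map_zero _)

/-- Functionals that annihilate the ideal generated by the relations descend to the quadratic dual:
the largest ideal in the kernel of such a functional contains the relations. -/
theorem eq_zero_of_mk_eq_zero {Φ : Module.Dual R (TensorAlgebra R (Module.Dual R (𝒜 1)))}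
    (h : ∀ u y v, dualRel 𝒜 y 0 → Φ (u * y * v) = 0)
    {x : TensorAlgebra R (Module.Dual R (𝒜 1))} (hx : mk 𝒜 x = 0) : Φ x = 0 := by
  let K : TwoSidedIdeal (TensorAlgebra R (Module.Dual R (𝒜 1))) :=
    TwoSidedIdeal.mk' {x | ∀ u v, Φ (u * x * v) = 0} (by simp)
      (fun {x y} hx hy u v => by rw [mul_add, add_mul, map_add, hx, hy, add_zero])
      (fun {x} hx u v => by rw [mul_neg, neg_mul, map_neg, hx, neg_zero])
      (fun {x y} hy u v => by rw [← mul_assoc]; exact hy _ _)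
      (fun {x y} hx u v => by rw [← mul_assoc, mul_assoc]; exact hx _ _)
  have hK : ∀ x, x ∈ K ↔ ∀ u v, Φ (u * x * v) = 0 := fun x => TwoSidedIdeal.mem_mk' ..
  have h1 : ∀ ⦃x y⦄, dualRel 𝒜 x y → K.ringCon.mk' x = K.ringCon.mk' y := by
    rintro x y ⟨rfl, hxy⟩
    refine (RingCon.eq _).mpr ((TwoSidedIdeal.mem_iff _ _).mp ((hK x).mpr fun u v => ?_))
    exact h u x v ⟨rfl, hxy⟩
  have h2 : RingQuot.mkRingHom (dualRel 𝒜) x = 0 := by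
    rw [← RingQuot.mkAlgHom_coe R]; exact hx
  have h3 := RingQuot.lift_mkRingHom_apply K.ringCon.mk' h1 x
  rw [h2, map_zero] at h3
  have h4 : x ∈ K := (RingCon.eq _).mp (h3.symm.trans (map_zero K.ringCon.mk').symm)
  simpa using (hK x).mp h4 1 1

theorem lift_ι : TensorAlgebra.lift R (ι 𝒜) = mk 𝒜 := by
  ext f; simp [ι]

theorem revLift_ι_eq (F : TensorAlgebra R (Module.Dual R (𝒜 1))) :
    revLift (ι 𝒜) F = mk 𝒜 (rev R _ F) := by
  rw [revLift, lift_ι]; rfl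

theorem revLift_ιop_eq (F : TensorAlgebra R (Module.Dual R (𝒜 1))) :
    revLift (ιop 𝒜) F = MulOpposite.op (mk 𝒜 F) := by
  induction F using cons_induction with
  | h0 => simp
  | hadd x y hx hy => simp only [map_add, hx, hy, MulOpposite.op_add]
  | hsmul r x hx => simp only [map_smul, hx, MulOpposite.op_smul]
  | h1 => simp
  | hc f w hw => rw [revLift_mul, hw, revLift_ι, map_mul]; rfl

theorem map_revLift_ι (d : ℕ) : (degPart R _ d).map (revLift (ι 𝒜)) = piece 𝒜 d := by
  have h : (degPart R (Module.Dual R (𝒜 1)) d).map (rev R _) = degPart R _ d := by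
    rw [← words_replicate_top, map_rev_words, List.reverse_replicate]
  rw [revLift, Submodule.map_comp, h, degPart, Submodule.map_pow, lift_ι, piece, ι,
    LinearMap.range_comp]

theorem map_revLift_ιop (d : ℕ) : (degPart R _ d).map (revLift (ιop 𝒜)) =
    (piece 𝒜 d).map (MulOpposite.opLinearEquiv R).toLinearMap := by
  have : revLift (ιop 𝒜) = (MulOpposite.opLinearEquiv R).toLinearMap ∘ₗ (mk 𝒜).toLinearMap :=
    LinearMap.ext revLift_ιop_eq
  rw [this, Submodule.map_comp, degPart, Submodule.map_pow, piece, ι, LinearMap.range_comp]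

theorem lift_inr_eq ⦃x y : TensorAlgebra R (Module.Dual R (𝒜 1))⦄ (h : dualRel 𝒜 x y) :
    TensorAlgebra.lift R (TrivSqZeroExt.inrHom R (Module.Dual R (𝒜 1))) x =
      TensorAlgebra.lift R (TrivSqZeroExt.inrHom R (Module.Dual R (𝒜 1))) y := by
  obtain ⟨rfl, f, rfl, -⟩ := h
  rw [map_zero]
  have := toTensorAlgebra_mem_degPart f
  rw [degPart, pow_two] at this
  refine Submodule.mul_induction_on this ?_ fun x y hx hy => by rw [map_add, hx, hy, add_zero]
  rintro _ ⟨a, rfl⟩ _ ⟨b, rfl⟩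
  simp

/-- The projection of the quadratic dual to its pieces of degree zero and one. -/
def low (𝒜 : ℕ → Submodule R A) : QuadDual 𝒜 →ₐ[R] TrivSqZeroExt R (Module.Dual R (𝒜 1)) :=
  RingQuot.liftAlgHom R ⟨TensorAlgebra.lift R (TrivSqZeroExt.inrHom R _), lift_inr_eq⟩

@[simp] theorem low_ι (f : Module.Dual R (𝒜 1)) : low 𝒜 (ι 𝒜 f) = TrivSqZeroExt.inr f :=
  (RingQuot.liftAlgHom_mkAlgHom_apply R _ lift_inr_eq (TensorAlgebra.ι R f)).trans (by simp)

section

variable {E : Type*} [AddCommGroup E] [Module R E] {S : RightSystem R E}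
  {β : Module.Dual R (𝒜 1) →ₗ[R] Module.Dual R E} {e : 𝒜 1 →ₗ[R] E} {i : A →ₗ[R] E}
  (hi : Function.Injective i) (he : LinearMap.range e = S.L 1)
include hi he

theorem mem_dualRels_iff {F : TensorAlgebra R (Module.Dual R (𝒜 1))}
    {y : TensorAlgebra R (Module.Dual R (𝒜 1))} (hFy : F ∈ degPart R _ 2 ↔ y ∈ degPart R _ 2)
    {T : TensorAlgebra R E →ₗ[R] TensorAlgebra R E}
    (hT : (ones S.L S.L 2).map T = ones S.L S.L 2)
    (hpair : ∀ (f : ⨂[R]^2 (Module.Dual R (𝒜 1))) (q : ⨂[R]^2 (𝒜 1)),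
      TensorPower.toTensorAlgebra f = y →
      revPairing LinearMap.id 2 f q = wordPairing β F (T (spell e q)))
    (hmul : ∀ q : ⨂[R]^2 (𝒜 1), glue S.mul 0 (T (spell e q)) =
      TensorAlgebra.ι R (i (fromTensor 𝒜 (TensorPower.toTensorAlgebra q)))) :
    F ∈ S.dualRels β ↔ dualRel 𝒜 y 0 := by
  have h1 : LinearMap.range (T ∘ₗ spell e : ⨂[R]^2 (𝒜 1) →ₗ[R] _) = ones S.L S.L 2 := by
    rw [LinearMap.range_comp]
    conv_rhs => rw [← hT]
    congr 1
    rw [spell, LinearMap.range_comp, range_toTensorAlgebra_two, ← words_replicate_top,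
      map_wordMap_words, ones, lettersOf_self, List.map_replicate, List.map_replicate,
      Submodule.map_top, he]
  have h2 : ∀ x, x ∈ S.alg.col 2 ↔ ∃ q : ⨂[R]^2 (𝒜 1), T (spell e q) = x ∧
      fromTensor 𝒜 (TensorPower.toTensorAlgebra q) = 0 := by
    intro x
    rw [col_two_eq]
    change x ∈ ones S.L S.L 2 ∧ glue S.mul 0 x = 0 ↔ _
    rw [← h1]
    constructor
    · rintro ⟨⟨q, rfl⟩, h⟩
      rw [LinearMap.comp_apply, hmul] at h
      exact ⟨q, rfl, hi (((TensorAlgebra.ι_eq_zero_iff R _).mp h).trans (map_zero i).symm)⟩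
    · rintro ⟨q, rfl, h⟩
      exact ⟨⟨q, rfl⟩, by rw [hmul, h, map_zero, map_zero]⟩
  constructor
  · rintro ⟨hF, hF'⟩
    obtain ⟨f, hf⟩ := (range_toTensorAlgebra_two (R := R) (V := Module.Dual R (𝒜 1))).ge
      (hFy.mp hF)
    refine ⟨rfl, f, hf.symm, fun q hq => ?_⟩
    rw [hpair f q hf]
    exact hF' _ ((h2 _).mpr ⟨q, rfl, hq⟩)
  · rintro ⟨-, f, hf, h⟩
    refine ⟨hFy.mpr (hf ▸ toTensorAlgebra_mem_degPart f), fun x hx => ?_⟩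
    obtain ⟨q, rfl, hq⟩ := (h2 x).mp hx
    rw [← hpair f q hf.symm]
    exact h q hq

variable (hβ : ∀ f v, β f (e v) = f v)
include hβ

theorem isPresentedBy (hmul : ∀ v w : 𝒜 1, S.mul (e v) (e w) = i (v * w)) :
    IsPresentedBy (ι 𝒜) (S.dualRels β) := by
  have key : ∀ F, F ∈ S.dualRels β ↔ dualRel 𝒜 (rev R _ F) 0 := fun F => by
    refine mem_dualRels_iff (T := LinearMap.id) hi he
      ⟨rev_mem_degPart, fun h => by simpa using rev_mem_degPart h⟩ (Submodule.map_id _)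
      (fun f q hf => ?_) fun q => ?_
    · rw [LinearMap.id_apply, ← wordPairing_rev_spell (b := β) (e := e) (e' := LinearMap.id) hβ,
        spell_id, hf, rev_rev]
    · induction q using PiTensorProduct.induction_on with
      | smul_tprod r v =>
        simp [spell_tprod, List.ofFn_succ, TensorPower.toTensorAlgebra_tprod,
          TensorAlgebra.tprod_apply, glue_zero_cons_two, hmul, fromTensor]
      | add x y hx hy => simp only [map_add, LinearMap.id_apply] at hx hy ⊢; rw [hx, hy]
  refine ⟨fun x => ?_, fun F hF => ?_, fun Φ hΦ F hF => ?_⟩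
  · obtain ⟨y, rfl⟩ := mk_surjective x
    exact ⟨rev R _ y, by rw [revLift_ι_eq, rev_rev]⟩
  · rw [revLift_ι_eq, mk_eq_zero ((key F).mp hF)]
  · rw [revLift_ι_eq] at hF
    have := eq_zero_of_mk_eq_zero (Φ := Φ ∘ₗ rev R _) (fun u y v h => by
      rw [LinearMap.comp_apply, rev_mul, rev_mul, ← mul_assoc]
      exact hΦ _ _ ((key _).mpr (by rwa [rev_rev])) _) hF
    simpa using this

theorem isPresentedBy_op (hmul : ∀ v w : 𝒜 1, S.mul (e v) (e w) = i (w * v)) :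
    IsPresentedBy (ιop 𝒜) (S.dualRels β) := by
  have key : ∀ F, F ∈ S.dualRels β ↔ dualRel 𝒜 F 0 := fun F => by
    refine mem_dualRels_iff (T := rev R E) hi he Iff.rfl
      (by simp only [map_rev_words, lettersOf_self, List.map_replicate, List.reverse_replicate]
          rfl)
      (fun f q hf => ?_) fun q => ?_
    · rw [← wordPairing_spell_rev (b := β) (e := e) (e' := LinearMap.id) hβ, spell_id, hf]
    · induction q using PiTensorProduct.induction_on with
      | smul_tprod r v =>
        simp [spell_tprod, List.ofFn_succ, TensorPower.toTensorAlgebra_tprod,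
          TensorAlgebra.tprod_apply, glue_zero_cons_two, hmul, fromTensor]
      | add x y hx hy => simp only [map_add] at hx hy ⊢; rw [hx, hy]
  refine ⟨fun x => ?_, fun F hF => ?_, fun Φ hΦ F hF => ?_⟩
  · obtain ⟨y, hy⟩ := mk_surjective x.unop
    exact ⟨y, by rw [revLift_ιop_eq, hy, MulOpposite.op_unop]⟩
  · rw [revLift_ιop_eq, mk_eq_zero ((key F).mp hF), MulOpposite.op_zero]
  · rw [revLift_ιop_eq, MulOpposite.op_eq_zero_iff] at hF
    exact eq_zero_of_mk_eq_zero (fun u y v h => hΦ _ _ ((key _).mpr h) _) hF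

end

end QuadDual

/-! ### The quadratic dual of a module -/

namespace ModDual

variable {R A M C : Type*} [CommRing R] [Ring A] [Algebra R A] [AddCommGroup M] [Module R M]
  [Ring C] [Algebra R C] {𝒜 : ℕ → Submodule R A} {act : A →ₗ[R] M →ₗ[R] M} {X : Submodule R M}
  {ι : Module.Dual R (𝒜 1) →ₗ[R] C}

variable (𝒜 act X ι) in
/-- The class of `c ⊗ g`, as a bilinear map. -/
def mkBilin : C →ₗ[R] Module.Dual R X →ₗ[R] ModDual 𝒜 act X ι :=
  (TensorProduct.mk R C (Module.Dual R X)).compr₂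
    ((Submodule.mkQ (Submodule.span C (modRel 𝒜 act X ι))).restrictScalars R)

theorem mkBilin_apply (c : C) : mkBilin 𝒜 act X ι c = mk 𝒜 act X ι c := rfl

theorem smul_mkBilin (c c' : C) (g : Module.Dual R X) :
    c • mkBilin 𝒜 act X ι c' g = mkBilin 𝒜 act X ι (c * c') g := rfl

theorem piece_eq_map₂ (D : Submodule R C) :
    piece 𝒜 act X ι D = Submodule.map₂ (mkBilin 𝒜 act X ι) D ⊤ := by
  apply le_antisymm
  · refine iSup₂_le fun c hc => ?_
    rintro _ ⟨g, rfl⟩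
    exact Submodule.apply_mem_map₂ _ hc trivial
  · exact Submodule.map₂_le.mpr fun c hc g _ =>
      Submodule.mem_iSup_of_mem c (Submodule.mem_iSup_of_mem hc ⟨g, rfl⟩)

theorem exists_desc {P : Type*} [AddCommGroup P] [Module R P]
    (l : C →ₗ[R] Module.Dual R X →ₗ[R] P)
    (h : ∀ f : Module.Dual R (𝒜 1) ⊗[R] Module.Dual R X,
      (∀ q, actMap 𝒜 act X q = 0 → TensorProduct.dualDistrib R (𝒜 1) X f q = 0) →
      ∀ c, TensorProduct.lift (l ∘ₗ LinearMap.mulLeft R c ∘ₗ ι) f = 0) :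
    ∃ Ψ : ModDual 𝒜 act X ι →ₗ[R] P, ∀ c g, Ψ (mkBilin 𝒜 act X ι c g) = l c g := by
  let N := Submodule.span C (modRel 𝒜 act X ι)
  have hN : ∀ z ∈ N, ∀ c : C, TensorProduct.lift l (c • z) = 0 := by
    intro z hz
    induction hz using Submodule.span_induction with
    | mem z hz =>
      obtain ⟨f, rfl, hf⟩ := hz
      intro c
      refine Eq.trans ?_ (h f hf c)
      clear hf
      induction f with
      | zero => simp
      | tmul f g => rfl
      | add x y hx hy => rw [map_add, smul_add, map_add, hx, hy, map_add]
    | zero => simp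
    | add x y _ _ hx hy => intro c; rw [smul_add, map_add, hx, hy, add_zero]
    | smul a x _ hx => intro c; rw [smul_smul]; exact hx _
  refine ⟨(N.restrictScalars R).liftQ (TensorProduct.lift l) (fun z hz => by
      simpa using hN z hz 1) ∘ₗ (Submodule.Quotient.restrictScalarsEquiv R N).symm.toLinearMap,
    fun c g => ?_⟩
  have h1 : (Submodule.Quotient.restrictScalarsEquiv R N).symm (mkBilin 𝒜 act X ι c g) =
      Submodule.Quotient.mk (c ⊗ₜ g) := Submodule.Quotient.restrictScalarsEquiv_symm_mk ..
  rw [LinearMap.comp_apply, LinearEquiv.coe_coe, h1, Submodule.liftQ_apply,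
    TensorProduct.lift.tmul]

section

variable {E E' : Type*} [AddCommGroup E] [Module R E] [AddCommGroup E'] [Module R E']
  {S : RightSystem R E} {b : E' →ₗ[R] Module.Dual R E} {j : C →ₗ[R] E'}
  {k : ModDual 𝒜 act X ι →ₗ[R] E'} {r : E' →ₗ[R] ModDual 𝒜 act X ι}
  {e : 𝒜 1 →ₗ[R] E} {eM : X →ₗ[R] E} {i : M →ₗ[R] E}

theorem isModPresentedBy (hi : Function.Injective i) (he : LinearMap.range e = S.L 1)
    (heM : LinearMap.range eM = S.Mo 1) (hr : ∀ x, r (k x) = x)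
    (hmul : ∀ a x, S.mul (eM x) (e a) = i (act a x)) (hb : ∀ f a, b (j (ι f)) (e a) = f a)
    (hbM : ∀ g x, b (k (mkBilin 𝒜 act X ι 1 g)) (eM x) = g x) :
    IsModPresentedBy ι ((mkBilin 𝒜 act X ι).compr₂ k)
      (S.dualModRels b j ((mkBilin 𝒜 act X ι).compr₂ k) ι) := by
  let W : (𝒜 1) ⊗[R] X →ₗ[R] TensorAlgebra R E :=
    TensorProduct.lift ((LinearMap.mul R (TensorAlgebra R E)).compl₁₂ (TensorAlgebra.ι R ∘ₗ eM)
      (TensorAlgebra.ι R ∘ₗ e)).flip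
  have hW : ∀ a x, W (a ⊗ₜ x) = TensorAlgebra.ι R (eM x) * TensorAlgebra.ι R (e a) := fun a x => by
    simp [W]
  have hrange : LinearMap.range W = ones S.Mo S.L 2 := by
    have h1 : ones S.Mo S.L 2 = (LinearMap.range eM).map (TensorAlgebra.ι R) *
        (LinearMap.range e).map (TensorAlgebra.ι R) := by
      rw [he, heM]; simp [ones, lettersOf, List.replicate_succ]
    rw [h1]
    apply le_antisymm
    · rintro _ ⟨q, rfl⟩
      induction q with
      | zero => simp
      | tmul a x => rw [hW]; exact Submodule.mul_mem_mul ⟨_, ⟨x, rfl⟩, rfl⟩ ⟨_, ⟨a, rfl⟩, rfl⟩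
      | add x y hx hy => rw [map_add]; exact add_mem hx hy
    · refine Submodule.mul_le.mpr ?_
      rintro _ ⟨_, ⟨x, rfl⟩, rfl⟩ _ ⟨_, ⟨a, rfl⟩, rfl⟩
      exact ⟨a ⊗ₜ x, hW a x⟩
  have hglue : ∀ q, glue S.mul 0 (W q) = TensorAlgebra.ι R (i (actMap 𝒜 act X q)) := by
    have : glue S.mul 0 ∘ₗ W = TensorAlgebra.ι R ∘ₗ i ∘ₗ actMap 𝒜 act X :=
      TensorProduct.ext' fun a x => by simp [hW, glue_zero_cons_two, hmul, actMap]
    exact fun q => congr($this q)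
  have hpair : ∀ t q, wordPairing b (relWord j ((mkBilin 𝒜 act X ι).compr₂ k) ι t) (W q) =
      TensorProduct.dualDistrib R (𝒜 1) X t q := by
    have : (wordPairing b ∘ₗ relWord j ((mkBilin 𝒜 act X ι).compr₂ k) ι).compl₂ W =
        TensorProduct.dualDistrib R (𝒜 1) X := by
      refine TensorProduct.ext' fun f g => TensorProduct.ext' fun a x => ?_
      rw [LinearMap.compl₂_apply, LinearMap.comp_apply, relWord_tmul, hW, wordPairing_cons_cons,
        wordPairing_ι_ι, hb, LinearMap.compr₂_apply, hbM, TensorProduct.dualDistrib_apply, mul_comm]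
    exact fun t q => congr($this t q)
  have key : ∀ t, t ∈ S.dualModRels b j ((mkBilin 𝒜 act X ι).compr₂ k) ι ↔
      ∀ q, actMap 𝒜 act X q = 0 → TensorProduct.dualDistrib R (𝒜 1) X t q = 0 := by
    intro t
    change (∀ x ∈ S.col 2, _) ↔ _
    simp only [col_two_eq, ← hrange, Submodule.mem_inf, LinearMap.mem_range, LinearMap.mem_ker]
    constructor
    · intro h q hq
      rw [← hpair]
      exact h _ ⟨⟨q, rfl⟩, by rw [hglue, hq, map_zero, map_zero]⟩
    · rintro h _ ⟨⟨q, rfl⟩, hq⟩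
      rw [hpair]
      rw [hglue, TensorAlgebra.ι_eq_zero_iff] at hq
      exact h q (hi (hq.trans (map_zero i).symm))
  constructor
  · intro t ht
    have h1 : TensorProduct.lift ((mkBilin 𝒜 act X ι).compr₂ k ∘ₗ ι) = k ∘ₗ
        (Submodule.mkQ (Submodule.span C (modRel 𝒜 act X ι))).restrictScalars R ∘ₗ
        TensorProduct.map ι LinearMap.id := TensorProduct.ext' fun f g => rfl
    rw [h1]
    have h2 : (Submodule.mkQ (Submodule.span C (modRel 𝒜 act X ι)))
        (TensorProduct.map ι LinearMap.id t) = 0 :=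
      (Submodule.Quotient.mk_eq_zero _).mpr (Submodule.subset_span ⟨t, rfl, (key t).mp ht⟩)
    exact (congrArg k h2).trans (map_zero k)
  · intro η hη
    obtain ⟨Ψ, hΨ⟩ := exists_desc η fun f hf c => hη f ((key f).mpr hf) c
    exact ⟨Ψ ∘ₗ r, fun c g => by rw [LinearMap.comp_apply, LinearMap.compr₂_apply, hr, hΨ]⟩

end

end ModDual

/-! ### Quadratic duals as dual systems -/

section Instances

variable {R A : Type*} [CommRing R] [Ring A] [Algebra R A] {𝒜 : ℕ → Submodule R A}

/-- The projection `A^! → A₁^*`. -/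
def QuadDual.lowOne (𝒜 : ℕ → Submodule R A) : QuadDual 𝒜 →ₗ[R] Module.Dual R (𝒜 1) :=
  TrivSqZeroExt.sndHom R _ ∘ₗ (QuadDual.low 𝒜).toLinearMap

@[simp] theorem QuadDual.lowOne_ι (f : Module.Dual R (𝒜 1)) :
    QuadDual.lowOne 𝒜 (QuadDual.ι 𝒜 f) = f := by simp [lowOne]

theorem exists_proj_one {N : Type*} [AddCommGroup N] [Module R N] {κ : Type*} [DecidableEq κ]
    {𝒩 : κ → Submodule R N} (h : DirectSum.IsInternal 𝒩) (i : κ) :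
    ∃ p : N →ₗ[R] 𝒩 i, ∀ x : 𝒩 i, p x = x := by
  obtain ⟨f, h1, -, h2⟩ := exists_proj_of_isInternal h i
  exact ⟨f.codRestrict _ h2, fun x => Subtype.ext (h1 x x.2)⟩

/-- The quadratic dual algebra, with the opposite product, is dual to the algebra. -/
theorem exists_dualSystem_alg (h : IsGradedMul 𝒜 (LinearMap.mul R A))
    (hA : (algSystem h).MergesOnes) [Module.Finite R (𝒜 1)] [Module.Projective R (𝒜 1)] :
    ∃ D : DualSystem (algSystem h) (QuadDual 𝒜), D.mul = (LinearMap.mul R (QuadDual 𝒜)).flip ∧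
      D.L = QuadDual.piece 𝒜 ∧ D.Mo = QuadDual.piece 𝒜 ∧
      ∀ f v, D.b (QuadDual.ι 𝒜 f) ((𝒜 1).subtype v) = f v := by
  obtain ⟨p, hp⟩ := exists_proj_one h.isInternal 1
  let b : QuadDual 𝒜 →ₗ[R] Module.Dual R A := p.dualMap ∘ₗ QuadDual.lowOne 𝒜
  have hb : ∀ f v, b (QuadDual.ι 𝒜 f) ((𝒜 1).subtype v) = f v := fun f v => by simp [b, hp]
  have he : LinearMap.range (𝒜 1).subtype = (algSystem h).L 1 := Submodule.range_subtype _
  have hC : IsPresentedBy (QuadDual.ι 𝒜)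
      ((algSystem h).dualRels (b ∘ₗ LinearMap.id ∘ₗ QuadDual.ι 𝒜)) :=
    QuadDual.isPresentedBy (S := algSystem h) (i := LinearMap.id) Function.injective_id he hb
      fun v w => rfl
  have hj : ∀ x f, (LinearMap.mul R (QuadDual 𝒜)).flip (LinearMap.id (R := R) x)
      (LinearMap.id (R := R) (QuadDual.ι 𝒜 f)) = LinearMap.id (R := R) (QuadDual.ι 𝒜 f * x) :=
    fun x f => rfl
  have hL : ∀ d, 0 < d → QuadDual.piece 𝒜 d =
      ((degPart R _ d).map (revLift (QuadDual.ι 𝒜))).map LinearMap.id := fun d _ => by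
    rw [QuadDual.map_revLift_ι, Submodule.map_id]
  have hpair : IsDualPair b (QuadDual.piece 𝒜 1) ((algSystem h).L 1) := by
    rw [← he, QuadDual.piece, pow_one]
    exact isDualPair_range hb
  have hrel := dual_rel (b := b) hj hL hC
  have hgen := dual_gen hj hL
  have heval := dual_eval (b := b) hj hL hC hA (r := LinearMap.id) fun _ => rfl
  exact ⟨{
    mul := (LinearMap.mul R (QuadDual 𝒜)).flip
    L := QuadDual.piece 𝒜
    Mo := QuadDual.piece 𝒜
    b := b
    assoc := fun x y z => (mul_assoc z y x).symm
    pair_L := hpair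
    pair_Mo := hpair
    rel_L := hrel
    rel_Mo := hrel
    gen_L := hgen
    gen_Mo := hgen
    eval_L := heval
    eval_Mo := heval }, rfl, rfl, rfl, hb⟩

variable {M : Type*} [AddCommGroup M] [Module R M] {mulA : A →ₗ[R] A →ₗ[R] A}
  {act : A →ₗ[R] M →ₗ[R] M} {ℳ : ℤ → Submodule R M} {t : ℤ}
  {m : (A × M) →ₗ[R] (A × M) →ₗ[R] (A × M)}
  {C : Type*} [Ring C] [Algebra R C] {ι : Module.Dual R (𝒜 1) →ₗ[R] C}

/-- The quadratic dual of a module is dual to the module.  The algebra `C` acting on it from the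
left is identified with `A^!` by the linear map `θ`, which may reverse products. -/
theorem exists_dualSystem_mod (h : IsGradedAct 𝒜 mulA act ℳ t m) (hS : (modSystem h).MergesOnes)
    (hA : (modSystem h).alg.MergesOnes)
    [Module.Finite R (𝒜 1)] [Module.Projective R (𝒜 1)] [Module.Finite R (ℳ t)]
    [Module.Projective R (ℳ t)] (θ : QuadDual 𝒜 ≃ₗ[R] C) (hθ : ∀ f, θ (QuadDual.ι 𝒜 f) = ι f)
    (hpiece : ∀ d, (degPart R _ d).map (revLift ι) = (QuadDual.piece 𝒜 d).map θ.toLinearMap)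
    (hC : ∀ β : Module.Dual R (𝒜 1) →ₗ[R] Module.Dual R (A × M),
      (∀ f v, β f ((LinearMap.inl R A M ∘ₗ (𝒜 1).subtype) v) = f v) →
      IsPresentedBy ι ((modSystem h).dualRels β))
    (ε : C →ₗ[R] R) (hε : ε 1 = 1) (hε' : ∀ c f, ε (c * ι f) = 0)
    {mul' : (QuadDual 𝒜 × ModDual 𝒜 act (ℳ t) ι) →ₗ[R]
      (QuadDual 𝒜 × ModDual 𝒜 act (ℳ t) ι) →ₗ[R] (QuadDual 𝒜 × ModDual 𝒜 act (ℳ t) ι)}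
    (hmul' : ∀ x y, mul' x y = (θ.symm (θ y.1 * θ x.1), θ y.1 • x.2)) :
    ∃ D : DualSystem (modSystem h) (QuadDual 𝒜 × ModDual 𝒜 act (ℳ t) ι), D.mul = mul' ∧
      D.L = (fun d => (QuadDual.piece 𝒜 d).map (LinearMap.inl R _ _)) ∧
      D.Mo = (fun d => letter (QuadDual 𝒜) (ModDual.piece 𝒜 act (ℳ t) ι
        ((QuadDual.piece 𝒜 (d - 1)).map θ.toLinearMap))) ∧
      ∀ f v, D.b (degOneDual 𝒜 act (ℳ t) ι f) (degOne 𝒜 (ℳ t) v) = prodEval 𝒜 (ℳ t) f v := by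
  obtain ⟨p, hp⟩ := exists_proj_one h.gradedMul.isInternal 1
  obtain ⟨pM, hpM⟩ := exists_proj_one h.gradedFlat.isInternal t
  obtain ⟨P, hP⟩ := ModDual.exists_desc (𝒜 := 𝒜) (act := act) (X := ℳ t) (ι := ι)
    (LinearMap.toSpanSingleton R _ LinearMap.id ∘ₗ ε) fun f hf c => by
      clear hf
      have : (LinearMap.toSpanSingleton R (Module.Dual R (ℳ t) →ₗ[R] Module.Dual R (ℳ t))
          LinearMap.id ∘ₗ ε) ∘ₗ LinearMap.mulLeft R c ∘ₗ ι = 0 :=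
        LinearMap.ext fun f => by simp [hε']
      rw [this]
      induction f with
      | zero => simp
      | tmul f g => simp
      | add x y hx hy => rw [map_add, hx, hy, add_zero]
  let MD := ModDual 𝒜 act (ℳ t) ι
  let j : C →ₗ[R] QuadDual 𝒜 × MD := LinearMap.inl R _ _ ∘ₗ θ.symm.toLinearMap
  let k : C →ₗ[R] Module.Dual R (ℳ t) →ₗ[R] QuadDual 𝒜 × MD :=
    (ModDual.mkBilin 𝒜 act (ℳ t) ι).compr₂ (LinearMap.inr R _ _)
  let b : QuadDual 𝒜 × MD →ₗ[R] Module.Dual R (A × M) :=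
    (LinearMap.fst R A M).dualMap ∘ₗ p.dualMap ∘ₗ QuadDual.lowOne 𝒜 ∘ₗ LinearMap.fst R _ _ +
      (LinearMap.snd R A M).dualMap ∘ₗ pM.dualMap ∘ₗ P ∘ₗ LinearMap.snd R _ _
  have hθ' : ∀ f, θ.symm (ι f) = QuadDual.ι 𝒜 f := fun f => by rw [← hθ, θ.symm_apply_apply]
  have hb : ∀ f v, b (j (ι f)) ((LinearMap.inl R A M ∘ₗ (𝒜 1).subtype) v) = f v := fun f v => by
    simp [b, j, hθ', hp]
  have hbM : ∀ g x, b (k 1 g) ((LinearMap.inr R A M ∘ₗ (ℳ t).subtype) x) = g x := fun g x => by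
    simp [b, k, hpM, hP, hε]
  have he : LinearMap.range (LinearMap.inl R A M ∘ₗ (𝒜 1).subtype) = (modSystem h).L 1 := by
    rw [LinearMap.range_comp, Submodule.range_subtype]; rfl
  have heM : LinearMap.range (LinearMap.inr R A M ∘ₗ (ℳ t).subtype) = (modSystem h).Mo 1 := by
    rw [LinearMap.range_comp, Submodule.range_subtype]
    simp [modSystem, letter]
  have hC' : IsPresentedBy ι ((modSystem h).dualRels (b ∘ₗ j ∘ₗ ι)) := hC _ hb
  have hM : IsModPresentedBy ι k ((modSystem h).dualModRels b j k ι) :=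
    ModDual.isModPresentedBy (S := modSystem h) (i := LinearMap.inr R A M)
      (r := LinearMap.snd R _ _) LinearMap.inr_injective he heM (fun x => rfl)
      (fun a x => by simp [modSystem, h.m_apply]) hb hbM
  have hj : ∀ x f, mul' (j x) (j (ι f)) = j (ι f * x) := fun x f => by simp [hmul', j]
  have hk : ∀ x g f, mul' (k x g) (j (ι f)) = k (ι f * x) g := fun x g f => by
    simp only [hmul', j, k, LinearMap.compr₂_apply, LinearMap.comp_apply, LinearMap.inl_apply,
      LinearMap.inr_apply, LinearEquiv.coe_coe, LinearEquiv.apply_symm_apply, map_zero, mul_zero,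
      ModDual.smul_mkBilin]
  have hL : ∀ d, 0 < d → (QuadDual.piece 𝒜 d).map (LinearMap.inl R (QuadDual 𝒜) MD) =
      ((degPart R _ d).map (revLift ι)).map j := fun d _ => by
    rw [hpiece, ← Submodule.map_comp]
    congr 1
    exact LinearMap.ext fun x => by simp [j]
  have hMo : ∀ d, letter (QuadDual 𝒜) (ModDual.piece 𝒜 act (ℳ t) ι
      ((QuadDual.piece 𝒜 (d + 1 - 1)).map θ.toLinearMap)) =
      Submodule.map₂ k ((degPart R _ d).map (revLift ι)) ⊤ := fun d => by
    rw [letter, ModDual.piece_eq_map₂, hpiece, Submodule.map_map₂]; rfl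
  refine ⟨{
    mul := mul'
    L := fun d => (QuadDual.piece 𝒜 d).map (LinearMap.inl R _ _)
    Mo := fun d => letter (QuadDual 𝒜) (ModDual.piece 𝒜 act (ℳ t) ι
        ((QuadDual.piece 𝒜 (d - 1)).map θ.toLinearMap))
    b := b
    assoc := fun x y z => by simp [hmul', mul_assoc, smul_smul]
    pair_L := ?_
    pair_Mo := ?_
    rel_L := dual_rel hj hL hC'
    rel_Mo := dual_mod_rel hk hL hMo hM
    gen_L := dual_gen hj hL
    gen_Mo := dual_mod_gen hk hL hMo
    eval_L := dual_eval hj hL hC' hA (r := θ.toLinearMap ∘ₗ LinearMap.fst R _ _) fun c => by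
      simp [j]
    eval_Mo := dual_mod_eval hk hL hMo hM hC' hS hA }, rfl, rfl, rfl, ?_⟩
  · have h1 := dual_piece_one (L' := fun d => (QuadDual.piece 𝒜 d).map
      (LinearMap.inl R (QuadDual 𝒜) MD)) hL
    have h2 := isDualPair_range (e' := j ∘ₗ ι) hb
    rw [he] at h2
    rw [← h1] at h2
    exact h2
  · have h1 := dual_mod_one (Mo' := fun d => letter (QuadDual 𝒜) (ModDual.piece 𝒜 act (ℳ t) ι
        ((QuadDual.piece 𝒜 (d - 1)).map θ.toLinearMap))) hMo
    have h2 := isDualPair_range hbM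
    rw [heM] at h2
    rw [← h1] at h2
    exact h2
  · rintro ⟨f, g⟩ ⟨a, x⟩
    have h1 : P (ModDual.mk 𝒜 act (ℳ t) ι 1 g) = g := by
      rw [← ModDual.mkBilin_apply, hP]; simp [hε]
    simp [b, degOneDual, degOne, prodEval, hp, hpM, h1]

end Instances

/-! ### Duality for algebras and modules -/

section Duality

variable {R : Type u} [CommRing R] {A : Type v} [Ring A] [Algebra R A] {𝒜 : ℕ → Submodule R A}

/-- The duality for a Koszul algebra. -/
theorem schurDual (h : IsGradedMul 𝒜 (LinearMap.mul R A)) (hS : (algSystem h).MergesOnes)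
    [Module.Finite R (𝒜 1)] (hP : ∀ n, Module.Projective R (𝒜 n)) {α : List ℕ} (hα : IsComp α) :
    SchurDual 𝒜 α := by
  obtain ⟨D, hm, hL, hMo, hb⟩ := exists_dualSystem_alg h hS
  have hc := isConjugate_columns hα.1 hα.2
  refine D.exists_isCanonicalDual_of_rev hS hS ⟨fun n _ => hP n, fun n _ => hP n⟩ hc
    (e := (𝒜 1).subtype) (e' := QuadDual.ι 𝒜) (ev := LinearMap.id) hb rfl ?_ hc.sum_eq ?_ ?_ rfl rfl
    (schur_eq h α) ?_
  · rw [hm]; rfl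
  · rw [algSystem_lets, List.map_replicate]
  · rw [hL, hMo, lettersOf_self, List.map_replicate, List.reverse_replicate]
  · rw [hL, hMo, lettersOf_self, schur, transpose, List.map_reverse]

variable {M : Type w} [AddCommGroup M] [Module R M] {act : A →ₗ[R] M →ₗ[R] M}
  {ℳ : ℤ → Submodule R M} {t : ℤ}

theorem modSystem_lets_ones {mulA : A →ₗ[R] A →ₗ[R] A} {m : (A × M) →ₗ[R] (A × M) →ₗ[R] (A × M)}
    (h : IsGradedAct 𝒜 mulA act ℳ t m) (n : ℕ) :
    (modSystem h).lets (List.replicate (n + 1) 1) =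
      letter A (ℳ t) :: letters M 𝒜 (List.replicate n 1) := by
  have := modSystem_lets h 0 (List.replicate n 1)
  simpa [List.replicate_succ] using this

/-- The duality for a right module.  The piece of degree `t` of the module has index one in the
system, so that the first row and the first column are one box longer. -/
theorem schurDualR (h : IsGradedAct 𝒜 (LinearMap.mul R A) act ℳ t (mulR act))
    (hS : (modSystem h).MergesOnes) (hA : (modSystem h).alg.MergesOnes)
    [Module.Finite R (𝒜 1)] [Module.Finite R (ℳ t)] (hP : ∀ n, Module.Projective R (𝒜 n))
    (hPM : ∀ j, Module.Projective R (ℳ j)) {a c : ℕ} {α γ : List ℕ}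
    (hc : IsConjugate ((a + 1) :: α) ((c + 1) :: γ.reverse)) :
    SchurDualR 𝒜 act ℳ t a α γ c := by
  obtain ⟨D, hm, hL, hMo, hb⟩ := exists_dualSystem_mod h hS hA (LinearEquiv.refl R (QuadDual 𝒜))
    (ι := QuadDual.ι 𝒜) (fun _ => rfl)
    (fun d => by rw [QuadDual.map_revLift_ι]; exact (Submodule.map_id _).symm)
    (fun β hβ => QuadDual.isPresentedBy (S := modSystem h) (i := LinearMap.inl R A M)
      LinearMap.inl_injective (by rw [LinearMap.range_comp, Submodule.range_subtype]; rfl) hβ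
      fun v w => by simp [modSystem, mulR])
    ((TrivSqZeroExt.fstHom R R _).toLinearMap ∘ₗ (QuadDual.low 𝒜).toLinearMap)
    (by simp) (fun c f => by simp)
    (mul' := (mulL (leftAct R (QuadDual 𝒜) (DualR 𝒜 act (ℳ t)))).flip) (fun x y => rfl)
  have hs := hc.sum_eq
  simp only [List.sum_cons, List.sum_reverse] at hs
  refine D.exists_isCanonicalDual_of_rev hS hA
    ⟨modSystem_projective_L h hP, modSystem_projective_Mo h hPM⟩ hc hb rfl ?_
    (by simp only [List.sum_cons, List.sum_reverse]; omega) ?_ ?_ rfl (by simp) (schurR_eq h α a) ?_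
  · rw [hm]; rfl
  · rw [modSystem_lets_ones]
  · rw [hL, hMo]
    simp [List.replicate_succ, lettersOf, letters, DualR.piece]
  · rw [hL, hMo]
    simp [lettersOf, letters, DualR.piece, schurL]

/-- The duality for a left module, which is a right module over the opposite algebra; its words are
read from right to left. -/
theorem schurDualL (h : IsGradedAct 𝒜 (LinearMap.mul R A).flip act ℳ t (mulL act).flip)
    (hS : (modSystem h).MergesOnes) (hA : (modSystem h).alg.MergesOnes)
    [Module.Finite R (𝒜 1)] [Module.Finite R (ℳ t)] (hP : ∀ n, Module.Projective R (𝒜 n))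
    (hPM : ∀ j, Module.Projective R (ℳ j)) {a c : ℕ} {α γ : List ℕ}
    (hc : IsConjugate ((a + 1) :: α.reverse) ((c + 1) :: γ)) :
    SchurDualL 𝒜 act ℳ t α a c γ := by
  obtain ⟨D, hm, hL, hMo, hb⟩ := exists_dualSystem_mod h hS hA
    (MulOpposite.opLinearEquiv R (M := QuadDual 𝒜)) (ι := QuadDual.ιop 𝒜) (fun _ => rfl)
    QuadDual.map_revLift_ιop
    (fun β hβ => QuadDual.isPresentedBy_op (S := modSystem h) (i := LinearMap.inl R A M)
      LinearMap.inl_injective (by rw [LinearMap.range_comp, Submodule.range_subtype]; rfl) hβ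
      fun v w => by simp [modSystem, mulL])
    ((TrivSqZeroExt.fstHom R R _).toLinearMap ∘ₗ (QuadDual.low 𝒜).toLinearMap ∘ₗ
      (MulOpposite.opLinearEquiv R (M := QuadDual 𝒜)).symm.toLinearMap)
    (by simp) (fun c f => by simp [QuadDual.ιop])
    (mul' := mulR (rightAct R (QuadDual 𝒜) (DualL 𝒜 act (ℳ t)))) (fun x y => rfl)
  have hs := hc.sum_eq
  simp only [List.sum_cons, List.sum_reverse] at hs
  refine D.exists_isCanonicalDual_of_rev_left hS hA
    ⟨modSystem_projective_L h hP, modSystem_projective_Mo h hPM⟩ hc hb rfl hm.symm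
    (by simp only [List.sum_cons]; omega) ?_ ?_ (by simp) rfl (schurL_eq h α a) ?_
  · rw [modSystem_lets_ones]
    simp [letters]
  · rw [hL, hMo]
    simp [List.replicate_succ, lettersOf, letters, DualL.piece]
  · rw [hL, hMo]
    simp [lettersOf, letters, DualL.piece, schurR]

end Duality

/-! ### The shapes in the duality statements -/

theorem isConjugate_one_cons_reverse {α : List ℕ} (hα : Pos α) :
    IsConjugate (1 :: α.reverse) (((transpose α).headD 0 + 1) :: (transpose α).tail) := by
  by_cases h : α = []
  · subst h
    exact .column 0
  · have := (isConjugate_columns_reverse h hα).one_cons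
    cases ht : transpose α with
    | nil => exact absurd ht (isConjugate_columns_reverse h hα).ne_nil_right
    | cons e l => simpa [ht] using this

theorem isConjugate_succ_cons_reverse {α : List ℕ} {a : ℕ} (hα : Pos α) (ha : 0 < a) :
    IsConjugate ((a + 1) :: α.reverse) (1 :: transpose (α ++ [a])) := by
  have := isConjugate_columns_reverse (ρ := α ++ [a]) (by simp)
    (fun b hb => by
      rcases List.mem_append.mp hb with hb | hb
      · exact hα b hb
      · rw [List.mem_singleton.mp hb]
        exact ha)
  rw [List.reverse_append] at this
  exact this.succ_cons

theorem isConjugate_one_cons {α : List ℕ} (hα : Pos α) :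
    IsConjugate (1 :: α)
      (((transpose α).getLastD 0 + 1) :: (transpose α).dropLast.reverse) := by
  by_cases h : α = []
  · subst h
    exact .column 0
  · have := (isConjugate_columns h hα).one_cons
    unfold transpose
    cases ht : columns α with
    | nil => exact absurd ht (isConjugate_columns h hα).ne_nil_right
    | cons e l => simpa [ht] using this

theorem isConjugate_succ_cons {α : List ℕ} {a : ℕ} (ha : 0 < a) (hα : Pos α) :
    IsConjugate ((a + 1) :: α) (1 :: (transpose (a :: α)).reverse) := by
  have := isConjugate_columns (ρ := a :: α) (by simp)
    (fun b hb => by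
      rcases List.mem_cons.mp hb with rfl | hb
      · exact ha
      · exact hα b hb)
  rw [transpose, List.reverse_reverse]
  exact this.succ_cons

end RibbonSchur

end

theorem mainTheorem1 {R : Type u} [CommRing R] {A : Type v} [Ring A] [Algebra R A]
    (𝒜 : ℕ → Submodule R A) [GradedAlgebra 𝒜] (hflat : ∀ n, Module.Flat R (𝒜 n))
    (hquad : IsQuadratic 𝒜) :
    -- flatness and projectivity of `S^α_A`
    (IsKoszul 𝒜 → ∀ α, IsComp α → Module.Flat R (schur 𝒜 α)) ∧
    (IsKoszul 𝒜 → (∀ n, Module.Projective R (𝒜 n)) →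
      ∀ α, IsComp α → Module.Projective R (schur 𝒜 α)) ∧
    -- the canonical sequences are exact for all compositions if and only if `A` is Koszul
    (IsKoszul 𝒜 ↔ ∀ α β, IsComp α → IsComp β → SchurExact 𝒜 α β) ∧
    -- duality
    (IsKoszul 𝒜 → Module.Finite R (𝒜 1) → (∀ n, Module.Projective R (𝒜 n)) →
      ∀ α, IsComp α → SchurDual 𝒜 α) ∧
    -- left modules
    (IsKoszul 𝒜 → ∀ (M : Type w) [AddCommGroup M] [Module R M] [Module A M] [IsScalarTower R A M]
      (ℳ : ℤ → Submodule R M) (t : ℤ), IsGradedFlat 𝒜 (leftAct R A M) ℳ t →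
      (IsKoszulL 𝒜 (leftAct R A M) ℳ t → ∀ α : List ℕ, (∀ a ∈ α, 0 < a) →
        Module.Flat R (schurL 𝒜 (leftAct R A M) α (ℳ t))) ∧
      (IsKoszulL 𝒜 (leftAct R A M) ℳ t → (∀ n, Module.Projective R (𝒜 n)) →
        (∀ j, Module.Projective R (ℳ j)) → ∀ α : List ℕ, (∀ a ∈ α, 0 < a) →
        Module.Projective R (schurL 𝒜 (leftAct R A M) α (ℳ t))) ∧
      (IsKoszulL 𝒜 (leftAct R A M) ℳ t ↔ ∀ α β : List ℕ, IsComp α → (∀ b ∈ β, 0 < b) →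
        SchurExactL 𝒜 (leftAct R A M) ℳ t α β) ∧
      (IsGeneratedBy (leftAct R A M) (ℳ t) →
        (IsKoszulL 𝒜 (leftAct R A M) ℳ t ↔ ∀ α β : List ℕ, IsComp α → IsComp β →
          SchurExactL 𝒜 (leftAct R A M) ℳ t α β)) ∧
      (IsKoszulL 𝒜 (leftAct R A M) ℳ t → Module.Finite R (𝒜 1) → Module.Finite R (ℳ t) →
        (∀ n, Module.Projective R (𝒜 n)) → (∀ j, Module.Projective R (ℳ j)) →
        (∀ α : List ℕ, (∀ a ∈ α, 0 < a) →
          SchurDualL 𝒜 (leftAct R A M) ℳ t α 0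
            ((transpose α).headD 0) (transpose α).tail) ∧
        (∀ (α : List ℕ) (a : ℕ), (∀ b ∈ α, 0 < b) → 0 < a →
          SchurDualL 𝒜 (leftAct R A M) ℳ t α a 0 (transpose (α ++ [a]))))) ∧
    -- right modules
    (IsKoszul 𝒜 → ∀ (M : Type w) [AddCommGroup M] [Module R M] [Module Aᵐᵒᵖ M]
      [IsScalarTower R Aᵐᵒᵖ M]
      (ℳ : ℤ → Submodule R M) (t : ℤ), IsGradedFlat 𝒜 (rightAct R A M) ℳ t →
      (IsKoszulR 𝒜 (rightAct R A M) ℳ t → ∀ α : List ℕ, (∀ a ∈ α, 0 < a) →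
        Module.Flat R (schurR 𝒜 (rightAct R A M) α (ℳ t))) ∧
      (IsKoszulR 𝒜 (rightAct R A M) ℳ t → (∀ n, Module.Projective R (𝒜 n)) →
        (∀ j, Module.Projective R (ℳ j)) → ∀ α : List ℕ, (∀ a ∈ α, 0 < a) →
        Module.Projective R (schurR 𝒜 (rightAct R A M) α (ℳ t))) ∧
      (IsKoszulR 𝒜 (rightAct R A M) ℳ t ↔ ∀ α β : List ℕ, (∀ a ∈ α, 0 < a) → IsComp β →
        SchurExactR 𝒜 (rightAct R A M) ℳ t α β) ∧
      (IsGeneratedBy (rightAct R A M) (ℳ t) →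
        (IsKoszulR 𝒜 (rightAct R A M) ℳ t ↔ ∀ α β : List ℕ, IsComp α → IsComp β →
          SchurExactR 𝒜 (rightAct R A M) ℳ t α β)) ∧
      (IsKoszulR 𝒜 (rightAct R A M) ℳ t → Module.Finite R (𝒜 1) → Module.Finite R (ℳ t) →
        (∀ n, Module.Projective R (𝒜 n)) → (∀ j, Module.Projective R (ℳ j)) →
        (∀ α : List ℕ, (∀ a ∈ α, 0 < a) →
          SchurDualR 𝒜 (rightAct R A M) ℳ t 0 α
            (transpose α).dropLast ((transpose α).getLastD 0)) ∧
        (∀ (a : ℕ) (α : List ℕ), 0 < a → (∀ b ∈ α, 0 < b) →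
          SchurDualR 𝒜 (rightAct R A M) ℳ t a α (transpose (a :: α)) 0))) := by
  have hG := isGradedMul_mul 𝒜 hflat
  have hG' : IsGradedMul 𝒜 (LinearMap.mul R A).flip := hG.flip
  have hK := isKoszul_iff hG hquad
  refine ⟨fun hA α hα => ?_, fun hA hP α hα => ?_, ?_, fun hA hfin hP α hα => ?_, ?_, ?_⟩
  · rw [schur_eq hG]
    exact (hK.mp hA).flat_rib _ (hK.mp hA) hα.2
  · obtain ⟨σ, a, rfl, hσ, ha⟩ := hα.exists_snoc
    rw [schur_eq hG]
    exact (hK.mp hA).projective_rib _ (hK.mp hA) (fun n _ => hP n) (fun n _ => hP n) hσ a ha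
  · rw [hK]
    exact mergesOnes_iff_schurExact hG
  · exact schurDual hG (hK.mp hA) hP hα
  · intro hA M _ _ _ _ ℳ t hM
    have h : IsGradedAct 𝒜 (LinearMap.mul R A).flip (leftAct R A M) ℳ t
        (mulL (leftAct R A M)).flip :=
      ⟨hG', hM, fun x y z => (mul_smul y x z).symm, fun x y => rfl⟩
    have hA1 : (algSystem h.gradedMul).MergesOnes := mergesOnes_flip hG hG' (hK.mp hA)
    have hA2 := modSystem_alg_mergesOnes h hA1
    have hKL := isKoszulL_iff h hA1
    refine ⟨fun hS α hα => ?_, fun hS hP hPM α hα => ?_, ?_, fun hgen => ⟨fun hS α β hα hβ => ?_,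
      fun hE => ?_⟩, fun hS hfin hfinM hP hPM => ⟨fun α hα => ?_, fun α a hα ha => ?_⟩⟩
    · rw [schurL_eq_zero h]
      have := (hKL.mp hS).flat_rib _ hA2 (ρ := 1 :: α.reverse) (by simpa [Pos] using hα)
      exact flat_map_of_injective rev_injective _
    · rw [schurL_eq_zero h]
      have := (hKL.mp hS).projective_rib_of_pos hA2 (modSystem_projective_L h hP)
        (modSystem_projective_Mo h hPM) (ρ := 1 :: α.reverse) (by simp) (by simpa [Pos] using hα)
      exact projective_map_of_injective rev_injective _
    · rw [hKL]
      exact mergesOnes_iff_schurExactL h hG hA1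
    · exact (mergesOnes_iff_schurExactL h hG hA1).mp (hKL.mp hS) α β hα hβ.2
    · exact hKL.mpr (mergesOnes_of_schurExactL h hG hA1 hgen hE)
    · exact schurDualL h (hKL.mp hS) hA2 hP hPM (isConjugate_one_cons_reverse hα)
    · exact schurDualL h (hKL.mp hS) hA2 hP hPM (isConjugate_succ_cons_reverse hα ha)
  · intro hA M _ _ _ _ ℳ t hM
    have h : IsGradedAct 𝒜 (LinearMap.mul R A) (rightAct R A M) ℳ t (mulR (rightAct R A M)) :=
      ⟨hG, hM, fun x y z => (mul_smul (MulOpposite.op y) (MulOpposite.op x) z).symm,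
        fun x y => rfl⟩
    have hA1 : (algSystem h.gradedMul).MergesOnes := hK.mp hA
    have hA2 := modSystem_alg_mergesOnes h hA1
    have hKR := isKoszulR_iff h hA1
    refine ⟨fun hS α hα => ?_, fun hS hP hPM α hα => ?_, ?_, fun hgen => ⟨fun hS α β hα hβ => ?_,
      fun hE => ?_⟩, fun hS hfin hfinM hP hPM => ⟨fun α hα => ?_, fun a α ha hα => ?_⟩⟩
    · rw [schurR_eq_zero h]
      exact (hKR.mp hS).flat_rib _ hA2 (ρ := 1 :: α) (by simpa [Pos] using hα)
    · rw [schurR_eq_zero h]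
      exact (hKR.mp hS).projective_rib_of_pos hA2 (modSystem_projective_L h hP)
        (modSystem_projective_Mo h hPM) (ρ := 1 :: α) (by simp) (by simpa [Pos] using hα)
    · rw [hKR]
      exact mergesOnes_iff_schurExactR h hA1
    · exact (mergesOnes_iff_schurExactR h hA1).mp (hKR.mp hS) α β hα.2 hβ
    · exact hKR.mpr (mergesOnes_of_schurExactR h hA1 hgen hE)
    · exact schurDualR h (hKR.mp hS) hA2 hP hPM (isConjugate_one_cons hα)
    · exact schurDualR h (hKR.mp hS) hA2 hP hPM (isConjugate_succ_cons ha hα)
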